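/- **Setting.** Let $I=(0,1)$, $k\ge 1$, let $q_1,\dots,q_k\in S^2\subset\mathbb R^3$ be distinct, and put $Q_k=\{\pm q_1,\dots,\pm q_k\}$, $L_k=\bigcup_{l=1}^k\operatorname{span}(q_l)$. Let $G:\mathbb R^3\to[0,\infty)$ be continuous on $\mathbb R^3\setminus\{0\}$, zero-homogeneous ($G(cz)=G(z)$ for $c>0$), with $\{G=0\}=L_k$ (so $G(0)=0$). Let $\lambda_n,\delta_n,\mu_n>0$ with $\lambda_n\to0$ and $\delta_n\to 0$; put $N_n=\lfloor 1/\lambda_n\rfloor$. A *spin configuration* is a family $u=(u^i)_{0\le i\le N_n}$ in $S^2$ with $(u^1,u^0)=(u^{N_n},u^{N_n-1})$. Its energy is $$H^p_n(u)=\frac12\sum_{i=0}^{N_n-2}\lambda_n\bigl|u^{i+2}-2(1-\delta_n)u^{i+1}+u^i\bigr|^2+\mu_n\sum_{i=0}^{N_n-2}\lambda_n\,G(u^i\times u^{i+1}),$$ and its chirality $T_n(u)\in L^1(I,\mathbb R^3)$ is the piecewise constant function equal to $(2\delta_n)^{-1/2}\,u^i\times u^{i+1}$ on $[\lambda_n i,\lambda_n(i+1))$,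 $0\le i\le N_n-1$, and continued by its last value on the rest of $I$. For $z\in L^1(I,\mathbb R^3)$ let $H^p_n(z)=\inf\{H^p_n(u):T_n(u)=z\}$ (with $\inf\emptyset=+\infty$). For $q_-,q_+\in Q_k$ and a penalty $F$ with the same properties as $G$ define $$h_F(q_-,q_+)=\inf_w\int_{\mathbb R}\Bigl((|w|^2-1)^2+\frac{F(w)}2+|w'|^2\Bigr)\,dt,$$ the infimum being over all $w=u\times u'$ with $u\in H^2_{loc}(\mathbb R,S^2)$ and $\lim_{t\to\pm\infty}w(t)=q_\pm$. For $z\in BV(I,Q_k)$ let $S(z)\subset I$ be its (finite) jump set and $z(t^-),z(t^+)$ the left and right limits. **Theorem.** Assume $\beta_n:=\lambda_n/\sqrt{\delta_n}\to0$ and let $p_n:=\mu_n/(\sqrt2\,\lambda_n\delta_n^{3/2})$. Then the functionals $H^p_n/(\sqrt2\,\lambda_n\delta_n^{3/2})$ $\Gamma$-converge, with respect to the strong topology of $L^1(I,\mathbb R^3)$, to the following functional $H^p:L^1(I,\mathbb R^3)\to[0,+\infty]$: * (i) if $p_n\to p<+\infty$: $H^p(z)=p\int_I G(z)\,dt$ for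 $z\in L^1(I,S^2)$, and $+\infty$ otherwise; * (ii) if $p_n\to+\infty$ and $p_n\beta_n\to0$: $H^p(z)=0$ for $z\in L^1(I,Q_k)$, and $+\infty$ otherwise; * (iii) if $p_n\to+\infty$ and $p_n\beta_n\to\ell\in(0,\infty)$: $H^p(z)=\sum_{t\in S(z)}h_{\sqrt2\,\ell\,G}\bigl(z(t^-),z(t^+)\bigr)$ for $z\in BV(I,Q_k)$, and $+\infty$ otherwise; in particular the costs are $h_G$ when $\mu_n/\delta_n^2\to1$, that is $\ell=1/\sqrt2$; * (iv) if $p_n\to+\infty$ and $p_n\beta_n\to+\infty$: $H^p(z)=\frac83\,\#S(z)$ for $z\in BV(I,Q_k)$, and $+\infty$ otherwise. -/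

import Mathlib

open MeasureTheory Filter Topology Set
open scoped ENNReal

noncomputable section

namespace HelicalChain

/-- Three-dimensional Euclidean space. -/
abbrev E3 : Type := EuclideanSpace ℝ (Fin 3)

/-- The cross product of Euclidean 3-vectors. -/
def cross (a b : E3) : E3 := WithLp.toLp 2 (crossProduct (WithLp.ofLp a) (WithLp.ofLp b))

/-- Lebesgue measure on the interval `I = (0,1)`. -/
abbrev volI : Measure ℝ := volume.restrict (Ioo (0 : ℝ) 1)

/-- The space `L¹(I, ℝ³)` with its norm topology. -/
abbrev L1 : Type := Lp E3 1 volI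

/-- Sequential `Γ`-convergence of `[0,∞]`-valued functionals (the usual `Γ`-convergence on a
metrizable space): liminf inequality along every convergent sequence, and existence of a
recovery sequence. -/
structure GammaConverges {X : Type*} [TopologicalSpace X]
    (F : ℕ → X → ℝ≥0∞) (F₀ : X → ℝ≥0∞) : Prop where
  liminf_le : ∀ (x : X) (xs : ℕ → X), Tendsto xs atTop (𝓝 x) →
    F₀ x ≤ liminf (fun n => F n (xs n)) atTop
  recovery : ∀ x : X, ∃ xs : ℕ → X, Tendsto xs atTop (𝓝 x) ∧
    limsup (fun n => F n (xs n)) atTop ≤ F₀ x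

/-! ### The discrete energies -/

/-- The last lattice index `[1/lam]`: the integers `i` with `lam * i ∈ [0,1]` are `0, …, [1/lam]`. -/
def lastSite (lam : ℝ) : ℕ := ⌊1 / lam⌋₊

/-- Admissible spin configurations: unit vectors `u 0, …, u N`, `N = [1/lam]`, with the boundary
condition `(u 1, u 0) = (u N, u (N - 1))`. Only the values at `0, …, N` are ever used. -/
def IsSpinChain (lam : ℝ) (u : ℕ → E3) : Prop :=
  (∀ i, i ≤ lastSite lam → ‖u i‖ = 1) ∧
    inner ℝ (u 1) (u 0) = inner ℝ (u (lastSite lam)) (u (lastSite lam - 1))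

/-- The indices `i ≥ 0` with `i + 2 ≤ [1/lam]`. -/
def interiorSites (lam : ℝ) : Finset ℕ := Finset.range (lastSite lam - 1)

/-- The normalized frustrated chain energy
`(1/2) ∑ lam |u (i+2) - 2 (1 - del) u (i+1) + u i|²`. -/
def chainEnergy (lam del : ℝ) (u : ℕ → E3) : ℝ :=
  (1 / 2) * ∑ i ∈ interiorSites lam, lam * ‖u (i + 2) - (2 * (1 - del)) • u (i + 1) + u i‖ ^ 2

/-- The energy with the soft penalization `mu ∑ lam G (u i × u (i+1))` added. -/
def penalizedEnergy (G : E3 → ℝ) (lam del mu : ℝ) (u : ℕ → E3) : ℝ :=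
  chainEnergy lam del u + mu * ∑ i ∈ interiorSites lam, lam * G (cross (u i) (u (i + 1)))

/-- The piecewise constant chirality: `(u i × u (i+1)) / √(2 del)` on `[lam i, lam (i+1))` for
`0 ≤ i ≤ [1/lam] - 1`. On the remainder `[lam [1/lam], 1)`, of length less than `lam`, there is
no next spin and the last value is kept. -/
def chirality (lam del : ℝ) (u : ℕ → E3) (x : ℝ) : E3 :=
  (√(2 * del))⁻¹ • cross (u (min ⌊x / lam⌋₊ (lastSite lam - 1)))
    (u (min ⌊x / lam⌋₊ (lastSite lam - 1) + 1))

/-- The penalized energy as a functional of the chirality: the infimum over all admissible spin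
configurations with chirality `z` (so `+∞` if there is none). -/
def penalizedFunctional (G : E3 → ℝ) (lam del mu : ℝ) (z : L1) : ℝ≥0∞ :=
  ⨅ (u : ℕ → E3) (_ : IsSpinChain lam u) (_ : (z : ℝ → E3) =ᵐ[volI] chirality lam del u),
    ENNReal.ofReal (penalizedEnergy G lam del mu u)

/-- The functional divided by `√2 lam del^(3/2)`. -/
def scaledFunctional (G : E3 → ℝ) (lam del mu : ℝ) (z : L1) : ℝ≥0∞ :=
  penalizedFunctional G lam del mu z / ENNReal.ofReal (√2 * lam * del ^ (3 / 2 : ℝ))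

/-! ### The wells -/

/-- `Q_k = {± q_1, …, ± q_k}`. -/
def wells {k : ℕ} (q : Fin k → E3) : Set E3 := {x | ∃ l, x = q l ∨ x = -q l}

/-- `L_k`, the union of the lines spanned by the `q_l`. -/
def wellLines {k : ℕ} (q : Fin k → E3) : Set E3 := ⋃ l, (Submodule.span ℝ {q l} : Set E3)

/-! ### The optimal profile problem -/

/-- `f ∈ H¹_loc(ℝ, ℝ³)` (in its continuous representative) with weak derivative `g`:
`g ∈ L²_loc` and `f` is an indefinite integral of `g`. -/
def HasSobolevDeriv (f g : ℝ → E3) : Prop :=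
  (∀ a b : ℝ, MemLp g 2 (volume.restrict (Icc a b))) ∧ ∀ s t : ℝ, f t = f s + ∫ r in s..t, g r

/-- The class of all `w = u × u'` with `u ∈ H²_loc(ℝ, S²)`, `w(-∞) = q₁` and `w(+∞) = q₂`;
below `v = u'` and `a = u''`. -/
def profiles (q₁ q₂ : E3) : Set (ℝ → E3) :=
  {w | ∃ u v a : ℝ → E3, (∀ t, ‖u t‖ = 1) ∧ HasSobolevDeriv u v ∧ HasSobolevDeriv v a ∧
    (∀ t, w t = cross (u t) (v t)) ∧ Tendsto w atBot (𝓝 q₁) ∧ Tendsto w atTop (𝓝 q₂)}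

/-- The transition cost `h_G(q₁, q₂)`: the infimum of
`∫ (|w|² - 1)² + G(w)/2 + |w'|²` over the profiles `w` from `q₁` to `q₂`. -/
def transitionCost (G : E3 → ℝ) (q₁ q₂ : E3) : ℝ≥0∞ :=
  ⨅ (w : ℝ → E3) (w' : ℝ → E3) (_ : w ∈ profiles q₁ q₂) (_ : HasSobolevDeriv w w'),
    ∫⁻ t, ENNReal.ofReal ((‖w t‖ ^ 2 - 1) ^ 2 + G (w t) / 2 + ‖w' t‖ ^ 2)

/-! ### Functions of bounded variation on `I` and their jumps -/

/-- `z ∈ BV(I, ℝ³)`: some representative has finite variation on `I`. -/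
def IsBV (z : L1) : Prop :=
  ∃ f : ℝ → E3, f =ᵐ[volI] (z : ℝ → E3) ∧ BoundedVariationOn f (Ioo (0 : ℝ) 1)

/-- The discontinuity set `S(z)`: the points of `I` at which `z` has no (essential) limit. -/
def jumpSet (z : L1) : Set ℝ :=
  {t | t ∈ Ioo (0 : ℝ) 1 ∧ ¬ ∃ a : E3, Tendsto (z : ℝ → E3) (𝓝[≠] t ⊓ ae volI) (𝓝 a)}

/-- The (essential) left limit of `z` at `t`. -/
def leftLimit (z : L1) (t : ℝ) : E3 := limUnder (𝓝[<] t ⊓ ae volI) (z : ℝ → E3)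

/-- The (essential) right limit of `z` at `t`. -/
def rightLimit (z : L1) (t : ℝ) : E3 := limUnder (𝓝[>] t ⊓ ae volI) (z : ℝ → E3)

/-! ### The limit functionals -/

open Classical in
/-- `p ∫_I G(z)` on `L¹(I, S²)`, and `+∞` elsewhere. -/
def limitBulk (G : E3 → ℝ) (p : ℝ) (z : L1) : ℝ≥0∞ :=
  if ∀ᵐ t ∂volI, ‖z t‖ = 1 then
    ENNReal.ofReal p * ∫⁻ t, ENNReal.ofReal (G (z t)) ∂volI
  else ⊤

open Classical in
/-- `0` on `L¹(I, Q_k)`, and `+∞` elsewhere. -/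
def limitZero {k : ℕ} (q : Fin k → E3) (z : L1) : ℝ≥0∞ :=
  if ∀ᵐ t ∂volI, z t ∈ wells q then 0 else ⊤

open Classical in
/-- `∑_{t ∈ S(z)} h_G(z(t-), z(t+))` on `BV(I, Q_k)`, and `+∞` elsewhere. -/
def limitTransition {k : ℕ} (q : Fin k → E3) (G : E3 → ℝ) (z : L1) : ℝ≥0∞ :=
  if IsBV z ∧ ∀ᵐ t ∂volI, z t ∈ wells q then
    ∑' t : jumpSet z, transitionCost G (leftLimit z t) (rightLimit z t)
  else ⊤

open Classical in
/-- `(8/3) #S(z)` on `BV(I, Q_k)`, and `+∞` elsewhere. -/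
def limitCount {k : ℕ} (q : Fin k → E3) (z : L1) : ℝ≥0∞ :=
  if IsBV z ∧ ∀ᵐ t ∂volI, z t ∈ wells q then
    ENNReal.ofReal (8 / 3) * ((jumpSet z).encard : ℝ≥0∞)
  else ⊤

end HelicalChain

end

open HelicalChain

noncomputable section

namespace HelicalChain

/-! ### The cross product -/

/-! Put η = √(2δ), χ_i = η⁻¹ u_i × u_{i+1} and g = μ/(2δ²). Splitting the second difference of unit
vectors into its parts along and across the middle spin gives an exact identity,
`norm_second_difference_sq`. After division by √2 λ δ^{3/2} the energy becomes a sum of `site` terms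
(`penalizedEnergy_eq`), each of the form |χ_{i+1} − χ_i|²/η + η (1 − mean squared speed)² + η g
G(χ_i). This is a finite-difference version, with mesh η, of the profile functional ∫ (|w|² − 1)² +
g G(w) + |w'|² with w = u × u'. In the profile variable the interval I has length about η/λ → ∞.
Moreover p_n = η g/λ and g = p_n β_n/√2, so that g tends to 0, 0, ℓ/√2 and ∞ in the four regimes.

Lower bounds. Bounded energy and λ/η → 0 force |z| = 1 almost everywhere, and Fatou's lemma gives
the bulk term, hence z ∈ Q_k almost everywhere when p_n → ∞. When g stays bounded below, each change
of well costs a fixed amount (`IsPenalty.exists_switch_lower`), so z takes finitely many values on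
finitely many intervals. The sharp cost per jump has two sources. First, a Modica–Mortola argument
with the primitive 2x − (2/3)x³ of 2(1 − x²) shows that passing near w = 0 costs 8/3
(`eight_thirds_le_sum_bend`). If g → ∞ every transition must do this, because moving between wells
away from 0 means spending time where G is bounded below (`IsPenalty.exists_eight_thirds_lower`).
Second, for finite g, a passage that avoids 0 stays where G is uniformly continuous. The chain is
then interpolated by a quadratic spline projected to the sphere (`reach_spline_piece`), and its ends
are joined to the wells at small cost (`exists_reach_near`). The result competes in the definition
of the transition cost, which is at most 8/3 in any case (`IsPenalty.exists_transition_lower`).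

Upper bounds. A uniform rotation sampled with the angle 2 arcsin(η/2) has no bending energy at all
(`bend_eq_zero_of_circ`). A transition is therefore a curve that rotates about one axis before a
bounded time interval and about another one after it, and sampling it at this angle asymptotically
costs no more than its profile energy (`IsTransit.exists_sum_site_sample_le`). Successive
transitions are glued by waiting at most one turn until the phases agree (`exists_concatenation`);
this fits because η/λ → ∞. The building blocks are: slow changes of axis, of arbitrarily small cost,
when the potential is negligible (`reach_slow`); near-optimal profiles, which avoid 0 if they cost
less than 8/3 (`IsTransit.ne_zero`); and curves that stop for a moment at w = 0, on which the
penalty vanishes exactly (`admitsBridge_hold`). The last ones are needed because G is in general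
discontinuous at 0. -/

lemma inner_coord (a b : E3) : inner ℝ a b = a 0 * b 0 + a 1 * b 1 + a 2 * b 2 := by
  simp [PiLp.inner_apply, Fin.sum_univ_three, mul_comm]

lemma norm_sq_coord (a : E3) : ‖a‖ ^ 2 = a 0 ^ 2 + a 1 ^ 2 + a 2 ^ 2 := by
  rw [← real_inner_self_eq_norm_sq, inner_coord]; ring

@[simp] lemma cross_coord_zero (a b : E3) : cross a b 0 = a 1 * b 2 - a 2 * b 1 := by
  simp [cross, cross_apply]
@[simp] lemma cross_coord_one (a b : E3) : cross a b 1 = a 2 * b 0 - a 0 * b 2 := by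
  simp [cross, cross_apply]
@[simp] lemma cross_coord_two (a b : E3) : cross a b 2 = a 0 * b 1 - a 1 * b 0 := by
  simp [cross, cross_apply]

lemma ext3 {a b : E3} (h0 : a 0 = b 0) (h1 : a 1 = b 1) (h2 : a 2 = b 2) : a = b := by
  ext i; fin_cases i <;> assumption

lemma cross_add_left (a b c : E3) : cross (a + b) c = cross a c + cross b c := by
  apply ext3 <;> simp <;> ring
lemma cross_add_right (a b c : E3) : cross a (b + c) = cross a b + cross a c := by
  apply ext3 <;> simp <;> ring
lemma cross_smul_left (r : ℝ) (a b : E3) : cross (r • a) b = r • cross a b := by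
  apply ext3 <;> simp <;> ring
lemma cross_smul_right (r : ℝ) (a b : E3) : cross a (r • b) = r • cross a b := by
  apply ext3 <;> simp <;> ring
@[simp] lemma cross_same (a : E3) : cross a a = 0 := by
  apply ext3 <;> simp <;> ring
@[simp] lemma cross_zero_left (a : E3) : cross 0 a = 0 := by
  apply ext3 <;> simp
@[simp] lemma cross_zero_right (a : E3) : cross a 0 = 0 := by
  apply ext3 <;> simp
lemma cross_sub_left (a b c : E3) : cross (a - b) c = cross a c - cross b c := by
  apply ext3 <;> simp <;> ring
lemma cross_sub_right (a b c : E3) : cross a (b - c) = cross a b - cross a c := by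
  apply ext3 <;> simp <;> ring
lemma cross_neg_left (a b : E3) : cross (-a) b = -cross a b := by
  apply ext3 <;> simp <;> ring
lemma cross_swap (a b : E3) : cross a b = -cross b a := by
  apply ext3 <;> simp <;> ring

lemma inner_cross_left (a b : E3) : inner ℝ a (cross a b) = 0 := by
  rw [inner_coord]; simp; ring
lemma inner_cross_right (a b : E3) : inner ℝ b (cross a b) = 0 := by
  rw [inner_coord]; simp; ring

lemma cross_cross_left (a b c : E3) :
    cross (cross a b) c = (inner ℝ a c) • b - (inner ℝ b c) • a := by
  simp only [inner_coord]; apply ext3 <;> simp <;> ring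
lemma cross_cross_right (a b c : E3) :
    cross a (cross b c) = (inner ℝ a c) • b - (inner ℝ a b) • c := by
  simp only [inner_coord]; apply ext3 <;> simp <;> ring

lemma norm_cross_sq (a b : E3) :
    ‖cross a b‖ ^ 2 = ‖a‖ ^ 2 * ‖b‖ ^ 2 - (inner ℝ a b) ^ 2 := by
  simp only [inner_coord, norm_sq_coord]; simp; ring

lemma norm_cross_le (a b : E3) : ‖cross a b‖ ≤ ‖a‖ * ‖b‖ := by
  apply abs_le_of_sq_le_sq' _ (by positivity) |>.2
  rw [norm_cross_sq]; nlinarith [sq_nonneg (inner ℝ a b)]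

lemma norm_cross_of_orthogonal {a b : E3} (h : inner ℝ a b = 0) : ‖cross a b‖ = ‖a‖ * ‖b‖ := by
  have := norm_cross_sq a b
  rw [h] at this
  have h2 : ‖cross a b‖ ^ 2 = (‖a‖ * ‖b‖) ^ 2 := by rw [this]; ring
  exact (pow_left_inj₀ (by positivity) (by positivity) two_ne_zero).1 h2

/-- The cross product as a continuous bilinear map. -/
def crossL : E3 →L[ℝ] E3 →L[ℝ] E3 :=
  LinearMap.mkContinuous₂
    (LinearMap.mk₂ ℝ cross cross_add_left cross_smul_left cross_add_right cross_smul_right) 1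
    (fun a b => by simpa using norm_cross_le a b)

lemma hasDerivAt_cross {f g : ℝ → E3} {f' g' : E3} {t : ℝ} (hf : HasDerivAt f f' t)
    (hg : HasDerivAt g g' t) :
    HasDerivAt (fun s => cross (f s) (g s)) (cross (f t) g' + cross f' (g t)) t := by
  rw [← hasDerivWithinAt_univ] at hf hg ⊢
  exact crossL.hasDerivWithinAt_of_bilinear hf hg

lemma continuous_cross : Continuous (fun x : E3 × E3 => cross x.1 x.2) := by
  have : Continuous (fun x : E3 × E3 => crossL x.1 x.2) := by fun_prop
  exact this

lemma continuousOn_cross {X : Type*} [TopologicalSpace X] {f g : X → E3} {s : Set X}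
    (hf : ContinuousOn f s) (hg : ContinuousOn g s) :
    ContinuousOn (fun x => cross (f x) (g x)) s :=
  continuous_cross.comp_continuousOn (hf.prodMk hg)

/-! ### Functions with a weak derivative on an interval -/

/-- `f` is an indefinite integral of the square integrable function `g` on `[a, b]`. -/
def SobolevOn (a b : ℝ) (f g : ℝ → E3) : Prop :=
  MemLp g 2 (volume.restrict (Icc a b)) ∧
    ∀ s ∈ Icc a b, ∀ t ∈ Icc a b, f t = f s + ∫ r in s..t, g r

lemma hasSobolevDeriv_iff {f g : ℝ → E3} :
    HasSobolevDeriv f g ↔ ∀ a b, SobolevOn a b f g := by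
  constructor
  · intro h a b; exact ⟨h.1 a b, fun s _ t _ => h.2 s t⟩
  · intro h
    refine ⟨fun a b => (h a b).1, fun s t => ?_⟩
    exact (h (min s t) (max s t)).2 s ⟨min_le_left _ _, le_max_left _ _⟩ t
      ⟨min_le_right _ _, le_max_right _ _⟩

lemma SobolevOn.integrableOn {a b : ℝ} {f g : ℝ → E3} (h : SobolevOn a b f g) :
    IntegrableOn g (Icc a b) := h.1.integrable (by norm_num)

lemma SobolevOn.mono {a b c d : ℝ} {f g : ℝ → E3} (h : SobolevOn a b f g)
    (hac : a ≤ c) (hdb : d ≤ b) : SobolevOn c d f g :=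
  ⟨h.1.mono_measure (Measure.restrict_mono (Icc_subset_Icc hac hdb) le_rfl),
    fun s hs t ht => h.2 s (Icc_subset_Icc hac hdb hs) t (Icc_subset_Icc hac hdb ht)⟩

lemma SobolevOn.congr {a b : ℝ} {f g f' g' : ℝ → E3} (h : SobolevOn a b f g)
    (hf : EqOn f' f (Icc a b)) (hg : EqOn g' g (Ioc a b)) : SobolevOn a b f' g' := by
  have hae : g =ᵐ[volume.restrict (Icc a b)] g' := by
    rw [← restrict_Ioc_eq_restrict_Icc]
    filter_upwards [ae_restrict_mem measurableSet_Ioc] with x hx using (hg hx).symm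
  refine ⟨(memLp_congr_ae hae).1 h.1, fun s hs t ht => ?_⟩
  rw [hf hs, hf ht, h.2 s hs t ht]
  congr 1
  apply intervalIntegral.integral_congr_ae
  refine Eventually.of_forall fun x hx => ?_
  rw [hg]
  rcases mem_uIoc.1 hx with hx | hx
  · exact ⟨hs.1.trans_lt hx.1, hx.2.trans ht.2⟩
  · exact ⟨ht.1.trans_lt hx.1, hx.2.trans hs.2⟩

lemma SobolevOn.continuousOn {a b : ℝ} {f g : ℝ → E3} (h : SobolevOn a b f g) :
    ContinuousOn f (Icc a b) := by
  rcases lt_or_ge b a with hab | hab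
  · simp [Icc_eq_empty (not_le.2 hab)]
  have h1 : ContinuousOn (fun t => f a + ∫ r in a..t, g r) (Icc a b) := by
    apply continuousOn_const.add
    have := intervalIntegral.continuousOn_primitive_interval (a := a) (b := b) (f := g)
      (μ := volume) (by rw [uIcc_of_le hab]; exact h.integrableOn)
    rwa [uIcc_of_le hab] at this
  exact h1.congr fun t ht => h.2 a ⟨le_rfl, hab⟩ t ht

lemma SobolevOn.of_hasDerivAt {a b : ℝ} {f g : ℝ → E3}
    (hf : ∀ t ∈ Icc a b, HasDerivAt f (g t) t) (hg : ContinuousOn g (Icc a b)) :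
    SobolevOn a b f g := by
  refine ⟨?_, fun s hs t ht => ?_⟩
  · obtain ⟨C, hC⟩ := isCompact_Icc.exists_bound_of_continuousOn hg
    exact MemLp.of_bound (hg.aestronglyMeasurable measurableSet_Icc) C
      ((ae_restrict_mem measurableSet_Icc).mono fun x hx => hC x hx)
  · have hsub : uIcc s t ⊆ Icc a b := by
      intro x hx
      rcases mem_uIcc.1 hx with hx | hx
      · exact ⟨hs.1.trans hx.1, hx.2.trans ht.2⟩
      · exact ⟨ht.1.trans hx.1, hx.2.trans hs.2⟩
    rw [intervalIntegral.integral_eq_sub_of_hasDerivAt (fun x hx => hf x (hsub hx))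
      ((hg.mono hsub).intervalIntegrable)]
    abel

lemma SobolevOn.trans {a b c : ℝ} {f g : ℝ → E3} (hab : a ≤ b) (hbc : b ≤ c)
    (h1 : SobolevOn a b f g) (h2 : SobolevOn b c f g) : SobolevOn a c f g := by
  have hint : MemLp g 2 (volume.restrict (Icc a c)) := by
    have : Icc a c = Icc a b ∪ Icc b c := (Icc_union_Icc_eq_Icc hab hbc).symm
    rw [this]
    have h3 : MemLp g 2 (volume.restrict (Icc a b) + volume.restrict (Icc b c)) := by
      refine ⟨h1.1.1.add_measure h2.1.1, ?_⟩
      have e1 := h1.1.2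
      have e2 := h2.1.2
      rw [eLpNorm_lt_top_iff_lintegral_rpow_enorm_lt_top (by norm_num) (by norm_num)] at e1 e2 ⊢
      rw [lintegral_add_measure]
      exact ENNReal.add_lt_top.2 ⟨e1, e2⟩
    exact h3.mono_measure (Measure.restrict_union_le _ _)
  have hI : IntegrableOn g (Icc a c) := hint.integrable (by norm_num)
  have key : ∀ s ∈ Icc a c, f s = f b + ∫ r in b..s, g r := by
    intro s hs
    rcases le_total s b with h | h
    · exact h1.2 b ⟨hab, le_rfl⟩ s ⟨hs.1, h⟩
    · exact h2.2 b ⟨le_rfl, hbc⟩ s ⟨h, hs.2⟩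
  refine ⟨hint, fun s hs t ht => ?_⟩
  have hii : ∀ s ∈ Icc a c, ∀ t ∈ Icc a c, IntervalIntegrable g volume s t := by
    intro s hs t ht
    apply IntegrableOn.intervalIntegrable
    apply hI.mono_set
    intro x hx
    rcases mem_uIcc.1 hx with hx | hx
    · exact ⟨hs.1.trans hx.1, hx.2.trans ht.2⟩
    · exact ⟨ht.1.trans hx.1, hx.2.trans hs.2⟩
  have hb : b ∈ Icc a c := ⟨hab, hbc⟩
  rw [key t ht, key s hs, ← intervalIntegral.integral_add_adjacent_intervals
    (hii b hb s hs) (hii s hs t ht)]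
  abel

lemma SobolevOn.comp_sub {a b : ℝ} {f g : ℝ → E3} (h : SobolevOn a b f g) (d : ℝ) :
    SobolevOn (a + d) (b + d) (fun t => f (t - d)) (fun t => g (t - d)) := by
  have hmp : MeasurePreserving (fun t : ℝ => t - d) (volume.restrict (Icc (a + d) (b + d)))
      (volume.restrict (Icc a b)) := by
    have := (measurePreserving_sub_right (volume : Measure ℝ) d).restrict_preimage
      (measurableSet_Icc (a := a) (b := b))
    simpa [preimage_sub_const_Icc] using this
  refine ⟨h.1.comp_measurePreserving hmp, fun s hs t ht => ?_⟩
  show f (t - d) = f (s - d) + ∫ r in s..t, g (r - d)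
  rw [h.2 (s - d) ⟨by linarith [hs.1], by linarith [hs.2]⟩ (t - d)
    ⟨by linarith [ht.1], by linarith [ht.2]⟩, intervalIntegral.integral_comp_sub_right]

attribute [local irreducible] cross

/-! ### Arcs and their cost -/

/-- The energy density of the profile problem, with potential `V`. -/
def density (V : E3 → ℝ) (w w' : E3) : ℝ≥0∞ :=
  ENNReal.ofReal ((‖w‖ ^ 2 - 1) ^ 2 + V w + ‖w'‖ ^ 2)

/-- A curve `u` on the sphere over `[s, t]` with `w = u × u'`, of cost at most `C`. -/
structure IsArc (V : E3 → ℝ) (u w : ℝ → E3) (s t : ℝ) (C : ℝ≥0∞) : Prop where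
  unit : ∀ r ∈ Icc s t, ‖u r‖ = 1
  orth : ∀ r ∈ Icc s t, inner ℝ (u r) (w r) = 0
  -- For |u| = 1 and u ⟂ w, the relation w = u × u' is equivalent to u' = w × u. The pair (u, w) is
  -- thus a complete state, and arcs can be glued as soon as these two agree.
  deriv_u : SobolevOn s t u (fun r => cross (w r) (u r))
  deriv_v : ∃ a, SobolevOn s t (fun r => cross (w r) (u r)) a
  deriv_w : ∃ w', SobolevOn s t w w' ∧ ∫⁻ r in Icc s t, density V (w r) (w' r) ≤ C

lemma IsArc.cost_mono {V : E3 → ℝ} {u w : ℝ → E3} {s t : ℝ} {C D : ℝ≥0∞}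
    (h : IsArc V u w s t C) (hCD : C ≤ D) : IsArc V u w s t D :=
  ⟨h.unit, h.orth, h.deriv_u, h.deriv_v, h.deriv_w.imp fun _ h => ⟨h.1, h.2.trans hCD⟩⟩

lemma IsArc.congr {V : E3 → ℝ} {u w u' w' : ℝ → E3} {s t : ℝ} {C : ℝ≥0∞}
    (h : IsArc V u w s t C) (hu : EqOn u' u (Icc s t)) (hw : EqOn w' w (Icc s t)) :
    IsArc V u' w' s t C := by
  have hv : EqOn (fun r => cross (w' r) (u' r)) (fun r => cross (w r) (u r)) (Icc s t) :=
    fun r hr => by simp only [hu hr, hw hr]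
  refine ⟨fun r hr => by rw [hu hr, h.unit r hr], fun r hr => by rw [hu hr, hw hr, h.orth r hr],
    h.deriv_u.congr hu (hv.mono Ioc_subset_Icc_self), ?_, ?_⟩
  · obtain ⟨a, ha⟩ := h.deriv_v
    exact ⟨a, ha.congr hv fun _ _ => rfl⟩
  · obtain ⟨z, hz, hc⟩ := h.deriv_w
    refine ⟨z, hz.congr hw fun _ _ => rfl, le_trans (le_of_eq ?_) hc⟩
    exact setLIntegral_congr_fun measurableSet_Icc fun r hr => by simp only [hw hr]

lemma SobolevOn.glue {a b c : ℝ} (hab : a ≤ b) (hbc : b ≤ c) {f g₁ g₂ : ℝ → E3}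
    (h₁ : SobolevOn a b f g₁) (h₂ : SobolevOn b c f g₂) :
    SobolevOn a c f (fun r => if r ≤ b then g₁ r else g₂ r) :=
  SobolevOn.trans hab hbc
    (h₁.congr (fun _ _ => rfl) fun r hr => by simp [hr.2])
    (h₂.congr (fun _ _ => rfl) fun r hr => by simp [not_le.2 hr.1])

lemma IsArc.trans {V : E3 → ℝ} {u w : ℝ → E3} {a b c : ℝ} {C D : ℝ≥0∞} (hab : a ≤ b)
    (hbc : b ≤ c) (h₁ : IsArc V u w a b C) (h₂ : IsArc V u w b c D) :
    IsArc V u w a c (C + D) := by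
  have hcase : ∀ r ∈ Icc a c, r ∈ Icc a b ∨ r ∈ Icc b c := fun r hr =>
    (le_total r b).imp (fun h => ⟨hr.1, h⟩) fun h => ⟨h, hr.2⟩
  refine ⟨fun r hr => (hcase r hr).elim (h₁.unit r) (h₂.unit r),
    fun r hr => (hcase r hr).elim (h₁.orth r) (h₂.orth r), h₁.deriv_u.trans hab hbc h₂.deriv_u,
    ?_, ?_⟩
  · obtain ⟨a₁, h₁⟩ := h₁.deriv_v
    obtain ⟨a₂, h₂⟩ := h₂.deriv_v
    exact ⟨_, h₁.glue hab hbc h₂⟩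
  · obtain ⟨z₁, h₁, e₁⟩ := h₁.deriv_w
    obtain ⟨z₂, h₂, e₂⟩ := h₂.deriv_w
    refine ⟨_, h₁.glue hab hbc h₂, ?_⟩
    rw [← restrict_Ioc_eq_restrict_Icc] at e₁ e₂ ⊢
    rw [← Ioc_union_Ioc_eq_Ioc hab hbc]
    refine (lintegral_union_le _ _ _).trans (add_le_add (le_trans (le_of_eq ?_) e₁)
      (le_trans (le_of_eq ?_) e₂))
    · exact setLIntegral_congr_fun measurableSet_Ioc fun r hr => by simp [hr.2]
    · exact setLIntegral_congr_fun measurableSet_Ioc fun r hr => by simp [not_le.2 hr.1]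

lemma IsArc.shift {V : E3 → ℝ} {u w : ℝ → E3} {s t : ℝ} {C : ℝ≥0∞}
    (h : IsArc V u w s t C) (d : ℝ) :
    IsArc V (fun r => u (r - d)) (fun r => w (r - d)) (s + d) (t + d) C := by
  have hm : ∀ r ∈ Icc (s + d) (t + d), r - d ∈ Icc s t := fun r hr =>
    ⟨by linarith [hr.1], by linarith [hr.2]⟩
  refine ⟨fun r hr => h.unit _ (hm r hr), fun r hr => h.orth _ (hm r hr), h.deriv_u.comp_sub d,
    ?_, ?_⟩
  · obtain ⟨a, ha⟩ := h.deriv_v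
    exact ⟨_, ha.comp_sub d⟩
  · obtain ⟨z, hz, hc⟩ := h.deriv_w
    refine ⟨_, hz.comp_sub d, le_trans (le_of_eq ?_) hc⟩
    rw [← lintegral_indicator measurableSet_Icc, ← lintegral_indicator measurableSet_Icc,
      ← lintegral_sub_right_eq_self ((Icc s t).indicator _) d]
    refine lintegral_congr fun r => ?_
    by_cases hr : r - d ∈ Icc s t
    · rw [indicator_of_mem hr, indicator_of_mem]
      exact ⟨by linarith [hr.1], by linarith [hr.2]⟩
    · rw [indicator_of_notMem hr, indicator_of_notMem]
      exact fun h => hr (hm r h)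

lemma IsArc.of_smooth {V : E3 → ℝ} {u w w' : ℝ → E3} {s t : ℝ} {C : ℝ≥0∞}
    (unit : ∀ r ∈ Icc s t, ‖u r‖ = 1) (orth : ∀ r ∈ Icc s t, inner ℝ (u r) (w r) = 0)
    (hu : ∀ r ∈ Icc s t, HasDerivAt u (cross (w r) (u r)) r)
    (hw : ∀ r ∈ Icc s t, HasDerivAt w (w' r) r) (hw' : ContinuousOn w' (Icc s t))
    (hC : ∫⁻ r in Icc s t, density V (w r) (w' r) ≤ C) : IsArc V u w s t C := by
  have cu : ContinuousOn u (Icc s t) := fun r hr => (hu r hr).continuousAt.continuousWithinAt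
  have cw : ContinuousOn w (Icc s t) := fun r hr => (hw r hr).continuousAt.continuousWithinAt
  have cv := continuousOn_cross cw cu
  refine ⟨unit, orth, SobolevOn.of_hasDerivAt hu cv,
    ⟨fun r => cross (w r) (cross (w r) (u r)) + cross (w' r) (u r),
      SobolevOn.of_hasDerivAt (fun r hr => hasDerivAt_cross (hw r hr) (hu r hr)) ?_⟩,
    w', SobolevOn.of_hasDerivAt hw hw', hC⟩
  exact (continuousOn_cross cw cv).add (continuousOn_cross hw' cu)

lemma lintegral_Icc_le_of_density_le {V : E3 → ℝ} {w w' : ℝ → E3} {s t B : ℝ}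
    (hB : ∀ r ∈ Icc s t, (‖w r‖ ^ 2 - 1) ^ 2 + V (w r) + ‖w' r‖ ^ 2 ≤ B) (hst : s ≤ t) :
    ∫⁻ r in Icc s t, density V (w r) (w' r) ≤ ENNReal.ofReal ((t - s) * B) := by
  calc ∫⁻ r in Icc s t, density V (w r) (w' r)
      ≤ ∫⁻ r in Icc s t, ENNReal.ofReal B :=
        setLIntegral_mono measurable_const fun r hr => ENNReal.ofReal_le_ofReal (hB r hr)
    _ = _ := by
        rw [setLIntegral_const, Real.volume_Icc, mul_comm,
          ← ENNReal.ofReal_mul (sub_nonneg.2 hst)]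

/-- The state `x₁` can be reached from `x₀` at cost at most `C`; a state is a pair `(u, u × u')`. -/
def Reach (V : E3 → ℝ) (x₀ x₁ : E3 × E3) (C : ℝ≥0∞) : Prop :=
  ∃ (T : ℝ) (u w : ℝ → E3), 0 ≤ T ∧ IsArc V u w 0 T C ∧ (u 0, w 0) = x₀ ∧ (u T, w T) = x₁

lemma Reach.mono {V : E3 → ℝ} {x₀ x₁ : E3 × E3} {C D : ℝ≥0∞} (h : Reach V x₀ x₁ C)
    (hCD : C ≤ D) : Reach V x₀ x₁ D := by
  obtain ⟨T, u, w, hT, ha, h0, h1⟩ := h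
  exact ⟨T, u, w, hT, ha.cost_mono hCD, h0, h1⟩

/-- The curve following `u` until time `T` and then `v`, restarted at `0`. -/
def splice (T : ℝ) (u v : ℝ → E3) (r : ℝ) : E3 := if r ≤ T then u r else v (r - T)

lemma splice_of_le {T r : ℝ} {u v : ℝ → E3} (h : r ≤ T) : splice T u v r = u r := if_pos h

lemma splice_of_ge {T r : ℝ} {u v : ℝ → E3} (huv : u T = v 0) (h : T ≤ r) :
    splice T u v r = v (r - T) := by
  rcases h.eq_or_lt with rfl | h
  · simp [splice, huv]
  · exact if_neg (not_le.2 h)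

lemma IsArc.splice {V : E3 → ℝ} {u₁ w₁ u₂ w₂ : ℝ → E3} {a T b : ℝ} {C D : ℝ≥0∞} (haT : a ≤ T)
    (hb : 0 ≤ b) (h₁ : IsArc V u₁ w₁ a T C) (h₂ : IsArc V u₂ w₂ 0 b D) (hu : u₁ T = u₂ 0)
    (hw : w₁ T = w₂ 0) :
    IsArc V (splice T u₁ u₂) (splice T w₁ w₂) a (T + b) (C + D) := by
  refine IsArc.trans haT (by linarith : T ≤ T + b) ?_ ?_
  · exact h₁.congr (fun r hr => splice_of_le hr.2) (fun r hr => splice_of_le hr.2)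
  · have := h₂.shift T
    rw [zero_add, add_comm b] at this
    exact this.congr (fun r hr => splice_of_ge hu hr.1) (fun r hr => splice_of_ge hw hr.1)

lemma Reach.trans {V : E3 → ℝ} {x₀ x₁ x₂ : E3 × E3} {C D : ℝ≥0∞} (h : Reach V x₀ x₁ C)
    (h' : Reach V x₁ x₂ D) : Reach V x₀ x₂ (C + D) := by
  obtain ⟨T, u, w, hT, ha, h0, h1⟩ := h
  obtain ⟨T', u', w', hT', ha', h0', h1'⟩ := h'
  have hx := h1.trans h0'.symm
  simp only [Prod.mk.injEq] at hx
  refine ⟨T + T', _, _, by linarith, ha.splice hT hT' ha' hx.1 hx.2, ?_, ?_⟩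
  · rw [← h0, splice_of_le hT, splice_of_le hT]
  · rw [← h1', splice_of_ge hx.1 (by linarith), splice_of_ge hx.2 (by linarith)]
    simp

lemma norm_eq_one_of_sq {x : E3} (h : ‖x‖ ^ 2 = 1) : ‖x‖ = 1 :=
  (pow_left_inj₀ (norm_nonneg _) zero_le_one two_ne_zero).1 (by rw [h, one_pow])

/-! ### Rotations -/

/-- The point at angle `φ` on the unit circle perpendicular to `y` starting at `e`. -/
def circ (y e : E3) (φ : ℝ) : E3 := Real.cos φ • e + Real.sin φ • cross y e

@[simp] lemma circ_zero (y e : E3) : circ y e 0 = e := by simp [circ]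

lemma inner_circ {y e : E3} (h : inner ℝ y e = 0) (φ : ℝ) : inner ℝ y (circ y e φ) = 0 := by
  simp [circ, inner_add_right, inner_smul_right, h, inner_cross_left]

lemma cross_circ {y e : E3} (hy : ‖y‖ = 1) (h : inner ℝ y e = 0) (φ : ℝ) :
    cross y (circ y e φ) = (-Real.sin φ) • e + Real.cos φ • cross y e := by
  have h2 : inner ℝ y y = (1 : ℝ) := by rw [real_inner_self_eq_norm_sq, hy]; norm_num
  simp only [circ, cross_add_right, cross_smul_right, cross_cross_right, h, h2]
  module

lemma norm_circ {y e : E3} (hy : ‖y‖ = 1) (h : inner ℝ y e = 0) (φ : ℝ) :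
    ‖circ y e φ‖ = ‖e‖ := by
  have h1 : ‖circ y e φ‖ ^ 2 = ‖e‖ ^ 2 := by
    rw [circ, norm_add_sq_real, norm_smul, norm_smul, norm_cross_of_orthogonal h, hy,
      inner_smul_left, inner_smul_right, inner_cross_right]
    simp only [Real.norm_eq_abs, mul_pow, sq_abs, one_mul, mul_zero, add_zero]
    linear_combination (‖e‖ ^ 2) * (Real.cos_sq_add_sin_sq φ)
  exact (pow_left_inj₀ (norm_nonneg _) (norm_nonneg _) two_ne_zero).1 h1

lemma hasDerivAt_circ {y e : E3} (hy : ‖y‖ = 1) (h : inner ℝ y e = 0) {φ : ℝ → ℝ} {s t : ℝ}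
    (hφ : HasDerivAt φ s t) :
    HasDerivAt (fun r => circ y e (φ r)) (s • cross y (circ y e (φ t))) t := by
  have h1 := (hφ.cos.smul_const e).add (hφ.sin.smul_const (cross y e))
  refine h1.congr_deriv ?_
  rw [cross_circ hy h]
  module

lemma circ_circ {y e : E3} (hy : ‖y‖ = 1) (h : inner ℝ y e = 0) (α β : ℝ) :
    circ y (circ y e α) β = circ y e (α + β) := by
  rw [circ, cross_circ hy h, circ, circ, Real.cos_add, Real.sin_add]
  module

lemma circ_add_two_pi (y e : E3) (φ : ℝ) (n : ℤ) : circ y e (φ + n * (2 * Real.pi)) = circ y e φ := by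
  simp [circ, Real.cos_add_int_mul_two_pi, Real.sin_add_int_mul_two_pi]

lemma eq_circ_combination {y e f : E3} (hy : ‖y‖ = 1) (he : ‖e‖ = 1) (hye : inner ℝ y e = 0)
    (hyf : inner ℝ y f = 0) : f = (inner ℝ e f) • e + (inner ℝ (cross y e) f) • cross y e := by
  have hn : ‖cross y e‖ = 1 := by rw [norm_cross_of_orthogonal hye, hy, he, one_mul]
  have h1 : cross (cross (cross y e) f) (cross y e) = (inner ℝ e f) • e := by
    rw [cross_cross_left y e f, hyf, zero_smul, zero_sub, cross_neg_left, cross_smul_left,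
      cross_cross_right, real_inner_self_eq_norm_sq, hy, hye]
    module
  rw [cross_cross_left, real_inner_self_eq_norm_sq, hn, real_inner_comm] at h1
  rw [← h1]
  module

/-- In the frame (e, y × e) the vector f has coordinates (cos φ, sin φ), and φ is free modulo 2π.
The arbitrary left end `L` is what later lets a transition wait up to one turn until the phases
match. -/
lemma exists_circ_eq {y e f : E3} (hy : ‖y‖ = 1) (he : ‖e‖ = 1) (hf : ‖f‖ = 1)
    (hye : inner ℝ y e = 0) (hyf : inner ℝ y f = 0) (L : ℝ) :
    ∃ φ ∈ Icc L (L + 2 * Real.pi), circ y e φ = f := by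
  have hc := eq_circ_combination hy he hye hyf
  set a := inner ℝ e f
  set b := inner ℝ (cross y e) f
  have hn : ‖cross y e‖ = 1 := by rw [norm_cross_of_orthogonal hye, hy, he, one_mul]
  have hab : a ^ 2 + b ^ 2 = 1 := by
    have h : ‖f‖ ^ 2 = ‖a • e + b • cross y e‖ ^ 2 := by rw [← hc]
    rw [hf, norm_add_sq_real, norm_smul, norm_smul, hn, he, inner_smul_left, inner_smul_right,
      inner_cross_right] at h
    simp only [Real.norm_eq_abs, mul_one, sq_abs, mul_zero, add_zero] at h
    linarith
  set z : ℂ := ⟨a, b⟩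
  have hz : ‖z‖ = 1 := by
    rw [Complex.norm_def, Complex.normSq_apply, ← Real.sqrt_one]
    congr 1
    show a * a + b * b = 1
    nlinarith
  have hz0 : z ≠ 0 := by rw [← norm_pos_iff, hz]; norm_num
  have h1 : Real.cos (Complex.arg z) = a := by rw [Complex.cos_arg hz0, hz, div_one]
  have h2 : Real.sin (Complex.arg z) = b := by rw [Complex.sin_arg, hz, div_one]
  obtain ⟨n, hn, -⟩ := existsUnique_add_zsmul_mem_Ico Real.two_pi_pos (Complex.arg z) L
  refine ⟨_, Ico_subset_Icc_self hn, ?_⟩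
  rw [zsmul_eq_mul, circ_add_two_pi, circ, h1, h2, ← hc]

/-- Rotation about the unit vector `y` with speed `s`, the derivative of the angle `φ`. -/
lemma IsArc.rotation {V : E3 → ℝ} {y e : E3} (hy : ‖y‖ = 1) (he : ‖e‖ = 1)
    (hye : inner ℝ y e = 0) {φ s s' : ℝ → ℝ} {a b : ℝ} {C : ℝ≥0∞}
    (hφ : ∀ r ∈ Icc a b, HasDerivAt φ (s r) r) (hs : ∀ r ∈ Icc a b, HasDerivAt s (s' r) r)
    (hs' : ContinuousOn s' (Icc a b))
    (hC : ∫⁻ r in Icc a b, ENNReal.ofReal ((s r ^ 2 - 1) ^ 2 + V (s r • y) + s' r ^ 2) ≤ C) :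
    IsArc V (fun r => circ y e (φ r)) (fun r => s r • y) a b C := by
  refine IsArc.of_smooth (w' := fun r => s' r • y) (fun r _ => by rw [norm_circ hy hye, he])
    (fun r _ => ?_) (fun r hr => ?_) (fun r hr => (hs r hr).smul_const y)
    (hs'.smul continuousOn_const) ?_
  · rw [inner_smul_right, real_inner_comm, inner_circ hye, mul_zero]
  · refine (hasDerivAt_circ hy hye (hφ r hr)).congr_deriv ?_
    rw [cross_smul_left]
  · simpa [density, norm_smul, hy] using hC

/-- At unit speed about a fixed axis the well term and the kinetic term vanish, so only the
potential is paid, for at most one turn. -/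
lemma reach_rotate {V : E3 → ℝ} {y e f : E3} (hy : ‖y‖ = 1) (he : ‖e‖ = 1) (hf : ‖f‖ = 1)
    (hye : inner ℝ y e = 0) (hyf : inner ℝ y f = 0) {v : ℝ} (hv : V y ≤ v) (hv0 : 0 ≤ v) :
    Reach V (e, y) (f, y) (ENNReal.ofReal (2 * Real.pi * v)) := by
  obtain ⟨T, hT, hTf⟩ := exists_circ_eq hy he hf hye hyf 0
  rw [zero_add] at hT
  refine ⟨T, _, _, hT.1, IsArc.rotation hy he hye (φ := id) (s := fun _ => 1)
    (s' := fun _ => 0) (fun r _ => hasDerivAt_id r) (fun r _ => hasDerivAt_const _ _)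
    continuousOn_const ?_, by simp, by simp [hTf]⟩
  have := lintegral_Icc_le_of_density_le (V := V) (w := fun _ => (1 : ℝ) • y)
    (w' := fun _ => (0 : ℝ) • y) (s := 0) (t := T) (B := v) (fun r _ => by simpa [hy] using hv) hT.1
  refine le_trans (le_of_eq ?_) (this.trans (ENNReal.ofReal_le_ofReal ?_))
  · simp [density, hy]
  · rw [sub_zero]; exact mul_le_mul_of_nonneg_right hT.2 hv0

/-- The speed is interpolated linearly over unit time with the axis fixed. The angle turned is the
mean speed, which gives the end point. -/
lemma reach_speed {V : E3 → ℝ} {y e : E3} (hy : ‖y‖ = 1) (he : ‖e‖ = 1)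
    (hye : inner ℝ y e = 0) {s₀ s₁ B : ℝ}
    (hB : ∀ s ∈ Icc (min s₀ s₁) (max s₀ s₁), (s ^ 2 - 1) ^ 2 + V (s • y) + (s₁ - s₀) ^ 2 ≤ B) :
    Reach V (e, s₀ • y) (circ y e ((s₀ + s₁) / 2), s₁ • y) (ENNReal.ofReal B) := by
  refine ⟨1, _, _, zero_le_one, IsArc.rotation hy he hye
    (φ := fun t => s₀ * t + (s₁ - s₀) / 2 * t ^ 2) (s := fun t => s₀ + (s₁ - s₀) * t)
    (s' := fun _ => s₁ - s₀) (fun r _ => ?_) (fun r _ => ?_)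
    continuousOn_const ?_, by simp, ?_⟩
  · have := ((hasDerivAt_id r).const_mul s₀).add
      (((hasDerivAt_id r).pow 2).const_mul ((s₁ - s₀) / 2))
    refine this.congr_deriv ?_
    simp; ring
  · simpa using ((hasDerivAt_id r).const_mul (s₁ - s₀)).const_add s₀
  · have := lintegral_Icc_le_of_density_le (V := V) (w := fun t => (s₀ + (s₁ - s₀) * t) • y)
      (w' := fun _ => (s₁ - s₀) • y) (s := 0) (t := 1) (B := B) (fun r hr => ?_) zero_le_one
    · refine le_trans (le_of_eq ?_) (this.trans (ENNReal.ofReal_le_ofReal ?_))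
      · simp [density, norm_smul, hy]
      · simp
    · have := hB (s₀ + (s₁ - s₀) * r) ?_
      · simpa [norm_smul, hy] using this
      · rcases le_total s₀ s₁ with h | h
        · rw [min_eq_left h, max_eq_right h]
          constructor <;> nlinarith [hr.1, hr.2]
        · rw [min_eq_right h, max_eq_left h]
          constructor <;> nlinarith [hr.1, hr.2]
  · simp only [Prod.mk.injEq]
    constructor
    · congr 1; ring
    · congr 1; ring

set_option maxHeartbeats 1000000 in
/-- Half a turn about an axis in the plane of `b` and `e` moves `b` to `c • b + s • e`. -/
lemma reach_half_turn {V : E3 → ℝ} {b e : E3} (hb : ‖b‖ = 1) (he : ‖e‖ = 1)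
    (hbe : inner ℝ b e = 0) {c s v : ℝ} (hcs : c ^ 2 + s ^ 2 = 1) (hc : 0 ≤ c) (hv0 : 0 ≤ v)
    (hv : ∀ x : E3, ‖x‖ = 1 → ‖x - b‖ ≤ 2 * |s| → V x ≤ v) :
    ∃ f : E3, ‖f‖ = 1 ∧ inner ℝ (c • b + s • e) f = 0 ∧
      Reach V (e, b) (f, c • b + s • e) (ENNReal.ofReal (Real.pi * (s ^ 2 + v))) := by
  -- κ is the tangent of half the angle between `b` and `c • b + s • e`. It is also the geodesic
  -- curvature of the small circle that `u` follows.
  obtain ⟨κ, hκ⟩ : ∃ x, x = s / (1 + c) := ⟨_, rfl⟩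
  have hc1 : 0 < 1 + c := by linarith
  have hκs : κ * (1 + c) = s := by rw [hκ]; field_simp
  have hκabs : |κ| ≤ |s| := by
    rw [hκ, abs_div, abs_of_pos hc1]
    exact div_le_self (abs_nonneg _) (by linarith)
  have hκsq : κ ^ 2 ≤ s ^ 2 := sq_le_sq.2 hκabs
  obtain ⟨k, hk⟩ : ∃ x, x = √(1 + κ ^ 2) := ⟨_, rfl⟩
  have hk2 : k ^ 2 = 1 + κ ^ 2 := by rw [hk]; exact Real.sq_sqrt (by positivity)
  have hk1 : 1 ≤ k := by rw [hk]; exact Real.one_le_sqrt.2 (le_add_of_nonneg_right (sq_nonneg κ))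
  have hk0 : 0 < k := by linarith
  have hcκ : c = (1 - κ ^ 2) / (1 + κ ^ 2) := by
    have : κ ^ 2 * (1 + c) = 1 - c := by
      have h : (κ ^ 2 * (1 + c) - (1 - c)) * (1 + c) = 0 := by
        have : κ ^ 2 * (1 + c) * (1 + c) = s ^ 2 := by rw [← hκs]; ring
        linear_combination this + hcs
      rcases mul_eq_zero.1 h with h | h <;> linarith
    field_simp; linarith
  have hsκ : s = 2 * κ / (1 + κ ^ 2) := by
    rw [← hκs, hcκ]; field_simp; ring
  have hbb : inner ℝ b b = (1 : ℝ) := by rw [real_inner_self_eq_norm_sq, hb]; norm_num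
  have hee : inner ℝ e e = (1 : ℝ) := by rw [real_inner_self_eq_norm_sq, he]; norm_num
  have heb : inner ℝ e b = 0 := by rw [real_inner_comm]; exact hbe
  obtain ⟨a, ha⟩ : ∃ x, x = k⁻¹ • (b + κ • e) := ⟨_, rfl⟩
  have haa : inner ℝ a a = (1 : ℝ) := by
    simp only [ha, inner_add_left, inner_add_right, inner_smul_left, inner_smul_right, hbb, hee,
      hbe, heb, RCLike.conj_to_real]
    field_simp
    linarith
  have han : ‖a‖ = 1 := by
    rw [real_inner_self_eq_norm_sq] at haa
    exact norm_eq_one_of_sq haa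
  have hae : inner ℝ a e = κ / k := by
    simp only [ha, inner_add_left, inner_smul_left, hee, hbe, RCLike.conj_to_real]
    field_simp; ring
  have hea : inner ℝ e a = κ / k := by rw [real_inner_comm]; exact hae
  obtain ⟨e₀, he₀⟩ : ∃ x, x = e - (κ / k) • a := ⟨_, rfl⟩
  have hae₀ : inner ℝ a e₀ = 0 := by
    simp only [he₀, inner_sub_right, inner_smul_right, hae, haa]; ring
  have he₀n : ‖e₀‖ ^ 2 = 1 - (κ / k) ^ 2 := by
    rw [← real_inner_self_eq_norm_sq, he₀]
    simp only [inner_sub_left, inner_sub_right, inner_smul_left, inner_smul_right, hee, haa, hae,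
      hea, RCLike.conj_to_real]
    ring
  -- A small circle at height κ/k over the plane perpendicular to `a`, run with angular velocity k.
  -- Since k² = 1 + κ², the curve has unit speed.
  obtain ⟨u, hu⟩ : ∃ x : ℝ → E3, x = fun t => (κ / k) • a + circ a e₀ (k * t) := ⟨_, rfl⟩
  have hau : ∀ t, inner ℝ a (u t) = κ / k := fun t => by
    simp only [hu, inner_add_right, inner_smul_right, haa, inner_circ hae₀]; ring
  have hua : ∀ t, inner ℝ (u t) a = κ / k := fun t => by rw [real_inner_comm]; exact hau t
  have hun : ∀ t, ‖u t‖ = 1 := fun t => by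
    have : ‖u t‖ ^ 2 = 1 := by
      simp only [hu]
      rw [norm_add_sq_real, norm_smul, inner_smul_left, inner_circ hae₀, norm_circ han hae₀, han,
        he₀n, Real.norm_eq_abs, mul_one, sq_abs, mul_zero, mul_zero]
      ring
    exact norm_eq_one_of_sq this
  have huu : ∀ t, inner ℝ (u t) (u t) = (1 : ℝ) := fun t => by
    rw [real_inner_self_eq_norm_sq, hun]; norm_num
  -- This is u × u' for rotation about `a` with angular velocity k. It stays a unit vector, so the
  -- well term vanishes, and |w'| = |κ|. Half a turn reflects `u` in the axis `a` and turns `w` from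
  -- `b` by twice the angle whose tangent is κ.
  obtain ⟨w, hw⟩ : ∃ x : ℝ → E3, x = fun t => k • a - κ • u t := ⟨_, rfl⟩
  have horth : ∀ t, inner ℝ (u t) (w t) = 0 := fun t => by
    simp only [hw, inner_sub_right, inner_smul_right, huu, hua]
    field_simp; ring
  have hwn : ∀ t, ‖w t‖ = 1 := fun t => by
    have : ‖w t‖ ^ 2 = 1 := by
      rw [← real_inner_self_eq_norm_sq]
      simp only [hw, inner_sub_left, inner_sub_right, inner_smul_left, inner_smul_right, haa, huu,
        hau, hua, RCLike.conj_to_real]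
      field_simp
      linarith
    exact norm_eq_one_of_sq this
  have hcross : ∀ t, cross (w t) (u t) = k • cross a (u t) := fun t => by
    simp [hw, cross_sub_left, cross_smul_left]
  have hder : ∀ t, HasDerivAt u (cross (w t) (u t)) t := fun t => by
    have h1 := hasDerivAt_circ han hae₀ (φ := fun t => k * t) (s := k) (t := t)
      (by simpa using (hasDerivAt_id t).const_mul k)
    rw [hcross, hu]
    refine (h1.const_add ((κ / k) • a)).congr_deriv ?_
    simp [cross_add_right, cross_smul_right]
  have hu0 : u 0 = e := by simp [hu, he₀]
  have hw0 : w 0 = b := by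
    simp only [hw, hu0, ha, smul_smul, mul_inv_cancel₀ hk0.ne']; module
  have hcos : Real.cos (k * (Real.pi / k)) = -1 := by
    rw [mul_div_cancel₀ _ hk0.ne', Real.cos_pi]
  have hsin : Real.sin (k * (Real.pi / k)) = 0 := by
    rw [mul_div_cancel₀ _ hk0.ne', Real.sin_pi]
  have huT : u (Real.pi / k) = (2 * κ / k) • a - e := by
    simp only [hu, circ, hcos, hsin, he₀]; module
  have hwT : w (Real.pi / k) = c • b + s • e := by
    have h1 : k - κ * (2 * κ / k) = (k ^ 2 - 2 * κ ^ 2) / k := by field_simp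
    have h2 : w (Real.pi / k) = (k - κ * (2 * κ / k)) • a + κ • e := by
      simp only [hw, huT]; module
    rw [h2, h1, hk2, ha, hcκ, hsκ]
    have h3 : (1 + κ ^ 2 - 2 * κ ^ 2) / k * k⁻¹ = (1 - κ ^ 2) / k ^ 2 := by field_simp; ring
    rw [smul_smul, h3, hk2, smul_add, smul_smul, add_assoc, ← add_smul]
    congr 2
    field_simp
    ring
  have hdw : ∀ t, HasDerivAt w (-(κ • cross (w t) (u t))) t := fun t => by
    have := ((hder t).const_smul κ).const_sub (k • a)
    rw [hw]
    rw [hw] at this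
    exact this
  refine ⟨u (Real.pi / k), hun _, ?_, Real.pi / k, u, w, by positivity, IsArc.of_smooth
    (fun r _ => hun r) (fun r _ => horth r) (fun r _ => hder r) (fun r _ => hdw r) ?_ ?_,
    by rw [hu0, hw0], by rw [hwT]⟩
  · rw [← hwT, real_inner_comm]; exact horth _
  · have cu : Continuous u := continuous_iff_continuousAt.2 fun t => (hder t).continuousAt
    have cw : Continuous w := continuous_iff_continuousAt.2 fun t => (hdw t).continuousAt
    exact ((continuousOn_cross cw.continuousOn cu.continuousOn).const_smul κ).neg
  · refine (lintegral_Icc_le_of_density_le (B := s ^ 2 + v) (fun r _ => ?_)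
      (by positivity)).trans (ENNReal.ofReal_le_ofReal ?_)
    · have h1 : V (w r) ≤ v := by
        refine hv _ (hwn r) ?_
        have : w r - b = κ • (e - u r) := by rw [← hw0]; simp only [hw, hu0]; module
        rw [this, norm_smul, Real.norm_eq_abs]
        have h2 : ‖e - u r‖ ≤ 2 := (norm_sub_le _ _).trans (by rw [he, hun]; norm_num)
        rw [mul_comm]
        exact mul_le_mul h2 hκabs (abs_nonneg _) zero_le_two
      have h2 : ‖-(κ • cross (w r) (u r))‖ ^ 2 = κ ^ 2 := by
        rw [norm_neg, norm_smul, norm_cross_of_orthogonal (by rw [real_inner_comm, horth]), hwn,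
          hun, Real.norm_eq_abs, mul_one, mul_one, sq_abs]
      rw [hwn, h2]
      linarith
    · rw [sub_zero]
      apply mul_le_mul_of_nonneg_right _ (by positivity)
      exact div_le_self Real.pi_pos.le hk1

/-! ### Connecting nearby states -/

lemma exists_unit_smul {x : E3} (hx : x ≠ 0) : ∃ n : E3, ‖n‖ = 1 ∧ x = ‖x‖ • n :=
  ⟨‖x‖⁻¹ • x, by rw [norm_smul, norm_inv, norm_norm, inv_mul_cancel₀ (norm_ne_zero_iff.2 hx)],
    by rw [smul_smul, mul_inv_cancel₀ (norm_ne_zero_iff.2 hx), one_smul]⟩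

lemma exists_unit_orthogonal (y : E3) : ∃ e : E3, ‖e‖ = 1 ∧ inner ℝ y e = 0 := by
  have h : ∃ x : E3, x ≠ 0 ∧ inner ℝ y x = 0 := by
    by_cases h : y 0 = 0
    · refine ⟨!₂[1, 0, 0], fun h => ?_, by simp [inner_coord, h]⟩
      have := congrArg (fun x : E3 => x 0) h
      simp at this
    · refine ⟨!₂[-y 1, y 0, 0], fun h' => h ?_, by simp [inner_coord]; ring⟩
      have := congrArg (fun x : E3 => x 1) h'
      simpa using this
  obtain ⟨x, hx, hyx⟩ := h
  obtain ⟨n, hn, hxn⟩ := exists_unit_smul hx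
  refine ⟨n, hn, ?_⟩
  rw [hxn, inner_smul_right] at hyx
  exact (mul_eq_zero.1 hyx).resolve_left (norm_ne_zero_iff.2 hx)

/-- At a common normal of the two axes a curve can stop rotating about one and start rotating about
the other. -/
lemma exists_unit_orthogonal_pair (y y' : E3) :
    ∃ n : E3, ‖n‖ = 1 ∧ inner ℝ y n = 0 ∧ inner ℝ y' n = 0 := by
  by_cases h : cross y y' = 0
  · by_cases hy : y = 0
    · obtain ⟨e, he, h'⟩ := exists_unit_orthogonal y'
      exact ⟨e, he, by simp [hy], h'⟩
    obtain ⟨e, he, h'⟩ := exists_unit_orthogonal y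
    refine ⟨e, he, h', ?_⟩
    have h1 := cross_cross_right y y y'
    rw [h, cross_zero_right, real_inner_self_eq_norm_sq] at h1
    have h2 : inner ℝ ((‖y‖ ^ 2) • y') e = 0 := by
      rw [← sub_eq_zero.1 h1.symm, inner_smul_left, h', mul_zero]
    rw [inner_smul_left] at h2
    exact (mul_eq_zero.1 h2).resolve_left (by simpa using hy)
  · obtain ⟨n, hn, hxn⟩ := exists_unit_smul h
    refine ⟨n, hn, ?_, ?_⟩
    · have := inner_cross_left y y'
      rw [hxn, inner_smul_right] at this
      exact (mul_eq_zero.1 this).resolve_left (norm_ne_zero_iff.2 h)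
    · have := inner_cross_right y y'
      rw [hxn, inner_smul_right] at this
      exact (mul_eq_zero.1 this).resolve_left (norm_ne_zero_iff.2 h)

lemma exists_plane_coordinates {b b' : E3} (hb : ‖b‖ = 1) (hb' : ‖b'‖ = 1) :
    ∃ (e : E3) (c s : ℝ), ‖e‖ = 1 ∧ inner ℝ b e = 0 ∧ c ^ 2 + s ^ 2 = 1 ∧ b' = c • b + s • e ∧
      2 - 2 * c = ‖b' - b‖ ^ 2 := by
  have hc : 2 - 2 * inner ℝ b b' = ‖b' - b‖ ^ 2 := by
    rw [norm_sub_sq_real, hb, hb', real_inner_comm]; ring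
  have hbb : inner ℝ b b = (1 : ℝ) := by rw [real_inner_self_eq_norm_sq, hb]; norm_num
  by_cases h : b' - (inner ℝ b b') • b = 0
  · obtain ⟨e, he, hbe⟩ := exists_unit_orthogonal b
    have h1 := sub_eq_zero.1 h
    refine ⟨e, inner ℝ b b', 0, he, hbe, ?_, by rw [zero_smul, add_zero]; exact h1, hc⟩
    have h2 := congrArg (fun x => ‖x‖ ^ 2) h1
    simp only [norm_smul, hb, hb', Real.norm_eq_abs, mul_one, sq_abs] at h2
    linarith
  · obtain ⟨e, he, hxe⟩ := exists_unit_smul h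
    have hn := norm_ne_zero_iff.2 h
    have horth : inner ℝ b e = 0 := by
      have h1 : inner ℝ b (b' - (inner ℝ b b') • b) = 0 := by
        rw [inner_sub_right, inner_smul_right, hbb]; ring
      rw [hxe, inner_smul_right] at h1
      exact (mul_eq_zero.1 h1).resolve_left hn
    refine ⟨e, inner ℝ b b', ‖b' - (inner ℝ b b') • b‖, he, horth, ?_, ?_, hc⟩
    · rw [norm_sub_sq_real, norm_smul, inner_smul_right, hb, hb', real_inner_comm b b',
        Real.norm_eq_abs, mul_one, sq_abs]
      ring
    · rw [← hxe]; abel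

set_option maxHeartbeats 1000000 in
-- A state near `q` consists of an axis near `q`, a speed near 1 and a point of the circle
-- perpendicular to the axis. Five moves of bounded duration join two of them: bring the speed to 1,
-- rotate to the right point, tilt the axis by a half turn, rotate again, and adjust the speed. All
-- of them stay where the potential is at most ε/100, and the other terms are O(ρ).
lemma exists_reach_near {V : E3 → ℝ} {q : E3} (hq : ‖q‖ = 1)
    (hV : ∀ v > 0, ∃ ρ > 0, ∀ w, ‖w - q‖ < ρ → V w ≤ v) {ε : ℝ} (hε : 0 < ε) :
    ∃ ρ > 0, ∀ u₀ w₀ u₁ w₁ : E3, ‖u₀‖ = 1 → ‖u₁‖ = 1 → inner ℝ w₀ u₀ = 0 → inner ℝ w₁ u₁ = 0 →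
      ‖w₀ - q‖ < ρ → ‖w₁ - q‖ < ρ → Reach V (u₀, w₀) (u₁, w₁) (ENNReal.ofReal ε) := by
  obtain ⟨ρ₀, hρ₀, hVρ⟩ := hV (ε / 100) (by positivity)
  obtain ⟨v, hv⟩ : ∃ v, v = ε / 100 := ⟨_, rfl⟩
  rw [← hv] at hVρ
  have hv0 : 0 < v := by rw [hv]; positivity
  obtain ⟨ρ, hρ, h1, h2, h3⟩ : ∃ ρ > 0, 20 * ρ ≤ ρ₀ ∧ ρ ≤ 1 / 100 ∧ ρ ≤ ε / 200 :=
    ⟨min (ρ₀ / 20) (min (1 / 100) (ε / 200)), by positivity,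
      by linarith [min_le_left (ρ₀ / 20) (min (1 / 100) (ε / 200))],
      (min_le_right _ _).trans (min_le_left _ _), (min_le_right _ _).trans (min_le_right _ _)⟩
  refine ⟨ρ, hρ, fun u₀ w₀ u₁ w₁ hu₀ hu₁ ho₀ ho₁ hw₀ hw₁ => ?_⟩
  have hρ2 : ρ ^ 2 ≤ ρ / 100 := by
    rw [sq, div_eq_mul_one_div]; exact mul_le_mul_of_nonneg_left h2 hρ.le
  have key : ∀ w u : E3, ‖w - q‖ < ρ → inner ℝ w u = 0 → ∃ (b : E3) (s : ℝ), ‖b‖ = 1 ∧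
      w = s • b ∧ |s - 1| < ρ ∧ ‖b - q‖ < 2 * ρ ∧ inner ℝ b u = 0 := by
    intro w u hw ho
    have h4 : |‖w‖ - 1| < ρ := by rw [← hq]; exact (abs_norm_sub_norm_le _ _).trans_lt hw
    have h5 := abs_lt.1 h4
    have hw0 : w ≠ 0 := norm_pos_iff.1 (by linarith)
    obtain ⟨b, hb, hwb⟩ := exists_unit_smul hw0
    refine ⟨b, ‖w‖, hb, hwb, h4, ?_, ?_⟩
    · have : ‖b - w‖ < ρ := by
        have e : b - w = (1 - ‖w‖) • b := by rw [sub_smul, one_smul, ← hwb]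
        rw [e, norm_smul, hb, mul_one, Real.norm_eq_abs, abs_sub_comm]; exact h4
      calc ‖b - q‖ ≤ ‖b - w‖ + ‖w - q‖ := norm_sub_le_norm_sub_add_norm_sub _ _ _
        _ < 2 * ρ := by linarith
    · rw [hwb, inner_smul_left] at ho
      exact (mul_eq_zero.1 ho).resolve_left (norm_ne_zero_iff.2 hw0)
  obtain ⟨b₀, s₀, hb₀, rfl, hs₀, hbq₀, ho₀⟩ := key w₀ u₀ hw₀ ho₀
  obtain ⟨b₁, s₁, hb₁, rfl, hs₁, hbq₁, ho₁⟩ := key w₁ u₁ hw₁ ho₁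
  have hspeed : ∀ (b : E3) (σ s σ' : ℝ), ‖b‖ = 1 → ‖b - q‖ < 2 * ρ → |σ - 1| ≤ ρ → |σ' - 1| ≤ ρ →
      |σ' - σ| ≤ ρ → s ∈ Icc (min σ σ') (max σ σ') →
      (s ^ 2 - 1) ^ 2 + V (s • b) + (σ' - σ) ^ 2 ≤ 10 * ρ + v := by
    intro b σ s σ' hb hbq hσ hσ' hd hs
    have e1 := abs_le.1 hσ
    have e2 := abs_le.1 hσ'
    have e3 : 1 - ρ ≤ s := le_trans (le_min (by linarith) (by linarith)) hs.1
    have e4 : s ≤ 1 + ρ := le_trans hs.2 (max_le (by linarith) (by linarith))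
    have e5 : |s - 1| ≤ ρ := abs_le.2 ⟨by linarith, by linarith⟩
    have hVs : V (s • b) ≤ v := by
      apply hVρ
      have : s • b - q = (s - 1) • b + (b - q) := by module
      calc ‖s • b - q‖ ≤ ‖(s - 1) • b‖ + ‖b - q‖ := by rw [this]; exact norm_add_le _ _
        _ < ρ₀ := by rw [norm_smul, hb, Real.norm_eq_abs]; linarith
    have e6 : (s - 1) ^ 2 ≤ ρ ^ 2 := sq_le_sq' (by linarith) (by linarith)
    have e7 : (σ' - σ) ^ 2 ≤ ρ ^ 2 := sq_le_sq' (by linarith [(abs_le.1 hd).1]) (abs_le.1 hd).2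
    have e8 : (s + 1) ^ 2 ≤ 3 ^ 2 := pow_le_pow_left₀ (by linarith) (by linarith) 2
    have e9 : (s ^ 2 - 1) ^ 2 ≤ ρ ^ 2 * 9 := by
      have : (s ^ 2 - 1) ^ 2 = (s - 1) ^ 2 * (s + 1) ^ 2 := by ring
      rw [this]
      exact mul_le_mul e6 (e8.trans (by norm_num)) (sq_nonneg _) (sq_nonneg _)
    linarith
  have hVb : ∀ b : E3, ‖b - q‖ < 2 * ρ → V b ≤ v := fun b h => hVρ _ (by linarith)
  have hρabs : |(1 : ℝ) - 1| ≤ ρ := by simp [hρ.le]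
  -- adjust the speed, turn, and adjust the speed again
  have r1 := reach_speed (V := V) hb₀ hu₀ ho₀ (s₀ := s₀) (s₁ := 1) (B := 10 * ρ + v)
    fun s hs => hspeed b₀ s₀ s 1 hb₀ hbq₀ hs₀.le hρabs (by rw [abs_sub_comm]; exact hs₀.le) hs
  obtain ⟨e, c, s, he, hbe, hcs, hb₁e, hcn⟩ := exists_plane_coordinates hb₀ hb₁
  have hdist : ‖b₁ - b₀‖ ≤ 4 * ρ := by
    calc ‖b₁ - b₀‖ ≤ ‖b₁ - q‖ + ‖q - b₀‖ := norm_sub_le_norm_sub_add_norm_sub _ _ _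
      _ ≤ 4 * ρ := by rw [norm_sub_rev q b₀]; linarith
  have hd2 : ‖b₁ - b₀‖ ^ 2 ≤ (4 * ρ) ^ 2 := pow_le_pow_left₀ (norm_nonneg _) hdist 2
  have hc0 : 0 ≤ c := by
    have : (4 * ρ) ^ 2 = 16 * ρ ^ 2 := by ring
    linarith
  have hs2 : s ^ 2 ≤ (4 * ρ) ^ 2 := by
    have : s ^ 2 = (2 - 2 * c) - (1 - c) ^ 2 := by linear_combination hcs
    linarith [sq_nonneg (1 - c)]
  have hs4 : |s| ≤ 4 * ρ := abs_le_of_sq_le_sq hs2 (by positivity)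
  obtain ⟨f, hf, hof, r3⟩ := reach_half_turn (V := V) hb₀ he hbe hcs hc0 hv0.le fun x _ hx => by
    apply hVρ
    calc ‖x - q‖ ≤ ‖x - b₀‖ + ‖b₀ - q‖ := norm_sub_le_norm_sub_add_norm_sub _ _ _
      _ < ρ₀ := by linarith
  rw [← hb₁e] at hof r3
  have r2 := reach_rotate (V := V) hb₀ (norm_circ hb₀ ho₀ ((s₀ + 1) / 2) |>.trans hu₀) he
    (inner_circ ho₀ _) hbe (hVb _ hbq₀) hv0.le
  -- Going back from `u₁` by the angle that the last change of speed will turn makes the last move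
  -- end exactly at `u₁`.
  obtain ⟨u₂, h₂⟩ : ∃ x, x = circ b₁ u₁ (-((1 + s₁) / 2)) := ⟨_, rfl⟩
  have hu₂ : ‖u₂‖ = 1 := by rw [h₂]; exact (norm_circ hb₁ ho₁ _).trans hu₁
  have ho₂ : inner ℝ b₁ u₂ = 0 := by rw [h₂]; exact inner_circ ho₁ _
  have r4 := reach_rotate (V := V) hb₁ hf hu₂ hof ho₂ (hVb _ hbq₁) hv0.le
  have r5 := reach_speed (V := V) hb₁ hu₂ ho₂ (s₀ := 1) (s₁ := s₁) (B := 10 * ρ + v)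
    fun s hs => hspeed b₁ 1 s s₁ hb₁ hbq₁ hρabs hs₁.le hs₁.le hs
  rw [show circ b₁ u₂ ((1 + s₁) / 2) = u₁ by
    rw [h₂, circ_circ hb₁ ho₁, neg_add_cancel, circ_zero], one_smul] at r5
  rw [one_smul] at r1
  refine ((((r1.trans r2).trans r3).trans r4).trans r5).mono ?_
  have hπ := Real.pi_le_four
  have hπ0 := Real.pi_pos
  rw [← ENNReal.ofReal_add (by positivity) (by positivity),
    ← ENNReal.ofReal_add (by positivity) (by positivity),
    ← ENNReal.ofReal_add (by positivity) (by positivity),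
    ← ENNReal.ofReal_add (by positivity) (by positivity)]
  apply ENNReal.ofReal_le_ofReal
  have e1 : Real.pi * (s ^ 2 + v) ≤ 4 * (s ^ 2 + v) :=
    mul_le_mul_of_nonneg_right hπ (by positivity)
  have e2 : Real.pi * v ≤ 4 * v := mul_le_mul_of_nonneg_right hπ hv0.le
  have e3 : (4 * ρ) ^ 2 = 16 * ρ ^ 2 := by ring
  linarith

/-- Without a potential, two unit vectors are joined at arbitrarily small cost. -/
lemma reach_slow {y y' e e' : E3} (hy : ‖y‖ = 1) (hy' : ‖y'‖ = 1) (he : ‖e‖ = 1) (he' : ‖e'‖ = 1)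
    (hye : inner ℝ y e = 0) (hye' : inner ℝ y' e' = 0) {ε : ℝ} (hε : 0 < ε) :
    Reach (fun _ => 0) (e, y) (e', y') (ENNReal.ofReal ε) := by
  obtain ⟨f, c, s, hf, hyf, hcs, hy'f, -⟩ := exists_plane_coordinates hy hy'
  obtain ⟨Θ, hΘ⟩ : ∃ Θ : ℝ, y' = Real.cos Θ • y + Real.sin Θ • f := by
    have hfy : inner ℝ f y = 0 := by rw [real_inner_comm]; exact hyf
    have hn : ‖cross f y‖ = 1 := by rw [norm_cross_of_orthogonal hfy, hf, hy, one_mul]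
    have h1 : inner ℝ (cross f y) y = 0 := by rw [real_inner_comm]; exact inner_cross_right _ _
    have h2 : inner ℝ (cross f y) f = 0 := by rw [real_inner_comm]; exact inner_cross_left _ _
    obtain ⟨Θ, -, h⟩ := exists_circ_eq hn hy hy' h1
      (by rw [hy'f, inner_add_right, inner_smul_right, inner_smul_right, h1, h2]; ring) 0
    refine ⟨-Θ, ?_⟩
    have h3 : cross (cross f y) y = -f := by
      rw [cross_cross_left, hfy, real_inner_self_eq_norm_sq, hy]; module
    rw [← h, circ, h3, Real.cos_neg, Real.sin_neg]; module
  have hyy : inner ℝ y y = (1 : ℝ) := by rw [real_inner_self_eq_norm_sq, hy]; norm_num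
  have hff : inner ℝ f f = (1 : ℝ) := by rw [real_inner_self_eq_norm_sq, hf]; norm_num
  have hfy : inner ℝ f y = 0 := by rw [real_inner_comm]; exact hyf
  set Y : ℝ → E3 := fun φ => Real.cos φ • y + Real.sin φ • f with hY
  set F : ℝ → E3 := fun φ => (-Real.sin φ) • y + Real.cos φ • f with hF
  have hYn : ∀ φ, ‖Y φ‖ = 1 := fun φ => norm_eq_one_of_sq (by
    rw [← real_inner_self_eq_norm_sq]
    simp only [hY, inner_add_left, inner_add_right, inner_smul_left, inner_smul_right, hyy, hff,
      hyf, hfy, RCLike.conj_to_real]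
    linear_combination Real.sin_sq_add_cos_sq φ)
  have hFn : ∀ φ, ‖F φ‖ = 1 := fun φ => norm_eq_one_of_sq (by
    rw [← real_inner_self_eq_norm_sq]
    simp only [hF, inner_add_left, inner_add_right, inner_smul_left, inner_smul_right, hyy, hff,
      hyf, hfy, RCLike.conj_to_real]
    linear_combination Real.sin_sq_add_cos_sq φ)
  have hYF : ∀ φ, inner ℝ (Y φ) (F φ) = 0 := fun φ => by
    simp only [hY, hF, inner_add_left, inner_add_right, inner_smul_left, inner_smul_right, hyy,
      hff, hyf, hfy, RCLike.conj_to_real]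
    ring
  -- The tilt Θ is cut into m half turns of tilt α = Θ/m, each of cost at most 4α², so the total is
  -- 4Θ²/m < ε; the rotations between them are free. The bound |Θ| < m gives |α| ≤ 1 and hence the
  -- nonnegative cosine that a half turn requires.
  obtain ⟨m, hm⟩ := exists_nat_gt (max (|Θ|) (4 * Θ ^ 2 / ε))
  have hm1 : |Θ| < m := (le_max_left _ _).trans_lt hm
  have hm2 : 4 * Θ ^ 2 / ε < m := (le_max_right _ _).trans_lt hm
  have hm0 : (0 : ℝ) < m := (abs_nonneg _).trans_lt hm1
  set α := Θ / m with hα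
  have hα1 : |α| ≤ 1 := by
    rw [hα, abs_div, abs_of_pos hm0]; exact (div_le_one hm0).2 hm1.le
  have hcos : 0 ≤ Real.cos α := by
    apply Real.cos_nonneg_of_mem_Icc
    have := abs_le.1 hα1
    have := Real.pi_gt_three
    constructor <;> linarith
  have step : ∀ j : ℕ, Reach (fun _ => 0) (e, y) (F (j * α), Y (j * α))
      (ENNReal.ofReal (j * (4 * α ^ 2))) := by
    intro j
    induction j with
    | zero =>
      have := reach_rotate (V := fun _ => 0) hy he hf hye hyf le_rfl le_rfl
      simpa [hY, hF] using this
    | succ j ih =>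
      obtain ⟨g, hg, hog, r⟩ := reach_half_turn (V := fun _ => 0) (v := 0) (hYn (j * α))
        (hFn (j * α)) (hYF _) (Real.cos_sq_add_sin_sq α) hcos le_rfl (fun _ _ _ => le_rfl)
      have hnext : Real.cos α • Y (j * α) + Real.sin α • F (j * α) = Y ((j + 1 : ℕ) * α) := by
        have : ((j + 1 : ℕ) : ℝ) * α = j * α + α := by push_cast; ring
        rw [this]
        simp only [hY, hF, Real.cos_add, Real.sin_add]
        module
      rw [hnext] at hog r
      have r2 := reach_rotate (V := fun _ => 0) (hYn _) hg (hFn _) hog (hYF _) le_rfl le_rfl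
      refine ((ih.trans r).trans r2).mono ?_
      rw [mul_zero, ENNReal.ofReal_zero, add_zero, add_zero,
        ← ENNReal.ofReal_add (by positivity) (by positivity)]
      apply ENNReal.ofReal_le_ofReal
      have h1 : Real.sin α ^ 2 ≤ α ^ 2 := sq_le_sq.2 Real.abs_sin_le_abs
      have h2 : Real.pi * Real.sin α ^ 2 ≤ 4 * α ^ 2 :=
        mul_le_mul Real.pi_le_four h1 (sq_nonneg _) (by norm_num)
      push_cast
      linarith
  have h := step m
  have hmα : m * α = Θ := by rw [hα]; field_simp
  have hYm : Y (m * α) = y' := by rw [hmα, hΘ]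
  rw [hYm] at h
  have hYF' := hYF (m * α)
  rw [hYm] at hYF'
  have r2 := reach_rotate (V := fun _ => 0) hy' (hFn _) he' hYF' hye' le_rfl le_rfl
  refine (h.trans r2).mono ?_
  rw [mul_zero, ENNReal.ofReal_zero, add_zero]
  apply ENNReal.ofReal_le_ofReal
  have : (m : ℝ) * (4 * α ^ 2) = 4 * Θ ^ 2 / m := by rw [hα]; field_simp
  rw [this, div_le_iff₀ hm0]
  rw [div_lt_iff₀ hε] at hm2
  linarith

/-! ### Global profiles -/

/-- A curve on the sphere over the whole line, rotating about `y` before time `0` and about `y'`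
after time `T`, with profile `w` and cost at most `C`. -/
structure IsTransit (V : E3 → ℝ) (y e y' e' : E3) (T : ℝ) (C : ℝ≥0∞) (u w a w' : ℝ → E3) :
    Prop where
  unit : ∀ t, ‖u t‖ = 1
  orth : ∀ t, inner ℝ (u t) (w t) = 0
  deriv_u : HasSobolevDeriv u (fun r => cross (w r) (u r))
  deriv_v : HasSobolevDeriv (fun r => cross (w r) (u r)) a
  deriv_w : HasSobolevDeriv w w'
  before_u : ∀ t ≤ 0, u t = circ y e t
  before_w : ∀ t ≤ 0, w t = y
  after_u : ∀ t ≥ T, u t = circ y' e' (t - T)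
  after_w : ∀ t ≥ T, w t = y'
  cost : ∫⁻ t, density V (w t) (w' t) ≤ C

lemma sobolevOn_circ {y e : E3} (hy : ‖y‖ = 1) (hye : inner ℝ y e = 0) (d s t : ℝ) :
    SobolevOn s t (fun r => circ y e (r - d)) (fun r => cross y (circ y e (r - d))) ∧
    SobolevOn s t (fun r => cross y (circ y e (r - d)))
      (fun r => cross y (cross y (circ y e (r - d)))) := by
  have h1 : ∀ r, HasDerivAt (fun r => circ y e (r - d)) (cross y (circ y e (r - d))) r := fun r => by
    simpa using hasDerivAt_circ hy hye (φ := fun r => r - d) ((hasDerivAt_id r).sub_const d)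
  have h2 : ∀ r, HasDerivAt (fun r => cross y (circ y e (r - d)))
      (cross y (cross y (circ y e (r - d)))) r := fun r => by
    simpa using hasDerivAt_cross (hasDerivAt_const r y) (h1 r)
  have c1 : ContinuousOn (fun r => cross y (circ y e (r - d))) (Icc s t) := fun r _ =>
    (h2 r).continuousAt.continuousWithinAt
  exact ⟨SobolevOn.of_hasDerivAt (fun r _ => h1 r) c1,
    SobolevOn.of_hasDerivAt (fun r _ => h2 r) (continuousOn_cross continuousOn_const c1)⟩

lemma SobolevOn.extend {T : ℝ} (hT : 0 ≤ T) {f f₀ f₁ f₂ g₀ g₁ g₂ : ℝ → E3}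
    (h₀ : ∀ s t, SobolevOn s t f₀ g₀) (h₁ : SobolevOn 0 T f₁ g₁) (h₂ : ∀ s t, SobolevOn s t f₂ g₂)
    (e₀ : ∀ t ≤ 0, f t = f₀ t) (e₁ : EqOn f f₁ (Icc 0 T)) (e₂ : ∀ t ≥ T, f t = f₂ t) :
    HasSobolevDeriv f (fun r => if r ≤ 0 then g₀ r else if r ≤ T then g₁ r else g₂ r) := by
  rw [hasSobolevDeriv_iff]
  intro a b
  obtain ⟨M, hM, h1, h2⟩ : ∃ M, 0 ≤ M ∧ -M ≤ a ∧ b ≤ T + M :=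
    ⟨|a| + |b|, by positivity, by linarith [neg_abs_le a, abs_nonneg b],
      by linarith [le_abs_self b, abs_nonneg a]⟩
  have k₀ : SobolevOn (-M) 0 f g₀ := (h₀ (-M) 0).congr (fun t ht => e₀ t ht.2) fun _ _ => rfl
  have k₁ : SobolevOn 0 T f g₁ := h₁.congr e₁ fun _ _ => rfl
  have k₂ : SobolevOn T (T + M) f g₂ := (h₂ T (T + M)).congr (fun t ht => e₂ t ht.1) fun _ _ => rfl
  exact (k₀.glue (by linarith) (by linarith) (k₁.glue hT (by linarith) k₂)).mono h1 h2

/-- Prolonging by uniform rotations about the end axes costs nothing, because their speed is 1 and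
the potential vanishes there. A finite arc thus becomes a competitor on the whole line. -/
lemma IsArc.extend {V : E3 → ℝ} {u w : ℝ → E3} {T : ℝ} {C : ℝ≥0∞} (hT : 0 ≤ T)
    (h : IsArc V u w 0 T C) {y e y' e' : E3} (hy : ‖y‖ = 1) (hy' : ‖y'‖ = 1)
    (h0 : (u 0, w 0) = (e, y)) (h1 : (u T, w T) = (e', y')) (hV : V y = 0) (hV' : V y' = 0) :
    ∃ u₁ w₁ a w', IsTransit V y e y' e' T C u₁ w₁ a w' ∧ EqOn u₁ u (Icc 0 T) ∧
      EqOn w₁ w (Icc 0 T) := by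
  simp only [Prod.mk.injEq] at h0 h1
  have i0 : (0 : ℝ) ∈ Icc 0 T := ⟨le_rfl, hT⟩
  have iT : T ∈ Icc 0 T := ⟨hT, le_rfl⟩
  have he : ‖e‖ = 1 := by rw [← h0.1]; exact h.unit 0 i0
  have he' : ‖e'‖ = 1 := by rw [← h1.1]; exact h.unit T iT
  have hye : inner ℝ y e = 0 := by rw [real_inner_comm, ← h0.1, ← h0.2]; exact h.orth 0 i0
  have hye' : inner ℝ y' e' = 0 := by rw [real_inner_comm, ← h1.1, ← h1.2]; exact h.orth T iT
  obtain ⟨U, hU⟩ : ∃ U : ℝ → E3, U = fun r =>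
    if r ≤ 0 then circ y e r else if r ≤ T then u r else circ y' e' (r - T) := ⟨_, rfl⟩
  obtain ⟨W, hW⟩ : ∃ W : ℝ → E3, W = fun r => if r ≤ 0 then y else if r ≤ T then w r else y' :=
    ⟨_, rfl⟩
  have U0 : ∀ t ≤ 0, U t = circ y e t := fun t ht => by simp [hU, ht]
  have W0 : ∀ t ≤ 0, W t = y := fun t ht => by simp [hW, ht]
  have U1 : EqOn U u (Icc 0 T) := fun t ht => by
    rcases ht.1.eq_or_lt with h | h
    · rw [← h, U0 0 le_rfl, circ_zero, h0.1]
    · simp [hU, not_le.2 h, ht.2]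
  have W1 : EqOn W w (Icc 0 T) := fun t ht => by
    rcases ht.1.eq_or_lt with h | h
    · rw [← h, W0 0 le_rfl, h0.2]
    · simp [hW, not_le.2 h, ht.2]
  have U2 : ∀ t ≥ T, U t = circ y' e' (t - T) := fun t ht => by
    rcases ht.eq_or_lt with h | h
    · rw [← h, U1 iT, h1.1]; simp
    · have : 0 < t := hT.trans_lt h
      simp [hU, not_le.2 h, not_le.2 this]
  have W2 : ∀ t ≥ T, W t = y' := fun t ht => by
    rcases ht.eq_or_lt with h | h
    · rw [← h, W1 iT, h1.2]
    · have : 0 < t := hT.trans_lt h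
      simp [hW, not_le.2 h, not_le.2 this]
  obtain ⟨a, ha⟩ := h.deriv_v
  obtain ⟨w', hw', hc⟩ := h.deriv_w
  have hconst : ∀ (x : E3) s t, SobolevOn s t (fun _ => x) (fun _ => 0) := fun x s t =>
    SobolevOn.of_hasDerivAt (fun r _ => hasDerivAt_const r x) continuousOn_const
  have hcirc := fun s t => sobolevOn_circ hy hye 0 s t
  have hcirc' := fun s t => sobolevOn_circ hy' hye' T s t
  simp only [sub_zero] at hcirc
  have hcase : ∀ t, t ≤ 0 ∨ t ∈ Icc 0 T ∨ T ≤ t := fun t => by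
    rcases le_total t 0 with h | h
    · exact Or.inl h
    · rcases le_total t T with h' | h'
      · exact Or.inr (Or.inl ⟨h, h'⟩)
      · exact Or.inr (Or.inr h')
  refine ⟨U, W, _, _, ⟨fun t => ?_, fun t => ?_, ?_,
    SobolevOn.extend hT (fun s t => (hcirc s t).2) ha (fun s t => (hcirc' s t).2)
      (fun t ht => by rw [W0 t ht, U0 t ht]) (fun t ht => by simp only [W1 ht, U1 ht])
      (fun t ht => by rw [W2 t ht, U2 t ht]),
    SobolevOn.extend hT (hconst y) hw' (hconst y') W0 W1 W2, U0, W0, U2, W2, ?_⟩, U1, W1⟩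
  · rcases hcase t with ht | ht | ht
    · rw [U0 t ht, norm_circ hy hye, he]
    · rw [U1 ht, h.unit t ht]
    · rw [U2 t ht, norm_circ hy' hye', he']
  · rcases hcase t with ht | ht | ht
    · rw [U0 t ht, W0 t ht, real_inner_comm, inner_circ hye]
    · rw [U1 ht, W1 ht, h.orth t ht]
    · rw [U2 t ht, W2 t ht, real_inner_comm, inner_circ hye']
  · have := SobolevOn.extend (f := U) hT (fun s t => (hcirc s t).1) h.deriv_u
      (fun s t => (hcirc' s t).1) U0 U1 U2
    convert this using 1
    ext1 r
    rcases hcase r with ht | ht | ht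
    · rw [if_pos ht, W0 r ht, U0 r ht]
    · rw [W1 ht, U1 ht]
      rcases ht.1.eq_or_lt with h' | h'
      · rw [if_pos h'.symm.le, ← h', h0.1, h0.2, circ_zero]
      · rw [if_neg (not_le.2 h'), if_pos ht.2]
    · rw [W2 r ht, U2 r ht]
      rcases (ht : T ≤ r).eq_or_lt with h' | h'
      -- This happens only for `T = 0`. Both junctions then coincide and the end states are equal,
      -- so the branch chosen for the derivative does not matter.
      · by_cases hr : r ≤ 0
        · have hT0 : T = 0 := le_antisymm (h' ▸ hr) hT
          have hr0 : r = 0 := by rw [← h', hT0]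
          rw [if_pos hr, hr0, hT0, sub_zero, circ_zero, circ_zero, ← h0.1, ← h0.2, ← h1.1, ← h1.2,
            hT0]
        · rw [if_neg hr, if_pos h'.symm.le, ← h', sub_self, circ_zero, h1.1, h1.2]
      · rw [if_neg (not_le.2 (hT.trans_lt h')), if_neg (not_le.2 h')]
  · have hzero : ∀ x : E3, ‖x‖ = 1 → V x = 0 → density V x 0 = 0 := fun x h1 h2 => by
      simp [density, h1, h2]
    have hsplit : (univ : Set ℝ) = Iic 0 ∪ (Ioc 0 T ∪ Ioi T) := by
      rw [Ioc_union_Ioi_eq_Ioi hT, Iic_union_Ioi]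
    rw [← setLIntegral_univ, hsplit]
    refine (lintegral_union_le _ _ _).trans ((add_le_add le_rfl (lintegral_union_le _ _ _)).trans ?_)
    have k0 : ∫⁻ r in Iic 0, density V (W r)
        (if r ≤ 0 then 0 else if r ≤ T then w' r else 0) = 0 := by
      rw [setLIntegral_congr_fun (g := fun _ => 0) measurableSet_Iic fun r hr => ?_]
      · simp
      · have hr' : r ≤ 0 := hr
        simp only [W0 r hr', if_pos hr', hzero y hy hV]
    have k2 : ∫⁻ r in Ioi T, density V (W r)
        (if r ≤ 0 then 0 else if r ≤ T then w' r else 0) = 0 := by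
      rw [setLIntegral_congr_fun (g := fun _ => 0) measurableSet_Ioi fun r hr => ?_]
      · simp
      · have hr' : T < r := hr
        simp only [W2 r hr'.le, if_neg (not_le.2 (hT.trans_lt hr')), if_neg (not_le.2 hr'),
          hzero y' hy' hV']
    have k1 : ∫⁻ r in Ioc 0 T, density V (W r)
        (if r ≤ 0 then 0 else if r ≤ T then w' r else 0) ≤ C := by
      rw [restrict_Ioc_eq_restrict_Icc.symm] at hc
      refine le_trans (le_of_eq (setLIntegral_congr_fun measurableSet_Ioc fun r hr => ?_)) hc
      simp only [W1 (Ioc_subset_Icc_self hr), if_neg (not_le.2 hr.1), if_pos hr.2]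
    rw [k0, k2, zero_add, add_zero]
    exact k1

lemma Reach.exists_isTransit {V : E3 → ℝ} {C : ℝ≥0∞} {y e y' e' : E3} (hy : ‖y‖ = 1)
    (hy' : ‖y'‖ = 1) (h : Reach V (e, y) (e', y') C) (hV : V y = 0) (hV' : V y' = 0) :
    ∃ T u w a w', 0 ≤ T ∧ IsTransit V y e y' e' T C u w a w' := by
  obtain ⟨T, u, w, hT, ha, h0, h1⟩ := h
  obtain ⟨u₁, w₁, a, w', h, -⟩ := ha.extend hT hy hy' h0 h1 hV hV'
  exact ⟨T, u₁, w₁, a, w', hT, h⟩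

lemma IsTransit.transitionCost_le {F : E3 → ℝ} {y e y' e' : E3} {T : ℝ} {C : ℝ≥0∞}
    {u w a w' : ℝ → E3} (h : IsTransit (fun x => F x / 2) y e y' e' T C u w a w') :
    transitionCost F y y' ≤ C := by
  have hw : w ∈ profiles y y' := by
    refine ⟨u, _, a, h.unit, h.deriv_u, h.deriv_v, fun t => ?_, ?_, ?_⟩
    · rw [cross_cross_right, real_inner_self_eq_norm_sq, h.unit, h.orth]; simp
    · exact tendsto_const_nhds.congr' ((eventually_le_atBot 0).mono fun t ht => (h.before_w t ht).symm)
    · exact tendsto_const_nhds.congr' ((eventually_ge_atTop T).mono fun t ht => (h.after_w t ht).symm)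
  exact (iInf_le_of_le w (iInf_le_of_le w' (iInf_le_of_le hw (iInf_le_of_le h.deriv_w
    h.cost))))

lemma hasSobolevDeriv_continuous {f g : ℝ → E3} (h : HasSobolevDeriv f g) : Continuous f := by
  rw [hasSobolevDeriv_iff] at h
  refine continuous_iff_continuousAt.2 fun t => ?_
  exact ((h (t - 1) (t + 1)).continuousOn).continuousAt (Icc_mem_nhds (by linarith) (by linarith))

lemma HasSobolevDeriv.hasDerivAt {f g : ℝ → E3} (h : HasSobolevDeriv f g) (hg : Continuous g)
    (t : ℝ) : HasDerivAt f (g t) t := by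
  have h1 : f = fun s => f 0 + ∫ r in (0 : ℝ)..s, g r := by
    ext1 s; exact h.2 0 s
  rw [h1]
  exact (intervalIntegral.integral_hasDerivAt_right (hg.intervalIntegrable _ _)
    hg.aestronglyMeasurable.stronglyMeasurableAtFilter hg.continuousAt).const_add _

/-- Differentiating |u|² = 1 gives u ⟂ u', and then w × u = (u × u') × u = u'. A profile is
therefore an arc on every interval, with the same underlying curve. -/
lemma profiles_isArc {V : E3 → ℝ} {q₁ q₂ : E3} {w w' : ℝ → E3} (hw : w ∈ profiles q₁ q₂)
    (hw' : HasSobolevDeriv w w') :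
    ∃ u, ∀ s t, IsArc V u w s t (∫⁻ t, density V (w t) (w' t)) := by
  obtain ⟨u, v, a, hu, hv, ha, hw, -, -⟩ := hw
  have hd := fun t => hv.hasDerivAt (hasSobolevDeriv_continuous ha) t
  have huv : ∀ t, inner ℝ (u t) (v t) = 0 := fun t => by
    have h1 := (hd t).norm_sq
    have h2 : (fun s => ‖u s‖ ^ 2) = fun _ => (1 : ℝ) := by ext1 s; rw [hu]; norm_num
    have h3 := h1.unique (h2 ▸ hasDerivAt_const t (1 : ℝ))
    linarith
  have hcr : (fun r => cross (w r) (u r)) = v := by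
    ext1 t
    rw [hw, cross_cross_left, real_inner_self_eq_norm_sq, hu, real_inner_comm, huv]; simp
  rw [hasSobolevDeriv_iff] at hv ha hw'
  refine ⟨u, fun s t => ⟨fun r _ => hu r, fun r _ => by rw [hw, inner_cross_left],
    by rw [hcr]; exact hv s t, ⟨a, by rw [hcr]; exact ha s t⟩, w', hw' s t,
    setLIntegral_le_lintegral _ _⟩⟩

/-- A potential is small near `q`. -/
def SmallNear (V : E3 → ℝ) (q : E3) : Prop := ∀ v > 0, ∃ ρ > 0, ∀ w, ‖w - q‖ < ρ → V w ≤ v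

/-- The profile is cut at times at which `w` is already close to its limits, and both ends are
joined to the prescribed states at cost ε/2 each. So a transition may be taken to last a finite time
and to start and end at chosen spins. -/
lemma reach_of_transitionCost_lt {F : E3 → ℝ} {q₁ q₂ e₁ e₂ : E3} (hq₁ : ‖q₁‖ = 1)
    (hq₂ : ‖q₂‖ = 1) (he₁ : ‖e₁‖ = 1) (he₂ : ‖e₂‖ = 1) (ho₁ : inner ℝ q₁ e₁ = 0)
    (ho₂ : inner ℝ q₂ e₂ = 0) (hV₁ : SmallNear (fun x => F x / 2) q₁)
    (hV₂ : SmallNear (fun x => F x / 2) q₂) {C : ℝ≥0∞} (hC : transitionCost F q₁ q₂ < C) {ε : ℝ}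
    (hε : 0 < ε) : Reach (fun x => F x / 2) (e₁, q₁) (e₂, q₂) (C + ENNReal.ofReal ε) := by
  simp only [transitionCost, iInf_lt_iff] at hC
  obtain ⟨w, w', hw, hw', hC⟩ := hC
  obtain ⟨u, hu⟩ := profiles_isArc (V := fun x => F x / 2) hw hw'
  obtain ⟨ρ₁, hρ₁, r₁⟩ := exists_reach_near hq₁ hV₁ (half_pos hε)
  obtain ⟨ρ₂, hρ₂, r₂⟩ := exists_reach_near hq₂ hV₂ (half_pos hε)
  obtain ⟨-, -, -, -, -, -, -, hl, hr⟩ := hw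
  have hl' : ∀ᶠ t in atBot, ‖w t - q₁‖ < ρ₁ := by
    simpa [dist_eq_norm] using hl.eventually (Metric.ball_mem_nhds q₁ hρ₁)
  have hr' : ∀ᶠ t in atTop, ‖w t - q₂‖ < ρ₂ := by
    simpa [dist_eq_norm] using hr.eventually (Metric.ball_mem_nhds q₂ hρ₂)
  obtain ⟨s, hs, hs0⟩ := (hl'.and (eventually_le_atBot 0)).exists
  obtain ⟨t, ht, ht0⟩ := (hr'.and (eventually_ge_atTop 0)).exists
  have harc := (hu s t).shift (-s)
  have hst : 0 ≤ t - s := by linarith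
  rw [add_neg_cancel, ← sub_eq_add_neg] at harc
  have hreach : Reach (fun x => F x / 2) (u s, w s) (u t, w t)
      (∫⁻ t, density (fun x => F x / 2) (w t) (w' t)) :=
    ⟨t - s, _, _, hst, harc, by simp, by simp⟩
  have k₁ := r₁ e₁ q₁ (u s) (w s) he₁ ((hu s s).unit s ⟨le_rfl, le_rfl⟩) ho₁
    (by rw [real_inner_comm]; exact (hu s s).orth s ⟨le_rfl, le_rfl⟩) (by simpa using hρ₁) hs
  have k₂ := r₂ (u t) (w t) e₂ q₂ ((hu t t).unit t ⟨le_rfl, le_rfl⟩) he₂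
    (by rw [real_inner_comm]; exact (hu t t).orth t ⟨le_rfl, le_rfl⟩) ho₂ ht (by simpa using hρ₂)
  refine ((k₁.trans hreach).trans k₂).mono ?_
  have e : ENNReal.ofReal ε = ENNReal.ofReal (ε / 2) + ENNReal.ofReal (ε / 2) := by
    rw [← ENNReal.ofReal_add (by positivity) (by positivity), add_halves]
  have hC' : ∫⁻ t, density (fun x => F x / 2) (w t) (w' t) ≤ C := hC.le
  calc _ ≤ ENNReal.ofReal (ε / 2) + C + ENNReal.ofReal (ε / 2) := by gcongr
    _ = C + ENNReal.ofReal ε := by rw [e]; ring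

lemma transitionCost_le_of_reach {F : E3 → ℝ} {y e y' e' : E3} {C : ℝ≥0∞} (hy : ‖y‖ = 1)
    (hy' : ‖y'‖ = 1) (hF : F y = 0) (hF' : F y' = 0)
    (h : Reach (fun x => F x / 2) (e, y) (e', y') C) : transitionCost F y y' ≤ C := by
  obtain ⟨T, u, w, a, w', -, h⟩ := h.exists_isTransit hy hy' (by simp [hF]) (by simp [hF'])
  exact h.transitionCost_le

lemma transitionCost_self {F : E3 → ℝ} {y : E3} (hy : ‖y‖ = 1) (hF : F y = 0) :
    transitionCost F y y = 0 := by
  obtain ⟨e, he, hye⟩ := exists_unit_orthogonal y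
  have := reach_rotate (V := fun x => F x / 2) hy he he hye hye (v := 0) (by simp [hF]) le_rfl
  simpa using transitionCost_le_of_reach hy hy hF hF this

/-- Two near-optimal transitions of finite duration are made to meet in one state (e₂, y₂) and are
run one after the other. -/
lemma transitionCost_triangle {F : E3 → ℝ} {y₁ y₂ y₃ : E3} (h₁ : ‖y₁‖ = 1) (h₂ : ‖y₂‖ = 1)
    (h₃ : ‖y₃‖ = 1) (F₁ : F y₁ = 0) (F₃ : F y₃ = 0) (V₁ : SmallNear (fun x => F x / 2) y₁)
    (V₂ : SmallNear (fun x => F x / 2) y₂) (V₃ : SmallNear (fun x => F x / 2) y₃) :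
    transitionCost F y₁ y₃ ≤ transitionCost F y₁ y₂ + transitionCost F y₂ y₃ := by
  rcases eq_or_ne (transitionCost F y₁ y₂) ⊤ with h | h
  · simp [h]
  rcases eq_or_ne (transitionCost F y₂ y₃) ⊤ with h' | h'
  · simp [h']
  obtain ⟨e₁, he₁, o₁⟩ := exists_unit_orthogonal y₁
  obtain ⟨e₂, he₂, o₂⟩ := exists_unit_orthogonal y₂
  obtain ⟨e₃, he₃, o₃⟩ := exists_unit_orthogonal y₃
  refine ENNReal.le_of_forall_pos_le_add fun ε hε _ => ?_
  have hε4 : (0 : ℝ) < ε / 4 := by positivity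
  have hε4' : ENNReal.ofReal (ε / 4) ≠ 0 := by simpa using hε4
  have r₁ := reach_of_transitionCost_lt h₁ h₂ he₁ he₂ o₁ o₂ V₁ V₂ (ENNReal.lt_add_right h hε4') hε4
  have r₂ := reach_of_transitionCost_lt h₂ h₃ he₂ he₃ o₂ o₃ V₂ V₃ (ENNReal.lt_add_right h' hε4') hε4
  refine (transitionCost_le_of_reach h₁ h₃ F₁ F₃ (r₁.trans r₂)).trans (le_of_eq ?_)
  have : (ε : ℝ≥0∞) = ENNReal.ofReal (ε / 4) + ENNReal.ofReal (ε / 4) + ENNReal.ofReal (ε / 4)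
      + ENNReal.ofReal (ε / 4) := by
    rw [← ENNReal.ofReal_add (by positivity) (by positivity), ← ENNReal.ofReal_add (by positivity)
      (by positivity), ← ENNReal.ofReal_add (by positivity) (by positivity),
      ← ENNReal.ofReal_coe_nnreal]
    congr 1; ring
  rw [this]; ring

/-! ### Transitions through zero -/

/-- s = k tanh(k r) with k² = 1 + ε solves s' = k² − s² and, unlike tanh r, reaches 1 in finite
time. While 0 ≤ s ≤ 1 the density is at most 2(k² − s²)s', whose integral is 2(k² − 1/3) = 4/3 + 2ε.
-/
lemma exists_acceleration {ε : ℝ} (hε : 0 < ε) :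
    ∃ (T : ℝ) (φ s s' : ℝ → ℝ), 0 ≤ T ∧ (∀ r, HasDerivAt φ (s r) r) ∧
      (∀ r, HasDerivAt s (s' r) r) ∧ Continuous s' ∧ s 0 = 0 ∧ φ 0 = 0 ∧ s T = 1 ∧
      ∫⁻ r in Icc 0 T, ENNReal.ofReal ((s r ^ 2 - 1) ^ 2 + s' r ^ 2) ≤
        ENNReal.ofReal (4 / 3 + 2 * ε) := by
  obtain ⟨k, hk⟩ : ∃ k, k = √(1 + ε) := ⟨_, rfl⟩
  have hk2 : k ^ 2 = 1 + ε := by rw [hk]; exact Real.sq_sqrt (by positivity)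
  have hk1 : 1 < k := by rw [hk]; exact Real.lt_sqrt_of_sq_lt (by linarith)
  have hk0 : 0 < k := by linarith
  have hmem : 1 / k ∈ Ioo (-1 : ℝ) 1 :=
    ⟨by have : 0 < 1 / k := by positivity
        linarith, by rw [div_lt_one hk0]; exact hk1⟩
  have hder : ∀ r, HasDerivAt (fun r => k * (Real.sinh (k * r) / Real.cosh (k * r)))
      (k ^ 2 - (k * (Real.sinh (k * r) / Real.cosh (k * r))) ^ 2) r := fun r => by
    have h0 : HasDerivAt (fun r => k * r) k r := by simpa using (hasDerivAt_id r).const_mul k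
    have hc := (Real.cosh_pos (k * r)).ne'
    refine ((h0.sinh.div h0.cosh hc).const_mul k).congr_deriv ?_
    field_simp
  have hφ : ∀ r, HasDerivAt (fun r => Real.log (Real.cosh (k * r)))
      (k * (Real.sinh (k * r) / Real.cosh (k * r))) r := fun r => by
    have h0 : HasDerivAt (fun r => k * r) k r := by simpa using (hasDerivAt_id r).const_mul k
    refine (h0.cosh.log (Real.cosh_pos (k * r)).ne').congr_deriv ?_
    ring
  obtain ⟨s, hs⟩ : ∃ s : ℝ → ℝ, s = fun r => k * (Real.sinh (k * r) / Real.cosh (k * r)) :=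
    ⟨_, rfl⟩
  have hder' : ∀ r, HasDerivAt s (k ^ 2 - s r ^ 2) r := fun r => by rw [hs]; exact hder r
  have cs : Continuous s := continuous_iff_continuousAt.2 fun t => (hder' t).continuousAt
  have hT : s (Real.artanh (1 / k) / k) = 1 := by
    simp only [hs]
    rw [mul_div_cancel₀ _ hk0.ne', ← Real.tanh_eq_sinh_div_cosh, Real.tanh_artanh hmem]
    field_simp
  have hT0 : 0 ≤ Real.artanh (1 / k) / k :=
    div_nonneg (Real.artanh_nonneg (x := 1 / k) (by positivity)) hk0.le
  have hmono : Monotone s := by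
    apply monotone_of_deriv_nonneg (fun r => (hder' r).differentiableAt)
    intro r
    rw [(hder' r).deriv, sub_nonneg, sq_le_sq, hs]
    beta_reduce
    rw [← Real.tanh_eq_sinh_div_cosh, abs_mul]
    exact mul_le_of_le_one_right (abs_nonneg _) (Real.abs_tanh_lt_one _).le
  have hs0 : s 0 = 0 := by simp [hs]
  refine ⟨_, _, s, fun r => k ^ 2 - s r ^ 2, hT0, fun r => by rw [hs]; exact hφ r, hder',
    by fun_prop, hs0, by simp, hT, ?_⟩
  generalize Real.artanh (1 / k) / k = T at hT hT0
  have hle : ∀ r ∈ Icc 0 T, 0 ≤ s r ∧ s r ≤ 1 := fun r hr =>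
    ⟨hs0 ▸ hmono hr.1, hT ▸ hmono hr.2⟩
  have hbound : ∀ r ∈ Icc 0 T, (s r ^ 2 - 1) ^ 2 + (k ^ 2 - s r ^ 2) ^ 2 ≤
      2 * (k ^ 2 - s r ^ 2) * (k ^ 2 - s r ^ 2) := fun r hr => by
    have h1 : s r ^ 2 ≤ 1 := pow_le_one₀ (hle r hr).1 (hle r hr).2
    have : (s r ^ 2 - 1) ^ 2 ≤ (k ^ 2 - s r ^ 2) ^ 2 := by
      rw [sq_le_sq, abs_of_nonpos (by linarith), abs_of_nonneg (by linarith)]; linarith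
    linarith
  have hprim : ∀ r ∈ uIcc 0 T, HasDerivAt (fun r => 2 * (k ^ 2 * s r - s r ^ 3 / 3))
      (2 * (k ^ 2 - s r ^ 2) * (k ^ 2 - s r ^ 2)) r := fun r _ => by
    refine ((((hder' r).const_mul (k ^ 2)).sub (((hder' r).pow 3).div_const 3)).const_mul
      2).congr_deriv ?_
    push_cast; ring
  have cint : Continuous fun r => 2 * (k ^ 2 - s r ^ 2) * (k ^ 2 - s r ^ 2) := by fun_prop
  calc ∫⁻ r in Icc 0 T, ENNReal.ofReal ((s r ^ 2 - 1) ^ 2 + (k ^ 2 - s r ^ 2) ^ 2)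
      ≤ ∫⁻ r in Icc 0 T, ENNReal.ofReal (2 * (k ^ 2 - s r ^ 2) * (k ^ 2 - s r ^ 2)) :=
        setLIntegral_mono (by fun_prop) fun r hr => ENNReal.ofReal_le_ofReal (hbound r hr)
    _ = ENNReal.ofReal (∫ r in Icc 0 T, 2 * (k ^ 2 - s r ^ 2) * (k ^ 2 - s r ^ 2)) := by
        rw [ofReal_integral_eq_lintegral_ofReal]
        · exact cint.continuousOn.integrableOn_Icc
        · exact Eventually.of_forall fun r => by
            simp only [Pi.zero_apply]; nlinarith [sq_nonneg (k ^ 2 - s r ^ 2)]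
    _ = ENNReal.ofReal (4 / 3 + 2 * ε) := by
        rw [integral_Icc_eq_integral_Ioc, ← intervalIntegral.integral_of_le hT0,
          intervalIntegral.integral_eq_sub_of_hasDerivAt hprim (cint.intervalIntegrable _ _), hT,
          hs0, hk2]
        congr 1; ring

lemma lintegral_Icc_reflect (T : ℝ) (f : ℝ → ℝ≥0∞) :
    ∫⁻ r in Icc 0 T, f (T - r) = ∫⁻ r in Icc 0 T, f r := by
  rw [← lintegral_indicator measurableSet_Icc, ← lintegral_indicator measurableSet_Icc,
    ← lintegral_sub_left_eq_self ((Icc 0 T).indicator f) T]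
  refine lintegral_congr fun r => ?_
  have : r ∈ Icc 0 T ↔ T - r ∈ Icc 0 T := by
    simp only [mem_Icc]; constructor <;> rintro ⟨h1, h2⟩ <;> constructor <;> linarith
  by_cases hr : r ∈ Icc 0 T
  · rw [indicator_of_mem hr, indicator_of_mem (this.1 hr)]
  · rw [indicator_of_notMem hr, indicator_of_notMem (fun h => hr (this.2 h))]

/-- A transition of cost close to `8/3`, through `w = 0`: the curve stops for a while at a point
perpendicular to both end values. -/
lemma exists_isTransit_hold {V : E3 → ℝ} {y y' : E3} (hy : ‖y‖ = 1) (hy' : ‖y'‖ = 1)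
    (hV : ∀ s : ℝ, V (s • y) = 0) (hV' : ∀ s : ℝ, V (s • y') = 0) {ε : ℝ} (hε : 0 < ε) :
    ∃ e e' T u w a w' t₀ h₀, 0 ≤ T ∧ 0 < h₀ ∧
      IsTransit V y e y' e' T (ENNReal.ofReal (8 / 3 + ε)) u w a w' ∧
      (∀ t ≤ t₀ + h₀, inner ℝ y (u t) = 0) ∧ ∀ t ≥ t₀, inner ℝ y' (u t) = 0 := by
  obtain ⟨n, hn, hyn, hyn'⟩ := exists_unit_orthogonal_pair y y'
  obtain ⟨T, φ, s, s', hT, hφ, hs, hs', hs0, hφ0, hsT, hcost⟩ :=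
    exists_acceleration (ε := ε / 8) (by positivity)
  -- At w = 0 the density is 1, so the stop costs its duration h₀. With two changes of speed at cost
  -- 4/3 + ε/4 each, the total is at most 8/3 + ε.
  obtain ⟨h₀, hh₀, hh₀'⟩ : ∃ h₀ > 0, h₀ ≤ ε / 2 := ⟨ε / 2, by positivity, le_rfl⟩
  -- Slowing down from 1 to 0 is the time reversal of the acceleration.
  have hdφ : ∀ r, HasDerivAt (fun r => -φ (T - r)) (s (T - r)) r := fun r => by
    have := ((hφ (T - r)).comp_const_sub T r).neg
    rw [neg_neg] at this
    exact this
  have hds : ∀ r, HasDerivAt (fun r => s (T - r)) (-s' (T - r)) r := fun r => by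
    simpa using (hs (T - r)).comp_const_sub T r
  have a₁ := IsArc.rotation (V := V) hy hn hyn (a := 0) (b := T) (fun r _ => hdφ r)
    (fun r _ => hds r) (by fun_prop) (C := ENNReal.ofReal (4 / 3 + 2 * (ε / 8))) (by
      refine le_trans (le_of_eq ?_) hcost
      rw [← lintegral_Icc_reflect]
      simp [hV])
  have a₂ := IsArc.rotation (V := V) hy hn hyn (a := 0) (b := h₀) (φ := fun _ => 0)
    (s := fun _ => 0) (s' := fun _ => 0) (C := ENNReal.ofReal h₀)
    (fun r _ => hasDerivAt_const _ _) (fun r _ => hasDerivAt_const _ _) continuousOn_const (by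
      have := hV 0
      rw [zero_smul] at this
      simp [this])
  have a₃ := IsArc.rotation (V := V) hy' hn hyn' (a := 0) (b := T) (fun r _ => hφ r)
    (fun r _ => hs r) hs'.continuousOn (C := ENNReal.ofReal (4 / 3 + 2 * (ε / 8))) (by
      refine le_trans (le_of_eq ?_) hcost
      simp [hV'])
  have b₁ := a₁.splice hT hh₀.le a₂ (by simp [hφ0]) (by simp [hs0])
  have jc : ∀ (f g : ℝ → E3), f T = g 0 → splice T f g (T + h₀) = g h₀ := fun f g h => by
    rw [splice_of_ge h (by linarith)]; simp
  have b₂ := b₁.splice (by linarith) hT a₃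
    (by rw [jc _ _ (by simp [hφ0])]; simp [hφ0]) (by rw [jc _ _ (by simp [hs0])]; simp [hs0])
  have hC : ENNReal.ofReal (4 / 3 + 2 * (ε / 8)) + ENNReal.ofReal h₀ +
      ENNReal.ofReal (4 / 3 + 2 * (ε / 8)) ≤ ENNReal.ofReal (8 / 3 + ε) := by
    rw [← ENNReal.ofReal_add (by positivity) (by positivity),
      ← ENNReal.ofReal_add (by positivity) (by positivity)]
    apply ENNReal.ofReal_le_ofReal; linarith
  have b₃ := b₂.cost_mono hC
  have h1 := hV 1
  have h1' := hV' 1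
  rw [one_smul] at h1 h1'
  obtain ⟨U, hU⟩ : ∃ U, U = splice (T + h₀) (splice T (fun r => circ y n (-φ (T - r)))
    fun _ => circ y n 0) fun r => circ y' n (φ r) := ⟨_, rfl⟩
  rw [← hU] at b₃
  obtain ⟨u₁, w₁, a, w', h, hEq, -⟩ := b₃.extend (e := circ y n (-φ T)) (e' := circ y' n (φ T))
    (by linarith) hy hy'
    (by
      rw [hU, splice_of_le (by linarith), splice_of_le hT, splice_of_le (by linarith),
        splice_of_le hT]
      simp [hsT])
    (by
      rw [hU, splice_of_ge (by rw [jc _ _ (by simp [hφ0])]; simp [hφ0]) (by linarith),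
        splice_of_ge (by rw [jc _ _ (by simp [hs0])]; simp [hs0]) (by linarith)]
      simp [hsT]) h1 h1'
  refine ⟨_, _, _, u₁, w₁, a, w', T, h₀, by linarith, hh₀, h, fun t ht => ?_, fun t ht => ?_⟩
  · rcases le_total t 0 with h0 | h0
    · rw [h.before_u t h0]; exact inner_circ (inner_circ hyn _) _
    · rw [hEq ⟨h0, by linarith⟩, hU, splice_of_le ht]
      rcases le_total t T with h2 | h2
      · rw [splice_of_le h2]; exact inner_circ hyn _
      · rw [splice_of_ge (by simp [hφ0]) h2]; exact inner_circ hyn _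
  · rcases le_total (T + h₀ + T) t with h0 | h0
    · rw [h.after_u t h0]; exact inner_circ (inner_circ hyn' _) _
    · rw [hEq ⟨by linarith [ht.le], h0⟩, hU]
      rcases le_total t (T + h₀) with h2 | h2
      · rw [splice_of_le h2, splice_of_ge (by simp [hφ0]) ht, circ_zero]; exact hyn'
      · rw [splice_of_ge (by rw [jc _ _ (by simp [hφ0])]; simp [hφ0]) h2]; exact inner_circ hyn' _

lemma transitionCost_le_eight_thirds {F : E3 → ℝ} {y y' : E3} (hy : ‖y‖ = 1) (hy' : ‖y'‖ = 1)
    (hF : ∀ s : ℝ, F (s • y) = 0) (hF' : ∀ s : ℝ, F (s • y') = 0) :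
    transitionCost F y y' ≤ ENNReal.ofReal (8 / 3) := by
  refine ENNReal.le_of_forall_pos_le_add fun ε hε _ => ?_
  obtain ⟨e, e', T, u, w, a, w', t₀, h₀, -, -, h, -⟩ := exists_isTransit_hold
    (V := fun x => F x / 2) hy hy' (by simp [hF]) (by simp [hF']) (ε := ε) (by exact_mod_cast hε)
  refine h.transitionCost_le.trans (le_of_eq ?_)
  rw [ENNReal.ofReal_add (by norm_num) (by positivity), ENNReal.ofReal_coe_nnreal]

/-! ### Discrete energies -/

/-- The chirality of the pair of sites `i`, `i + 1`, in units of `η`. -/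
def chi (η : ℝ) (u : ℕ → E3) (i : ℕ) : E3 := η⁻¹ • cross (u i) (u (i + 1))

/-- The discrete speed, in units of `η`. -/
def speed (η : ℝ) (u : ℕ → E3) (i : ℕ) : ℝ := ‖u (i + 1) - u i‖ / η

/-- The rescaled chain energy of the sites `i`, `i + 1`, `i + 2`. -/
def bend (η : ℝ) (u : ℕ → E3) (i : ℕ) : ℝ :=
  ‖chi η u (i + 1) - chi η u i‖ ^ 2 / η +
    η * (1 - (speed η u i ^ 2 + speed η u (i + 1) ^ 2) / 2) ^ 2

/-- The rescaled energy with potential `V` of the sites `i`, `i + 1`, `i + 2`. -/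
def site (η : ℝ) (V : E3 → ℝ) (u : ℕ → E3) (i : ℕ) : ℝ := bend η u i + η * V (chi η u i)

lemma bend_nonneg {η : ℝ} (hη : 0 < η) (u : ℕ → E3) (i : ℕ) : 0 ≤ bend η u i := by
  unfold bend; positivity

lemma bend_le_site {η : ℝ} (hη : 0 < η) {V : E3 → ℝ} (hV : ∀ x, 0 ≤ V x) (u : ℕ → E3) (i : ℕ) :
    bend η u i ≤ site η V u i := by
  have := mul_nonneg hη.le (hV (chi η u i))
  unfold site; linarith

lemma site_nonneg {η : ℝ} (hη : 0 < η) {V : E3 → ℝ} (hV : ∀ x, 0 ≤ V x) (u : ℕ → E3) (i : ℕ) :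
    0 ≤ site η V u i := (bend_nonneg hη u i).trans (bend_le_site hη hV u i)

lemma speed_nonneg {η : ℝ} (hη : 0 < η) (u : ℕ → E3) (i : ℕ) : 0 ≤ speed η u i := by
  unfold speed; positivity

lemma inner_eq_speed {η : ℝ} (hη : 0 < η) {u : ℕ → E3} {i : ℕ} (h0 : ‖u i‖ = 1)
    (h1 : ‖u (i + 1)‖ = 1) : inner ℝ (u i) (u (i + 1)) = 1 - η ^ 2 * speed η u i ^ 2 / 2 := by
  have h : ‖u (i + 1) - u i‖ ^ 2 = 2 - 2 * inner ℝ (u i) (u (i + 1)) := by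
    rw [norm_sub_sq_real, h0, h1, real_inner_comm]; ring
  have h2 : η ^ 2 * speed η u i ^ 2 = ‖u (i + 1) - u i‖ ^ 2 := by
    unfold speed; field_simp
  rw [h2, h]; ring

/-- Up to the factor η⁻¹, |χ| is the sine and the speed the chord of the same angle. This is the
exact relation between the two. -/
lemma norm_chi_sq {η : ℝ} (hη : 0 < η) {u : ℕ → E3} {i : ℕ} (h0 : ‖u i‖ = 1)
    (h1 : ‖u (i + 1)‖ = 1) :
    ‖chi η u i‖ ^ 2 = speed η u i ^ 2 * (1 - η ^ 2 * speed η u i ^ 2 / 4) := by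
  rw [chi, norm_smul, mul_pow, norm_cross_sq, h0, h1, inner_eq_speed hη h0 h1, norm_inv,
    Real.norm_eq_abs, abs_of_pos hη]
  field_simp
  ring

lemma norm_chi_le_speed {η : ℝ} (hη : 0 < η) {u : ℕ → E3} {i : ℕ} (h0 : ‖u i‖ = 1)
    (h1 : ‖u (i + 1)‖ = 1) : ‖chi η u i‖ ≤ speed η u i := by
  apply abs_le_of_sq_le_sq' _ (speed_nonneg hη u i) |>.2
  rw [norm_chi_sq hη h0 h1]
  have : 0 ≤ speed η u i ^ 2 * (η ^ 2 * speed η u i ^ 2 / 4) := by positivity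
  linarith

/-- With x = u_{i+2} + u_i, split x − 2(1 − η²/2)u_{i+1} into its parts across and along the unit
vector u_{i+1}. The first has the length of u_{i+1} × x = η(χ_{i+1} − χ_i). The second has length
η²|1 − mean squared speed|, because scalar products of neighbours are given by chords. No expansion
is involved. -/
lemma norm_second_difference_sq {η : ℝ} (hη : 0 < η) {u : ℕ → E3} {i : ℕ} (h0 : ‖u i‖ = 1)
    (h1 : ‖u (i + 1)‖ = 1) (h2 : ‖u (i + 2)‖ = 1) :
    ‖u (i + 2) - (2 * (1 - η ^ 2 / 2)) • u (i + 1) + u i‖ ^ 2 = η ^ 3 * bend η u i := by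
  have e1 := inner_eq_speed hη h0 h1
  have e2 := inner_eq_speed hη h1 h2
  have hc : chi η u (i + 1) - chi η u i = η⁻¹ • cross (u (i + 1)) (u (i + 2) + u i) := by
    rw [cross_add_right, cross_swap (u (i + 1)) (u i)]
    simp only [chi]; module
  have hX : inner ℝ (u (i + 1)) (u (i + 2) + u i) =
      2 - η ^ 2 * ((speed η u i ^ 2 + speed η u (i + 1) ^ 2) / 2) := by
    rw [inner_add_right, e2, real_inner_comm, e1]; ring
  have hL : ‖u (i + 2) - (2 * (1 - η ^ 2 / 2)) • u (i + 1) + u i‖ ^ 2 =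
      ‖u (i + 2) + u i‖ ^ 2 - 2 * (2 * (1 - η ^ 2 / 2)) *
        inner ℝ (u (i + 1)) (u (i + 2) + u i) + (2 * (1 - η ^ 2 / 2)) ^ 2 := by
    rw [show u (i + 2) - (2 * (1 - η ^ 2 / 2)) • u (i + 1) + u i =
      (u (i + 2) + u i) - (2 * (1 - η ^ 2 / 2)) • u (i + 1) by abel, norm_sub_sq_real, norm_smul,
      inner_smul_right, h1, Real.norm_eq_abs, mul_one, sq_abs, real_inner_comm]
    ring
  rw [hL, bend, hc, norm_smul, mul_pow ‖η⁻¹‖, norm_cross_sq, h1, hX, norm_inv, Real.norm_eq_abs,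
    abs_of_pos hη]
  field_simp
  ring

/-- The quartic growth of the well term in the speed gives this a priori bound. Consequently η²
speed² = O(η), and chord and sine are comparable. -/
lemma speed_sq_le {η E : ℝ} (hη : 0 < η) (hη1 : η ≤ 1) (hE : 3 ≤ E) {u : ℕ → E3} {i : ℕ}
    (h : bend η u i ≤ E) : η * speed η u i ^ 2 ≤ 2 * E ∧ η * speed η u (i + 1) ^ 2 ≤ 2 * E := by
  obtain ⟨A, hA⟩ : ∃ A, A = (speed η u i ^ 2 + speed η u (i + 1) ^ 2) / 2 := ⟨_, rfl⟩
  have h1 : η * (1 - A) ^ 2 ≤ E := by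
    rw [hA]
    have : 0 ≤ ‖chi η u (i + 1) - chi η u i‖ ^ 2 / η := by positivity
    unfold bend at h; linarith
  have key : η * A ≤ E := by
    by_contra hc
    push Not at hc
    have hA3 : 3 < A := by
      have : E / η < A := by rw [div_lt_iff₀ hη]; linarith
      have h3 : E ≤ E / η := by rw [le_div_iff₀ hη]; nlinarith
      linarith
    have h4 : (2 / 3 * A) ^ 2 ≤ (1 - A) ^ 2 := by
      rw [sq_le_sq, abs_of_pos (by linarith), abs_of_neg (by linarith)]; linarith
    have h5 : η * (2 / 3 * A) ^ 2 ≤ E := (mul_le_mul_of_nonneg_left h4 hη.le).trans h1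
    have h6 : η * A * A ≤ 9 / 4 * E := by nlinarith
    nlinarith
  have e1 := mul_nonneg hη.le (sq_nonneg (speed η u i))
  have e2 := mul_nonneg hη.le (sq_nonneg (speed η u (i + 1)))
  rw [hA] at key
  constructor <;> linarith

lemma norm_chi_sub_sq_le {η : ℝ} (hη : 0 < η) {u : ℕ → E3} {i : ℕ} :
    ‖chi η u (i + 1) - chi η u i‖ ^ 2 ≤ η * bend η u i := by
  have : ‖chi η u (i + 1) - chi η u i‖ ^ 2 / η ≤ bend η u i := by
    unfold bend
    have : 0 ≤ η * (1 - (speed η u i ^ 2 + speed η u (i + 1) ^ 2) / 2) ^ 2 := by positivity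
    linarith
  rw [div_le_iff₀ hη] at this; linarith

/-- A discrete Modica–Mortola inequality for P(x) = 2x − (2/3)x³, a primitive of 2(1 − x²). One has
P(x') − P(x) = (x' − x)(2 − x² − x'²) + (x' − x)³/3. The product is bounded by Young's inequality
and the cube is of higher order. Here x, x' are speeds, s, s' norms of chiralities and ω the length
of the chirality increment. -/
lemma abs_primitive_sub_le_of_real {η x x' s s' ω b : ℝ} (hη : 0 < η) (hη1 : η ≤ 1 / 100)
    (k1 : η * x ^ 2 ≤ 6) (k2 : η * x' ^ 2 ≤ 6) (n1 : s ^ 2 = x ^ 2 * (1 - η ^ 2 * x ^ 2 / 4))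
    (n2 : s' ^ 2 = x' ^ 2 * (1 - η ^ 2 * x' ^ 2 / 4)) (hω : ω ^ 2 ≤ η * b) (l1 : s ≤ x)
    (l2 : s' ≤ x') (p1 : 0 ≤ x) (p2 : 0 ≤ x') (s1 : 0 ≤ s) (s2 : 0 ≤ s') (hω0 : 0 ≤ ω)
    (hb : b = ω ^ 2 / η + η * (1 - (x ^ 2 + x' ^ 2) / 2) ^ 2) (h : b ≤ 3) (hs : |s' - s| ≤ ω) :
    |(2 * x' - 2 / 3 * x' ^ 3) - (2 * x - 2 / 3 * x ^ 3)| ≤ (1 + 17 * η) * b := by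
  have hγ : η ^ 2 * (x ^ 2 + x' ^ 2) / 4 ≤ 3 * η := by
    have := mul_le_mul_of_nonneg_left (add_le_add k1 k2) hη.le
    linarith
  have hηη : η * η ≤ η * (1 / 100) := mul_le_mul_of_nonneg_left hη1 hη.le
  -- Increments of the speed are controlled by those of the chirality: the difference of the squares
  -- s'² − s² contains the factor (x' − x)(x + x'), and s + s' ≤ x + x' can be cancelled.
  have hdx : (1 - 3 * η) * |x' - x| ≤ ω := by
    refine le_trans ?_ hs
    rcases (add_nonneg p1 p2).eq_or_lt with h0 | hpos
    · have hx : x = 0 := by linarith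
      have hx' : x' = 0 := by linarith
      simp [hx, hx']
    · have e1 : (s' - s) * (s' + s) = (x' - x) * (x + x') * (1 - η ^ 2 * (x ^ 2 + x' ^ 2) / 4) := by
        linear_combination n2 - n1
      have e2 : |s' - s| * (s' + s) = |x' - x| * (x + x') * (1 - η ^ 2 * (x ^ 2 + x' ^ 2) / 4) := by
        have := congrArg abs e1
        rwa [abs_mul, abs_mul, abs_mul, abs_of_nonneg (by linarith : 0 ≤ s' + s), abs_of_pos hpos,
          abs_of_nonneg (by linarith : 0 ≤ 1 - η ^ 2 * (x ^ 2 + x' ^ 2) / 4)] at this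
      have e3 : |x' - x| * (x + x') * (1 - 3 * η) ≤ |s' - s| * (x + x') := by
        calc |x' - x| * (x + x') * (1 - 3 * η)
            ≤ |x' - x| * (x + x') * (1 - η ^ 2 * (x ^ 2 + x' ^ 2) / 4) := by gcongr
          _ = |s' - s| * (s' + s) := e2.symm
          _ ≤ |s' - s| * (x + x') := by
              apply mul_le_mul_of_nonneg_left (by linarith) (abs_nonneg _)
      have e4 : ((1 - 3 * η) * |x' - x|) * (x + x') ≤ |s' - s| * (x + x') := by linarith
      exact le_of_mul_le_mul_right e4 hpos
  obtain ⟨d, hd⟩ : ∃ d, d = |x' - x| := ⟨_, rfl⟩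
  have hd0 : 0 ≤ d := hd ▸ abs_nonneg _
  rw [← hd] at hdx
  obtain ⟨m, hm⟩ : ∃ m, m = |2 - x ^ 2 - x' ^ 2| := ⟨_, rfl⟩
  have hm0 : 0 ≤ m := hm ▸ abs_nonneg _
  have hm2 : η * (1 - (x ^ 2 + x' ^ 2) / 2) ^ 2 = η * m ^ 2 / 4 := by
    rw [hm, sq_abs]; ring
  have hωm : ω * m ≤ b := by
    rw [hb, hm2]
    have : 0 ≤ (ω - η * m / 2) ^ 2 / η := by positivity
    have e : (ω - η * m / 2) ^ 2 / η = ω ^ 2 / η + η * m ^ 2 / 4 - ω * m := by field_simp; ring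
    linarith
  have hdω : d ≤ (1 + 4 * η) * ω := by
    have h1 : (1 + 4 * η) * ((1 - 3 * η) * d) ≤ (1 + 4 * η) * ω :=
      mul_le_mul_of_nonneg_left hdx (by linarith)
    have h2 : 1 ≤ (1 + 4 * η) * (1 - 3 * η) := by linarith
    have h3 := mul_le_mul_of_nonneg_right h2 hd0
    linarith
  have hdm : d * m ≤ (1 + 4 * η) * b := by
    calc d * m ≤ (1 + 4 * η) * ω * m := by gcongr
      _ = (1 + 4 * η) * (ω * m) := by ring
      _ ≤ _ := by gcongr
  have hb0 : 0 ≤ b := le_trans (by positivity) hωm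
  have hηb := mul_nonneg hη.le hb0
  have hd2 : d ^ 2 ≤ 2 * (η * b) := by
    calc d ^ 2 ≤ ((1 + 4 * η) * ω) ^ 2 := pow_le_pow_left₀ hd0 hdω 2
      _ = (1 + 4 * η) ^ 2 * ω ^ 2 := by ring
      _ ≤ 2 * (η * b) := by
          apply mul_le_mul _ hω (sq_nonneg _) (by norm_num)
          have : (1 + 4 * η) ^ 2 ≤ (26 / 25) ^ 2 :=
            pow_le_pow_left₀ (by linarith) (by linarith) 2
          linarith
  have hd1 : d ≤ 1 := by
    have : η * b ≤ 1 / 100 * 3 := mul_le_mul hη1 h hb0 (by norm_num)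
    exact (pow_le_one_iff_of_nonneg hd0 two_ne_zero).1 (by linarith)
  have hd3 : d ^ 3 / 3 ≤ 13 * η * b := by
    have : d ^ 3 ≤ d ^ 2 := pow_le_pow_of_le_one hd0 hd1 (by norm_num)
    linarith
  have hΦ : (2 * x' - 2 / 3 * x' ^ 3) - (2 * x - 2 / 3 * x ^ 3) =
      (x' - x) * (2 - x ^ 2 - x' ^ 2) + (x' - x) ^ 3 / 3 := by ring
  rw [hΦ]
  refine (abs_add_le _ _).trans ?_
  rw [abs_mul, abs_div, abs_pow, ← hd, ← hm, abs_of_pos (by norm_num : (0:ℝ) < 3)]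
  linarith

/-- One step of the optimal profile inequality. -/
lemma abs_primitive_sub_le {η : ℝ} (hη : 0 < η) (hη1 : η ≤ 1 / 100) {u : ℕ → E3} {i : ℕ}
    (h0 : ‖u i‖ = 1) (h1 : ‖u (i + 1)‖ = 1) (h2 : ‖u (i + 2)‖ = 1) (h : bend η u i ≤ 3) :
    |(2 * speed η u (i + 1) - 2 / 3 * speed η u (i + 1) ^ 3) -
      (2 * speed η u i - 2 / 3 * speed η u i ^ 3)| ≤ (1 + 17 * η) * bend η u i := by
  obtain ⟨k1, k2⟩ := speed_sq_le hη (by linarith) le_rfl h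
  exact abs_primitive_sub_le_of_real hη hη1 (by linarith) (by linarith) (norm_chi_sq hη h0 h1)
    (norm_chi_sq hη h1 h2) (norm_chi_sub_sq_le hη) (norm_chi_le_speed hη h0 h1)
    (norm_chi_le_speed hη h1 h2) (speed_nonneg hη u i) (speed_nonneg hη u _) (norm_nonneg _)
    (norm_nonneg _) (norm_nonneg _) rfl h (abs_norm_sub_norm_le _ _)

/-- P has the critical value 4/3 at 1: 4/3 − P(x) = (2/3)(x − 1)²(x + 2). The hypotheses put the
speed x within r + 3η of 1. -/
lemma primitive_ge_of_near_one {η r x s : ℝ} (hη : 0 < η) (hη1 : η ≤ 1 / 100) (hr : 0 < r)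
    (hr1 : r ≤ 1 / 100) (h1 : x ^ 2 * (1 - 3 / 2 * η) ≤ s ^ 2) (h2 : s ≤ x) (h0 : 0 ≤ s)
    (hc : |s - 1| < r) :
    4 / 3 - 3 * (r + 2 * η) ≤ 2 * x - 2 / 3 * x ^ 3 := by
  have h3 := abs_lt.1 hc
  have hηη : η * η ≤ η * (1 / 100) := mul_le_mul_of_nonneg_left hη1 hη.le
  have hxs : x ≤ s * (1 + 2 * η) := by
    apply abs_le_of_sq_le_sq' _ (by positivity) |>.2
    have e2 : 1 ≤ (1 + 2 * η) ^ 2 * (1 - 3 / 2 * η) := by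
      have e : (1 + 2 * η) ^ 2 * (1 - 3 / 2 * η) = 1 + η * (5 / 2 - 2 * η - 6 * (η * η)) := by ring
      rw [e]
      have : 0 ≤ η * (5 / 2 - 2 * η - 6 * (η * η)) := mul_nonneg hη.le (by linarith)
      linarith
    have e3 : (1 + 2 * η) ^ 2 * (x ^ 2 * (1 - 3 / 2 * η)) ≤ (1 + 2 * η) ^ 2 * s ^ 2 :=
      mul_le_mul_of_nonneg_left h1 (by positivity)
    have e4 := mul_le_mul_of_nonneg_left e2 (sq_nonneg x)
    linarith
  have hsη : s * (2 * η) ≤ (1 + r) * (2 * η) :=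
    mul_le_mul_of_nonneg_right (by linarith) (by linarith)
  have hrη : r * η ≤ 1 / 100 * η := mul_le_mul_of_nonneg_right hr1 hη.le
  have hx1 : |x - 1| ≤ r + 3 * η := by
    rw [abs_le]
    constructor <;> linarith
  have hx3 := abs_le.1 hx1
  have hx2 : (x - 1) ^ 2 ≤ (r + 3 * η) ^ 2 := sq_le_sq' (by linarith) hx3.2
  have : 4 / 3 - (2 * x - 2 / 3 * x ^ 3) = 2 / 3 * ((x - 1) ^ 2 * (x + 2)) := by ring
  have e5 : (x - 1) ^ 2 * (x + 2) ≤ (r + 3 * η) ^ 2 * 4 :=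
    mul_le_mul hx2 (by linarith) (by linarith) (sq_nonneg _)
  have e6 : (r + 3 * η) ^ 2 ≤ (r + 3 * η) * (1 / 10) := by
    rw [sq]; exact mul_le_mul_of_nonneg_left (by linarith) (by positivity)
  linarith

/-- Reaching `0` from the unit sphere and coming back costs almost `8/3`. -/
lemma eight_thirds_le_sum_bend {ε : ℝ} (hε : 0 < ε) :
    ∃ r > 0, ∃ η₀ > 0, ∀ η, 0 < η → η ≤ η₀ → ∀ (u : ℕ → E3) (N j : ℕ),
      (∀ i ≤ N + 1, ‖u i‖ = 1) → j ≤ N → |‖chi η u 0‖ - 1| < r → |‖chi η u N‖ - 1| < r →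
      ‖chi η u j‖ < r → 8 / 3 - ε ≤ ∑ i ∈ Finset.range N, bend η u i := by
  obtain ⟨r, hr, hr1, hr2⟩ : ∃ r > 0, r ≤ 1 / 100 ∧ r ≤ ε / 100 :=
    ⟨min (1 / 100) (ε / 100), by positivity, min_le_left _ _, min_le_right _ _⟩
  obtain ⟨η₀, hη₀, he1, he2⟩ : ∃ r > 0, r ≤ 1 / 100 ∧ r ≤ ε / 200 :=
    ⟨min (1 / 100) (ε / 200), by positivity, min_le_left _ _, min_le_right _ _⟩
  refine ⟨r, hr, η₀, hη₀, fun η hη hηle u N j hu hj c0 cN cj => ?_⟩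
  by_contra hcon
  push Not at hcon
  have hη1 : η ≤ 1 / 100 := hηle.trans he1
  have hb : ∀ i ∈ Finset.range N, bend η u i ≤ 3 := fun i hi => by
    have := Finset.single_le_sum (fun i _ => bend_nonneg hη u i) hi
    linarith
  have hN : 0 < N := by
    rcases Nat.eq_zero_or_pos N with h | h
    · have hj0 : j = 0 := by omega
      rw [hj0] at cj
      have := (abs_lt.1 c0).1
      linarith
    · exact h
  have hx : ∀ i ≤ N, η * speed η u i ^ 2 ≤ 6 := fun i hi => by
    rcases hi.eq_or_lt with h | h
    · have := (speed_sq_le hη (by linarith) le_rfl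
        (hb (N - 1) (Finset.mem_range.2 (by omega)))).2
      rw [Nat.sub_add_cancel hN] at this
      rw [h]; linarith
    · have := (speed_sq_le hη (by linarith) le_rfl (hb i (Finset.mem_range.2 h))).1
      linarith
  have hchi : ∀ i ≤ N, speed η u i ^ 2 * (1 - 3 / 2 * η) ≤ ‖chi η u i‖ ^ 2 := fun i hi => by
    rw [norm_chi_sq hη (hu i (by omega)) (hu (i + 1) (by omega))]
    apply mul_le_mul_of_nonneg_left _ (sq_nonneg _)
    have := mul_le_mul_of_nonneg_left (hx i hi) hη.le
    linarith
  obtain ⟨P, hP⟩ : ∃ P : ℕ → ℝ, P = fun i => 2 * speed η u i - 2 / 3 * speed η u i ^ 3 := ⟨_, rfl⟩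
  have hend : ∀ i ≤ N, |‖chi η u i‖ - 1| < r → 4 / 3 - 3 * (r + 2 * η) ≤ P i := fun i hi hc => by
    have h1 := hchi i hi
    have h2 := norm_chi_le_speed hη (hu i (by omega)) (hu (i + 1) (by omega))
    have h0 := norm_nonneg (chi η u i)
    simp only [hP]
    exact primitive_ge_of_near_one hη hη1 hr hr1 h1 h2 h0 hc
  have hmid : P j ≤ 4 * r := by
    have h1 := hchi j hj
    have h2 := speed_nonneg hη u j
    simp only [hP]
    have h3 : speed η u j ≤ 2 * r := by
      apply abs_le_of_sq_le_sq' _ (by positivity) |>.2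
      have : ‖chi η u j‖ ^ 2 ≤ r ^ 2 := pow_le_pow_left₀ (norm_nonneg _) cj.le 2
      have h4 := mul_le_mul_of_nonneg_left (by linarith : (1 / 2 : ℝ) ≤ 1 - 3 / 2 * η)
        (sq_nonneg (speed η u j))
      have h5 := sq_nonneg r
      linarith
    have := pow_nonneg h2 3
    linarith
  have hstep : ∀ i ∈ Finset.range N, |P (i + 1) - P i| ≤ (1 + 17 * η) * bend η u i := fun i hi => by
    have hi' := Finset.mem_range.1 hi
    rw [hP]
    exact abs_primitive_sub_le hη hη1 (hu i (by omega)) (hu _ (by omega)) (hu _ (by omega)) (hb i hi)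
  -- The two sides of the dip are telescoped separately. P drops from about 4/3 to about 0 and
  -- climbs back, which accounts for twice 4/3.
  have hsum : (P 0 - P j) + (P N - P j) ≤ (1 + 17 * η) * ∑ i ∈ Finset.range N, bend η u i := by
    rw [Finset.mul_sum, ← Finset.sum_range_add_sum_Ico _ hj]
    apply add_le_add
    · rw [← neg_sub (P j), ← Finset.sum_range_sub, ← Finset.sum_neg_distrib]
      apply Finset.sum_le_sum fun i hi => ?_
      exact (neg_le_abs _).trans (hstep i (Finset.mem_range.2 ((Finset.mem_range.1 hi).trans_le hj)))
    · rw [← Finset.sum_Ico_sub P hj]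
      apply Finset.sum_le_sum fun i hi => ?_
      exact (le_abs_self _).trans (hstep i (Finset.mem_range.2 (Finset.mem_Ico.1 hi).2))
  have k0 := hend 0 (by omega) c0
  have kN := hend N le_rfl cN
  have : (1 + 17 * η) * ∑ i ∈ Finset.range N, bend η u i ≤ (1 + 17 * η) * (8 / 3 - ε) :=
    mul_le_mul_of_nonneg_left hcon.le (by positivity)
  have h17 : 0 ≤ 17 * η * ε := by positivity
  linarith

/-! ### Interpolation of spin chains -/

/-- The state of the quadratic spline at the midpoint of two neighbouring spins. -/
def node (η : ℝ) (p q : E3) : E3 × E3 :=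
  (‖p + q‖⁻¹ • (p + q), (4 / ‖p + q‖ ^ 2) • η⁻¹ • cross p q)

/-- A pointwise comparison of the density along one spline piece with the discrete density. In the
application x, y are the two speeds, nz, nz' the norms of the two chiralities, nw, nw' those of w
and w' on the piece, ω is the chirality increment and X bounds the speeds. The potential v is only
carried along. -/
lemma spline_density_le {η X ω x y v nw nz nw' : ℝ} (hη : 0 < η) (hX : 1 ≤ X)
    (hηX : η * X ^ 3 ≤ 1 / 100) (hω : 0 ≤ ω) (hnw0 : 0 ≤ nw) (hnz0 : 0 ≤ nz) (hx0 : 0 ≤ x)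
    (hxX : x ≤ X) (hy0 : 0 ≤ y) (hyX : y ≤ X) {nz' : ℝ} (hnz' : 0 ≤ nz') (hzx : nz ≤ x)
    (hzy : nz' ≤ y) (hz : nz ^ 2 = x ^ 2 * (1 - η ^ 2 * x ^ 2 / 4))
    (hz' : nz' ^ 2 = y ^ 2 * (1 - η ^ 2 * y ^ 2 / 4)) (hzz : |nz' - nz| ≤ ω)
    (hwz : |nw - nz| ≤ ω + 8 * η * X ^ 2) (hw : nw ≤ 11 / 10 * X) (hnw'0 : 0 ≤ nw')
    (hw' : nw' ≤ (1 + 9 * η * X ^ 3) * (ω / η) + 9 * η * X ^ 3) :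
    (nw ^ 2 - 1) ^ 2 + v + nw' ^ 2 ≤ (1 + 45 * η * X ^ 3) * (ω / η) ^ 2 +
      (1 - (x ^ 2 + y ^ 2) / 2) ^ 2 + v + 200 * X ^ 5 * (ω + η) := by
  have hX0 : 0 < X := by linarith
  obtain ⟨κ, hκ⟩ : ∃ κ, κ = 9 * η * X ^ 3 := ⟨_, rfl⟩
  have hκ0 : 0 ≤ κ := by rw [hκ]; positivity
  have hκ1 : κ ≤ 1 := by rw [hκ]; linarith
  obtain ⟨a, ha⟩ : ∃ a, a = ω / η := ⟨_, rfl⟩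
  have ha0 : 0 ≤ a := by rw [ha]; positivity
  have hX3 : X ^ 3 ≤ X ^ 5 := pow_le_pow_right₀ hX (by norm_num)
  have t1 : nw' ^ 2 ≤ (1 + 45 * η * X ^ 3) * (ω / η) ^ 2 + 27 * η * X ^ 3 := by
    rw [← hκ, ← ha] at hw'
    rw [← ha]
    have h1 : nw' ^ 2 ≤ ((1 + κ) * a + κ) ^ 2 := pow_le_pow_left₀ hnw'0 hw' 2
    have h2 : κ * (1 + κ) * (2 * a) ≤ κ * (1 + κ) * (a ^ 2 + 1) := by
      apply mul_le_mul_of_nonneg_left _ (by positivity)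
      linarith [sq_nonneg (a - 1)]
    have h3 : κ * κ ≤ κ * 1 := mul_le_mul_of_nonneg_left hκ1 hκ0
    have h4 : κ * κ * a ^ 2 ≤ κ * 1 * a ^ 2 := mul_le_mul_of_nonneg_right h3 (sq_nonneg a)
    have h5 : 45 * η * X ^ 3 = 5 * κ := by rw [hκ]; ring
    have h6 : 27 * η * X ^ 3 = 3 * κ := by rw [hκ]; ring
    rw [h5, h6]
    linarith
  have hX1 : X ≤ X ^ 3 := le_self_pow₀ hX (by norm_num)
  have hsmall : ∀ s, 0 ≤ s → s ≤ X → 0 ≤ s ^ 2 * (η ^ 2 * s ^ 2 / 4) ∧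
      s ^ 2 * (η ^ 2 * s ^ 2 / 4) ≤ η * X ^ 3 := fun s hs0 hs => by
    refine ⟨by positivity, ?_⟩
    have h1 : η * s ≤ η * X ^ 3 := mul_le_mul_of_nonneg_left (hs.trans hX1) hη.le
    have h2 : s ^ 3 ≤ X ^ 3 := pow_le_pow_left₀ hs0 hs 3
    have h3 : η * s * (η * s ^ 3) ≤ 1 * (η * X ^ 3) :=
      mul_le_mul (by linarith) (mul_le_mul_of_nonneg_left h2 hη.le) (by positivity) (by norm_num)
    have h4 : s ^ 2 * (η ^ 2 * s ^ 2 / 4) = η * s * (η * s ^ 3) / 4 := by ring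
    have h5 : 0 ≤ η * X ^ 3 := by positivity
    linarith
  obtain ⟨Y, hY⟩ : ∃ Y, Y = (x ^ 2 + y ^ 2) / 2 := ⟨_, rfl⟩
  have d1 : |nw ^ 2 - nz ^ 2| ≤ 3 * X * (ω + 8 * η * X ^ 2) := by
    have : nw ^ 2 - nz ^ 2 = (nw - nz) * (nw + nz) := by ring
    rw [this, abs_mul, abs_of_nonneg (by linarith : 0 ≤ nw + nz), mul_comm]
    exact mul_le_mul (by linarith) hwz (abs_nonneg _) (by positivity)
  have d2 : |nz' ^ 2 - nz ^ 2| ≤ 2 * X * ω := by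
    have : nz' ^ 2 - nz ^ 2 = (nz' - nz) * (nz' + nz) := by ring
    rw [this, abs_mul, abs_of_nonneg (by linarith : 0 ≤ nz' + nz), mul_comm]
    exact mul_le_mul (by linarith) hzz (abs_nonneg _) (by positivity)
  obtain ⟨s1, s2⟩ := hsmall x hx0 hxX
  obtain ⟨s3, s4⟩ := hsmall y hy0 hyX
  have a1 := abs_le.1 d1
  have a2 := abs_le.1 d2
  have hXX : X ≤ X ^ 3 := hX1
  have hXω : X * ω ≤ X ^ 3 * ω := mul_le_mul_of_nonneg_right hXX hω
  have hX3ω : 0 ≤ X ^ 3 * ω := by positivity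
  have hX3η : 0 ≤ X ^ 3 * η := by positivity
  have hd : |nw ^ 2 - Y| ≤ 26 * X ^ 3 * (ω + η) := by
    rw [abs_le, hY]
    constructor <;> linarith
  have t2 : (nw ^ 2 - 1) ^ 2 ≤ (1 - Y) ^ 2 + 156 * X ^ 5 * (ω + η) := by
    have e : (nw ^ 2 - 1) ^ 2 = (1 - Y) ^ 2 + (nw ^ 2 - Y) * (nw ^ 2 + Y - 2) := by ring
    have hx2 : x ^ 2 ≤ X ^ 2 := pow_le_pow_left₀ hx0 hxX 2
    have hy2 : y ^ 2 ≤ X ^ 2 := pow_le_pow_left₀ hy0 hyX 2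
    have hw2 : nw ^ 2 ≤ (11 / 10 * X) ^ 2 := pow_le_pow_left₀ hnw0 hw 2
    have hX2 : 1 ≤ X ^ 2 := one_le_pow₀ hX
    have h6 : |nw ^ 2 + Y - 2| ≤ 6 * X ^ 2 := by
      rw [abs_le, hY]
      have := sq_nonneg nw
      have := sq_nonneg x
      have := sq_nonneg y
      constructor <;> linarith
    have h7 : (nw ^ 2 - Y) * (nw ^ 2 + Y - 2) ≤ 26 * X ^ 3 * (ω + η) * (6 * X ^ 2) :=
      (le_abs_self _).trans (by
        rw [abs_mul]
        exact mul_le_mul hd h6 (abs_nonneg _) (by positivity))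
    have h8 : 26 * X ^ 3 * (ω + η) * (6 * X ^ 2) = 156 * X ^ 5 * (ω + η) := by ring
    rw [e]; linarith
  rw [hY] at t2
  have h9 : η * X ^ 3 ≤ η * X ^ 5 := mul_le_mul_of_nonneg_left hX3 hη.le
  have h10 : 0 ≤ X ^ 5 * ω := by positivity
  have h11 : 0 ≤ X ^ 5 * η := by positivity
  linarith

set_option maxHeartbeats 1000000 in
-- The quadratic spline joining the midpoints of [p, q] and [q, r], with end derivatives (q − p)/η
-- and (r − q)/η, is projected radially to the sphere. Consecutive pieces share midpoint and
-- derivative, so their states match. Everything stays within O(ηX) of `q`, so w is close to the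
-- chirality and |w'| close to its difference quotient.
lemma reach_spline_piece {V : E3 → ℝ} {η X v : ℝ} {p q r : E3} (hp : ‖p‖ = 1) (hq : ‖q‖ = 1)
    (hr : ‖r‖ = 1) (hη : 0 < η) (hX : 1 ≤ X) (hηX : η * X ^ 3 ≤ 1 / 100) (hpq : ‖q - p‖ / η ≤ X)
    (hqr : ‖r - q‖ / η ≤ X)
    (hv : ∀ w, ‖w - η⁻¹ • cross p q‖ ≤ ‖η⁻¹ • cross q r - η⁻¹ • cross p q‖ + 8 * η * X ^ 2 →
      V w ≤ v) :
    Reach V (node η p q) (node η q r) (ENNReal.ofReal (η *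
      ((1 + 45 * η * X ^ 3) * (‖η⁻¹ • cross q r - η⁻¹ • cross p q‖ / η) ^ 2 +
        (1 - ((‖q - p‖ / η) ^ 2 + (‖r - q‖ / η) ^ 2) / 2) ^ 2 + v +
        200 * X ^ 5 * (‖η⁻¹ • cross q r - η⁻¹ • cross p q‖ + η)))) := by
  have hX0 : 0 < X := by linarith
  have hX1 : X ≤ X ^ 3 := le_self_pow₀ hX (by norm_num)
  have hX2 : X ^ 2 ≤ X ^ 3 := pow_le_pow_right₀ hX (by norm_num)
  have hηX1 : η * X ≤ 1 / 100 := (mul_le_mul_of_nonneg_left hX1 hη.le).trans hηX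
  obtain ⟨D, hD⟩ : ∃ D : E3, D = η⁻¹ • (q - p) := ⟨_, rfl⟩
  obtain ⟨D', hD'⟩ : ∃ D : E3, D = η⁻¹ • (r - q) := ⟨_, rfl⟩
  have hDn : ‖D‖ = ‖q - p‖ / η := by
    rw [hD, norm_smul, norm_inv, Real.norm_eq_abs, abs_of_pos hη]; ring
  have hDn' : ‖D'‖ = ‖r - q‖ / η := by
    rw [hD', norm_smul, norm_inv, Real.norm_eq_abs, abs_of_pos hη]; ring
  rw [← hDn] at hpq ⊢
  rw [← hDn'] at hqr ⊢
  have hpD : p = q - η • D := by rw [hD, smul_smul, mul_inv_cancel₀ hη.ne']; module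
  have hrD : r = q + η • D' := by rw [hD', smul_smul, mul_inv_cancel₀ hη.ne']; module
  have hqq : inner ℝ q q = (1 : ℝ) := by rw [real_inner_self_eq_norm_sq, hq]; norm_num
  have hqD : inner ℝ q D = η * ‖D‖ ^ 2 / 2 := by
    have h : ‖p‖ ^ 2 = 1 - 2 * η * inner ℝ q D + η ^ 2 * ‖D‖ ^ 2 := by
      rw [hpD, norm_sub_sq_real, hq, inner_smul_right, norm_smul, Real.norm_eq_abs, mul_pow, sq_abs]
      ring
    rw [hp] at h
    have h2 : η * (inner ℝ q D - η * ‖D‖ ^ 2 / 2) = 0 := by linarith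
    have := (mul_eq_zero.1 h2).resolve_left hη.ne'
    linarith
  have hqD' : inner ℝ q D' = -(η * ‖D'‖ ^ 2 / 2) := by
    have h : ‖r‖ ^ 2 = 1 + 2 * η * inner ℝ q D' + η ^ 2 * ‖D'‖ ^ 2 := by
      rw [hrD, norm_add_sq_real, hq, inner_smul_right, norm_smul, Real.norm_eq_abs, mul_pow, sq_abs]
      ring
    rw [hr] at h
    have h2 : η * (inner ℝ q D' + η * ‖D'‖ ^ 2 / 2) = 0 := by linarith
    have := (mul_eq_zero.1 h2).resolve_left hη.ne'
    linarith
  obtain ⟨z, hz⟩ : ∃ z : E3, z = η⁻¹ • cross p q := ⟨_, rfl⟩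
  obtain ⟨z', hz'⟩ : ∃ z : E3, z = η⁻¹ • cross q r := ⟨_, rfl⟩
  have hzD : z = cross q D := by
    rw [hz, hpD, cross_sub_left, cross_same, cross_smul_left, zero_sub, ← smul_neg,
      ← cross_swap, smul_smul, inv_mul_cancel₀ hη.ne', one_smul]
  have hzD' : z' = cross q D' := by
    rw [hz', hrD, cross_add_right, cross_same, cross_smul_right, zero_add, smul_smul,
      inv_mul_cancel₀ hη.ne', one_smul]
  have hzn : ‖z‖ ^ 2 = ‖D‖ ^ 2 * (1 - η ^ 2 * ‖D‖ ^ 2 / 4) := by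
    rw [hzD, norm_cross_sq, hq, hqD]; ring
  have hzn' : ‖z'‖ ^ 2 = ‖D'‖ ^ 2 * (1 - η ^ 2 * ‖D'‖ ^ 2 / 4) := by
    rw [hzD', norm_cross_sq, hq, hqD']; ring
  have hzle : ‖z‖ ≤ ‖D‖ := by rw [hzD]; simpa [hq] using norm_cross_le q D
  have hzle' : ‖z'‖ ≤ ‖D'‖ := by rw [hzD']; simpa [hq] using norm_cross_le q D'
  rw [← hz] at hv
  rw [← hz'] at hv
  have e0 : node η p q = (‖p + q‖⁻¹ • (p + q), (4 / ‖p + q‖ ^ 2) • z) := by rw [node, hz]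
  have e1 : node η q r = (‖q + r‖⁻¹ • (q + r), (4 / ‖q + r‖ ^ 2) • z') := by rw [node, hz']
  rw [e0, e1, ← hz, ← hz']
  obtain ⟨ω, hω⟩ : ∃ ω, ω = ‖z' - z‖ := ⟨_, rfl⟩
  rw [← hω] at hv ⊢
  have hω0 : 0 ≤ ω := hω ▸ norm_nonneg _
  -- The constant second derivative of the spline. Its part across `q` has length ω/η, the discrete
  -- |w'|. Its part along `q` is at most X² and contributes to U × A only through ‖U − q‖ = O(ηX).
  obtain ⟨A, hA⟩ : ∃ A : E3, A = η⁻¹ • (D' - D) := ⟨_, rfl⟩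
  have hηA : η • A = D' - D := by rw [hA, smul_smul, mul_inv_cancel₀ hη.ne', one_smul]
  have hqA : cross q A = η⁻¹ • (z' - z) := by
    rw [hA, cross_smul_right, cross_sub_right, hzD, hzD']
  have hqAn : ‖cross q A‖ = ω / η := by
    rw [hqA, norm_smul, norm_inv, Real.norm_eq_abs, abs_of_pos hη, hω]; ring
  have hx0 := norm_nonneg D
  have hy0 := norm_nonneg D'
  have hAn : ‖A‖ ≤ ω / η + X ^ 2 := by
    have h1 := norm_cross_sq q A
    have h2 : inner ℝ q A = -((‖D‖ ^ 2 + ‖D'‖ ^ 2) / 2) := by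
      rw [hA, inner_smul_right, inner_sub_right, hqD, hqD']; field_simp; ring
    rw [hqAn, hq, h2] at h1
    apply abs_le_of_sq_le_sq' _ (by positivity) |>.2
    have hx2 : ‖D‖ ^ 2 ≤ X ^ 2 := pow_le_pow_left₀ hx0 hpq 2
    have hy2 : ‖D'‖ ^ 2 ≤ X ^ 2 := pow_le_pow_left₀ hy0 hqr 2
    have h3 : ((‖D‖ ^ 2 + ‖D'‖ ^ 2) / 2) ^ 2 ≤ (X ^ 2) ^ 2 :=
      pow_le_pow_left₀ (by positivity) (by linarith) 2
    have h4 : 0 ≤ ω / η * X ^ 2 := by positivity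
    have h5 : (ω / η + X ^ 2) ^ 2 = (ω / η) ^ 2 + 2 * (ω / η * X ^ 2) + (X ^ 2) ^ 2 := by ring
    rw [h5]
    linarith
  -- the spline and its derivative
  obtain ⟨U, hU⟩ : ∃ U : ℝ → E3, U = fun t => (1 / 2 : ℝ) • (p + q) + t • D + (t ^ 2 / 2) • A :=
    ⟨_, rfl⟩
  obtain ⟨U', hU'⟩ : ∃ U : ℝ → E3, U = fun t => D + t • A := ⟨_, rfl⟩
  have dU : ∀ t, HasDerivAt U (U' t) t := fun t => by
    rw [hU, hU']
    have h1 := ((hasDerivAt_id t).smul_const D).const_add ((1 / 2 : ℝ) • (p + q))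
    have h2 := (((hasDerivAt_id t).pow 2).div_const 2).smul_const A
    refine (h1.add h2).congr_deriv ?_
    simp only [id, Nat.cast_ofNat]
    module
  have dU' : ∀ t, HasDerivAt U' A t := fun t => by
    rw [hU']
    simpa using ((hasDerivAt_id t).smul_const A).const_add D
  obtain ⟨n, hn⟩ : ∃ n : ℝ → ℝ, n = fun t => ‖U t‖ ^ 2 := ⟨_, rfl⟩
  have dn : ∀ t, HasDerivAt n (2 * inner ℝ (U t) (U' t)) t := fun t => by
    rw [hn]; exact (dU t).norm_sq
  have bU : ∀ t ∈ Icc 0 η, ‖U t - q‖ ≤ 2 * (η * X) := fun t ht => by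
    have h1 : U t - q = (t - η / 2) • D + (t ^ 2 / (2 * η)) • (D' - D) := by
      simp only [hU, ← hηA, smul_smul]
      rw [hpD, show t ^ 2 / (2 * η) * η = t ^ 2 / 2 by field_simp]
      module
    have h2 : |t - η / 2| ≤ η / 2 := by rw [abs_le]; constructor <;> linarith [ht.1, ht.2]
    have h3 : t ^ 2 / (2 * η) ≤ η / 2 := by
      rw [div_le_iff₀ (by positivity)]
      have := pow_le_pow_left₀ ht.1 ht.2 2
      linarith
    have h4 : ‖D' - D‖ ≤ 2 * X := (norm_sub_le _ _).trans (by linarith)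
    rw [h1]
    refine (norm_add_le _ _).trans ?_
    rw [norm_smul, norm_smul, Real.norm_eq_abs, Real.norm_eq_abs,
      abs_of_nonneg (by positivity : 0 ≤ t ^ 2 / (2 * η))]
    have h5 := mul_le_mul h2 hpq hx0 (by positivity)
    have h6 := mul_le_mul h3 h4 (norm_nonneg _) (by positivity)
    have : 0 ≤ η * X := by positivity
    linarith
  have bn : ∀ t ∈ Icc 0 η, |n t - 1| ≤ 5 * (η * X) := fun t ht => by
    have h1 := bU t ht
    have h2 : |‖U t‖ - 1| ≤ 2 * (η * X) := by
      rw [← hq]; exact (abs_norm_sub_norm_le _ _).trans h1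
    have h3 := abs_le.1 h2
    have h4 : n t - 1 = (‖U t‖ - 1) * (‖U t‖ + 1) := by rw [hn]; ring
    rw [h4, abs_mul, abs_of_nonneg (by positivity : 0 ≤ ‖U t‖ + 1)]
    have := mul_le_mul h2 (by linarith : ‖U t‖ + 1 ≤ 5 / 2) (by positivity) (by positivity)
    linarith
  have npos : ∀ t ∈ Icc 0 η, 0 < n t := fun t ht => by linarith [(abs_le.1 (bn t ht)).1]
  have hUU : ∀ t, inner ℝ (U t) (U t) = n t := fun t => by rw [real_inner_self_eq_norm_sq, hn]
  have hsqrt : ∀ t, √(n t) = ‖U t‖ := fun t => by simp only [hn]; exact Real.sqrt_sq (norm_nonneg _)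
  -- For u = U/|U| the radial part of the derivative drops out of u × u', which leaves U × U'/|U|².
  obtain ⟨w, hw⟩ : ∃ w : ℝ → E3, w = fun t => (n t)⁻¹ • cross (U t) (U' t) := ⟨_, rfl⟩
  obtain ⟨w', hw'⟩ : ∃ w : ℝ → E3, w = fun t =>
    (n t)⁻¹ • cross (U t) A + (-(2 * inner ℝ (U t) (U' t)) / n t ^ 2) • cross (U t) (U' t) :=
    ⟨_, rfl⟩
  have dw : ∀ t ∈ Icc 0 η, HasDerivAt w (w' t) t := fun t ht => by
    have h1 := ((dn t).inv (npos t ht).ne').smul (hasDerivAt_cross (dU t) (dU' t))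
    rw [hw, hw']
    refine h1.congr_deriv ?_
    simp
  obtain ⟨ũ, hũ⟩ : ∃ ũ : ℝ → E3, ũ = fun t => (√(n t))⁻¹ • U t := ⟨_, rfl⟩
  have dũ : ∀ t ∈ Icc 0 η, HasDerivAt ũ (cross (w t) (ũ t)) t := fun t ht => by
    have h0 := npos t ht
    have hs := Real.sqrt_pos.2 h0
    have h1 := (((dn t).sqrt h0.ne').inv hs.ne').smul (dU t)
    have hsq := Real.sq_sqrt h0.le
    have e : cross (w t) (ũ t) = ((n t)⁻¹ * (√(n t))⁻¹) •
        (n t • U' t - (inner ℝ (U t) (U' t)) • U t) := by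
      simp only [hw, hũ]
      rw [cross_smul_left, cross_smul_right, cross_cross_left, hUU, real_inner_comm (U t) (U' t)]
      module
    rw [hũ]
    refine h1.congr_deriv ?_
    rw [← hũ, e, smul_sub, smul_smul, smul_smul]
    have e1 : (n t)⁻¹ * (√(n t))⁻¹ * n t = (√(n t))⁻¹ := by field_simp
    rw [e1, hsq, sub_eq_add_neg, ← neg_smul]
    congr 2
    field_simp
  have hũn : ∀ t ∈ Icc 0 η, ‖ũ t‖ = 1 := fun t ht => by
    have hs : 0 < ‖U t‖ := by rw [← hsqrt]; exact Real.sqrt_pos.2 (npos t ht)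
    simp only [hũ]
    rw [hsqrt, norm_smul, norm_inv, norm_norm, inv_mul_cancel₀ hs.ne']
  have cU : Continuous U := continuous_iff_continuousAt.2 fun t => (dU t).continuousAt
  have cU' : Continuous U' := continuous_iff_continuousAt.2 fun t => (dU' t).continuousAt
  have cn : Continuous n := continuous_iff_continuousAt.2 fun t => (dn t).continuousAt
  have cw' : ContinuousOn w' (Icc 0 η) := by
    rw [hw']
    have c1 := continuousOn_cross cU.continuousOn (continuousOn_const (c := A) (s := Icc 0 η))
    have c2 := continuousOn_cross (s := Icc 0 η) cU.continuousOn cU'.continuousOn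
    have c3 : ContinuousOn (fun t => (n t)⁻¹) (Icc 0 η) :=
      cn.continuousOn.inv₀ fun t ht => (npos t ht).ne'
    have c4 : Continuous fun t => -(2 * inner ℝ (U t) (U' t)) :=
      (continuous_const.mul (cU.inner cU')).neg
    exact (c3.smul c1).add ((c4.continuousOn.div (cn.pow 2).continuousOn
      fun t ht => (pow_pos (npos t ht) 2).ne').smul c2)
  refine ⟨η, ũ, w, hη.le, IsArc.of_smooth hũn (fun t _ => ?_) dũ dw cw' ?_, ?_, ?_⟩
  · simp only [hũ, hw]
    rw [inner_smul_left, inner_smul_right, inner_cross_left]; simp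
  · have hbound : ∀ t ∈ Icc 0 η, (‖w t‖ ^ 2 - 1) ^ 2 + V (w t) + ‖w' t‖ ^ 2 ≤
        (1 + 45 * η * X ^ 3) * (ω / η) ^ 2 + (1 - (‖D‖ ^ 2 + ‖D'‖ ^ 2) / 2) ^ 2 + v +
          200 * X ^ 5 * (ω + η) := by
      intro t ht
      have hτ0 : 0 ≤ t / η := div_nonneg ht.1 hη.le
      have hτ1 : t / η ≤ 1 := (div_le_one hη).2 ht.2
      have hU'e : U' t = (1 - t / η) • D + (t / η) • D' := by
        have : t • A = (t / η) • (D' - D) := by rw [← hηA, smul_smul, div_mul_cancel₀ _ hη.ne']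
        simp only [hU', this]; module
      have hU'n : ‖U' t‖ ≤ X := by
        rw [hU'e]
        refine (norm_add_le _ _).trans ?_
        rw [norm_smul, norm_smul, Real.norm_eq_abs, Real.norm_eq_abs, abs_of_nonneg hτ0,
          abs_of_nonneg (by linarith : 0 ≤ 1 - t / η)]
        have h1 := mul_le_mul_of_nonneg_left hpq (by linarith : 0 ≤ 1 - t / η)
        have h2 := mul_le_mul_of_nonneg_left hqr hτ0
        linarith
      have hδ := bU t ht
      have hnb := bn t ht
      have hnb' := abs_le.1 hnb
      have hn0 := npos t ht
      have hUn : ‖U t‖ ≤ 51 / 50 := by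
        have : ‖U t‖ ≤ ‖U t - q‖ + ‖q‖ := by simpa using norm_add_le (U t - q) q
        linarith
      obtain ⟨M, hM⟩ : ∃ M : E3, M = cross (U t) (U' t) := ⟨_, rfl⟩
      have hMn : ‖M‖ ≤ 51 / 50 * X := by
        rw [hM]
        exact (norm_cross_le _ _).trans (mul_le_mul hUn hU'n (norm_nonneg _) (by norm_num))
      have hMz : ‖M - z‖ ≤ ω + 2 * (η * X) * X := by
        have e : M - z = (t / η) • (z' - z) + cross (U t - q) (U' t) := by
          rw [hM, cross_sub_left, hU'e]
          simp only [cross_add_right, cross_smul_right, ← hzD, ← hzD']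
          module
        rw [e]
        refine (norm_add_le _ _).trans (add_le_add ?_ ?_)
        · rw [norm_smul, ← hω, Real.norm_eq_abs, abs_of_nonneg hτ0]
          exact mul_le_of_le_one_left hω0 hτ1
        · exact (norm_cross_le _ _).trans (mul_le_mul hδ hU'n (norm_nonneg _) (by positivity))
      have hinv : (n t)⁻¹ ≤ 1 + 6 * (η * X) := by
        rw [inv_le_iff_one_le_mul₀ hn0]
        have h1 : (1 + 6 * (η * X)) * (1 - 5 * (η * X)) ≤ (1 + 6 * (η * X)) * n t :=
          mul_le_mul_of_nonneg_left (by linarith) (by positivity)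
        have h2 : (η * X) * (η * X) ≤ (η * X) * (1 / 100) :=
          mul_le_mul_of_nonneg_left hηX1 (by positivity)
        have h3 : 0 ≤ η * X := by positivity
        linarith
      have hinv0 : 0 < (n t)⁻¹ := inv_pos.2 hn0
      have hinv2 : |(n t)⁻¹ - 1| ≤ 27 / 5 * (η * X) := by
        have e : (n t)⁻¹ - 1 = (n t)⁻¹ * (1 - n t) := by field_simp
        rw [e, abs_mul, abs_of_pos hinv0, abs_sub_comm]
        have := mul_le_mul (hinv.trans (by linarith : _ ≤ (53 / 50 : ℝ))) hnb (abs_nonneg _)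
          (by norm_num)
        have h3 : 0 ≤ η * X := by positivity
        linarith
      have hwM : w t = (n t)⁻¹ • M := by rw [hw, hM]
      have hwz : ‖w t - z‖ ≤ ω + 8 * η * X ^ 2 := by
        have e : w t - z = ((n t)⁻¹ - 1) • M + (M - z) := by rw [hwM]; module
        rw [e]
        refine (norm_add_le _ _).trans ?_
        rw [norm_smul, Real.norm_eq_abs]
        have h1 := mul_le_mul hinv2 hMn (norm_nonneg _) (by positivity)
        have h2 : 0 ≤ η * X * X := by positivity
        linarith
      have hwn : ‖w t‖ ≤ 11 / 10 * X := by
        rw [hwM, norm_smul, Real.norm_eq_abs, abs_of_pos hinv0]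
        have := mul_le_mul (hinv.trans (by linarith : _ ≤ (53 / 50 : ℝ))) hMn (norm_nonneg _)
          (by norm_num)
        linarith
      have hUU' : |inner ℝ (U t) (U' t)| ≤ 5 / 2 * (η * X ^ 2) := by
        have e : inner ℝ (U t) (U' t) = inner ℝ q (U' t) + inner ℝ (U t - q) (U' t) := by
          rw [inner_sub_left]; ring
        have h1 : |inner ℝ (U t - q) (U' t)| ≤ 2 * (η * X) * X :=
          (abs_real_inner_le_norm _ _).trans (mul_le_mul hδ hU'n (norm_nonneg _) (by positivity))
        have h2 : |inner ℝ q (U' t)| ≤ η * X ^ 2 / 2 := by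
          rw [hU'e, inner_add_right, inner_smul_right, inner_smul_right, hqD, hqD']
          have hx2 : ‖D‖ ^ 2 ≤ X ^ 2 := pow_le_pow_left₀ hx0 hpq 2
          have hy2 : ‖D'‖ ^ 2 ≤ X ^ 2 := pow_le_pow_left₀ hy0 hqr 2
          have k1 : (1 - t / η) * (η * ‖D‖ ^ 2 / 2) ≤ (1 - t / η) * (η * X ^ 2 / 2) := by
            gcongr
          have k2 : (t / η) * (η * ‖D'‖ ^ 2 / 2) ≤ (t / η) * (η * X ^ 2 / 2) := by gcongr
          have k3 : 0 ≤ (1 - t / η) * (η * ‖D‖ ^ 2 / 2) :=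
            mul_nonneg (by linarith) (by positivity)
          have k4 : 0 ≤ (t / η) * (η * ‖D'‖ ^ 2 / 2) := by positivity
          have k5 : 0 ≤ (1 - t / η) * (η * X ^ 2 / 2) := mul_nonneg (by linarith) (by positivity)
          have k6 : 0 ≤ (t / η) * (η * X ^ 2 / 2) := by positivity
          rw [abs_le]
          constructor <;> linarith
        rw [e]
        refine (abs_add_le _ _).trans ?_
        linarith
      have hw'n : ‖w' t‖ ≤ (1 + 9 * η * X ^ 3) * (ω / η) + 9 * η * X ^ 3 := by
        have h1 : ‖cross (U t) A‖ ≤ ω / η + 2 * (η * X) * (ω / η + X ^ 2) := by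
          have e : cross (U t) A = cross q A + cross (U t - q) A := by rw [cross_sub_left]; abel
          rw [e]
          refine (norm_add_le _ _).trans (add_le_add hqAn.le ?_)
          exact (norm_cross_le _ _).trans (mul_le_mul hδ hAn (norm_nonneg _) (by positivity))
        have h2 : ‖(n t)⁻¹ • cross (U t) A‖ ≤
            (1 + 6 * (η * X)) * (ω / η + 2 * (η * X) * (ω / η + X ^ 2)) := by
          rw [norm_smul, Real.norm_eq_abs, abs_of_pos hinv0]
          exact mul_le_mul hinv h1 (norm_nonneg _) (by positivity)
        have h3 : ‖(-(2 * inner ℝ (U t) (U' t)) / n t ^ 2) • cross (U t) (U' t)‖ ≤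
            6 * (η * X ^ 2) * X := by
          rw [norm_smul, ← hM, Real.norm_eq_abs, div_eq_mul_inv, abs_mul, abs_neg, abs_mul,
            abs_two, abs_of_pos (inv_pos.2 (pow_pos hn0 2)), ← inv_pow]
          have k1 : (n t)⁻¹ ^ 2 ≤ (53 / 50) ^ 2 :=
            pow_le_pow_left₀ hinv0.le (hinv.trans (by linarith)) 2
          have k2 := mul_le_mul (mul_le_mul_of_nonneg_left hUU' zero_le_two) k1
            (sq_nonneg _) (by positivity)
          have k3 := mul_le_mul k2 hMn (norm_nonneg _) (by positivity)
          have : 0 ≤ η * X ^ 2 * X := by positivity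
          linarith
        have h4 : ‖w' t‖ ≤ (1 + 6 * (η * X)) * (ω / η + 2 * (η * X) * (ω / η + X ^ 2)) +
            6 * (η * X ^ 2) * X := by
          rw [hw']; exact (norm_add_le _ _).trans (add_le_add h2 h3)
        refine h4.trans ?_
        obtain ⟨b, hb⟩ : ∃ b, b = ω / η := ⟨_, rfl⟩
        have hb0 : 0 ≤ b := by rw [hb]; positivity
        obtain ⟨ξ, hξ⟩ : ∃ ξ, ξ = η * X := ⟨_, rfl⟩
        have hξ0 : 0 ≤ ξ := by rw [hξ]; positivity
        rw [← hξ] at hηX1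
        have hξξ : ξ * ξ ≤ ξ * (1 / 100) := mul_le_mul_of_nonneg_left hηX1 hξ0
        have hξX : ξ ≤ η * X ^ 3 := by rw [hξ]; exact mul_le_mul_of_nonneg_left hX1 hη.le
        have c1 : (1 + 6 * ξ) * (1 + 2 * ξ) ≤ 1 + 9 * (η * X ^ 3) := by linarith
        have c2 := mul_le_mul_of_nonneg_right c1 hb0
        have c3 : ξ * X ^ 2 = η * X ^ 3 := by rw [hξ]; ring
        have c4 : η * X ^ 2 * X = η * X ^ 3 := by ring
        have c5 : (1 + 6 * ξ) * (2 * ξ * X ^ 2) ≤ 3 * (η * X ^ 3) := by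
          have : (1 + 6 * ξ) * (2 * (ξ * X ^ 2)) ≤ (3 / 2) * (2 * (ξ * X ^ 2)) :=
            mul_le_mul_of_nonneg_right (by linarith) (by rw [c3]; positivity)
          rw [c3] at this
          rw [mul_assoc 2 ξ, c3]
          linarith
        rw [← hb, ← hξ]
        linarith
      have hVv := hv (w t) hwz
      have := spline_density_le (v := V (w t)) hη hX hηX hω0 (norm_nonneg (w t)) (norm_nonneg z)
        hx0 hpq hy0 hqr (norm_nonneg z') hzle hzle' hzn hzn'
        ((abs_norm_sub_norm_le _ _).trans hω.ge) ((abs_norm_sub_norm_le _ _).trans hwz) hwn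
        (norm_nonneg (w' t)) hw'n
      linarith
    have := lintegral_Icc_le_of_density_le hbound hη.le
    rwa [sub_zero] at this
  · have hU0 : U 0 = (1 / 2 : ℝ) • (p + q) := by simp [hU]
    have hU'0 : U' 0 = D := by simp [hU']
    have hn0 : n 0 = ‖p + q‖ ^ 2 / 4 := by
      rw [hn]; simp only [hU0]
      rw [norm_smul, mul_pow]; norm_num; ring
    have hs0 : √(n 0) = ‖p + q‖ / 2 := by
      rw [hsqrt, hU0, norm_smul]; norm_num; ring
    have hM : cross (U 0) (U' 0) = z := by
      rw [hU0, hU'0, hzD, hpD]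
      simp only [cross_smul_left, cross_add_left, cross_sub_left, cross_same]
      module
    have a1 : ũ 0 = ‖p + q‖⁻¹ • (p + q) := by
      simp only [hũ]
      rw [hs0, hU0, smul_smul, inv_div]
      congr 1
      ring
    have a2 : w 0 = (4 / ‖p + q‖ ^ 2) • z := by
      simp only [hw]
      rw [hM, hn0, inv_div]
    rw [a1, a2]
  · have hU0 : U η = (1 / 2 : ℝ) • (q + r) := by
      have h1 : (η ^ 2 / 2) • A = (η / 2) • (D' - D) := by
        rw [← hηA, smul_smul]; congr 1; ring
      simp only [hU, h1]
      rw [hpD, hrD]; module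
    have hU'0 : U' η = D' := by simp only [hU', hηA]; abel
    have hn0 : n η = ‖q + r‖ ^ 2 / 4 := by
      rw [hn]; simp only [hU0]
      rw [norm_smul, mul_pow]; norm_num; ring
    have hs0 : √(n η) = ‖q + r‖ / 2 := by
      rw [hsqrt, hU0, norm_smul]; norm_num; ring
    have hM : cross (U η) (U' η) = z' := by
      rw [hU0, hU'0, hzD', hrD]
      simp only [cross_smul_left, cross_add_left, cross_same]
      module
    have a1 : ũ η = ‖q + r‖⁻¹ • (q + r) := by
      simp only [hũ]
      rw [hs0, hU0, smul_smul, inv_div]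
      congr 1
      ring
    have a2 : w η = (4 / ‖q + r‖ ^ 2) • z' := by
      simp only [hw]
      rw [hM, hn0, inv_div]
    rw [a1, a2]

/-! ### The penalty: bounds, uniform continuity away from 0, coercivity. -/

/-- A zero-homogeneous penalty that vanishes on the sphere exactly at the finite set `Q`. -/
structure IsPenalty (Q : Set E3) (G : E3 → ℝ) : Prop where
  finite : Q.Finite
  unit : ∀ y ∈ Q, ‖y‖ = 1
  nonneg : ∀ x, 0 ≤ G x
  cont : ContinuousOn G {0}ᶜ
  hom : ∀ c : ℝ, 0 < c → ∀ x, G (c • x) = G x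
  zero : ∀ y ∈ Q, ∀ s : ℝ, G (s • y) = 0
  mem_of_zero : ∀ y, ‖y‖ = 1 → G y = 0 → y ∈ Q
  map_zero : G 0 = 0

section penalty

variable {Q : Set E3} {G : E3 → ℝ}

lemma IsPenalty.eq_zero (hG : IsPenalty Q G) {y : E3} (hy : y ∈ Q) : G y = 0 := by
  simpa using hG.zero y hy 1

lemma IsPenalty.exists_bound (hG : IsPenalty Q G) : ∃ Γ > 0, ∀ x, G x ≤ Γ := by
  have hc : IsCompact (Metric.sphere (0 : E3) 1) := isCompact_sphere 0 1
  have hcont : ContinuousOn G (Metric.sphere (0 : E3) 1) := hG.cont.mono fun x hx => by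
    rintro rfl; simp at hx
  obtain ⟨C, hC⟩ := hc.exists_bound_of_continuousOn hcont
  refine ⟨|C| + 1, by positivity, fun x => ?_⟩
  rcases eq_or_ne x 0 with rfl | hx
  · rw [hG.map_zero]; positivity
  · have hx0 := norm_pos_iff.2 hx
    have h := hC (‖x‖⁻¹ • x) (by simp [norm_smul, hx0.ne'])
    rw [hG.hom _ (inv_pos.2 hx0)] at h
    have := le_abs_self (G x)
    rw [Real.norm_eq_abs] at h
    have := le_abs_self C
    linarith

lemma IsPenalty.smallNear (hG : IsPenalty Q G) {g : ℝ} {y : E3} (hy : y ∈ Q) :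
    SmallNear (fun x => g * G x) y := by
  intro v hv
  have hy0 : y ≠ 0 := by rw [← norm_pos_iff, hG.unit y hy]; exact one_pos
  have hc : ContinuousAt G y := hG.cont.continuousAt (isOpen_compl_singleton.mem_nhds hy0)
  have hc' : ContinuousAt (fun x => g * G x) y := continuousAt_const.mul hc
  obtain ⟨ρ, hρ, h⟩ := Metric.continuousAt_iff.1 hc' v hv
  refine ⟨ρ, hρ, fun w hw => ?_⟩
  have := h (by rwa [dist_eq_norm])
  rw [hG.eq_zero hy, mul_zero, Real.dist_eq, sub_zero] at this
  exact (le_abs_self _).trans this.le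

/-- Uniform continuity is available only on annuli: a nonconstant zero-homogeneous function is
discontinuous at the origin. This is why the chirality has to be kept away from 0 later on. -/
lemma IsPenalty.exists_uniform (hG : IsPenalty Q G) {r R ε : ℝ} (hr : 0 < r) (hε : 0 < ε) :
    ∃ δ > 0, ∀ x w, r ≤ ‖x‖ → ‖x‖ ≤ R → ‖w - x‖ ≤ δ → G w ≤ G x + ε := by
  obtain ⟨K, hK⟩ : ∃ K : Set E3, K = Metric.closedBall 0 (R + 1) ∩ {x | r / 2 ≤ ‖x‖} := ⟨_, rfl⟩
  have hKc : IsCompact K := by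
    rw [hK]
    exact (isCompact_closedBall _ _).inter_right (isClosed_le continuous_const continuous_norm)
  have hu := hKc.uniformContinuousOn_of_continuous (hG.cont.mono fun x hx => by
    rw [hK] at hx
    rintro rfl
    have : r / 2 ≤ ‖(0 : E3)‖ := hx.2
    rw [norm_zero] at this; linarith)
  obtain ⟨δ, hδ, h⟩ := Metric.uniformContinuousOn_iff_le.1 hu ε hε
  refine ⟨min δ (min (r / 2) 1), by positivity, fun x w h1 h2 h3 => ?_⟩
  have h4 := (h3.trans (min_le_right _ _)).trans (min_le_left _ _)
  have h5 := (h3.trans (min_le_right _ _)).trans (min_le_right _ _)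
  have k1 : ‖w‖ ≤ ‖w - x‖ + ‖x‖ := by simpa using norm_add_le (w - x) x
  have k2 : ‖x‖ ≤ ‖w - x‖ + ‖w‖ := by
    have := norm_sub_le w (w - x); rw [sub_sub_cancel] at this; linarith
  have hx : x ∈ K := by
    rw [hK]
    exact ⟨by rw [mem_closedBall_zero_iff]; linarith, by simp only [mem_ofPred_eq]; linarith⟩
  have hw : w ∈ K := by
    rw [hK]
    exact ⟨by rw [mem_closedBall_zero_iff]; linarith, by simp only [mem_ofPred_eq]; linarith⟩
  have := h w hw x hx (by rw [dist_eq_norm]; exact h3.trans (min_le_left _ _))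
  rw [Real.dist_eq] at this
  linarith [le_abs_self (G w - G x)]

/-- Away from `Q`, the penalty is bounded below on the sphere. -/
lemma IsPenalty.exists_lower (hG : IsPenalty Q G) {ρ : ℝ} (hρ : 0 < ρ) :
    ∃ c > 0, c ≤ 1 ∧ ∀ x, ‖x‖ = 1 → (∀ y ∈ Q, ρ ≤ ‖x - y‖) → c ≤ G x := by
  obtain ⟨K, hK⟩ : ∃ K : Set E3, K = Metric.sphere 0 1 ∩ {x | ∀ y ∈ Q, ρ ≤ ‖x - y‖} := ⟨_, rfl⟩
  have hcl : IsClosed {x : E3 | ∀ y ∈ Q, ρ ≤ ‖x - y‖} := by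
    have : {x : E3 | ∀ y ∈ Q, ρ ≤ ‖x - y‖} = ⋂ y ∈ Q, {x | ρ ≤ ‖x - y‖} := by ext; simp
    rw [this]
    exact isClosed_biInter fun y _ =>
      isClosed_le continuous_const (continuous_norm.comp (continuous_id.sub continuous_const))
  have hKc : IsCompact K := by rw [hK]; exact (isCompact_sphere 0 1).inter_right hcl
  rcases K.eq_empty_or_nonempty with he | hne
  · refine ⟨1, one_pos, le_rfl, fun x h1 h2 => ?_⟩
    have : x ∈ K := by rw [hK]; exact ⟨by simpa using h1, h2⟩
    rw [he] at this; exact this.elim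
  · obtain ⟨x₀, hx₀, hmin⟩ := hKc.exists_isMinOn hne (hG.cont.mono fun x hx => by
      rw [hK] at hx; rintro rfl; simpa using hx.1)
    have hx₀' := hx₀
    rw [hK] at hx₀'
    have hpos : 0 < G x₀ := by
      refine (hG.nonneg x₀).lt_of_ne fun h => ?_
      have := hx₀'.2 x₀ (hG.mem_of_zero x₀ (by simpa using hx₀'.1) h.symm)
      rw [sub_self, norm_zero] at this; linarith
    refine ⟨min (G x₀) 1, lt_min hpos one_pos, min_le_right _ _, fun x h1 h2 => ?_⟩
    exact (min_le_left _ _).trans (hmin (by rw [hK]; exact ⟨by simpa using h1, h2⟩))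

lemma IsPenalty.exists_separation (hG : IsPenalty Q G) :
    ∃ d > 0, d ≤ 1 ∧ ∀ y ∈ Q, ∀ y' ∈ Q, y ≠ y' → d ≤ ‖y - y'‖ := by
  obtain ⟨S, hS⟩ : ∃ S : Finset (E3 × E3), S = (hG.finite.prod hG.finite).toFinset.filter
      (fun p => p.1 ≠ p.2) := by classical exact ⟨_, rfl⟩
  rcases S.eq_empty_or_nonempty with he | hne
  · refine ⟨1, one_pos, le_rfl, fun y hy y' hy' hne => ?_⟩
    have : (y, y') ∈ S := by rw [hS]; simp [hy, hy', hne]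
    rw [he] at this; simp at this
  · obtain ⟨p, hp, hmin⟩ := S.exists_min_image (fun p => ‖p.1 - p.2‖) hne
    have hp' := hp
    rw [hS] at hp'
    refine ⟨min ‖p.1 - p.2‖ 1, lt_min (norm_pos_iff.2 (sub_ne_zero.2 (by simp at hp'; exact hp'.2)))
      one_pos, min_le_right _ _, fun y hy y' hy' hne => ?_⟩
    exact (min_le_left _ _).trans (hmin (y, y') (by rw [hS]; simp [hy, hy', hne]))

/-- Sites whose chirality is away from `Q` carry energy. -/
lemma IsPenalty.exists_coercive (hG : IsPenalty Q G) {r : ℝ} (hr : 0 < r) (hr1 : r ≤ 1) :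
    ∃ c > 0, c ≤ 1 ∧ ∃ τ > 0, ∀ η, 0 < η → η ≤ τ → ∀ (u : ℕ → E3) (i : ℕ), ‖u i‖ = 1 →
      ‖u (i + 1)‖ = 1 → ‖u (i + 2)‖ = 1 → bend η u i ≤ 3 → (∀ y ∈ Q, r ≤ ‖chi η u i - y‖) →
      ∀ g, 0 ≤ g → η * (min 1 g * c) ≤ site η (fun x => g * G x) u i := by
  obtain ⟨c, hc, hc1, hcG⟩ := hG.exists_lower (half_pos hr)
  refine ⟨min c ((r / 16) ^ 2), by positivity, (min_le_left _ _).trans hc1,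
    (r / 64) ^ 2, by positivity, fun η hη hητ u i h0 h1 h2 hb hy g hg => ?_⟩
  have hb0 := bend_nonneg hη u i
  have hr' : r / 64 ≤ 1 := by linarith
  have hη1 : η ≤ (r / 64) := hητ.trans (pow_le_of_le_one (by positivity) hr' two_ne_zero)
  set x := chi η u i with hx
  have hm : 0 ≤ min 1 g := le_min zero_le_one hg
  have hm1 : min 1 g * min c ((r / 16) ^ 2) ≤ 1 * (r / 16) ^ 2 :=
    mul_le_mul (min_le_left _ _) (min_le_right _ _) (by positivity) zero_le_one
  have hm2 : min 1 g * min c ((r / 16) ^ 2) ≤ g * c :=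
    mul_le_mul (min_le_right _ _) (min_le_left _ _) (by positivity) hg
  obtain ⟨s, hs⟩ : ∃ s, s = speed η u i := ⟨_, rfl⟩
  obtain ⟨s', hs'⟩ : ∃ s, s = speed η u (i + 1) := ⟨_, rfl⟩
  have hsite : site η (fun x => g * G x) u i = ‖chi η u (i + 1) - x‖ ^ 2 / η +
      η * (1 - (s ^ 2 + s' ^ 2) / 2) ^ 2 + η * (g * G x) := by rw [site, bend, hs, hs', hx]
  have hω0 : 0 ≤ ‖chi η u (i + 1) - x‖ ^ 2 / η := by positivity
  have hgG : 0 ≤ g * G x := mul_nonneg hg (hG.nonneg x)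
  -- Either the well term already pays for the site, or both speeds are near 1. In the second case
  -- χ_i is near the unit sphere, its direction is still at least r/2 away from `Q`, and the penalty
  -- pays.
  by_cases hcase : (r / 16) ^ 2 ≤ (1 - (s ^ 2 + s' ^ 2) / 2) ^ 2
  · rw [hsite]
    have := mul_le_mul_of_nonneg_left (hm1.trans (by linarith : _ ≤ (1 - (s ^ 2 + s' ^ 2) / 2) ^ 2))
      hη.le
    have := mul_nonneg hη.le hgG
    linarith
  · push Not at hcase
    have hab := abs_lt_of_sq_lt_sq hcase (by positivity)
    rw [abs_lt] at hab
    have hs2 : s ^ 2 ≤ 4 := by linarith [sq_nonneg s']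
    have hs2' : s' ^ 2 ≤ 4 := by linarith [sq_nonneg s]
    have n1 : ‖x‖ ^ 2 = s ^ 2 * (1 - η ^ 2 * s ^ 2 / 4) := by rw [hx, hs]; exact norm_chi_sq hη h0 h1
    have n2 : ‖chi η u (i + 1)‖ ^ 2 = s' ^ 2 * (1 - η ^ 2 * s' ^ 2 / 4) := by
      rw [hs']; exact norm_chi_sq hη h1 h2
    have hηη : η ^ 2 ≤ r / 64 := by
      rw [sq]; calc η * η ≤ (r / 64) * 1 := mul_le_mul hη1 (by linarith) hη.le (by positivity)
        _ = _ := mul_one _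
    have e1 : η ^ 2 * (s ^ 2 * s ^ 2) ≤ (r / 64) * (4 * 4) := by gcongr
    have e2 : η ^ 2 * (s' ^ 2 * s' ^ 2) ≤ (r / 64) * (4 * 4) := by gcongr
    have e1' : 0 ≤ η ^ 2 * (s ^ 2 * s ^ 2) := by positivity
    have e2' : 0 ≤ η ^ 2 * (s' ^ 2 * s' ^ 2) := by positivity
    have hx2 : ‖x‖ ≤ 2 := by
      refine (pow_le_pow_iff_left₀ (norm_nonneg _) (b := 2) (by norm_num) two_ne_zero).1 ?_
      linarith
    have hx2' : ‖chi η u (i + 1)‖ ≤ 2 := by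
      refine (pow_le_pow_iff_left₀ (norm_nonneg _) (b := 2) (by norm_num) two_ne_zero).1 ?_
      linarith
    have hd : ‖chi η u (i + 1) - x‖ ≤ r / 32 := by
      refine (pow_le_pow_iff_left₀ (norm_nonneg _) (b := r / 32) (by positivity) two_ne_zero).1 ?_
      have := norm_chi_sub_sq_le hη (u := u) (i := i)
      have h3 : η * bend η u i ≤ (r / 64) ^ 2 * 3 := mul_le_mul hητ hb hb0 (by positivity)
      have : 0 < r ^ 2 := by positivity
      linarith
    have hdn := (abs_norm_sub_norm_le (chi η u (i + 1)) x).trans hd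
    have hdn2 : |‖chi η u (i + 1)‖ ^ 2 - ‖x‖ ^ 2| ≤ r / 32 * 4 := by
      rw [sq_sub_sq, abs_mul, mul_comm]
      refine mul_le_mul hdn ?_ (abs_nonneg _) (by positivity)
      rw [abs_of_nonneg (by positivity)]; linarith
    rw [abs_le] at hdn2
    have hxn2 : |‖x‖ ^ 2 - 1 ^ 2| ≤ r / 2 := by
      rw [abs_le]; constructor <;> linarith
    have hxn : |‖x‖ - 1| ≤ r / 2 := by
      rw [sq_sub_sq, abs_mul] at hxn2
      have h4 : 1 ≤ |‖x‖ + 1| := by rw [abs_of_nonneg (by positivity)]; linarith [norm_nonneg x]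
      exact (le_mul_of_one_le_left (abs_nonneg _) h4).trans hxn2
    have hx0 : 0 < ‖x‖ := by rw [abs_le] at hxn; linarith
    have hGx : c ≤ G x := by
      rw [← hG.hom _ (inv_pos.2 hx0)]
      refine hcG _ (by simp [norm_smul, hx0.ne']) fun y hyQ => ?_
      have k1 : ‖‖x‖⁻¹ • x - x‖ ≤ r / 2 := by
        have : ‖x‖⁻¹ • x - x = (‖x‖⁻¹ * (1 - ‖x‖)) • x := by
          rw [mul_sub, inv_mul_cancel₀ hx0.ne']; module
        rw [this, norm_smul, Real.norm_eq_abs, abs_mul, abs_of_pos (inv_pos.2 hx0), abs_sub_comm]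
        calc ‖x‖⁻¹ * |‖x‖ - 1| * ‖x‖ = |‖x‖ - 1| := by field_simp
          _ ≤ _ := hxn
      have k2 := hy y hyQ
      have k3 : ‖x - y‖ ≤ ‖‖x‖⁻¹ • x - y‖ + ‖‖x‖⁻¹ • x - x‖ := by
        have := norm_sub_le (‖x‖⁻¹ • x - y) (‖x‖⁻¹ • x - x)
        rwa [sub_sub_sub_cancel_left] at this
      linarith
    rw [hsite]
    have := mul_le_mul_of_nonneg_left (hm2.trans (mul_le_mul_of_nonneg_left hGx hg)) hη.le
    have := mul_nonneg hη.le (sq_nonneg (1 - (s ^ 2 + s' ^ 2) / 2))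
    linarith

end penalty

/-! ### Lower bounds for transitions between wells. -/

/-- A last index satisfying `A` before a first index satisfying `B`. -/
lemma exists_crossing {A B : ℕ → Prop} {a b : ℕ} (hab : a ≤ b) (hA : A a) (hB : B b) :
    ∃ i j, a ≤ i ∧ i ≤ j ∧ j ≤ b ∧ A i ∧ B j ∧ ∀ m, i < m → m < j → ¬ A m ∧ ¬ B m := by
  classical
  obtain ⟨j, hj1, hj2, hj3⟩ : ∃ j, (a ≤ j ∧ B j) ∧ j ≤ b ∧ ∀ m < j, ¬ (a ≤ m ∧ B m) := by
    have h : ∃ j, a ≤ j ∧ B j := ⟨b, hab, hB⟩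
    exact ⟨Nat.find h, Nat.find_spec h, Nat.find_min' h ⟨hab, hB⟩, fun m hm => Nat.find_min h hm⟩
  obtain ⟨i, hi1, hi2⟩ : ∃ i, (i ≤ j ∧ A i ∧ a ≤ i) ∧ ∀ m, i < m → m ≤ j → ¬ A m := by
    refine ⟨Nat.findGreatest (fun i => A i) j, ⟨Nat.findGreatest_le _,
      Nat.findGreatest_spec (P := fun i => A i) hj1.1 hA,
      Nat.le_findGreatest hj1.1 hA⟩, fun m h1 h2 => Nat.findGreatest_is_greatest h1 h2⟩
  exact ⟨i, j, hi1.2.2, hi1.1, hj2, hi1.2.1, hj1.2, fun m h1 h2 =>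
    ⟨hi2 m h1 h2.le, fun h => hj3 m h2 ⟨hi1.2.2.trans h1.le, h⟩⟩⟩

lemma sum_window_le {f : ℕ → ℝ} (hf : ∀ i, 0 ≤ f i) {a m N : ℕ} (h : a + m ≤ N) :
    ∑ i ∈ Finset.range m, f (a + i) ≤ ∑ i ∈ Finset.range N, f i := by
  obtain ⟨k, rfl⟩ := Nat.exists_eq_add_of_le h
  rw [Finset.sum_range_add, Finset.sum_range_add]
  have h1 : 0 ≤ ∑ i ∈ Finset.range a, f i := Finset.sum_nonneg fun i _ => hf i
  have h2 : 0 ≤ ∑ i ∈ Finset.range k, f (a + m + i) := Finset.sum_nonneg fun i _ => hf _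
  linarith

/-- Lower bounds for the passages between consecutively visited wells add up. -/
lemma le_sum_site_of_legs {Q : Finset E3} {η r ε : ℝ} {V : E3 → ℝ} {H : E3 → E3 → ℝ} (hη : 0 < η)
    (hV : ∀ x, 0 ≤ V x) (hε : 0 ≤ ε) (hH0 : ∀ y ∈ Q, H y y = 0)
    (hH : ∀ x ∈ Q, ∀ y ∈ Q, ∀ z ∈ Q, H x z ≤ H x y + H y z)
    (hsep : ∀ y ∈ Q, ∀ y' ∈ Q, ∀ x, ‖x - y‖ < r → ‖x - y'‖ < r → y = y')
    (hleg : ∀ (u : ℕ → E3) (N : ℕ), (∀ i ≤ N + 1, ‖u i‖ = 1) → ∀ y ∈ Q, ∀ y' ∈ Q, y ≠ y' →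
      ‖chi η u 0 - y‖ < r → ‖chi η u N - y'‖ < r →
      (∀ j, 0 < j → j < N → ∀ x ∈ Q, r ≤ ‖chi η u j - x‖) →
      H y y' - ε ≤ ∑ i ∈ Finset.range N, site η V u i)
    {u : ℕ → E3} {N : ℕ} (hu : ∀ i ≤ N + 1, ‖u i‖ = 1) {y y' : E3} (hy : y ∈ Q) (hy' : y' ∈ Q)
    (h0 : ‖chi η u 0 - y‖ < r) (hN : ‖chi η u N - y'‖ < r) :
    H y y' - Q.card * ε ≤ ∑ i ∈ Finset.range N, site η V u i := by
  classical
  have key : ∀ (k : ℕ) (S : Finset E3), S.card = k → S ⊆ Q → ∀ (u : ℕ → E3) (N : ℕ),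
      (∀ i ≤ N + 1, ‖u i‖ = 1) → ∀ y ∈ Q, ‖chi η u 0 - y‖ < r → ‖chi η u N - y'‖ < r →
      (∀ j ≤ N, ∀ x ∈ Q, ‖chi η u j - x‖ < r → x ∈ S) →
      H y y' - S.card * ε ≤ ∑ i ∈ Finset.range N, site η V u i := by
    intro k
    induction k with
    | zero =>
      intro S hS hSQ u N hu y hy h0 hN hv
      have := hv 0 (Nat.zero_le _) y hy h0
      rw [Finset.card_eq_zero.1 hS] at this; simp at this
    | succ k ih =>
      intro S hS hSQ u N hu y hy h0 hN hv
      have hyS := hv 0 (Nat.zero_le _) y hy h0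
      -- Take the last visit to `y`. The leg up to the next visited well is charged to `hleg`. The
      -- rest of the chain never sees `y` again, so the induction is on the set of wells still
      -- available, and there are at most `Q.card` legs.
      obtain ⟨i, hi, hiy, hmax⟩ : ∃ i ≤ N, ‖chi η u i - y‖ < r ∧
          ∀ m, i < m → m ≤ N → ¬ ‖chi η u m - y‖ < r :=
        ⟨Nat.findGreatest (fun i => ‖chi η u i - y‖ < r) N, Nat.findGreatest_le _,
          Nat.findGreatest_spec (P := fun i => ‖chi η u i - y‖ < r) (Nat.zero_le _) h0,
          fun m h1 h2 => Nat.findGreatest_is_greatest h1 h2⟩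
      rcases eq_or_ne y y' with rfl | hne
      · rw [hH0 y hy]
        have : 0 ≤ ∑ i ∈ Finset.range N, site η V u i :=
          Finset.sum_nonneg fun i _ => site_nonneg hη hV u i
        have : 0 ≤ (S.card : ℝ) * ε := by positivity
        linarith
      have hiN : i < N := hi.lt_of_ne fun h => hne (hsep y hy y' hy' _ hiy (h ▸ hN))
      have hex : ∃ j, i < j ∧ j ≤ N ∧ ∃ x ∈ Q, ‖chi η u j - x‖ < r := ⟨N, hiN, le_rfl, y', hy', hN⟩
      obtain ⟨j, ⟨hij, hjN, x, hxQ, hxj⟩, hjmin⟩ : ∃ j, (i < j ∧ j ≤ N ∧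
          ∃ x ∈ Q, ‖chi η u j - x‖ < r) ∧ ∀ m < j, ¬ (i < m ∧ m ≤ N ∧ ∃ x ∈ Q, ‖chi η u m - x‖ < r) :=
        ⟨Nat.find hex, Nat.find_spec hex, fun m hm => Nat.find_min hex hm⟩
      have hyx : y ≠ x := by rintro rfl; exact hmax j hij hjN hxj
      obtain ⟨a, rfl⟩ := Nat.exists_eq_add_of_lt hij
      obtain ⟨b, rfl⟩ := Nat.exists_eq_add_of_le hjN
      have hl := hleg (fun t => u (i + t)) (a + 1) (fun t ht => hu _ (by omega)) y hy x hxQ hyx hiy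
        hxj (fun t h1 h2 x' hx' => by
          by_contra! hlt
          exact hjmin (i + t) (by omega) ⟨by omega, by omega, x', hx', hlt⟩)
      have hr := ih (S.erase y) (by rw [Finset.card_erase_of_mem hyS, hS]; rfl)
        ((Finset.erase_subset _ _).trans hSQ) (fun t => u (i + a + 1 + t)) b
        (fun t ht => hu _ (by omega)) x hxQ hxj hN (fun t ht x' hx' hlt => by
          refine Finset.mem_erase.2 ⟨?_, hv (i + a + 1 + t) (by omega) x' hx' hlt⟩
          rintro rfl
          exact hmax (i + a + 1 + t) (by omega) (by omega) hlt)
      have htri := hH y hy x hxQ y' hy'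
      rw [Finset.sum_range_add, add_assoc i a 1, Finset.sum_range_add]
      have h1 : 0 ≤ ∑ t ∈ Finset.range i, site η V u t :=
        Finset.sum_nonneg fun t _ => site_nonneg hη hV u t
      have hcard : (S.card : ℝ) = (S.erase y).card + 1 := by
        rw [Finset.card_erase_of_mem hyS, hS]; push_cast; simp
      rw [hcard]
      have e1 : ∑ t ∈ Finset.range (a + 1), site η V (fun t => u (i + t)) t =
        ∑ t ∈ Finset.range (a + 1), site η V u (i + t) := rfl
      have e2 : ∑ t ∈ Finset.range b, site η V (fun t => u (i + a + 1 + t)) t =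
        ∑ t ∈ Finset.range b, site η V u (i + (a + 1) + t) := rfl
      rw [e1] at hl
      rw [e2] at hr
      linarith
  exact key _ Q rfl subset_rfl u N hu y hy h0 hN fun j _ x hx _ => hx

/-- Cauchy--Schwarz for the increments of the chirality. -/
lemma norm_chi_sub_sq_le_sum {η : ℝ} (hη : 0 < η) (u : ℕ → E3) (i m : ℕ) :
    ‖chi η u (i + m) - chi η u i‖ ^ 2 ≤ m * η * ∑ t ∈ Finset.range m, bend η u (i + t) := by
  have h1 : ‖chi η u (i + m) - chi η u i‖ ≤
      ∑ t ∈ Finset.range m, ‖chi η u (i + t + 1) - chi η u (i + t)‖ := by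
    have := Finset.sum_range_sub (fun t => chi η u (i + t)) m
    simp only [add_zero] at this
    rw [← this]
    exact norm_sum_le _ _
  have h2 := sq_sum_le_card_mul_sum_sq (s := Finset.range m)
    (f := fun t => ‖chi η u (i + t + 1) - chi η u (i + t)‖)
  rw [Finset.card_range] at h2
  refine (pow_le_pow_left₀ (norm_nonneg _) h1 2).trans (h2.trans ?_)
  rw [mul_assoc]
  refine mul_le_mul_of_nonneg_left ?_ (Nat.cast_nonneg _)
  rw [Finset.mul_sum]
  exact Finset.sum_le_sum fun t _ => norm_chi_sub_sq_le hη

/-- With this filter, finitely many smallness requirements on one parameter are met simultaneously.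
-/
lemma eventually_mul_lt (C : ℝ) {c : ℝ} (hc : 0 < c) : ∀ᶠ τ in 𝓝[>] (0 : ℝ), τ * C < c := by
  have h : Tendsto (fun τ : ℝ => τ * C) (𝓝 0) (𝓝 (0 * C)) := tendsto_id.mul_const C
  rw [zero_mul] at h
  exact (h.eventually (gt_mem_nhds hc)).filter_mono nhdsWithin_le_nhds

lemma bend_le_sum {η : ℝ} (hη : 0 < η) {V : E3 → ℝ} (hV : ∀ x, 0 ≤ V x) (u : ℕ → E3) {i N : ℕ}
    (hi : i < N) : bend η u i ≤ ∑ t ∈ Finset.range N, site η V u t :=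
  (bend_le_site hη hV u i).trans (Finset.single_le_sum (fun t _ => site_nonneg hη hV u t)
    (Finset.mem_range.2 hi))

lemma mul_le_sum_site {η κ : ℝ} (hη : 0 < η) {V : E3 → ℝ} (hV : ∀ x, 0 ≤ V x) {u : ℕ → E3} {m : ℕ}
    (h : ∀ i, 0 < i → i < m + 1 → η * κ ≤ site η V u i) :
    m * η * κ ≤ ∑ t ∈ Finset.range (m + 1), site η V u t := by
  rw [Finset.sum_range_succ']
  have h1 : ∑ _t ∈ Finset.range m, η * κ ≤ ∑ t ∈ Finset.range m, site η V u (t + 1) :=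
    Finset.sum_le_sum fun t ht => h _ (by omega) (by have := Finset.mem_range.1 ht; omega)
  rw [Finset.sum_const, Finset.card_range, nsmul_eq_mul] at h1
  have := site_nonneg hη hV u 0
  linarith

lemma sum_bend_le_sum_site {η : ℝ} (hη : 0 < η) {V : E3 → ℝ} (hV : ∀ x, 0 ≤ V x) (u : ℕ → E3)
    (i : ℕ) {m N : ℕ} (h : i + m ≤ N) :
    ∑ t ∈ Finset.range m, bend η u (i + t) ≤ ∑ t ∈ Finset.range N, site η V u t :=
  (Finset.sum_le_sum fun t _ => bend_le_site hη hV u (i + t)).trans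
    (sum_window_le (fun t => site_nonneg hη hV u t) h)

lemma ite_eq_triangle {α : Type*} [DecidableEq α] {c : ℝ} (hc : 0 ≤ c) (x y z : α) :
    (if x = z then 0 else c) ≤ (if x = y then 0 else c) + if y = z then 0 else c := by
  rcases eq_or_ne x y with rfl | h
  · simp
  · rw [if_neg h]
    have h1 : (if x = z then 0 else c) ≤ c := by split_ifs <;> [exact hc; exact le_rfl]
    have h2 : 0 ≤ if y = z then 0 else c := by split_ifs <;> [exact le_rfl; exact hc]
    linarith

section

variable {Q : Set E3} {G : E3 → ℝ}

/-- A transition between different wells costs a fixed amount of energy. -/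
lemma IsPenalty.exists_switch_lower (hG : IsPenalty Q G) {g₀ : ℝ} (hg₀ : 0 < g₀) :
    ∃ c > 0, ∃ r > 0, ∃ τ > 0, ∀ η, 0 < η → η ≤ τ → ∀ g, g₀ ≤ g → ∀ (u : ℕ → E3) (N : ℕ),
      (∀ i ≤ N + 1, ‖u i‖ = 1) → ∀ y ∈ Q, ∀ y' ∈ Q, y ≠ y' → ‖chi η u 0 - y‖ < r →
      ‖chi η u N - y'‖ < r → c ≤ ∑ i ∈ Finset.range N, site η (fun x => g * G x) u i := by
  classical
  obtain ⟨d, hd, hd1, hsep⟩ := hG.exists_separation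
  obtain ⟨c₀, hc₀, hc₀1, τ, hτ, hco⟩ := hG.exists_coercive (r := d / 4) (by positivity) (by linarith)
  obtain ⟨κ, hκ⟩ : ∃ κ, κ = min 1 g₀ * c₀ := ⟨_, rfl⟩
  have hκ0 : 0 < κ := by rw [hκ]; exact mul_pos (lt_min one_pos hg₀) hc₀
  -- A leg of energy E < 1 has its interior sites outside the wells, so its rescaled duration is at
  -- most 1/κ + 1. The chirality must move by d/2, and Cauchy–Schwarz gives (d/2)² ≤ (1/κ + 1)E.
  obtain ⟨c, hc⟩ : ∃ c, c = min 1 ((d / 2) ^ 2 / (1 / κ + 1)) := ⟨_, rfl⟩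
  have hc0 : 0 < c := by rw [hc]; positivity
  refine ⟨c, hc0, d / 4, by positivity, min τ 1, by positivity, ?_⟩
  intro η hη hητ g hg
  have hg0 : 0 < g := hg₀.trans_le hg
  have hV : ∀ x, 0 ≤ g * G x := fun x => mul_nonneg hg0.le (hG.nonneg x)
  have hsep' : ∀ y ∈ Q, ∀ y' ∈ Q, ∀ x : E3, ‖x - y‖ < d / 4 → ‖x - y'‖ < d / 4 → y = y' := by
    intro y hy y' hy' x h1 h2
    by_contra hne
    have h3 := hsep y hy y' hy' hne
    have h4 := norm_sub_le (x - y') (x - y)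
    rw [sub_sub_sub_cancel_left] at h4
    linarith
  have hleg : ∀ (u : ℕ → E3) (N : ℕ), (∀ i ≤ N + 1, ‖u i‖ = 1) → ∀ y ∈ Q, ∀ y' ∈ Q, y ≠ y' →
      ‖chi η u 0 - y‖ < d / 4 → ‖chi η u N - y'‖ < d / 4 →
      (∀ j, 0 < j → j < N → ∀ x ∈ Q, d / 4 ≤ ‖chi η u j - x‖) →
      c ≤ ∑ i ∈ Finset.range N, site η (fun x => g * G x) u i := by
    intro u N hu y hy y' hy' hne h0 hN hout
    obtain ⟨E, hE⟩ : ∃ E, E = ∑ i ∈ Finset.range N, site η (fun x => g * G x) u i := ⟨_, rfl⟩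
    rw [← hE]
    rcases le_or_gt 1 E with h1E | hE1
    · rw [hc]; exact (min_le_left _ _).trans h1E
    obtain ⟨m, rfl⟩ : ∃ m, N = m + 1 := by
      cases N with
      | zero => exact (hne (hsep' y hy y' hy' _ h0 hN)).elim
      | succ m => exact ⟨m, rfl⟩
    have hm : m * η * κ ≤ E := by
      rw [hE]
      refine mul_le_sum_site hη hV fun i hi0 hi => ?_
      refine le_trans ?_ (hco η hη (hητ.trans (min_le_left _ _)) u i (hu _ (by omega))
        (hu _ (by omega)) (hu _ (by omega)) ?_ (hout i hi0 hi) g hg0.le)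
      · rw [hκ]; gcongr
      · have := bend_le_sum hη hV u hi
        linarith
    have hcs := norm_chi_sub_sq_le_sum hη u 0 (m + 1)
    rw [zero_add] at hcs
    have hb := sum_bend_le_sum_site hη hV u 0 (zero_add (m + 1)).le
    rw [← hE] at hb
    have hdist : d / 2 ≤ ‖chi η u (m + 1) - chi η u 0‖ := by
      have h3 := hsep y hy y' hy' hne
      have h4 : ‖y - y'‖ ≤ ‖chi η u 0 - y‖ + ‖chi η u (m + 1) - y'‖ +
          ‖chi η u (m + 1) - chi η u 0‖ := by
        have e : y - y' = -(chi η u 0 - y) + (chi η u (m + 1) - y') -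
          (chi η u (m + 1) - chi η u 0) := by abel
        rw [e]
        refine (norm_sub_le _ _).trans (add_le_add_left ((norm_add_le _ _).trans ?_) _)
        rw [norm_neg]
      linarith
    have hE0 : 0 ≤ E := by rw [hE]; exact Finset.sum_nonneg fun t _ => site_nonneg hη hV u t
    have h5 : (d / 2) ^ 2 ≤ ((m + 1 : ℕ) : ℝ) * η * E :=
      (pow_le_pow_left₀ (by positivity) hdist 2).trans
        (hcs.trans (mul_le_mul_of_nonneg_left hb (by positivity)))
    have h6 : m * η ≤ 1 / κ := by
      rw [le_div_iff₀ hκ0]; linarith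
    have h7 : ((m + 1 : ℕ) : ℝ) * η ≤ 1 / κ + 1 := by
      push_cast; linarith [hητ.trans (min_le_right τ 1)]
    rw [hc]
    refine (min_le_right _ _).trans ?_
    rw [div_le_iff₀ (by positivity)]
    have := mul_le_mul_of_nonneg_right h7 hE0
    linarith
  intro u N hu y hy y' hy' hne h0 hN
  -- The cost that is c between distinct wells and 0 otherwise satisfies the triangle inequality, so
  -- the decomposition into legs applies without loss.
  have := le_sum_site_of_legs (Q := hG.finite.toFinset) (H := fun y y' => if y = y' then 0 else c)
    hη hV le_rfl (by simp) ?_ ?_ ?_ hu (hG.finite.mem_toFinset.2 hy)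
    (hG.finite.mem_toFinset.2 hy') h0 hN
  · simpa [hne] using this
  · exact fun x _ y _ z _ => ite_eq_triangle hc0.le x y z
  · simpa using hsep'
  · intro u N hu y hy y' hy' hne h0 hN hout
    simp only [if_neg hne, sub_zero]
    exact hleg u N hu y (by simpa using hy) y' (by simpa using hy') hne h0 hN (by simpa using hout)

lemma norm_normalize_sub_le {x y : E3} {r : ℝ} (hr : 0 < r) (hx : r ≤ ‖x‖) (hy : r ≤ ‖y‖) :
    ‖‖y‖⁻¹ • y - ‖x‖⁻¹ • x‖ ≤ 2 / r * ‖y - x‖ := by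
  have hx0 : 0 < ‖x‖ := hr.trans_le hx
  have hy0 : 0 < ‖y‖ := hr.trans_le hy
  have e : ‖y‖⁻¹ • y - ‖x‖⁻¹ • x = ‖x‖⁻¹ • (y - x) + (‖x‖⁻¹ * (‖y‖⁻¹ * (‖x‖ - ‖y‖))) • y := by
    have : ‖x‖⁻¹ * (‖y‖⁻¹ * (‖x‖ - ‖y‖)) = ‖y‖⁻¹ - ‖x‖⁻¹ := by field_simp
    rw [this]; module
  rw [e]
  refine (norm_add_le _ _).trans ?_
  rw [norm_smul, norm_smul, norm_mul, norm_mul, norm_inv, norm_inv, norm_norm, norm_norm]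
  have h1 : ‖x‖⁻¹ * (‖y‖⁻¹ * ‖‖x‖ - ‖y‖‖) * ‖y‖ = ‖x‖⁻¹ * ‖‖x‖ - ‖y‖‖ := by field_simp
  have h2 : ‖‖x‖ - ‖y‖‖ ≤ ‖y - x‖ := by
    rw [norm_sub_rev y x]; exact abs_norm_sub_norm_le x y
  have h3 : ‖x‖⁻¹ ≤ r⁻¹ := inv_anti₀ hr hx
  rw [h1]
  have h4 : ‖x‖⁻¹ * ‖‖x‖ - ‖y‖‖ ≤ r⁻¹ * ‖y - x‖ := mul_le_mul h3 h2 (norm_nonneg _) (by positivity)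
  have h5 := mul_le_mul_of_nonneg_right h3 (norm_nonneg (y - x))
  rw [div_eq_mul_inv]
  linarith

/-- With a strong penalty every transition passes near the origin. -/
lemma IsPenalty.exists_eight_thirds_lower (hG : IsPenalty Q G) {ε : ℝ} (hε : 0 < ε) :
    ∃ r > 0, ∃ τ > 0, ∃ K, ∀ η, 0 < η → η ≤ τ → ∀ g, K ≤ g → ∀ (u : ℕ → E3) (N : ℕ),
      (∀ i ≤ N + 1, ‖u i‖ = 1) → ∀ y ∈ Q, ∀ y' ∈ Q, y ≠ y' → ‖chi η u 0 - y‖ < r →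
      ‖chi η u N - y'‖ < r →
      8 / 3 - ε ≤ ∑ i ∈ Finset.range N, site η (fun x => g * G x) u i := by
  obtain ⟨d, hd, hd1, hsep⟩ := hG.exists_separation
  obtain ⟨r₁, hr₁, η₁, hη₁, hdip⟩ := eight_thirds_le_sum_bend hε
  obtain ⟨c, hc, -, hcG⟩ := hG.exists_lower (ρ := d / 8) (by positivity)
  -- The least rescaled time needed for a displacement d r₁/16 with energy 3: Cauchy–Schwarz gives
  -- 6s ≤ 3(m + 1)η, and η ≤ s removes the extra step.
  obtain ⟨s, hs⟩ : ∃ s, s = (d * r₁ / 16) ^ 2 / 6 := ⟨_, rfl⟩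
  have hs0 : 0 < s := by rw [hs]; positivity
  refine ⟨min r₁ (d / 16), by positivity, min η₁ s, by positivity, 4 / (s * c), ?_⟩
  intro η hη hητ g hg u N hu y hy y' hy' hne h0 hN
  have hg0 : 0 < g := lt_of_lt_of_le (by positivity) hg
  have hV : ∀ x, 0 ≤ g * G x := fun x => mul_nonneg hg0.le (hG.nonneg x)
  have habs : ∀ {x z : E3} {t : ℝ}, z ∈ Q → ‖x - z‖ < t → |‖x‖ - 1| < t := by
    intro x z t hz h
    rw [← hG.unit z hz]; exact (abs_norm_sub_norm_le _ _).trans_lt h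
  by_contra! hlt
  have hbig : ∀ j ≤ N, r₁ ≤ ‖chi η u j‖ := by
    intro j hj
    by_contra! hsmall
    have := hdip η hη (hητ.trans (min_le_left _ _)) u N j hu hj
      ((habs hy h0).trans_le (min_le_left _ _)) ((habs hy' hN).trans_le (min_le_left _ _)) hsmall
    have h2 := Finset.sum_le_sum (s := Finset.range N) fun i _ => bend_le_site hη hV u i
    linarith
  obtain ⟨D, hD⟩ : ∃ D : ℕ → E3, D = fun j => ‖chi η u j‖⁻¹ • chi η u j := ⟨_, rfl⟩
  have hnear : ∀ {x z : E3}, z ∈ Q → ‖x - z‖ < d / 16 → ‖‖x‖⁻¹ • x - z‖ ≤ d / 8 := by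
    intro x z hz h
    have h1 := (habs hz h).le
    have hx0 : 0 < ‖x‖ := by rw [abs_le] at h1; linarith
    have h2 : ‖‖x‖⁻¹ • x - x‖ ≤ d / 16 := by
      have : ‖x‖⁻¹ • x - x = (‖x‖⁻¹ * (1 - ‖x‖)) • x := by
        rw [mul_sub, inv_mul_cancel₀ hx0.ne']; module
      rw [this, norm_smul, Real.norm_eq_abs, abs_mul, abs_of_pos (inv_pos.2 hx0), abs_sub_comm]
      calc ‖x‖⁻¹ * |‖x‖ - 1| * ‖x‖ = |‖x‖ - 1| := by field_simp
        _ ≤ _ := h1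
    have h3 : ‖‖x‖⁻¹ • x - z‖ ≤ ‖‖x‖⁻¹ • x - x‖ + ‖x - z‖ := by
      have := norm_add_le (‖x‖⁻¹ • x - x) (x - z); rwa [sub_add_sub_cancel] at this
    linarith
  have hA : ‖D 0 - y‖ ≤ d / 8 := by rw [hD]; exact hnear hy (h0.trans_le (min_le_right _ _))
  have hB : d / 4 ≤ ‖D N - y‖ := by
    have h1 : ‖D N - y'‖ ≤ d / 8 := by rw [hD]; exact hnear hy' (hN.trans_le (min_le_right _ _))
    have h2 := hsep y hy y' hy' hne
    have h3 := norm_sub_le (D N - y') (D N - y)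
    rw [sub_sub_sub_cancel_left] at h3
    linarith
  -- Between the last direction within d/8 of `y` and the first one at distance d/4 or more, the
  -- direction is at least d/8 away from every well, so G ≥ c there. The time spent exceeds s, so
  -- the penalty is at least s g c, which exceeds 3 for large g.
  obtain ⟨i, j, -, hij, hjN, hAi, hBj, hbtw⟩ := exists_crossing
    (A := fun j => ‖D j - y‖ ≤ d / 8) (B := fun j => d / 4 ≤ ‖D j - y‖) (Nat.zero_le N) hA hB
  have hij' : i < j := hij.lt_of_ne (by rintro rfl; linarith)
  obtain ⟨m, rfl⟩ := Nat.exists_eq_add_of_lt hij'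
  have hdisp : d / 8 ≤ ‖D (i + m + 1) - D i‖ := by
    have := norm_add_le (D (i + m + 1) - D i) (D i - y)
    rw [sub_add_sub_cancel] at this
    linarith
  have hdisp2 : d * r₁ / 16 ≤ ‖chi η u (i + (m + 1)) - chi η u i‖ := by
    have := norm_normalize_sub_le hr₁ (hbig i (by omega)) (hbig (i + m + 1) hjN)
    rw [hD] at hdisp
    have h2 := hdisp.trans this
    rw [div_mul_eq_mul_div, le_div_iff₀ hr₁] at h2
    rw [← add_assoc]
    linarith
  have hE3 : ∑ i ∈ Finset.range N, site η (fun x => g * G x) u i ≤ 3 := by linarith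
  have hcs := norm_chi_sub_sq_le_sum hη u i (m + 1)
  have hb := (sum_bend_le_sum_site hη hV u i (m := m + 1) (N := N) (by omega)).trans hE3
  have h5 : (d * r₁ / 16) ^ 2 ≤ ((m + 1 : ℕ) : ℝ) * η * 3 :=
    (pow_le_pow_left₀ (by positivity) hdisp2 2).trans
      (hcs.trans (mul_le_mul_of_nonneg_left hb (by positivity)))
  have h6 : s ≤ m * η := by
    have h7 : (d * r₁ / 16) ^ 2 = 6 * s := by rw [hs]; ring
    have h8 := hητ.trans (min_le_right _ _)
    push_cast at h5
    linarith
  have h9 : m * η * (g * c) ≤ 3 := by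
    refine le_trans ?_ hE3
    refine le_trans (mul_le_sum_site (u := fun t => u (i + t)) (m := m) hη hV fun t ht0 ht => ?_)
      (sum_window_le (f := fun t => site η (fun x => g * G x) u t)
        (fun t => site_nonneg hη hV u t) (a := i) (m := m + 1) (N := N) (by omega))
    have hbt := hbtw (i + t) (by omega) (by omega)
    push Not at hbt
    have hr0 : 0 < ‖chi η u (i + t)‖ := hr₁.trans_le (hbig (i + t) (by omega))
    have hGc : c ≤ G (chi η u (i + t)) := by
      rw [← hG.hom _ (inv_pos.2 hr0)]
      refine hcG _ (by simp [norm_smul, hr0.ne']) fun x hx => ?_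
      rcases eq_or_ne x y with rfl | hxy
      · have := hbt.1; rw [hD] at this; exact this.le
      · have h1 := hsep x hx y hy hxy
        have h2 := hbt.2
        have h3 := norm_sub_le (D (i + t) - y) (D (i + t) - x)
        rw [sub_sub_sub_cancel_left] at h3
        rw [hD] at h2 h3
        simp only at h2 h3
        linarith
    have h10 : site η (fun x => g * G x) (fun t => u (i + t)) t =
      bend η u (i + t) + η * (g * G (chi η u (i + t))) := rfl
    rw [h10]
    have := bend_nonneg hη u (i + t)
    have := mul_le_mul_of_nonneg_left (mul_le_mul_of_nonneg_left hGc hg0.le) hη.le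
    linarith
  have h11 : s * (g * c) ≤ m * η * (g * c) := mul_le_mul_of_nonneg_right h6 (by positivity)
  rw [div_le_iff₀ (by positivity)] at hg
  linarith

end

lemma speed_sq_le_of_norm_chi_le {η R : ℝ} (hη : 0 < η) (hη1 : η ≤ 1 / 100) {u : ℕ → E3} {i : ℕ}
    (h0 : ‖u i‖ = 1) (h1 : ‖u (i + 1)‖ = 1) (h : η * speed η u i ^ 2 ≤ 2 * 3)
    (hR : ‖chi η u i‖ ≤ R) : speed η u i ≤ 2 * R := by
  have hR0 : 0 ≤ R := (norm_nonneg _).trans hR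
  have h2 := norm_chi_sq hη h0 h1
  have h3 := pow_le_pow_left₀ (norm_nonneg _) hR 2
  have h4 : η * (η * speed η u i ^ 2) ≤ 1 / 100 * (2 * 3) :=
    mul_le_mul hη1 h (by positivity) (by norm_num)
  have h5 : speed η u i ^ 2 * (1 / 2) ≤ speed η u i ^ 2 * (1 - η ^ 2 * speed η u i ^ 2 / 4) := by
    refine mul_le_mul_of_nonneg_left ?_ (sq_nonneg _)
    linarith
  refine (pow_le_pow_iff_left₀ (speed_nonneg hη u i) (by positivity) two_ne_zero).1 ?_
  linarith [sq_nonneg R]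

/-- The profile value at the midpoint is χ_i multiplied by 4/|u_i + u_{i+1}|² = 4/(4 − ξ²), where ξ
is the chord. -/
lemma node_near {η X : ℝ} (hη : 0 < η) {u : ℕ → E3} {i : ℕ} (h0 : ‖u i‖ = 1)
    (h1 : ‖u (i + 1)‖ = 1) (hX : speed η u i ≤ X) (hηX : η * X ≤ 1) :
    ‖(node η (u i) (u (i + 1))).1‖ = 1 ∧
      inner ℝ (node η (u i) (u (i + 1))).2 (node η (u i) (u (i + 1))).1 = 0 ∧
      ‖(node η (u i) (u (i + 1))).2 - chi η u i‖ ≤ η * X * ‖chi η u i‖ := by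
  obtain ⟨ξ, hξ⟩ : ∃ ξ, ξ = η * speed η u i := ⟨_, rfl⟩
  have hs0 := speed_nonneg hη u i
  have hξ0 : 0 ≤ ξ := by rw [hξ]; positivity
  have hξX : ξ ≤ η * X := by rw [hξ]; gcongr
  have hn : ‖u i + u (i + 1)‖ ^ 2 = 4 - ξ ^ 2 := by
    rw [norm_add_sq_real, inner_eq_speed hη h0 h1, h0, h1, hξ]; ring
  have hξ2 : ξ ^ 2 ≤ ξ := pow_le_of_le_one hξ0 (hξX.trans hηX) two_ne_zero
  have hpos : 0 < ‖u i + u (i + 1)‖ := by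
    refine (norm_nonneg _).lt_of_ne fun h => ?_
    rw [← h] at hn
    linarith
  refine ⟨by simp only [node]; rw [norm_smul, norm_inv, norm_norm, inv_mul_cancel₀ hpos.ne'], ?_, ?_⟩
  · simp only [node, inner_smul_left, inner_smul_right, inner_add_right]
    rw [real_inner_comm, inner_cross_left, real_inner_comm, inner_cross_right]; simp
  · have e : (node η (u i) (u (i + 1))).2 - chi η u i =
        (ξ ^ 2 / (4 - ξ ^ 2)) • chi η u i := by
      have h3 : ξ ^ 2 / (4 - ξ ^ 2) = 4 / (4 - ξ ^ 2) - 1 := by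
        have : 4 - ξ ^ 2 ≠ 0 := by linarith
        field_simp
        ring
      simp only [node, chi, hn]
      rw [h3, sub_smul, one_smul]
    rw [e, norm_smul, Real.norm_eq_abs]
    have h3 : 0 < 4 - ξ ^ 2 := by linarith
    refine mul_le_mul_of_nonneg_right ?_ (norm_nonneg _)
    rw [abs_of_nonneg (by positivity), div_le_iff₀ h3]
    have : ξ * 1 ≤ ξ * (4 - ξ ^ 2) := mul_le_mul_of_nonneg_left (by linarith) hξ0
    have := mul_le_mul_of_nonneg_right hξX h3.le
    linarith

lemma reach_chain {V : E3 → ℝ} {x : ℕ → E3 × E3} {c : ℕ → ℝ} (m : ℕ) (hc : ∀ j < m + 1, 0 ≤ c j)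
    (h : ∀ j < m + 1, Reach V (x j) (x (j + 1)) (ENNReal.ofReal (c j))) :
    Reach V (x 0) (x (m + 1)) (ENNReal.ofReal (∑ j ∈ Finset.range (m + 1), c j)) := by
  induction m with
  | zero => simpa using h 0 (by omega)
  | succ m ih =>
    rw [Finset.sum_range_succ, ENNReal.ofReal_add
      (Finset.sum_nonneg fun j hj => hc j (by have := Finset.mem_range.1 hj; omega))
      (hc _ (by omega))]
    exact (ih (fun j hj => hc j (by omega)) fun j hj => h j (by omega)).trans (h (m + 1) (by omega))

variable {Q : Set E3} {G : E3 → ℝ}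

lemma IsPenalty.exists_reach_near (hG : IsPenalty Q G) (g : ℝ) {ε : ℝ} (hε : 0 < ε) :
    ∀ᶠ ρ in 𝓝[>] (0 : ℝ), ∀ y ∈ Q, ∀ u₀ w₀ u₁ w₁ : E3, ‖u₀‖ = 1 → ‖u₁‖ = 1 → inner ℝ w₀ u₀ = 0 →
      inner ℝ w₁ u₁ = 0 → ‖w₀ - y‖ < ρ → ‖w₁ - y‖ < ρ →
      Reach (fun x => g * G x) (u₀, w₀) (u₁, w₁) (ENNReal.ofReal ε) := by
  refine (eventually_all_finite hG.finite).2 fun y hy => ?_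
  obtain ⟨ρ, hρ, h⟩ := HelicalChain.exists_reach_near (hG.unit y hy) (hG.smallNear (g := g) hy) hε
  filter_upwards [Ioo_mem_nhdsGT hρ] with t ht u₀ w₀ u₁ w₁ h1 h2 h3 h4 h5 h6
  exact h u₀ w₀ u₁ w₁ h1 h2 h3 h4 (h5.trans ht.2) (h6.trans ht.2)

lemma IsPenalty.transitionCost_lt_top (hG : IsPenalty Q G) (γ : ℝ) {y y' : E3} (hy : y ∈ Q)
    (hy' : y' ∈ Q) : transitionCost (fun x => γ * G x) y y' ≤ ENNReal.ofReal (8 / 3) :=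
  transitionCost_le_eight_thirds (hG.unit y hy) (hG.unit y' hy') (fun s => by simp [hG.zero y hy])
    fun s => by simp [hG.zero y' hy']

set_option maxHeartbeats 1000000 in
/-- A passage between two wells costs at least the optimal profile energy. -/
lemma IsPenalty.exists_leg_lower (hG : IsPenalty Q G) {g₀ : ℝ} (hg₀ : 0 < g₀) {ε d : ℝ}
    (hε : 0 < ε) (hd : 0 < d) :
    ∃ r > 0, r ≤ d ∧ ∃ τ > 0, ∀ η, 0 < η → η ≤ τ → ∀ g, |g - g₀| ≤ τ → ∀ (u : ℕ → E3) (m : ℕ),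
      (∀ i ≤ m + 2, ‖u i‖ = 1) → ∀ y ∈ Q, ∀ y' ∈ Q, ‖chi η u 0 - y‖ < r →
      ‖chi η u (m + 1) - y'‖ < r → (∀ j, 0 < j → j < m + 1 → ∀ x ∈ Q, r ≤ ‖chi η u j - x‖) →
      (transitionCost (fun x => 2 * g₀ * G x) y y').toReal - ε ≤
        ∑ i ∈ Finset.range (m + 1), site η (fun x => g * G x) u i := by
  obtain ⟨r₁, hr₁, η₁, hη₁, hdip⟩ := eight_thirds_le_sum_bend hε
  obtain ⟨Γ, hΓ, hGΓ⟩ := hG.exists_bound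
  obtain ⟨ρ, hρ, hconn⟩ := ((hG.exists_reach_near g₀ (ε := ε / 4) (by positivity)).and
    self_mem_nhdsWithin).exists.imp fun ρ h => And.intro h.2 h.1
  replace hρ : 0 < ρ := hρ
  obtain ⟨r, hr⟩ : ∃ r, r = min (min r₁ (ρ / 2)) (min d 1) := ⟨_, rfl⟩
  have hr0 : 0 < r := by rw [hr]; positivity
  have hrr₁ : r ≤ r₁ := by rw [hr]; exact (min_le_left _ _).trans (min_le_left _ _)
  have hrρ : r ≤ ρ / 2 := by rw [hr]; exact (min_le_left _ _).trans (min_le_right _ _)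
  have hrd : r ≤ d := by rw [hr]; exact (min_le_right _ _).trans (min_le_left _ _)
  have hr1 : r ≤ 1 := by rw [hr]; exact (min_le_right _ _).trans (min_le_right _ _)
  obtain ⟨c₀, hc₀, hc₀1, η₂, hη₂, hco⟩ := hG.exists_coercive hr0 hr1
  obtain ⟨κ, hκ⟩ : ∃ κ, κ = min 1 (g₀ / 2) * c₀ := ⟨_, rfl⟩
  have hκ0 : 0 < κ := by rw [hκ]; positivity
  -- M bounds the rescaled duration (m + 1)η, since every interior site costs at least ηκ and the
  -- energy is at most 3. Through Cauchy–Schwarz this gives the bound R for the chirality, and X =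
  -- 2R for the speeds.
  obtain ⟨M, hM⟩ : ∃ M, M = 3 / κ + 1 := ⟨_, rfl⟩
  have hM1 : 1 ≤ M := by rw [hM]; linarith [div_pos three_pos hκ0]
  obtain ⟨R, hR⟩ : ∃ R, R = 3 + 3 * M := ⟨_, rfl⟩
  obtain ⟨X, hX⟩ : ∃ X, X = 2 * R := ⟨_, rfl⟩
  have hX1 : 1 ≤ X := by rw [hX, hR]; linarith
  obtain ⟨ε₁, hε₁⟩ : ∃ ε₁, ε₁ = ε / (8 * M) := ⟨_, rfl⟩
  have hε₁0 : 0 < ε₁ := by rw [hε₁]; positivity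
  have hε₁M : M * ε₁ = ε / 8 := by rw [hε₁]; field_simp
  obtain ⟨δ, hδ, hunif⟩ := hG.exists_uniform (R := R) hr₁ (show 0 < ε₁ / g₀ by positivity)
  obtain ⟨σ, hσ0, hσ⟩ : ∃ σ > (0 : ℝ), σ * 1 < η₁ ∧ σ * 1 < η₂ ∧ σ * 1 < 1 / 100 ∧
      σ * X ^ 3 < 1 / 100 ∧ σ * (2 + 8 * X ^ 2) < δ ∧ σ * (2 * X * 2) < ρ ∧ σ * Γ < ε₁ ∧
      σ * (135 * X ^ 3) < ε / 8 ∧ σ * (600 * X ^ 5) < ε₁ ∧ σ * 1 < g₀ / 2 := by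
    have := ((((((((((eventually_mul_lt 1 hη₁).and (eventually_mul_lt 1 hη₂)).and
      (eventually_mul_lt 1 (show (0 : ℝ) < 1 / 100 by norm_num))).and
      (eventually_mul_lt (X ^ 3) (show (0 : ℝ) < 1 / 100 by norm_num))).and
      (eventually_mul_lt (2 + 8 * X ^ 2) hδ)).and
      (eventually_mul_lt (2 * X * 2) hρ)).and (eventually_mul_lt Γ hε₁0)).and
      (eventually_mul_lt (135 * X ^ 3) (show 0 < ε / 8 by positivity))).and
      (eventually_mul_lt (600 * X ^ 5) hε₁0)).and
      (eventually_mul_lt 1 (show 0 < g₀ / 2 by positivity))).and self_mem_nhdsWithin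
    obtain ⟨σ, ⟨⟨⟨⟨⟨⟨⟨⟨⟨h1, h2⟩, h3⟩, h4⟩, h5⟩, h6⟩, h7⟩, h8⟩, h9⟩, h10⟩, h11⟩ := this.exists
    exact ⟨σ, h11, h1, h2, h3, h4, h5, h6, h7, h8, h9, h10⟩
  obtain ⟨s1, s2, s3, s4, s5, s6, s7, s8, s9, s10⟩ := hσ
  rw [mul_one] at s1 s2 s3 s10
  -- The square is chosen because a chirality increment has squared length at most η times the
  -- bending energy, so η ≤ σ² makes the increments O(σ).
  refine ⟨r, hr0, hrd, σ ^ 2, by positivity, ?_⟩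
  intro η hη hησ g hg u m hu y hy y' hy' h0 hN hout
  have hσσ : σ ^ 2 ≤ σ := pow_le_of_le_one hσ0.le (by linarith) two_ne_zero
  have hησ1 : η ≤ σ := hησ.trans hσσ
  have hgg := abs_le.1 (hg.trans hσσ)
  have hg0 : 0 < g := by linarith
  have hV : ∀ x, 0 ≤ g * G x := fun x => mul_nonneg hg0.le (hG.nonneg x)
  obtain ⟨E, hE⟩ : ∃ E, E = ∑ i ∈ Finset.range (m + 1), site η (fun x => g * G x) u i := ⟨_, rfl⟩
  rw [← hE]
  have hle83 : (transitionCost (fun x => 2 * g₀ * G x) y y').toReal ≤ 8 / 3 :=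
    ENNReal.toReal_le_of_le_ofReal (by norm_num) (hG.transitionCost_lt_top _ hy hy')
  -- The transition cost never exceeds 8/3, so a counterexample has energy below 8/3 − ε. This
  -- excludes a dip to 0 and gives all the bounds below.
  by_contra! hlt
  have hE3 : E ≤ 3 := by linarith
  have hbend : ∀ i < m + 1, bend η u i ≤ 3 := fun i hi =>
    (bend_le_sum hη hV u hi).trans (hE ▸ hE3)
  have hmκ : m * η * κ ≤ 3 := by
    refine le_trans ?_ (hE ▸ hE3)
    refine mul_le_sum_site hη hV fun i hi0 hi => ?_
    refine le_trans ?_ (hco η hη (by linarith) u i (hu _ (by omega))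
      (hu _ (by omega)) (hu _ (by omega)) (hbend i hi) (hout i hi0 hi) g hg0.le)
    rw [hκ]
    have : g₀ / 2 ≤ g := by linarith
    gcongr
  have hmM : ((m + 1 : ℕ) : ℝ) * η ≤ M := by
    have : m * η ≤ 3 / κ := by rw [le_div_iff₀ hκ0]; linarith
    rw [hM]; push_cast; linarith
  have habs : ∀ {x z : E3} {t : ℝ}, z ∈ Q → ‖x - z‖ < t → |‖x‖ - 1| < t := by
    intro x z t hz h
    rw [← hG.unit z hz]; exact (abs_norm_sub_norm_le _ _).trans_lt h
  -- A visit near 0 would alone cost 8/3 − ε. Hence the chirality remains in an annulus on which the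
  -- penalty is uniformly continuous.
  have hbig : ∀ j ≤ m + 1, r₁ ≤ ‖chi η u j‖ := by
    intro j hj
    by_contra! hsmall
    have := hdip η hη (by linarith) u (m + 1) j hu hj
      ((habs hy h0).trans_le hrr₁) ((habs hy' hN).trans_le hrr₁) hsmall
    have h2 := Finset.sum_le_sum (s := Finset.range (m + 1)) fun i _ => bend_le_site hη hV u i
    linarith
  have h0n : ‖chi η u 0‖ ≤ 2 := by have := abs_lt.1 (habs hy h0); linarith
  have hNn : ‖chi η u (m + 1)‖ ≤ 2 := by have := abs_lt.1 (habs hy' hN); linarith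
  have hchiR : ∀ j ≤ m + 1, ‖chi η u j‖ ≤ R := by
    intro j hj
    have h1 := norm_chi_sub_sq_le_sum hη u 0 j
    have h2 := (sum_bend_le_sum_site hη hV u 0 (m := j) (N := m + 1) (by omega))
    rw [← hE] at h2
    have h3 : (j : ℝ) * η ≤ M := by
      refine le_trans ?_ hmM
      gcongr
    rw [zero_add] at h1
    have h4 : ‖chi η u j - chi η u 0‖ ^ 2 ≤ M * 3 := h1.trans
      (mul_le_mul h3 (h2.trans hE3) (Finset.sum_nonneg fun t _ => bend_nonneg hη u _) (by linarith))
    have h5 : ‖chi η u j - chi η u 0‖ ≤ 1 + 3 * M := by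
      refine (pow_le_pow_iff_left₀ (norm_nonneg _) (by positivity) two_ne_zero).1 ?_
      have : 0 ≤ M ^ 2 := sq_nonneg M
      linarith
    have h6 : ‖chi η u j‖ ≤ ‖chi η u j - chi η u 0‖ + ‖chi η u 0‖ := by
      have := norm_add_le (chi η u j - chi η u 0) (chi η u 0); rwa [sub_add_cancel] at this
    rw [hR]; linarith
  have hspeed : ∀ j ≤ m + 1, speed η u j ≤ X := by
    intro j hj
    rw [hX]
    refine speed_sq_le_of_norm_chi_le hη (by linarith) (hu _ (by omega)) (hu _ (by omega)) ?_
      (hchiR j hj)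
    rcases hj.lt_or_eq with h | h
    · exact (speed_sq_le hη (by linarith) le_rfl (hbend j h)).1
    · rw [h]; exact (speed_sq_le hη (by linarith) le_rfl (hbend m (by omega))).2
  have hXX : X ≤ X ^ 3 := le_self_pow₀ hX1 (by norm_num)
  have hηX3 : η * X ^ 3 ≤ 1 / 100 :=
    (mul_le_mul_of_nonneg_right hησ1 (by positivity)).trans s4.le
  have hηX : η * X ≤ 1 := (mul_le_mul_of_nonneg_left hXX hη.le).trans (by linarith)
  have hηX' : η * X ≤ σ * X := mul_le_mul_of_nonneg_right hησ1 (by linarith)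
  have hω : ∀ j < m + 1, ‖chi η u (j + 1) - chi η u j‖ ≤ 2 * σ := by
    intro j hj
    refine (pow_le_pow_iff_left₀ (norm_nonneg _) (by positivity) two_ne_zero).1 ?_
    have h1 := norm_chi_sub_sq_le hη (u := u) (i := j)
    have h2 := mul_le_mul hησ (hbend j hj) (bend_nonneg hη u j) (by positivity)
    have := sq_nonneg σ
    linarith
  obtain ⟨C, hC⟩ : ∃ C : ℕ → ℝ, C = fun j => η *
      ((1 + 45 * η * X ^ 3) * (‖chi η u (j + 1) - chi η u j‖ / η) ^ 2 +
        (1 - (speed η u j ^ 2 + speed η u (j + 1) ^ 2) / 2) ^ 2 + (g₀ * G (chi η u j) + ε₁) +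
        200 * X ^ 5 * (‖chi η u (j + 1) - chi η u j‖ + η)) := ⟨_, rfl⟩
  have hC0 : ∀ j < m + 1, 0 ≤ C j := fun j _ => by
    have := hG.nonneg (chi η u j)
    rw [hC]; positivity
  have hpiece : ∀ j < m + 1, Reach (fun x => g₀ * G x) (node η (u j) (u (j + 1)))
      (node η (u (j + 1)) (u (j + 1 + 1))) (ENNReal.ofReal (C j)) := by
    intro j hj
    rw [hC]
    refine reach_spline_piece (hu _ (by omega)) (hu _ (by omega)) (hu _ (by omega)) hη hX1 hηX3
      (hspeed j (by omega)) (hspeed (j + 1) (by omega)) fun w hw => ?_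
    have h1 : ‖w - chi η u j‖ ≤ δ := by
      refine hw.trans ?_
      have h2 := hω j hj
      have h3 := mul_le_mul_of_nonneg_right hησ1 (sq_nonneg X)
      simp only [chi] at h2
      linarith
    have := mul_le_mul_of_nonneg_left (hunif _ w (hbig j (by omega)) (hchiR j (by omega)) h1) hg₀.le
    rwa [mul_add, mul_div_cancel₀ _ hg₀.ne'] at this
  have hchain := reach_chain (x := fun j => node η (u j) (u (j + 1))) m hC0 hpiece
  have hsum : ∑ j ∈ Finset.range (m + 1), C j ≤ E + ε / 2 := by
    have h1 : ∀ j ∈ Finset.range (m + 1), C j ≤ site η (fun x => g * G x) u j +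
        45 * (η * X ^ 3) * bend η u j + η * (3 * ε₁) := by
      intro j hj
      have hj' := Finset.mem_range.1 hj
      obtain ⟨ω, hωe⟩ : ∃ ω, ω = ‖chi η u (j + 1) - chi η u j‖ := ⟨_, rfl⟩
      have hω2 := hω j hj'
      rw [← hωe] at hω2
      obtain ⟨S, hS⟩ : ∃ S, S = (1 - (speed η u j ^ 2 + speed η u (j + 1) ^ 2) / 2) ^ 2 := ⟨_, rfl⟩
      have hS0 : 0 ≤ S := by rw [hS]; positivity
      have hbe : bend η u j = ω ^ 2 / η + η * S := by rw [bend, hωe, hS]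
      have e1 : η * (ω / η) ^ 2 = ω ^ 2 / η := by field_simp
      have hω0 : 0 ≤ ω ^ 2 / η := by positivity
      have k1 : 45 * (η * X ^ 3) * (ω ^ 2 / η) ≤ 45 * (η * X ^ 3) * bend η u j := by
        rw [hbe]
        have : 0 ≤ η * S := by positivity
        gcongr; linarith
      have k2 : (g₀ - g) * G (chi η u j) ≤ ε₁ := by
        have : (g₀ - g) * G (chi η u j) ≤ σ * Γ :=
          mul_le_mul (by linarith) (hGΓ _) (hG.nonneg _) hσ0.le
        linarith
      have k3 : 200 * X ^ 5 * (ω + η) ≤ ε₁ := by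
        have : 200 * X ^ 5 * (ω + η) ≤ 200 * X ^ 5 * (3 * σ) :=
          mul_le_mul_of_nonneg_left (by linarith) (by positivity)
        linarith
      have k4 := mul_le_mul_of_nonneg_left k2 hη.le
      have k5 := mul_le_mul_of_nonneg_left k3 hη.le
      have hCj : C j = η * ((1 + 45 * η * X ^ 3) * (ω / η) ^ 2 + S + (g₀ * G (chi η u j) + ε₁) +
        200 * X ^ 5 * (ω + η)) := by rw [hC, hωe, hS]
      have hCj' : C j = ω ^ 2 / η + 45 * (η * X ^ 3) * (ω ^ 2 / η) + η * S +
          η * (g₀ * G (chi η u j)) + η * ε₁ + η * (200 * X ^ 5 * (ω + η)) := by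
        rw [hCj, ← e1]; ring
      rw [hCj', site, hbe] at *
      linarith
    refine (Finset.sum_le_sum h1).trans ?_
    rw [Finset.sum_add_distrib, Finset.sum_add_distrib, ← hE, ← Finset.mul_sum, Finset.sum_const,
      Finset.card_range, nsmul_eq_mul]
    have h2 : 45 * (η * X ^ 3) * ∑ j ∈ Finset.range (m + 1), bend η u j ≤ 45 * (σ * X ^ 3) * 3 := by
      refine mul_le_mul (by gcongr) ?_ (Finset.sum_nonneg fun t _ => bend_nonneg hη u _)
        (by positivity)
      exact (Finset.sum_le_sum fun i _ => bend_le_site hη hV u i).trans (hE ▸ hE3)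
    have h3 : ((m + 1 : ℕ) : ℝ) * (η * (3 * ε₁)) ≤ M * (3 * ε₁) := by
      rw [← mul_assoc]; exact mul_le_mul_of_nonneg_right hmM (by positivity)
    linarith
  obtain ⟨e, he, hye⟩ := exists_unit_orthogonal y
  obtain ⟨e', he', hye'⟩ := exists_unit_orthogonal y'
  have hnear : ∀ j ≤ m + 1, ‖chi η u j‖ ≤ 2 → ∀ z, ‖chi η u j - z‖ < r →
      ‖(node η (u j) (u (j + 1))).2 - z‖ < ρ := by
    intro j hj hj2 z hz
    have h1 := (node_near hη (hu j (by omega)) (hu (j + 1) (by omega)) (hspeed j hj) hηX).2.2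
    have h2 : η * X * ‖chi η u j‖ ≤ σ * X * 2 :=
      mul_le_mul hηX' hj2 (norm_nonneg _) (by positivity)
    have h3 := norm_add_le ((node η (u j) (u (j + 1))).2 - chi η u j) (chi η u j - z)
    rw [sub_add_sub_cancel] at h3
    linarith
  have n0 := node_near hη (hu 0 (by omega)) (hu 1 (by omega)) (hspeed 0 (by omega)) hηX
  have nN := node_near hη (hu (m + 1) (by omega)) (hu (m + 2) (by omega)) (hspeed (m + 1) le_rfl) hηX
  have r0 := hconn y hy e y _ _ he n0.1 hye n0.2.1 (by simpa using hρ)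
    (hnear 0 (by omega) h0n y h0)
  have rN := hconn y' hy' _ _ e' y' nN.1 he' nN.2.1 hye'
    (hnear (m + 1) le_rfl hNn y' hN) (by simpa using hρ)
  -- The bill is ε/4 for each end and E + ε/2 for the spline. The halving in the profile functional
  -- turns 2 g₀ G into the potential g₀ G.
  have hreach : Reach (fun x => 2 * g₀ * G x / 2) (e, y) (e', y') (ENNReal.ofReal (E + ε)) := by
    have h1 := (r0.trans hchain).trans rN
    have hV2 : (fun x => 2 * g₀ * G x / 2) = fun x => g₀ * G x := by funext x; ring
    rw [hV2]
    refine Reach.mono h1 ?_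
    have hs0 : 0 ≤ ∑ j ∈ Finset.range (m + 1), C j :=
      Finset.sum_nonneg fun j hj => hC0 j (Finset.mem_range.1 hj)
    rw [← ENNReal.ofReal_add (by positivity) hs0, ← ENNReal.ofReal_add (by positivity)
      (by positivity)]
    exact ENNReal.ofReal_le_ofReal (by linarith)
  have hE0 : 0 ≤ E := by rw [hE]; exact Finset.sum_nonneg fun t _ => site_nonneg hη hV u t
  have := transitionCost_le_of_reach (F := fun x => 2 * g₀ * G x) (hG.unit y hy) (hG.unit y' hy')
    (by simp [hG.eq_zero hy]) (by simp [hG.eq_zero hy']) hreach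
  have := ENNReal.toReal_le_of_le_ofReal (by linarith) this
  linarith

/-- A transition between two wells costs at least the optimal profile energy. -/
lemma IsPenalty.exists_transition_lower (hG : IsPenalty Q G) {g₀ : ℝ} (hg₀ : 0 < g₀) {ε : ℝ}
    (hε : 0 < ε) :
    ∃ r > 0, ∃ τ > 0, ∀ η, 0 < η → η ≤ τ → ∀ g, |g - g₀| ≤ τ → ∀ (u : ℕ → E3) (N : ℕ),
      (∀ i ≤ N + 1, ‖u i‖ = 1) → ∀ y ∈ Q, ∀ y' ∈ Q, ‖chi η u 0 - y‖ < r → ‖chi η u N - y'‖ < r →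
      (transitionCost (fun x => 2 * g₀ * G x) y y').toReal - ε ≤
        ∑ i ∈ Finset.range N, site η (fun x => g * G x) u i := by
  classical
  obtain ⟨d, hd, hd1, hsep⟩ := hG.exists_separation
  -- There is at most one leg per well, so an error ε' on each leg adds up to at most ε.
  obtain ⟨ε', hε'⟩ : ∃ ε', ε' = ε / (hG.finite.toFinset.card + 1) := ⟨_, rfl⟩
  have hε'0 : 0 < ε' := by rw [hε']; positivity
  obtain ⟨r, hr, hrd, τ, hτ, h⟩ := hG.exists_leg_lower hg₀ hε'0 (half_pos hd)
  have hsep' : ∀ y ∈ Q, ∀ y' ∈ Q, ∀ x : E3, ‖x - y‖ < r → ‖x - y'‖ < r → y = y' := by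
    intro y hy y' hy' x h1 h2
    by_contra hne
    have h3 := hsep y hy y' hy' hne
    have h4 := norm_sub_le (x - y') (x - y)
    rw [sub_sub_sub_cancel_left] at h4
    linarith
  have hfin : ∀ y ∈ Q, ∀ y' ∈ Q, transitionCost (fun x => 2 * g₀ * G x) y y' ≠ ⊤ :=
    fun y hy y' hy' => ((hG.transitionCost_lt_top _ hy hy').trans_lt ENNReal.ofReal_lt_top).ne
  have hsm : ∀ y ∈ Q, SmallNear (fun x => 2 * g₀ * G x / 2) y := fun y hy => by
    have := hG.smallNear (g := g₀) hy
    have hV2 : (fun x => 2 * g₀ * G x / 2) = fun x => g₀ * G x := by funext x; ring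
    rwa [hV2]
  have hz : ∀ y ∈ Q, 2 * g₀ * G y = 0 := fun y hy => by simp [hG.eq_zero hy]
  refine ⟨r, hr, min τ (g₀ / 2), by positivity, fun η hη hητ g hg u N hu y hy y' hy' h0 hN => ?_⟩
  have hg0 : 0 < g := by have := (abs_le.1 (hg.trans (min_le_right _ _))).1; linarith
  have := le_sum_site_of_legs (Q := hG.finite.toFinset) (r := r) (ε := ε')
    (V := fun x => g * G x)
    (H := fun y y' => (transitionCost (fun x => 2 * g₀ * G x) y y').toReal) hη
    (fun x => mul_nonneg hg0.le (hG.nonneg x)) hε'0.le ?_ ?_ (by simpa using hsep') ?_ hu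
    (hG.finite.mem_toFinset.2 hy) (hG.finite.mem_toFinset.2 hy') h0 hN
  · have h5 : (hG.finite.toFinset.card : ℝ) * ε' ≤ ε := by
      rw [hε', ← mul_div_assoc, div_le_iff₀ (by positivity)]; linarith
    linarith
  · intro y hy
    rw [hG.finite.mem_toFinset] at hy
    rw [transitionCost_self (hG.unit y hy) (hz y hy), ENNReal.toReal_zero]
  · intro a ha b hb c hc
    rw [hG.finite.mem_toFinset] at ha hb hc
    rw [← ENNReal.toReal_add (hfin a ha b hb) (hfin b hb c hc)]
    exact ENNReal.toReal_mono (ENNReal.add_ne_top.2 ⟨hfin a ha b hb, hfin b hb c hc⟩)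
      (transitionCost_triangle (hG.unit a ha) (hG.unit b hb) (hG.unit c hc) (hz a ha) (hz c hc)
        (hsm a ha) (hsm b hb) (hsm c hc))
  · intro u N hu y hy y' hy' hne h0 hN hout
    rw [hG.finite.mem_toFinset] at hy hy'
    obtain ⟨m, rfl⟩ : ∃ m, N = m + 1 := by
      cases N with
      | zero => exact (hne (hsep' y hy y' hy' _ h0 hN)).elim
      | succ m => exact ⟨m, rfl⟩
    exact h η hη (hητ.trans (min_le_left _ _)) g (hg.trans (min_le_left _ _)) u m hu y hy y' hy' h0
      hN (by simpa using hout)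

/-! ### Step functions and their jumps. -/

/-- `z` equals the constant `y j ∈ Q` on the `j`-th interval of the partition
`0 = s 0 < s 1 < … < s (m + 1) = 1`, and consecutive values differ. -/
structure IsStep (Q : Set E3) (z : ℝ → E3) (m : ℕ) (s : ℕ → ℝ) (y : ℕ → E3) : Prop where
  zero : s 0 = 0
  one : s (m + 1) = 1
  lt : ∀ j ≤ m, s j < s (j + 1)
  mem : ∀ j, y j ∈ Q
  eq : ∀ j ≤ m, ∀ᵐ t ∂volI, t ∈ Ioo (s j) (s (j + 1)) → z t = y j
  ne : ∀ j < m, y j ≠ y (j + 1)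

/-- The index map that leaves out `k`. -/
def skip (k i : ℕ) : ℕ := if i < k then i else i + 1

lemma skip_lt {k i : ℕ} (h : i < k) : skip k i = i := if_pos h
lemma skip_ge {k i : ℕ} (h : k ≤ i) : skip k i = i + 1 := if_neg (by omega)

/-- Removing redundant intervals from a partition. -/
lemma exists_isStep_of_partition {Q : Set E3} {z : ℝ → E3} {m : ℕ} {s : ℕ → ℝ} {y : ℕ → E3}
    (h0 : s 0 = 0) (h1 : s (m + 1) = 1) (hle : ∀ j ≤ m, s j ≤ s (j + 1)) (hQ : ∀ j, y j ∈ Q)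
    (heq : ∀ j ≤ m, ∀ᵐ t ∂volI, t ∈ Ioo (s j) (s (j + 1)) → z t = y j) :
    ∃ m s y, IsStep Q z m s y := by
  induction m using Nat.strong_induction_on generalizing s y with
  | _ m ih =>
    by_cases hgood : (∀ j ≤ m, s j < s (j + 1)) ∧ ∀ j < m, y j ≠ y (j + 1)
    · exact ⟨m, s, y, h0, h1, hgood.1, hQ, heq, hgood.2⟩
    have hbad : (∃ j < m, s j = s (j + 1) ∨ y j = y (j + 1)) ∨ s m = s (m + 1) := by
      by_contra! hcon
      refine hgood ⟨fun j hj => ?_, fun j hj => (hcon.1 j hj).2⟩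
      rcases hj.lt_or_eq with h | rfl
      · exact (hle j hj).lt_of_ne (hcon.1 j h).1
      · exact (hle j hj).lt_of_ne hcon.2
    rcases hbad with ⟨j, hj, hor⟩ | hm
    · obtain ⟨m, rfl⟩ : ∃ k, m = k + 1 := ⟨m - 1, by omega⟩
      -- The breakpoint s (j+1) and the value y j are dropped. Either the j-th interval is empty, or
      -- y j = y (j+1); in both cases the merged interval carries the value y (j+1).
      refine ih m (by omega) (s := fun i => s (skip (j + 1) i)) (y := fun i => y (skip j i)) ?_ ?_
        ?_ (fun i => hQ _) ?_
      · simpa [skip_lt] using h0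
      · simp only [skip_ge (show j + 1 ≤ m + 1 by omega)]; exact h1
      · intro i hi
        rcases lt_trichotomy i j with h | rfl | h
        · simp only [skip_lt (show i < j + 1 by omega), skip_lt (show i + 1 < j + 1 by omega)]
          exact hle i (by omega)
        · simp only [skip_lt (show i < i + 1 by omega), skip_ge (show i + 1 ≤ i + 1 by omega)]
          exact (hle i (by omega)).trans (hle (i + 1) (by omega))
        · simp only [skip_ge (show j + 1 ≤ i by omega), skip_ge (show j + 1 ≤ i + 1 by omega)]
          exact hle (i + 1) (by omega)
      · intro i hi
        rcases lt_trichotomy i j with h | rfl | h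
        · simp only [skip_lt (show i < j + 1 by omega), skip_lt (show i + 1 < j + 1 by omega),
            skip_lt h]
          exact heq i (by omega)
        · simp only [skip_lt (show i < i + 1 by omega), skip_ge (show i + 1 ≤ i + 1 by omega),
            skip_ge (le_refl i)]
          have hne : ∀ᵐ t ∂volI, t ≠ s (i + 1) := by
            refine ae_restrict_of_ae ?_
            simp [ae_iff]
          filter_upwards [heq i (by omega), heq (i + 1) (by omega), hne] with t h2 h3 h4 h5
          rcases lt_or_gt_of_ne h4 with h6 | h6
          · rcases hor with h7 | h7
            · exact (h5.1.not_gt (h7 ▸ h6)).elim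
            · rw [← h7]; exact h2 ⟨h5.1, h6⟩
          · exact h3 ⟨h6, h5.2⟩
        · simp only [skip_ge (show j + 1 ≤ i by omega), skip_ge (show j + 1 ≤ i + 1 by omega),
            skip_ge h.le]
          exact heq (i + 1) (by omega)
    · obtain ⟨m, rfl⟩ : ∃ k, m = k + 1 := by
        cases m with
        | zero => rw [h0, h1] at hm; norm_num at hm
        | succ k => exact ⟨k, rfl⟩
      refine ih m (by omega) (s := s) (y := y) h0 (hm.trans h1) (fun j hj => hle j (by omega)) hQ
        fun j hj => heq j (by omega)

/-- A function with a bounded number of switches is a step function. -/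
lemma exists_isStep {Q : Set E3} {z : ℝ → E3} {D : Set ℝ} (hD : ∀ᵐ t ∂volI, t ∈ D)
    (hz : ∀ t ∈ D, z t ∈ Q) {K : ℕ} (hK : ∀ (n : ℕ) (c : ℕ → ℝ), (∀ k < n, c k ≤ c (k + 1)) →
      (∀ k ≤ n, c k ∈ D) → (∀ k < n, z (c k) ≠ z (c (k + 1))) → n ≤ K) :
    ∃ m s y, IsStep Q z m s y := by
  classical
  -- The supremum κ t of this set is the largest number of switches that `z` can make on D up to
  -- time t. It is monotone, at most K, and `z` is constant on its level sets in D, because a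
  -- further change of value would increase κ.
  obtain ⟨P, hP⟩ : ∃ P : ℝ → Set ℕ, P = fun t => {n | ∃ c : ℕ → ℝ, (∀ k < n, c k ≤ c (k + 1)) ∧
    (∀ k ≤ n, c k ∈ D ∧ c k ≤ t) ∧ ∀ k < n, z (c k) ≠ z (c (k + 1))} := ⟨_, rfl⟩
  have hPmem : ∀ t n, n ∈ P t ↔ ∃ c : ℕ → ℝ, (∀ k < n, c k ≤ c (k + 1)) ∧
    (∀ k ≤ n, c k ∈ D ∧ c k ≤ t) ∧ ∀ k < n, z (c k) ≠ z (c (k + 1)) := by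
    intro t n; rw [hP]; rfl
  have hPK : ∀ t n, n ∈ P t → n ≤ K := by
    intro t n h
    obtain ⟨c, h1, h2, h3⟩ := (hPmem t n).1 h
    exact hK n c h1 (fun k hk => (h2 k hk).1) h3
  have hbdd : ∀ t, BddAbove (P t) := fun t => ⟨K, fun n hn => hPK t n hn⟩
  obtain ⟨κ, hκ⟩ : ∃ κ : ℝ → ℕ, κ = fun t => sSup (P t) := ⟨_, rfl⟩
  have hκle : ∀ t n, n ∈ P t → n ≤ κ t := fun t n h => by rw [hκ]; exact le_csSup (hbdd t) h
  have hκK : ∀ t, κ t ≤ K := fun t => by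
    rw [hκ]
    rcases (P t).eq_empty_or_nonempty with h | h
    · simp [h]
    · exact csSup_le h (hPK t)
  have hmono : Monotone κ := fun a b hab => by
    rcases (P a).eq_empty_or_nonempty with h | h
    · rw [hκ]; simp [h]
    · refine hκle b _ ?_
      have := Nat.sSup_mem h (hbdd a)
      rw [hκ]
      obtain ⟨c, h1, h2, h3⟩ := (hPmem a _).1 this
      exact (hPmem b _).2 ⟨c, h1, fun k hk => ⟨(h2 k hk).1, (h2 k hk).2.trans hab⟩, h3⟩
  have hext : ∀ (n : ℕ) (c : ℕ → ℝ) (b : ℝ), (∀ k < n, c k ≤ c (k + 1)) →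
      (∀ k ≤ n, c k ∈ D ∧ c k ≤ b) → (∀ k < n, z (c k) ≠ z (c (k + 1))) → b ∈ D →
      z (c n) ≠ z b → n + 1 ∈ P b := by
    intro n c b h1 h2 h3 hb hne
    refine (hPmem b _).2 ⟨fun k => if k ≤ n then c k else b, fun k hk => ?_, fun k hk => ?_,
      fun k hk => ?_⟩
    · rcases (Nat.lt_succ_iff.1 hk).lt_or_eq with h | rfl
      · simp only [if_pos h.le, if_pos (Nat.succ_le_of_lt h)]; exact h1 k h
      · simp only [le_refl, if_true, if_neg (show ¬ k + 1 ≤ k by omega)]; exact (h2 k le_rfl).2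
    · simp only
      split_ifs with h
      · exact h2 k h
      · exact ⟨hb, le_rfl⟩
    · rcases (Nat.lt_succ_iff.1 hk).lt_or_eq with h | rfl
      · simp only [if_pos h.le, if_pos (Nat.succ_le_of_lt h)]; exact h3 k h
      · simp only [le_refl, if_true, if_neg (show ¬ k + 1 ≤ k by omega)]; exact hne
  have hconst : ∀ a ∈ D, ∀ b ∈ D, a ≤ b → κ a = κ b → z a = z b := by
    intro a ha b hb hab hk
    by_contra hne
    have hne' : (P a).Nonempty := ⟨0, (hPmem a 0).2 ⟨fun _ => a, by simp, fun k _ => ⟨ha, le_rfl⟩,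
      by simp⟩⟩
    have hmem := Nat.sSup_mem hne' (hbdd a)
    have hka : sSup (P a) = κ a := by rw [hκ]
    rw [hka] at hmem
    obtain ⟨c, h1, h2, h3⟩ := (hPmem a _).1 hmem
    by_cases hcb : z (c (κ a)) = z b
    · have := hκle a _ (hext _ c a h1 h2 h3 ha (by rw [hcb]; exact Ne.symm hne))
      omega
    · have := hκle b _ (hext _ c b h1 (fun k hk => ⟨(h2 k hk).1, (h2 k hk).2.trans hab⟩) h3 hb hcb)
      omega
  have hDne : D.Nonempty := by
    by_contra h
    rw [not_nonempty_iff_eq_empty] at h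
    rw [h] at hD
    have h1 : volI (Ioo (0 : ℝ) 1) = 0 := 
      measure_mono_null (fun x _ hx => Set.notMem_empty x hx) (ae_iff.1 hD)
    rw [Measure.restrict_apply measurableSet_Ioo, inter_self, Real.volume_Ioo] at h1
    simp at h1
  obtain ⟨t₀, ht₀⟩ := hDne
  obtain ⟨y, hy⟩ : ∃ y : ℕ → E3, y = fun j => if h : ∃ t ∈ D, κ t = j then z h.choose else z t₀ :=
    ⟨_, rfl⟩
  have hyQ : ∀ j, y j ∈ Q := fun j => by
    rw [hy]; simp only
    split_ifs with h
    · exact hz _ h.choose_spec.1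
    · exact hz _ ht₀
  have hyz : ∀ t ∈ D, z t = y (κ t) := by
    intro t ht
    have h : ∃ t' ∈ D, κ t' = κ t := ⟨t, ht, rfl⟩
    rw [hy]; simp only
    rw [dif_pos h]
    rcases le_total t h.choose with h' | h'
    · exact hconst _ ht _ h.choose_spec.1 h' h.choose_spec.2.symm
    · exact (hconst _ h.choose_spec.1 _ ht h' h.choose_spec.2).symm
  -- The breakpoints are the suprema of {κ < j}. The point 0 is added to keep the sets nonempty;
  -- some of the resulting intervals may be empty.
  obtain ⟨A, hA⟩ : ∃ A : ℕ → Set ℝ, A = fun j => {t | t = 0 ∨ (t ∈ Icc (0 : ℝ) 1 ∧ κ t < j)} :=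
    ⟨_, rfl⟩
  have hAmem : ∀ j t, t ∈ A j ↔ t = 0 ∨ (t ∈ Icc (0 : ℝ) 1 ∧ κ t < j) := by
    intro j t; rw [hA]; rfl
  have hA1 : ∀ j t, t ∈ A j → t ≤ 1 := by
    intro j t h
    rcases (hAmem j t).1 h with rfl | h
    · exact zero_le_one
    · exact h.1.2
  have hAb : ∀ j, BddAbove (A j) := fun j => ⟨1, fun t ht => hA1 j t ht⟩
  have hA0 : ∀ j, (A j).Nonempty := fun j => ⟨0, (hAmem j 0).2 (Or.inl rfl)⟩
  refine exists_isStep_of_partition (m := K) (s := fun j => sSup (A j)) (y := y) ?_ ?_ ?_ hyQ ?_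
  · have : A 0 = {0} := by ext t; rw [hAmem]; simp
    simp [this]
  · refine le_antisymm (csSup_le (hA0 _) (hA1 _)) (le_csSup (hAb _) ?_)
    exact (hAmem _ _).2 (Or.inr ⟨⟨zero_le_one, le_rfl⟩, Nat.lt_succ_of_le (hκK 1)⟩)
  · intro j _
    refine csSup_le_csSup (hAb _) (hA0 _) fun t ht => (hAmem _ _).2 ?_
    exact ((hAmem _ _).1 ht).imp_right fun h => ⟨h.1, h.2.trans (Nat.lt_succ_self j)⟩
  · intro j _
    filter_upwards [hD, ae_restrict_mem measurableSet_Ioo] with t htD htI ht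
    rw [hyz t htD]
    congr 1
    have k1 : j ≤ κ t := by
      by_contra! hlt
      exact ht.1.not_ge (le_csSup (hAb _) ((hAmem _ _).2 (Or.inr ⟨Ioo_subset_Icc_self htI, hlt⟩)))
    obtain ⟨t', ht', htt'⟩ := exists_lt_of_lt_csSup (hA0 _) ht.2
    rcases (hAmem _ _).1 ht' with rfl | h
    · exact (htI.1.not_gt htt').elim
    · have := hmono htt'.le
      omega

section

variable {Q : Set E3} {z : ℝ → E3} {m : ℕ} {s : ℕ → ℝ} {y : ℕ → E3}

lemma IsStep.monotone (h : IsStep Q z m s y) {i j : ℕ} (hij : i ≤ j) (hj : j ≤ m + 1) :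
    s i ≤ s j := by
  induction j with
  | zero => rw [Nat.le_zero.1 hij]
  | succ j ih =>
    rcases hij.lt_or_eq with h' | rfl
    · exact (ih (by omega) (by omega)).trans (h.lt j (by omega)).le
    · exact le_rfl

lemma IsStep.strictMono (h : IsStep Q z m s y) {i j : ℕ} (hij : i < j) (hj : j ≤ m + 1) :
    s i < s j := (h.lt i (by omega)).trans_le (h.monotone hij hj)

lemma IsStep.nonneg (h : IsStep Q z m s y) {j : ℕ} (hj : j ≤ m + 1) : 0 ≤ s j := by
  rw [← h.zero]; exact h.monotone (Nat.zero_le _) hj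

lemma IsStep.le_one (h : IsStep Q z m s y) {j : ℕ} (hj : j ≤ m + 1) : s j ≤ 1 := by
  rw [← h.one]; exact h.monotone hj le_rfl

lemma IsStep.break_mem (h : IsStep Q z m s y) {j : ℕ} (hj : j < m) : s (j + 1) ∈ Ioo (0 : ℝ) 1 := by
  constructor
  · rw [← h.zero]; exact h.strictMono (by omega) (by omega)
  · rw [← h.one]; exact h.strictMono (by omega) le_rfl

lemma IsStep.exists_index (h : IsStep Q z m s y) {t : ℝ} (ht : t ∈ Ioo (0 : ℝ) 1) :
    ∃ j ≤ m, s j ≤ t ∧ t < s (j + 1) := by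
  have hex : ∃ j, t < s (j + 1) := ⟨m, by rw [h.one]; exact ht.2⟩
  classical
  refine ⟨Nat.find hex, Nat.find_min' hex (by rw [h.one]; exact ht.2), ?_, Nat.find_spec hex⟩
  rcases Nat.eq_zero_or_pos (Nat.find hex) with h0 | h0
  · rw [h0, h.zero]; exact ht.1.le
  · have := Nat.find_min hex (m := Nat.find hex - 1) (by omega)
    rwa [Nat.sub_add_cancel h0, not_lt] at this

lemma IsStep.tendsto_of_subset (h : IsStep Q z m s y) {j : ℕ} (hj : j ≤ m) {l : Filter ℝ}
    (hl : Ioo (s j) (s (j + 1)) ∈ l) : Tendsto z (l ⊓ ae volI) (𝓝 (y j)) := by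
  refine tendsto_nhds_of_eventually_eq ?_
  rw [eventually_inf]
  exact ⟨_, hl, _, h.eq j hj, fun t ht => ht.2 ht.1⟩

/-- One-sided neighbourhoods have positive measure. Without this, essential one-sided limits would
not be unique and `limUnder` would carry no information. -/
lemma neBot_nhds_inf_ae {t : ℝ} {l : Filter ℝ} (ht : t ∈ Ioo (0 : ℝ) 1)
    (hl : l = 𝓝[<] t ∨ l = 𝓝[>] t) : (l ⊓ ae volI).NeBot := by
  rw [inf_neBot_iff]
  intro U hU V hV
  obtain ⟨a, b, hab, ha, hb, hU'⟩ : ∃ a b, a < b ∧ 0 ≤ a ∧ b ≤ 1 ∧ Ioo a b ⊆ U := by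
    rcases hl with rfl | rfl
    · obtain ⟨a, ha, h⟩ := (mem_nhdsLT_iff_exists_Ioo_subset' ht.1).1 hU
      exact ⟨max a 0, t, max_lt ha ht.1, le_max_right _ _, ht.2.le,
        (Ioo_subset_Ioo_left (le_max_left _ _)).trans h⟩
    · obtain ⟨b, hb, h⟩ := (mem_nhdsGT_iff_exists_Ioo_subset' ht.2).1 hU
      exact ⟨t, min b 1, lt_min hb ht.2, ht.1.le, min_le_right _ _,
        (Ioo_subset_Ioo_right (min_le_left _ _)).trans h⟩
  by_contra hne
  rw [not_nonempty_iff_eq_empty] at hne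
  have h1 : volI (Ioo a b) = 0 := by
    refine measure_mono_null (t := Vᶜ) (fun x hx (hxV : x ∈ V) => ?_) (mem_ae_iff.1 hV)
    have : x ∈ U ∩ V := ⟨hU' hx, hxV⟩
    rw [hne] at this; exact this
  rw [Measure.restrict_apply measurableSet_Ioo, inter_eq_left.2 (Ioo_subset_Ioo ha hb),
    Real.volume_Ioo, ENNReal.ofReal_eq_zero] at h1
  linarith

end

section

variable {Q : Set E3} {z : L1} {m : ℕ} {s : ℕ → ℝ} {y : ℕ → E3}

lemma IsStep.leftLimit_eq (h : IsStep Q z m s y) {j : ℕ} (hj : j < m) :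
    leftLimit z (s (j + 1)) = y j := by
  have := neBot_nhds_inf_ae (h.break_mem hj) (Or.inl rfl)
  exact (h.tendsto_of_subset (by omega) (Ioo_mem_nhdsLT (h.lt j (by omega)))).limUnder_eq

lemma IsStep.rightLimit_eq (h : IsStep Q z m s y) {j : ℕ} (hj : j < m) :
    rightLimit z (s (j + 1)) = y (j + 1) := by
  have := neBot_nhds_inf_ae (h.break_mem hj) (Or.inr rfl)
  exact (h.tendsto_of_subset (j := j + 1) (by omega)
    (Ioo_mem_nhdsGT (h.lt (j + 1) (by omega)))).limUnder_eq

lemma IsStep.jumpSet_eq (h : IsStep Q z m s y) :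
    jumpSet z = ((Finset.range m).image fun j => s (j + 1) : Finset ℝ) := by
  ext t
  simp only [Finset.coe_image, Finset.coe_range, mem_image, mem_Iio]
  constructor
  · rintro ⟨htI, hnot⟩
    obtain ⟨j, hj, h1, h2⟩ := h.exists_index htI
    rcases h1.eq_or_lt with h3 | h3
    · cases j with
      | zero => rw [h.zero] at h3; exact absurd h3 htI.1.ne
      | succ j => exact ⟨j, by omega, h3⟩
    · exact (hnot ⟨y j, h.tendsto_of_subset hj
        (mem_nhdsWithin_of_mem_nhds (Ioo_mem_nhds h3 h2))⟩).elim
  · rintro ⟨j, hj, rfl⟩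
    refine ⟨h.break_mem hj, fun ⟨a, ha⟩ => ?_⟩
    have n1 := neBot_nhds_inf_ae (h.break_mem hj) (Or.inl rfl)
    have n2 := neBot_nhds_inf_ae (h.break_mem hj) (Or.inr rfl)
    have e1 := tendsto_nhds_unique (h.tendsto_of_subset (by omega)
      (Ioo_mem_nhdsLT (h.lt j (by omega)))) (ha.mono_left (inf_le_inf_right _
        (nhdsWithin_mono _ fun x hx => ne_of_lt hx)))
    have e2 := tendsto_nhds_unique (h.tendsto_of_subset (j := j + 1) (by omega)
      (Ioo_mem_nhdsGT (h.lt (j + 1) (by omega)))) (ha.mono_left (inf_le_inf_right _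
        (nhdsWithin_mono _ fun x hx => ne_of_gt hx)))
    exact h.ne j hj (e1.trans e2.symm)

lemma IsStep.break_injOn (h : IsStep Q z m s y) :
    InjOn (fun j => s (j + 1)) (Finset.range m : Set ℕ) := by
  intro i hi j hj hij
  simp only [Finset.coe_range, mem_Iio] at hi hj
  by_contra hne
  rcases lt_or_gt_of_ne hne with h' | h'
  · exact (h.strictMono (i := i + 1) (j := j + 1) (by omega) (by omega)).ne hij
  · exact (h.strictMono (i := j + 1) (j := i + 1) (by omega) (by omega)).ne' hij

lemma IsStep.encard_jumpSet (h : IsStep Q z m s y) : (jumpSet z).encard = m := by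
  rw [h.jumpSet_eq, Set.encard_coe_eq_coe_finsetCard, Finset.card_image_of_injOn h.break_injOn,
    Finset.card_range]

lemma IsStep.tsum_eq (h : IsStep Q z m s y) (c : E3 → E3 → ℝ≥0∞) :
    ∑' t : jumpSet z, c (leftLimit z t) (rightLimit z t) =
      ∑ j ∈ Finset.range m, c (y j) (y (j + 1)) := by
  rw [h.jumpSet_eq, Finset.tsum_subtype' ((Finset.range m).image fun j => s (j + 1))
    (fun t => c (leftLimit z t) (rightLimit z t)), Finset.sum_image h.break_injOn]
  refine Finset.sum_congr rfl fun j hj => ?_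
  rw [Finset.mem_range] at hj
  rw [h.leftLimit_eq hj, h.rightLimit_eq hj]

/-- Off the breakpoints, `z` is y ∘ κ, where κ counts the breakpoints passed. The count is monotone
and bounded, and y is 2-Lipschitz on the integers because its values are unit vectors. -/
lemma IsStep.isBV (h : IsStep Q z m s y) (hQ : ∀ x ∈ Q, ‖x‖ = 1) : IsBV z := by
  classical
  obtain ⟨κ, hκ⟩ : ∃ κ : ℝ → ℕ, κ = fun t => ((Finset.range m).filter fun j => s (j + 1) ≤ t).card :=
    ⟨_, rfl⟩
  have hmono : Monotone fun t => (κ t : ℝ) := fun a b hab => by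
    rw [hκ]
    exact Nat.cast_le.2 (Finset.card_le_card fun j hj => by
      rw [Finset.mem_filter] at hj ⊢; exact ⟨hj.1, hj.2.trans hab⟩)
  -- The floor makes y a function on ℝ, so that composition with a Lipschitz map on the range of the
  -- real-valued count applies.
  refine ⟨fun t => y ⌊(κ t : ℝ)⌋₊, ?_, ?_⟩
  · have hall : ∀ᵐ t ∂volI, ∀ j ≤ m, t ∈ Ioo (s j) (s (j + 1)) → (z : ℝ → E3) t = y j := by
      have := (ae_ball_iff (Set.to_countable (Iic m))).2 fun j (hj : j ∈ Iic m) => h.eq j hj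
      exact this
    have hne : ∀ᵐ t ∂volI, ∀ j, t ≠ s j := by
      refine ae_restrict_of_ae (ae_all_iff.2 fun j => ?_)
      simp [ae_iff]
    filter_upwards [hall, hne, ae_restrict_mem measurableSet_Ioo] with t h1 h2 htI
    obtain ⟨j, hj, h3, h4⟩ := h.exists_index htI
    rw [h1 j hj ⟨h3.lt_of_ne (h2 j).symm, h4⟩, Nat.floor_natCast]
    congr 1
    rw [hκ]
    have : ((Finset.range m).filter fun i => s (i + 1) ≤ t) = Finset.range j := by
      ext i
      rw [Finset.mem_filter, Finset.mem_range, Finset.mem_range]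
      constructor
      · rintro ⟨hi, h5⟩
        by_contra! hji
        exact (h4.trans_le (h.monotone (by omega) (by omega))).not_ge h5
      · intro hi
        exact ⟨by omega, (h.monotone (by omega) (by omega)).trans h3⟩
    simp [this]
  · have hbv : BoundedVariationOn (fun t => (κ t : ℝ)) (Ioo 0 1) := by
      have := (hmono.monotoneOn univ).locallyBoundedVariationOn 0 1 (mem_univ _) (mem_univ _)
      exact this.mono (fun t ht => ⟨mem_univ _, Ioo_subset_Icc_self ht⟩)
    have hlip : LipschitzOnWith 2 (fun x : ℝ => y ⌊x⌋₊) (Set.range fun i : ℕ => (i : ℝ)) := by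
      refine LipschitzOnWith.of_dist_le_mul ?_
      rintro _ ⟨i, rfl⟩ _ ⟨j, rfl⟩
      simp only [Nat.floor_natCast, NNReal.coe_ofNat]
      rcases eq_or_ne i j with rfl | hij
      · simp
      · have h1 : dist (y i) (y j) ≤ 2 := by
          rw [dist_eq_norm]
          refine (norm_sub_le _ _).trans ?_
          rw [hQ _ (h.mem i), hQ _ (h.mem j)]; norm_num
        have h2 : (1 : ℝ) ≤ dist (i : ℝ) j := by
          rw [Nat.dist_cast_real, Nat.dist_eq]
          have : (1 : ℤ) ≤ |(i : ℤ) - j| := Int.one_le_abs (by omega)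
          exact_mod_cast this
        linarith
    exact hlip.comp_boundedVariationOn (fun t _ => ⟨κ t, rfl⟩) hbv

/-- A function of bounded variation with values in a finite set is a step function. -/
lemma IsBV.exists_isStep (hz : IsBV z) (hQz : ∀ᵐ t ∂volI, z t ∈ Q) {d : ℝ} (hd : 0 < d)
    (hsep : ∀ y ∈ Q, ∀ y' ∈ Q, y ≠ y' → d ≤ ‖y - y'‖) : ∃ m s y, IsStep Q z m s y := by
  obtain ⟨f, hfz, hf⟩ := hz
  obtain ⟨D, hDe⟩ : ∃ D : Set ℝ, D = {t | t ∈ Ioo (0 : ℝ) 1 ∧ f t = z t ∧ z t ∈ Q} := ⟨_, rfl⟩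
  have hDm : ∀ t, t ∈ D ↔ t ∈ Ioo (0 : ℝ) 1 ∧ f t = z t ∧ z t ∈ Q := by intro t; rw [hDe]; rfl
  refine HelicalChain.exists_isStep (D := D) (K := ⌊(eVariationOn f (Ioo (0 : ℝ) 1)).toReal / d⌋₊) ?_
    (fun t ht => ((hDm t).1 ht).2.2) fun n c h1 h2 h3 => ?_
  · filter_upwards [hfz, hQz, ae_restrict_mem measurableSet_Ioo] with t k1 k2 k3
    exact (hDm t).2 ⟨k3, k1, k2⟩
  · have hmono : MonotoneOn c (Iic n) := by
      intro i hi j hj hij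
      simp only [mem_Iic] at hi hj
      clear hi
      induction j with
      | zero => rw [Nat.le_zero.1 hij]
      | succ j ih =>
        rcases hij.lt_or_eq with h' | rfl
        · exact (ih (by omega) (by omega)).trans (h1 j (by omega))
        · exact le_rfl
    have hsum := eVariationOn.sum_le_of_monotoneOn_Iic (f := f) (s := Ioo (0 : ℝ) 1) hmono
      (fun i hi => ((hDm _).1 (h2 i hi)).1)
    have hlow : (n : ℝ≥0∞) * ENNReal.ofReal d ≤ eVariationOn f (Ioo (0 : ℝ) 1) := by
      refine le_trans ?_ hsum
      calc (n : ℝ≥0∞) * ENNReal.ofReal d = ∑ _i ∈ Finset.range n, ENNReal.ofReal d := by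
            rw [Finset.sum_const, Finset.card_range, nsmul_eq_mul]
        _ ≤ _ := Finset.sum_le_sum fun i hi => by
            rw [Finset.mem_range] at hi
            have a1 := (hDm _).1 (h2 i hi.le)
            have a2 := (hDm _).1 (h2 (i + 1) hi)
            rw [edist_dist, dist_eq_norm, a1.2.1, a2.2.1]
            exact ENNReal.ofReal_le_ofReal (hsep _ a2.2.2 _ a1.2.2 (h3 i hi).symm)
    refine Nat.le_floor ?_
    rw [le_div_iff₀ hd]
    have := ENNReal.toReal_mono hf hlow
    rwa [ENNReal.toReal_mul, ENNReal.toReal_natCast, ENNReal.toReal_ofReal hd.le] at this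

end

/-! ### From the functionals to sums of site energies. -/

/-- With η² = 2δ one has √2 δ^{3/2} = η³/2. Half of the second-difference identity produces exactly
this factor, and the penalty weight becomes μ = (η³/2) η g with g = μ/(2δ²). Homogeneity lets G be
evaluated at the rescaled chirality. -/
lemma penalizedEnergy_eq {G : E3 → ℝ} {lam del mu : ℝ} (hdel : 0 < del)
    (hG : ∀ c : ℝ, 0 < c → ∀ x, G (c • x) = G x) {u : ℕ → E3}
    (hu : ∀ i ≤ lastSite lam, ‖u i‖ = 1) :
    penalizedEnergy G lam del mu u = (√2 * lam * del ^ (3 / 2 : ℝ)) *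
      ∑ i ∈ interiorSites lam, site √(2 * del) (fun x => mu / (2 * del ^ 2) * G x) u i := by
  obtain ⟨η, hη⟩ : ∃ η, η = √(2 * del) := ⟨_, rfl⟩
  have hη0 : 0 < η := by rw [hη]; positivity
  have hη2 : η ^ 2 = 2 * del := by rw [hη, Real.sq_sqrt (by positivity)]
  obtain ⟨c, hc⟩ : ∃ c, c = √2 * del ^ (3 / 2 : ℝ) := ⟨_, rfl⟩
  have hcη : 2 * c = η ^ 3 := by
    have h1 : del ^ (3 / 2 : ℝ) = del * √del := by
      rw [show (3 / 2 : ℝ) = 1 + 1 / 2 by norm_num, Real.rpow_add hdel, Real.rpow_one,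
        ← Real.sqrt_eq_rpow]
    rw [pow_succ, hη2, hη, Real.sqrt_mul (by norm_num), hc, h1]; ring
  have hcg : c * (η * (mu / (2 * del ^ 2))) = mu := by
    have : c = η ^ 3 / 2 := by linarith
    have h4 : η ^ 4 = (2 * del) ^ 2 := by rw [← hη2]; ring
    rw [this]
    calc η ^ 3 / 2 * (η * (mu / (2 * del ^ 2))) = η ^ 4 * mu / (4 * del ^ 2) := by ring
      _ = mu := by rw [h4]; field_simp; ring
  rw [penalizedEnergy, chainEnergy, ← hη]
  rw [show √2 * lam * del ^ (3 / 2 : ℝ) = lam * c by rw [hc]; ring]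
  simp only [Finset.mul_sum]
  rw [← Finset.sum_add_distrib]
  refine Finset.sum_congr rfl fun i hi => ?_
  have hi' : i + 2 ≤ lastSite lam := by
    have := Finset.mem_range.1 hi; omega
  have h1 := norm_second_difference_sq hη0 (hu i (by omega)) (hu (i + 1) (by omega)) (hu (i + 2) hi')
  rw [hη2, mul_div_cancel_left₀ _ two_ne_zero] at h1
  have h2 : G (chi η u i) = G (cross (u i) (u (i + 1))) := hG _ (inv_pos.2 hη0) _
  rw [h1, site, h2, ← hcη]
  calc 1 / 2 * (lam * (2 * c * bend η u i)) + mu * (lam * G (cross (u i) (u (i + 1))))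
      = lam * c * bend η u i + mu * (lam * G (cross (u i) (u (i + 1)))) := by ring
    _ = lam * c * bend η u i + (c * (η * (mu / (2 * del ^ 2)))) *
        (lam * G (cross (u i) (u (i + 1)))) := by rw [hcg]
    _ = _ := by ring

lemma scale_pos {lam del : ℝ} (hlam : 0 < lam) (hdel : 0 < del) :
    0 < √2 * lam * del ^ (3 / 2 : ℝ) := by positivity

lemma exists_chain_of_scaledFunctional_lt {G : E3 → ℝ} {lam del mu : ℝ} (hlam : 0 < lam)
    (hdel : 0 < del) (hG : ∀ c : ℝ, 0 < c → ∀ x, G (c • x) = G x) {z : L1} {C : ℝ≥0∞}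
    (hC : C ≠ ⊤) (h : scaledFunctional G lam del mu z < C) :
    ∃ u : ℕ → E3, (∀ i ≤ lastSite lam, ‖u i‖ = 1) ∧ (z : ℝ → E3) =ᵐ[volI] chirality lam del u ∧
      ∑ i ∈ interiorSites lam, site √(2 * del) (fun x => mu / (2 * del ^ 2) * G x) u i ≤
        C.toReal := by
  have hs := scale_pos hlam hdel
  rw [scaledFunctional, ENNReal.div_lt_iff (Or.inl (by simpa using hs)) (Or.inl ENNReal.ofReal_ne_top),
    penalizedFunctional] at h
  simp only [iInf_lt_iff] at h
  obtain ⟨u, hu, hz, h⟩ := h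
  refine ⟨u, hu.1, hz, ?_⟩
  rw [penalizedEnergy_eq hdel hG hu.1, mul_comm, ENNReal.ofReal_mul' hs.le] at h
  have h2 := lt_of_mul_lt_mul_right' h
  exact (ENNReal.ofReal_le_iff_le_toReal hC).1 h2.le

lemma scaledFunctional_le {G : E3 → ℝ} {lam del mu : ℝ} (hlam : 0 < lam)
    (hdel : 0 < del) (hG : ∀ c : ℝ, 0 < c → ∀ x, G (c • x) = G x) {z : L1} {u : ℕ → E3}
    (hu : IsSpinChain lam u) (hz : (z : ℝ → E3) =ᵐ[volI] chirality lam del u) :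
    scaledFunctional G lam del mu z ≤ ENNReal.ofReal
      (∑ i ∈ interiorSites lam, site √(2 * del) (fun x => mu / (2 * del ^ 2) * G x) u i) := by
  have hs := scale_pos hlam hdel
  rw [scaledFunctional, penalizedFunctional]
  refine ENNReal.div_le_of_le_mul ?_
  refine (iInf₂_le_of_le u hu (iInf_le _ hz)).trans ?_
  rw [penalizedEnergy_eq hdel hG hu.1, mul_comm, ENNReal.ofReal_mul' hs.le]

/-! ### Converging chains and the liminf inequality. -/

/-- Spin chains at vanishing scales whose chiralities converge almost everywhere. -/
structure IsConverging (η lam : ℕ → ℝ) (u : ℕ → ℕ → E3) (z : ℝ → E3) : Prop where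
  η_pos : ∀ n, 0 < η n
  η_tendsto : Tendsto η atTop (𝓝 0)
  lam_pos : ∀ n, 0 < lam n
  lam_tendsto : Tendsto lam atTop (𝓝 0)
  ratio : Tendsto (fun n => lam n / η n) atTop (𝓝 0)
  unit : ∀ n, ∀ i ≤ lastSite (lam n), ‖u n i‖ = 1
  conv : ∀ᵐ t ∂volI, Tendsto (fun n => chi (η n) (u n) (min ⌊t / lam n⌋₊ (lastSite (lam n) - 1)))
    atTop (𝓝 (z t))

/-- The margin 2 means that the site containing t carries an energy term and that the truncation at
the right end of I is inactive at t. -/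
lemma eventually_index {lam : ℕ → ℝ} (hpos : ∀ n, 0 < lam n) (h : Tendsto lam atTop (𝓝 0)) {t : ℝ}
    (ht : t ∈ Ioo (0 : ℝ) 1) : ∀ᶠ n in atTop, ⌊t / lam n⌋₊ + 2 ≤ lastSite (lam n) := by
  have h1 : ∀ᶠ n in atTop, lam n < (1 - t) / 2 :=
    h.eventually (gt_mem_nhds (by linarith [ht.2]))
  filter_upwards [h1] with n hn
  have hp := hpos n
  refine Nat.le_floor ?_
  push_cast
  have h2 : (⌊t / lam n⌋₊ : ℝ) ≤ t / lam n := Nat.floor_le (div_nonneg ht.1.le hp.le)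
  have h3 : t / lam n + 2 ≤ 1 / lam n := by
    rw [le_div_iff₀ hp, add_mul, div_mul_cancel₀ _ hp.ne']; linarith
  linarith

/-- The piecewise constant function with values `f i` on `[lam i, lam (i + 1))`, `i < M`. -/
def stepFn (f : ℕ → ℝ) (lam : ℝ) (M : ℕ) (t : ℝ) : ℝ≥0∞ :=
  if ⌊t / lam⌋₊ < M then ENNReal.ofReal (f ⌊t / lam⌋₊) else 0

lemma measurable_stepFn (f : ℕ → ℝ) (lam : ℝ) (M : ℕ) : Measurable (stepFn f lam M) := by
  have h1 : Measurable fun i : ℕ => if i < M then ENNReal.ofReal (f i) else 0 :=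
    Measurable.of_discrete
  have h2 : Measurable fun t : ℝ => ⌊t / lam⌋₊ := Nat.measurable_floor.comp (measurable_id.div_const lam)
  exact h1.comp h2

lemma lintegral_stepFn {f : ℕ → ℝ} {lam : ℝ} {M : ℕ} (hlam : 0 < lam) (hM : M * lam ≤ 1)
    (hf : ∀ i, 0 ≤ f i) :
    ∫⁻ t, stepFn f lam M t ∂volI = ENNReal.ofReal (lam * ∑ i ∈ Finset.range M, f i) := by
  have hvol : volI = volume.restrict (Ico (0 : ℝ) 1) := Measure.restrict_congr_set Ioo_ae_eq_Ico
  have h1 : ∀ t ∈ Ico (0 : ℝ) 1, stepFn f lam M t = ∑ i ∈ Finset.range M,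
      (Ico (i * lam) ((i + 1) * lam)).indicator (fun _ => ENNReal.ofReal (f i)) t := by
    intro t ht
    have hiff : ∀ i : ℕ, t ∈ Ico (i * lam) ((i + 1) * lam) ↔ ⌊t / lam⌋₊ = i := by
      intro i
      rw [Nat.floor_eq_iff (div_nonneg ht.1 hlam.le), le_div_iff₀ hlam, div_lt_iff₀ hlam]
      rfl
    simp only [indicator_apply, hiff]
    rw [Finset.sum_ite_eq]
    simp [stepFn]
  rw [hvol, setLIntegral_congr_fun measurableSet_Ico h1,
    lintegral_finsetSum _ fun i _ => measurable_const.indicator measurableSet_Ico,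
    Finset.mul_sum, ENNReal.ofReal_sum_of_nonneg fun i _ => mul_nonneg hlam.le (hf i)]
  refine Finset.sum_congr rfl fun i hi => ?_
  have hi' : ((i : ℝ) + 1) * lam ≤ 1 := by
    refine le_trans (mul_le_mul_of_nonneg_right ?_ hlam.le) hM
    exact_mod_cast Finset.mem_range.1 hi
  rw [lintegral_indicator_const measurableSet_Ico, Measure.restrict_apply measurableSet_Ico,
    inter_eq_left.2 (Ico_subset_Ico (by positivity) hi'), Real.volume_Ico, mul_comm,
    ← ENNReal.ofReal_mul (by rw [add_mul]; linarith)]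
  congr 1
  ring

lemma lastSite_mul_le {lam : ℝ} (hlam : 0 < lam) : ((lastSite lam - 1 : ℕ) : ℝ) * lam ≤ 1 := by
  have h1 : (lastSite lam : ℝ) ≤ 1 / lam := Nat.floor_le (by positivity)
  have h2 : ((lastSite lam - 1 : ℕ) : ℝ) ≤ lastSite lam := by exact_mod_cast Nat.sub_le _ _
  rw [le_div_iff₀ hlam] at h1
  exact (mul_le_mul_of_nonneg_right h2 hlam.le).trans h1

/-- Fatou's lemma for the piecewise constant densities. -/
lemma lintegral_liminf_stepFn_le {lam : ℕ → ℝ} (hpos : ∀ n, 0 < lam n) {f : ℕ → ℕ → ℝ}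
    (hf : ∀ n i, 0 ≤ f n i) {E : ℝ}
    (hE : ∀ᶠ n in atTop, lam n * ∑ i ∈ interiorSites (lam n), f n i ≤ E) :
    ∫⁻ t, liminf (fun n => stepFn (f n) (lam n) (lastSite (lam n) - 1) t) atTop ∂volI ≤
      ENNReal.ofReal E := by
  refine (lintegral_liminf_le fun n => measurable_stepFn _ _ _).trans ?_
  refine liminf_le_of_frequently_le' (Eventually.frequently ?_)
  filter_upwards [hE] with n hn
  rw [lintegral_stepFn (hpos n) (lastSite_mul_le (hpos n)) (hf n)]
  exact ENNReal.ofReal_le_ofReal hn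

/-- A small bending density makes the mean of the two squared speeds close to 1 and the chirality
increment at most η. Hence both squared norms of the chirality are close to their mean, which is
close to 1. -/
lemma abs_norm_chi_sq_sub_one_le {η b : ℝ} (hη : 0 < η) (hη1 : η ≤ 1 / 4) (hb : 0 < b) (hb1 : b ≤ 1)
    {u : ℕ → E3} {i : ℕ} (h0 : ‖u i‖ = 1) (h1 : ‖u (i + 1)‖ = 1) (h2 : ‖u (i + 2)‖ = 1)
    (h : bend η u i / η < b ^ 2) : |‖chi η u i‖ ^ 2 - 1| ≤ b + 8 * η := by
  rw [div_lt_iff₀ hη] at h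
  obtain ⟨x, hx⟩ : ∃ x, x = chi η u i := ⟨_, rfl⟩
  obtain ⟨s, hs⟩ : ∃ s, s = speed η u i := ⟨_, rfl⟩
  obtain ⟨s', hs'⟩ : ∃ s, s = speed η u (i + 1) := ⟨_, rfl⟩
  have hbe : bend η u i = ‖chi η u (i + 1) - x‖ ^ 2 / η +
      η * (1 - (s ^ 2 + s' ^ 2) / 2) ^ 2 := by rw [bend, hs, hs', hx]
  have hω0 : 0 ≤ ‖chi η u (i + 1) - x‖ ^ 2 / η := by positivity
  have hcase : (1 - (s ^ 2 + s' ^ 2) / 2) ^ 2 < b ^ 2 := by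
    rw [hbe] at h
    exact lt_of_mul_lt_mul_left (by linarith) hη.le
  have hab := abs_lt_of_sq_lt_sq hcase hb.le
  rw [abs_lt] at hab
  have hs2 : s ^ 2 ≤ 4 := by linarith [sq_nonneg s']
  have hs2' : s' ^ 2 ≤ 4 := by linarith [sq_nonneg s]
  have n1 : ‖x‖ ^ 2 = s ^ 2 * (1 - η ^ 2 * s ^ 2 / 4) := by rw [hx, hs]; exact norm_chi_sq hη h0 h1
  have n2 : ‖chi η u (i + 1)‖ ^ 2 = s' ^ 2 * (1 - η ^ 2 * s' ^ 2 / 4) := by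
    rw [hs']; exact norm_chi_sq hη h1 h2
  have hηη : η ^ 2 ≤ η * (1 / 4) := by rw [sq]; exact mul_le_mul_of_nonneg_left hη1 hη.le
  have e1 : η ^ 2 * (s ^ 2 * s ^ 2) ≤ η * (1 / 4) * (4 * 4) := by gcongr
  have e2 : η ^ 2 * (s' ^ 2 * s' ^ 2) ≤ η * (1 / 4) * (4 * 4) := by gcongr
  have e1' : 0 ≤ η ^ 2 * (s ^ 2 * s ^ 2) := by positivity
  have e2' : 0 ≤ η ^ 2 * (s' ^ 2 * s' ^ 2) := by positivity
  have hx2 : ‖x‖ ≤ 2 := by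
    refine (pow_le_pow_iff_left₀ (norm_nonneg _) (b := 2) (by norm_num) two_ne_zero).1 ?_
    linarith
  have hx2' : ‖chi η u (i + 1)‖ ≤ 2 := by
    refine (pow_le_pow_iff_left₀ (norm_nonneg _) (b := 2) (by norm_num) two_ne_zero).1 ?_
    linarith
  have hd : ‖chi η u (i + 1) - x‖ ≤ η := by
    refine (pow_le_pow_iff_left₀ (norm_nonneg _) hη.le two_ne_zero).1 ?_
    have h3 := norm_chi_sub_sq_le hη (u := u) (i := i)
    rw [← hx] at h3
    have h4 : η * bend η u i ≤ η * (b ^ 2 * η) := mul_le_mul_of_nonneg_left h.le hη.le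
    have h5 : b ^ 2 * η ≤ 1 * η := mul_le_mul_of_nonneg_right (pow_le_one₀ hb.le hb1) hη.le
    have h6 := mul_le_mul_of_nonneg_left h5 hη.le
    linarith
  have hdn := (abs_norm_sub_norm_le (chi η u (i + 1)) x).trans hd
  have hdn2 : |‖chi η u (i + 1)‖ ^ 2 - ‖x‖ ^ 2| ≤ η * 4 := by
    rw [sq_sub_sq, abs_mul, mul_comm]
    refine mul_le_mul hdn ?_ (abs_nonneg _) hη.le
    rw [abs_of_nonneg (by positivity)]; linarith
  rw [abs_le] at hdn2
  rw [← hx, abs_le]; constructor <;> linarith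

section

variable {η lam : ℕ → ℝ} {u : ℕ → ℕ → E3} {z : ℝ → E3}

lemma IsConverging.tendsto (h : IsConverging η lam u z) :
    ∀ᵐ t ∂volI, Tendsto (fun n => chi (η n) (u n) ⌊t / lam n⌋₊) atTop (𝓝 (z t)) := by
  filter_upwards [h.conv, ae_restrict_mem measurableSet_Ioo] with t ht htI
  refine ht.congr' ?_
  filter_upwards [eventually_index h.lam_pos h.lam_tendsto htI] with n hn
  rw [min_eq_left (by omega)]

/-- The density bend/η has integral at most (λ/η)E → 0. By Fatou its lower limit vanishes almost
everywhere, which forces |χ| → 1 there. -/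
lemma IsConverging.ae_norm_eq_one (h : IsConverging η lam u z) {E : ℝ}
    (hE : ∀ n, ∑ i ∈ interiorSites (lam n), bend (η n) (u n) i ≤ E) : ∀ᵐ t ∂volI, ‖z t‖ = 1 := by
  have hf : ∀ n i, 0 ≤ bend (η n) (u n) i / η n := fun n i =>
    div_nonneg (bend_nonneg (h.η_pos n) _ _) (h.η_pos n).le
  have hzero : ∫⁻ t, liminf (fun n => stepFn (fun i => bend (η n) (u n) i / η n) (lam n)
      (lastSite (lam n) - 1) t) atTop ∂volI = 0 := by
    refine le_antisymm ?_ zero_le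
    refine ENNReal.le_of_forall_pos_le_add fun ε hε _ => ?_
    rw [zero_add]
    have hlim : Tendsto (fun n => lam n / η n * E) atTop (𝓝 (0 * E)) := h.ratio.mul_const E
    rw [zero_mul] at hlim
    have := lintegral_liminf_stepFn_le h.lam_pos hf (E := ε) ?_
    · simpa using this
    · filter_upwards [hlim.eventually (gt_mem_nhds (NNReal.coe_pos.2 hε))] with n hn
      rw [← Finset.sum_div, ← mul_div_assoc, mul_div_right_comm]
      exact (mul_le_mul_of_nonneg_left (hE n) (div_nonneg (h.lam_pos n).le (h.η_pos n).le)).trans hn.le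
  rw [lintegral_eq_zero_iff (Measurable.liminf fun n => measurable_stepFn _ _ _)] at hzero
  filter_upwards [hzero, h.tendsto, ae_restrict_mem measurableSet_Ioo] with t h0 ht htI
  have key : ∀ b : ℝ, 0 < b → b ≤ 1 → |‖z t‖ ^ 2 - 1| ≤ b := by
    intro b hb hb1
    -- A vanishing lower limit gives smallness only along infinitely many n. That suffices, since χ
    -- at t converges along the whole sequence.
    have hfreq : ∃ᶠ n in atTop, stepFn (fun i => bend (η n) (u n) i / η n) (lam n)
        (lastSite (lam n) - 1) t < ENNReal.ofReal (b ^ 2) := by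
      refine frequently_lt_of_liminf_lt (by isBoundedDefault) ?_
      rw [h0]
      simpa using by positivity
    have hlim : Tendsto (fun n => |‖chi (η n) (u n) ⌊t / lam n⌋₊‖ ^ 2 - 1| - 8 * η n) atTop
        (𝓝 (|‖z t‖ ^ 2 - 1| - 8 * 0)) :=
      (((ht.norm.pow 2).sub_const 1).abs).sub (h.η_tendsto.const_mul 8)
    rw [mul_zero, sub_zero] at hlim
    refine le_of_tendsto_of_frequently hlim ?_
    refine (hfreq.and_eventually ((eventually_index h.lam_pos h.lam_tendsto htI).and
      (h.η_tendsto.eventually (gt_mem_nhds (show (0 : ℝ) < 1 / 4 by norm_num))))).mono ?_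
    rintro n ⟨h1, h2, h3⟩
    rw [stepFn, if_pos (by omega), ENNReal.ofReal_lt_ofReal_iff (by positivity)] at h1
    have := abs_norm_chi_sq_sub_one_le (h.η_pos n) h3.le hb hb1 (h.unit n _ (by omega))
      (h.unit n _ (by omega)) (h.unit n _ h2) h1
    linarith
  have h1 : |‖z t‖ ^ 2 - 1| ≤ 0 := by
    refine le_of_forall_pos_le_add fun ε hε => ?_
    rw [zero_add]
    exact (key (min ε 1) (by positivity) (min_le_right _ _)).trans (min_le_left _ _)
  have h2 : ‖z t‖ ^ 2 = 1 := by
    have := abs_nonpos_iff.1 h1; linarith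
  exact (pow_eq_one_iff_of_nonneg (norm_nonneg _) two_ne_zero).1 h2

/-- Fatou again. G is evaluated near unit vectors only, where it is continuous, so the densities
converge pointwise. -/
lemma IsConverging.lintegral_le (h : IsConverging η lam u z) {G : E3 → ℝ} (hG0 : ∀ x, 0 ≤ G x)
    (hGc : ContinuousOn G {0}ᶜ) (hz : ∀ᵐ t ∂volI, ‖z t‖ = 1) {p : ℕ → ℝ} {p₀ E : ℝ}
    (hp0 : ∀ n, 0 ≤ p n) (hp : Tendsto p atTop (𝓝 p₀))
    (hE : ∀ᶠ n in atTop, p n * (lam n * ∑ i ∈ interiorSites (lam n), G (chi (η n) (u n) i)) ≤ E) :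
    ENNReal.ofReal p₀ * ∫⁻ t, ENNReal.ofReal (G (z t)) ∂volI ≤ ENNReal.ofReal E := by
  have h1 := lintegral_liminf_stepFn_le h.lam_pos (f := fun n i => p n * G (chi (η n) (u n) i))
    (fun n i => mul_nonneg (hp0 n) (hG0 _)) (E := E) (by
      filter_upwards [hE] with n hn
      rw [← Finset.mul_sum]
      linarith)
  have hp₀ : 0 ≤ p₀ := ge_of_tendsto' hp hp0
  rw [← lintegral_const_mul' _ _ ENNReal.ofReal_ne_top]
  refine le_trans (lintegral_mono_ae ?_) h1
  filter_upwards [h.tendsto, hz, ae_restrict_mem measurableSet_Ioo] with t ht hzt htI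
  have hz0 : z t ≠ 0 := by rw [← norm_pos_iff, hzt]; exact one_pos
  have hc : ContinuousAt G (z t) := hGc.continuousAt (isOpen_compl_singleton.mem_nhds hz0)
  have hlim : Tendsto (fun n => ENNReal.ofReal (p n * G (chi (η n) (u n) ⌊t / lam n⌋₊))) atTop
      (𝓝 (ENNReal.ofReal (p₀ * G (z t)))) :=
    ENNReal.tendsto_ofReal (hp.mul (hc.tendsto.comp ht))
  have hlim2 := hlim.congr' (f₂ := fun n => stepFn (fun i => p n * G (chi (η n) (u n) i)) (lam n)
    (lastSite (lam n) - 1) t) (by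
      filter_upwards [eventually_index h.lam_pos h.lam_tendsto htI] with n hn
      rw [stepFn, if_pos (by omega)])
  rw [hlim2.liminf_eq, ENNReal.ofReal_mul hp₀]

/-- `H y y'` bounds the energy of all transitions from `y` to `y'` from below in the limit. -/
def LowerBound (Q : Set E3) (η : ℕ → ℝ) (V : ℕ → E3 → ℝ) (H : E3 → E3 → ℝ) : Prop :=
  ∀ ε > 0, ∃ r > 0, ∀ᶠ n in atTop, ∀ (u : ℕ → E3) (N : ℕ), (∀ i ≤ N + 1, ‖u i‖ = 1) →
    ∀ y ∈ Q, ∀ y' ∈ Q, ‖chi (η n) u 0 - y‖ < r → ‖chi (η n) u N - y'‖ < r →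
      H y y' - ε ≤ ∑ i ∈ Finset.range N, site (η n) (V n) u i

/-- The sites between ⌊c k/λ⌋ and ⌊c (k+1)/λ⌋ form disjoint windows for different k, and the
chiralities at the window ends are close to the wells z (c k). Each window pays for its own
transition, with error ε/(m+1). -/
lemma IsConverging.sum_le (h : IsConverging η lam u z) {Q : Set E3} {V : ℕ → E3 → ℝ}
    {H : E3 → E3 → ℝ} (hH : LowerBound Q η V H) (hV : ∀ n x, 0 ≤ V n x) {E : ℝ}
    (hE : ∀ n, ∑ i ∈ interiorSites (lam n), site (η n) (V n) (u n) i ≤ E) {m : ℕ} {c : ℕ → ℝ}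
    (hc : ∀ k < m, c k ≤ c (k + 1)) (hcI : ∀ k ≤ m, c k ∈ Ioo (0 : ℝ) 1)
    (hcQ : ∀ k ≤ m, z (c k) ∈ Q)
    (hct : ∀ k ≤ m, Tendsto (fun n => chi (η n) (u n) ⌊c k / lam n⌋₊) atTop (𝓝 (z (c k)))) :
    ∑ k ∈ Finset.range m, H (z (c k)) (z (c (k + 1))) ≤ E := by
  refine le_of_forall_pos_le_add fun ε hε => ?_
  obtain ⟨r, hr, hev⟩ := hH (ε / (m + 1)) (by positivity)
  have h1 : ∀ᶠ n in atTop, ∀ k ∈ Finset.range (m + 1),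
      ‖chi (η n) (u n) ⌊c k / lam n⌋₊ - z (c k)‖ < r := by
    refine (Finset.eventually_all _).2 fun k hk => ?_
    have := (Metric.tendsto_nhds.1 (hct k (by have := Finset.mem_range.1 hk; omega))) r hr
    simpa [dist_eq_norm] using this
  obtain ⟨n, hn1, hn2, hn3⟩ := (hev.and (h1.and
    (eventually_index h.lam_pos h.lam_tendsto (hcI m le_rfl)))).exists
  have hmono : ∀ k < m, ⌊c k / lam n⌋₊ ≤ ⌊c (k + 1) / lam n⌋₊ := fun k hk =>
    Nat.floor_le_floor (div_le_div_of_nonneg_right (hc k hk) (h.lam_pos n).le)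
  have hall : ∀ k ≤ m, ⌊c k / lam n⌋₊ + 2 ≤ lastSite (lam n) := by
    intro k hk
    refine le_trans (Nat.add_le_add_right ?_ 2) hn3
    induction hk using Nat.decreasingInduction with
    | of_succ j hj ih => exact (hmono j hj).trans ih
    | self => exact le_rfl
  have key : ∀ k ≤ m, ∑ j ∈ Finset.range k, H (z (c j)) (z (c (j + 1))) - k * (ε / (m + 1)) ≤
      ∑ i ∈ Finset.range ⌊c k / lam n⌋₊, site (η n) (V n) (u n) i := by
    intro k
    induction k with
    | zero =>
      intro _
      simpa using Finset.sum_nonneg fun i _ => site_nonneg (h.η_pos n) (hV n) (u n) i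
    | succ k ih =>
      intro hk
      obtain ⟨a, ha⟩ := Nat.exists_eq_add_of_le (hmono k hk)
      have hb := hall (k + 1) hk
      have h5 := hn1 (fun t => u n (⌊c k / lam n⌋₊ + t)) a (fun i hi => h.unit n _ (by omega))
        (z (c k)) (hcQ k (by omega)) (z (c (k + 1))) (hcQ (k + 1) hk)
        (hn2 k (Finset.mem_range.2 (by omega))) (by
          have := hn2 (k + 1) (Finset.mem_range.2 (by omega))
          rw [ha] at this
          exact this)
      have h6 := ih (by omega)
      rw [Finset.sum_range_succ, ha, Finset.sum_range_add]
      have e1 : ∑ i ∈ Finset.range a, site (η n) (V n) (fun t => u n (⌊c k / lam n⌋₊ + t)) i =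
        ∑ i ∈ Finset.range a, site (η n) (V n) (u n) (⌊c k / lam n⌋₊ + i) := rfl
      rw [e1] at h5
      push_cast
      linarith
  have h7 := key m le_rfl
  have h8 : ∑ i ∈ Finset.range ⌊c m / lam n⌋₊, site (η n) (V n) (u n) i ≤ E := by
    refine le_trans (Finset.sum_le_sum_of_subset_of_nonneg (fun i hi => ?_)
      fun i _ _ => site_nonneg (h.η_pos n) (hV n) (u n) i) (hE n)
    rw [interiorSites, Finset.mem_range]
    have := Finset.mem_range.1 hi
    have := hall m le_rfl
    omega
  have h9 : (m : ℝ) * (ε / (m + 1)) ≤ ε := by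
    rw [← mul_div_assoc, div_le_iff₀ (by positivity)]; linarith
  linarith

/-- If transitions between different wells cost at least `c > 0`, the limit is a step function. -/
lemma IsConverging.exists_isStep (h : IsConverging η lam u z) {Q : Set E3} {V : ℕ → E3 → ℝ} {c : ℝ}
    (hc : 0 < c) {H : E3 → E3 → ℝ} (hH : LowerBound Q η V H)
    (hHc : ∀ y ∈ Q, ∀ y' ∈ Q, y ≠ y' → c ≤ H y y') (hV : ∀ n x, 0 ≤ V n x)
    {E : ℝ} (hE : ∀ n, ∑ i ∈ interiorSites (lam n), site (η n) (V n) (u n) i ≤ E)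
    (hzQ : ∀ᵐ t ∂volI, z t ∈ Q) : ∃ m s y, IsStep Q z m s y := by
  obtain ⟨D, hDe⟩ : ∃ D : Set ℝ, D = {t | t ∈ Ioo (0 : ℝ) 1 ∧ z t ∈ Q ∧
    Tendsto (fun n => chi (η n) (u n) ⌊t / lam n⌋₊) atTop (𝓝 (z t))} := ⟨_, rfl⟩
  have hDm : ∀ t, t ∈ D ↔ t ∈ Ioo (0 : ℝ) 1 ∧ z t ∈ Q ∧
    Tendsto (fun n => chi (η n) (u n) ⌊t / lam n⌋₊) atTop (𝓝 (z t)) := by intro t; rw [hDe]; rfl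
  refine HelicalChain.exists_isStep (D := D) (K := ⌊E / c⌋₊) ?_ (fun t ht => ((hDm t).1 ht).2.1) ?_
  · filter_upwards [hzQ, h.tendsto, ae_restrict_mem measurableSet_Ioo] with t h1 h2 h3
    exact (hDm t).2 ⟨h3, h1, h2⟩
  · intro n t h1 h2 h3
    have hle := h.sum_le hH hV hE h1 (fun k hk => ((hDm _).1 (h2 k hk)).1)
      (fun k hk => ((hDm _).1 (h2 k hk)).2.1) fun k hk => ((hDm _).1 (h2 k hk)).2.2
    refine Nat.le_floor ?_
    rw [le_div_iff₀ hc]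
    refine le_trans ?_ hle
    calc (n : ℝ) * c = ∑ _k ∈ Finset.range n, c := by
          rw [Finset.sum_const, Finset.card_range, nsmul_eq_mul]
      _ ≤ _ := Finset.sum_le_sum fun k hk => by
          have hk' := Finset.mem_range.1 hk
          exact hHc _ ((hDm _).1 (h2 k hk'.le)).2.1 _ ((hDm _).1 (h2 (k + 1) hk')).2.1 (h3 k hk')

/-- Every interval of the partition has positive measure, so it contains a point at which the
chiralities converge and `z` has the right value; these are the test points. -/
lemma IsConverging.sum_le_of_isStep (h : IsConverging η lam u z) {Q : Set E3} {V : ℕ → E3 → ℝ}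
    {H : E3 → E3 → ℝ} (hH : LowerBound Q η V H) (hV : ∀ n x, 0 ≤ V n x)
    {E : ℝ} (hE : ∀ n, ∑ i ∈ interiorSites (lam n), site (η n) (V n) (u n) i ≤ E)
    {m : ℕ} {s : ℕ → ℝ} {y : ℕ → E3} (hs : IsStep Q z m s y) :
    ∑ k ∈ Finset.range m, H (y k) (y (k + 1)) ≤ E := by
  have hex : ∀ k, ∃ t, k ≤ m → t ∈ Ioo (s k) (s (k + 1)) ∧ z t = y k ∧
      Tendsto (fun n => chi (η n) (u n) ⌊t / lam n⌋₊) atTop (𝓝 (z t)) := by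
    intro k
    by_cases hk : k ≤ m
    · have hsub : Ioo (s k) (s (k + 1)) ⊆ Ioo (0 : ℝ) 1 :=
        Ioo_subset_Ioo (hs.nonneg (by omega)) (hs.le_one (by omega))
      by_contra! hcon
      have h1 : ∀ᵐ t ∂volI, t ∉ Ioo (s k) (s (k + 1)) := by
        filter_upwards [hs.eq k hk, h.tendsto] with t h2 h3 h4
        exact (hcon t).2 h4 (h2 h4) h3
      have h2 : volI (Ioo (s k) (s (k + 1))) = 0 := by
        have := ae_iff.1 h1
        refine measure_mono_null (fun x hx => ?_) this
        simpa using hx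
      rw [Measure.restrict_apply measurableSet_Ioo, inter_eq_left.2 hsub, Real.volume_Ioo,
        ENNReal.ofReal_eq_zero] at h2
      linarith [hs.lt k hk]
    · exact ⟨0, fun h => absurd h hk⟩
  choose c hc using hex
  have hle := h.sum_le hH hV hE (m := m) (c := c)
    (fun k hk => ((hc k hk.le).1.2.trans (hc (k + 1) hk).1.1).le)
    (fun k hk => Ioo_subset_Ioo (hs.nonneg (by omega)) (hs.le_one (by omega)) (hc k hk).1)
    (fun k hk => by rw [(hc k hk).2.1]; exact hs.mem k) fun k hk => (hc k hk).2.2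
  refine le_trans (le_of_eq (Finset.sum_congr rfl fun k hk => ?_)) hle
  have hk' := Finset.mem_range.1 hk
  rw [(hc k hk'.le).2.1, (hc (k + 1) hk').2.1]

end

section

variable {η lam g : ℕ → ℝ} {u : ℕ → ℕ → E3} {z : ℝ → E3} {G : E3 → ℝ} {E : ℝ}

lemma IsConverging.ae_norm_eq_one_of_site (h : IsConverging η lam u z) (hG0 : ∀ x, 0 ≤ G x)
    (hg : ∀ n, 0 ≤ g n)
    (hE : ∀ n, ∑ i ∈ interiorSites (lam n), site (η n) (fun x => g n * G x) (u n) i ≤ E) :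
    ∀ᵐ t ∂volI, ‖z t‖ = 1 :=
  h.ae_norm_eq_one fun n => (Finset.sum_le_sum fun i _ =>
    bend_le_site (h.η_pos n) (fun x => mul_nonneg (hg n) (hG0 x)) (u n) i).trans (hE n)

lemma IsConverging.sum_penalty_le (h : IsConverging η lam u z)
    (hE : ∀ n, ∑ i ∈ interiorSites (lam n), site (η n) (fun x => g n * G x) (u n) i ≤ E) (n : ℕ) :
    η n * g n / lam n * (lam n * ∑ i ∈ interiorSites (lam n), G (chi (η n) (u n) i)) ≤ E := by
  refine le_trans ?_ (hE n)
  rw [← mul_assoc, div_mul_cancel₀ _ (h.lam_pos n).ne', Finset.mul_sum]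
  refine Finset.sum_le_sum fun i _ => ?_
  rw [site]
  linarith [bend_nonneg (h.η_pos n) (u n) i]

lemma IsConverging.limitBulk_le {z : L1} (h : IsConverging η lam u z) (hG0 : ∀ x, 0 ≤ G x)
    (hGc : ContinuousOn G {0}ᶜ) (hg : ∀ n, 0 ≤ g n)
    (hE : ∀ n, ∑ i ∈ interiorSites (lam n), site (η n) (fun x => g n * G x) (u n) i ≤ E) {p₀ : ℝ}
    (hp : Tendsto (fun n => η n * g n / lam n) atTop (𝓝 p₀)) :
    limitBulk G p₀ z ≤ ENNReal.ofReal E := by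
  have h1 := h.ae_norm_eq_one_of_site hG0 hg hE
  rw [limitBulk, if_pos h1]
  exact h.lintegral_le hG0 hGc h1
    (fun n => div_nonneg (mul_nonneg (h.η_pos n).le (hg n)) (h.lam_pos n).le) hp
    (Eventually.of_forall (h.sum_penalty_le hE))

/-- The prefactor of the penalty eventually exceeds any M, so M ∫ G(z) ≤ E for all M. Hence G(z) = 0
almost everywhere, and |z| = 1 selects the wells on the lines. -/
lemma IsConverging.ae_mem {Q : Set E3} (hQ : IsPenalty Q G) {z : L1}
    (h : IsConverging η lam u z) (hg : ∀ n, 0 ≤ g n)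
    (hE : ∀ n, ∑ i ∈ interiorSites (lam n), site (η n) (fun x => g n * G x) (u n) i ≤ E)
    (hp : Tendsto (fun n => η n * g n / lam n) atTop atTop) : ∀ᵐ t ∂volI, z t ∈ Q := by
  have h1 := h.ae_norm_eq_one_of_site hQ.nonneg hg hE
  have hle : ∀ M : ℕ, (M : ℝ≥0∞) * ∫⁻ t, ENNReal.ofReal (G (z t)) ∂volI ≤ ENNReal.ofReal E := by
    intro M
    have := h.lintegral_le hQ.nonneg hQ.cont h1 (p := fun _ => (M : ℝ)) (p₀ := M) (E := E)
      (fun _ => Nat.cast_nonneg M) tendsto_const_nhds (by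
        filter_upwards [hp.eventually_ge_atTop (M : ℝ)] with n hn
        refine le_trans (mul_le_mul_of_nonneg_right hn (mul_nonneg (h.lam_pos n).le
          (Finset.sum_nonneg fun i _ => hQ.nonneg _))) (h.sum_penalty_le hE n))
    rwa [ENNReal.ofReal_natCast] at this
  have hzero : ∫⁻ t, ENNReal.ofReal (G (z t)) ∂volI = 0 := by
    by_contra hne
    obtain ⟨M, hM⟩ := ENNReal.exists_nat_mul_gt hne (b := ENNReal.ofReal E) ENNReal.ofReal_ne_top
    exact (hle M).not_gt hM
  have hGm : Measurable G := by
    have h2 : Measurable (Set.piecewise {0}ᶜ G fun _ => (0 : ℝ)) :=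
      hQ.cont.measurable_piecewise continuousOn_const (measurableSet_singleton (0 : E3)).compl
    convert h2 using 1
    funext x
    by_cases hx : x = 0
    · subst hx; simp [hQ.map_zero]
    · simp [Set.piecewise, hx]
  have hm : Measurable fun t => ENNReal.ofReal (G (z t)) :=
    (hGm.comp (Lp.stronglyMeasurable z).measurable).ennreal_ofReal
  rw [lintegral_eq_zero_iff hm] at hzero
  filter_upwards [hzero, h1] with t h2 h3
  exact hQ.mem_of_zero _ h3 (le_antisymm (by simpa using h2) (hQ.nonneg _))

lemma IsConverging.limitZero_le {k : ℕ} {q : Fin k → E3} (hQ : IsPenalty (wells q) G) {z : L1}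
    (h : IsConverging η lam u z) (hg : ∀ n, 0 ≤ g n)
    (hE : ∀ n, ∑ i ∈ interiorSites (lam n), site (η n) (fun x => g n * G x) (u n) i ≤ E)
    (hp : Tendsto (fun n => η n * g n / lam n) atTop atTop) :
    limitZero q z ≤ ENNReal.ofReal E := by
  rw [limitZero, if_pos (h.ae_mem hQ hg hE hp)]
  exact zero_le

lemma IsPenalty.lowerBound_transition {Q : Set E3} (hQ : IsPenalty Q G) (hη : ∀ n, 0 < η n)
    (hη0 : Tendsto η atTop (𝓝 0)) {g₀ : ℝ} (hg₀ : 0 < g₀) (hg : Tendsto g atTop (𝓝 g₀)) :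
    LowerBound Q η (fun n x => g n * G x)
      fun y y' => (transitionCost (fun x => 2 * g₀ * G x) y y').toReal := by
  intro ε hε
  obtain ⟨r, hr, τ, hτ, h⟩ := hQ.exists_transition_lower hg₀ hε
  refine ⟨r, hr, ?_⟩
  filter_upwards [hη0.eventually (gt_mem_nhds hτ), Metric.tendsto_nhds.1 hg τ hτ] with n h1 h2
  exact h (η n) (hη n) h1.le (g n) (by rw [← Real.dist_eq]; exact h2.le)

open Classical in
lemma IsPenalty.exists_lowerBound_switch {Q : Set E3} (hQ : IsPenalty Q G) (hη : ∀ n, 0 < η n)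
    (hη0 : Tendsto η atTop (𝓝 0)) {g₀ : ℝ} (hg₀ : 0 < g₀) (hg : ∀ᶠ n in atTop, g₀ ≤ g n)
    (hgn : ∀ n, 0 ≤ g n) :
    ∃ c > 0, LowerBound Q η (fun n x => g n * G x) fun y y' => if y = y' then 0 else c := by
  obtain ⟨c, hc, r, hr, τ, hτ, h⟩ := hQ.exists_switch_lower hg₀
  refine ⟨c, hc, fun ε hε => ⟨r, hr, ?_⟩⟩
  filter_upwards [hη0.eventually (gt_mem_nhds hτ), hg] with n h1 h2 u N hu y hy y' hy' h0 hN
  split_ifs with he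
  · have : 0 ≤ ∑ i ∈ Finset.range N, site (η n) (fun x => g n * G x) u i :=
      Finset.sum_nonneg fun i _ =>
        site_nonneg (hη n) (fun x => mul_nonneg (hgn n) (hQ.nonneg x)) u i
    linarith
  · have := h (η n) (hη n) h1.le (g n) h2 u N hu y hy y' hy' he h0 hN
    linarith

open Classical in
lemma IsPenalty.lowerBound_eight_thirds {Q : Set E3} (hQ : IsPenalty Q G) (hη : ∀ n, 0 < η n)
    (hη0 : Tendsto η atTop (𝓝 0)) (hg : Tendsto g atTop atTop) (hgn : ∀ n, 0 ≤ g n) :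
    LowerBound Q η (fun n x => g n * G x) fun y y' => if y = y' then 0 else 8 / 3 := by
  intro ε hε
  obtain ⟨r, hr, τ, hτ, K, h⟩ := hQ.exists_eight_thirds_lower hε
  refine ⟨r, hr, ?_⟩
  filter_upwards [hη0.eventually (gt_mem_nhds hτ), hg.eventually_ge_atTop K] with n h1 h2 u N hu y hy
    y' hy' h0 hN
  split_ifs with he
  · have : 0 ≤ ∑ i ∈ Finset.range N, site (η n) (fun x => g n * G x) u i :=
      Finset.sum_nonneg fun i _ =>
        site_nonneg (hη n) (fun x => mul_nonneg (hgn n) (hQ.nonneg x)) u i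
    linarith
  · exact h (η n) (hη n) h1.le (g n) h2 u N hu y hy y' hy' he h0 hN

/-- A crude positive bound per switch first shows that the limit is a step function. Only then can
the sharp bound be summed over its jumps. -/
lemma IsConverging.limitTransition_le {k : ℕ} {q : Fin k → E3} (hQ : IsPenalty (wells q) G)
    {z : L1} (h : IsConverging η lam u z) (hg : ∀ n, 0 ≤ g n)
    (hE : ∀ n, ∑ i ∈ interiorSites (lam n), site (η n) (fun x => g n * G x) (u n) i ≤ E)
    (hp : Tendsto (fun n => η n * g n / lam n) atTop atTop) {g₀ : ℝ} (hg₀ : 0 < g₀)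
    (hgt : Tendsto g atTop (𝓝 g₀)) :
    limitTransition q (fun x => 2 * g₀ * G x) z ≤ ENNReal.ofReal E := by
  classical
  have hmem := h.ae_mem hQ hg hE hp
  have hV : ∀ n x, 0 ≤ g n * G x := fun n x => mul_nonneg (hg n) (hQ.nonneg x)
  obtain ⟨c, hc, hlow⟩ := hQ.exists_lowerBound_switch h.η_pos h.η_tendsto (half_pos hg₀)
    (hgt.eventually (le_mem_nhds (half_lt_self hg₀))) hg
  obtain ⟨m, s, y, hs⟩ := h.exists_isStep hc hlow
    (fun y _ y' _ hne => by simp [hne]) hV hE hmem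
  rw [limitTransition, if_pos ⟨hs.isBV hQ.unit, hmem⟩,
    hs.tsum_eq (transitionCost fun x => 2 * g₀ * G x)]
  have hle := h.sum_le_of_isStep (hQ.lowerBound_transition h.η_pos h.η_tendsto hg₀ hgt) hV hE hs
  have hfin : ∀ j, transitionCost (fun x => 2 * g₀ * G x) (y j) (y (j + 1)) ≠ ⊤ := fun j =>
    ((hQ.transitionCost_lt_top _ (hs.mem j) (hs.mem (j + 1))).trans_lt ENNReal.ofReal_lt_top).ne
  rw [← ENNReal.ofReal_toReal (ENNReal.sum_ne_top.2 fun j _ => hfin j),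
    ENNReal.toReal_sum fun j _ => hfin j]
  exact ENNReal.ofReal_le_ofReal hle

lemma IsConverging.limitCount_le {k : ℕ} {q : Fin k → E3} (hQ : IsPenalty (wells q) G)
    {z : L1} (h : IsConverging η lam u z) (hg : ∀ n, 0 ≤ g n)
    (hE : ∀ n, ∑ i ∈ interiorSites (lam n), site (η n) (fun x => g n * G x) (u n) i ≤ E)
    (hp : Tendsto (fun n => η n * g n / lam n) atTop atTop) (hgt : Tendsto g atTop atTop) :
    limitCount q z ≤ ENNReal.ofReal E := by
  classical
  have hmem := h.ae_mem hQ hg hE hp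
  have hV : ∀ n x, 0 ≤ g n * G x := fun n x => mul_nonneg (hg n) (hQ.nonneg x)
  have hlow := hQ.lowerBound_eight_thirds h.η_pos h.η_tendsto hgt hg
  obtain ⟨m, s, y, hs⟩ := h.exists_isStep (c := 8 / 3) (by norm_num) hlow
    (fun y _ y' _ hne => by simp [hne]) hV hE hmem
  rw [limitCount, if_pos ⟨hs.isBV hQ.unit, hmem⟩, hs.encard_jumpSet]
  have hle := h.sum_le_of_isStep hlow hV hE hs
  have : ∑ j ∈ Finset.range m, (if y j = y (j + 1) then (0 : ℝ) else 8 / 3) = m * (8 / 3) := by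
    rw [Finset.sum_congr rfl fun j hj => if_neg (hs.ne j (Finset.mem_range.1 hj)),
      Finset.sum_const, Finset.card_range, nsmul_eq_mul]
  rw [this] at hle
  calc ENNReal.ofReal (8 / 3) * (((m : ℕ∞) : ℝ≥0∞)) = ENNReal.ofReal (8 / 3) * ENNReal.ofReal m := by
        rw [ENNReal.ofReal_natCast]; rfl
    _ = ENNReal.ofReal (m * (8 / 3)) := by rw [← ENNReal.ofReal_mul (by norm_num), mul_comm]
    _ ≤ _ := ENNReal.ofReal_le_ofReal hle

end

/-- If the inequality failed at a level C, infinitely many energies would lie below C. Along a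
further subsequence the chiralities converge almost everywhere, and near-minimal chains for them
contradict `core`. Each regime thus needs only a statement about converging chains of bounded
energy. -/
lemma liminf_le_of_converging {G : E3 → ℝ} (hG : ∀ c : ℝ, 0 < c → ∀ x, G (c • x) = G x)
    {lam del mu : ℕ → ℝ} (hlam_pos : ∀ n, 0 < lam n) (hdel_pos : ∀ n, 0 < del n)
    (hlam : Tendsto lam atTop (𝓝 0)) (hdel : Tendsto del atTop (𝓝 0))
    (hratio : Tendsto (fun n => lam n / √(2 * del n)) atTop (𝓝 0)) {F₀ : L1 → ℝ≥0∞}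
    (core : ∀ φ : ℕ → ℕ, Tendsto φ atTop atTop → ∀ (u : ℕ → ℕ → E3) (z : L1) (E : ℝ),
      IsConverging (fun n => √(2 * del (φ n))) (fun n => lam (φ n)) u z →
      (∀ n, ∑ i ∈ interiorSites (lam (φ n)), site √(2 * del (φ n))
        (fun x => mu (φ n) / (2 * del (φ n) ^ 2) * G x) (u n) i ≤ E) → F₀ z ≤ ENNReal.ofReal E)
    (x : L1) (xs : ℕ → L1) (hxs : Tendsto xs atTop (𝓝 x)) :
    F₀ x ≤ liminf (fun n => scaledFunctional G (lam n) (del n) (mu n) (xs n)) atTop := by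
  by_contra! hlt
  obtain ⟨C, hC1, hC2⟩ := exists_between hlt
  have hCtop : C ≠ ⊤ := (hC2.trans_le le_top).ne
  have hfreq := frequently_lt_of_liminf_lt (by isBoundedDefault) hC1
  obtain ⟨φ, hφ, hφC⟩ := extraction_of_frequently_atTop hfreq
  have hmeas : TendstoInMeasure volI (fun n => (xs (φ n) : ℝ → E3)) atTop x :=
    tendstoInMeasure_of_tendsto_Lp (hxs.comp hφ.tendsto_atTop)
  obtain ⟨ψ, hψ, hae⟩ := hmeas.exists_seq_tendsto_ae
  have hφψ : Tendsto (fun n => φ (ψ n)) atTop atTop := hφ.tendsto_atTop.comp hψ.tendsto_atTop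
  choose u hu1 hu2 hu3 using fun n => exists_chain_of_scaledFunctional_lt (hlam_pos (φ (ψ n)))
    (hdel_pos (φ (ψ n))) hG hCtop (hφC (ψ n))
  have hη : Tendsto (fun n => √(2 * del n)) atTop (𝓝 0) := by
    have := (hdel.const_mul 2).sqrt
    simpa using this
  have := core (fun n => φ (ψ n)) hφψ u x C.toReal
    { η_pos := fun n => by have := hdel_pos (φ (ψ n)); positivity
      η_tendsto := hη.comp hφψ
      lam_pos := fun n => hlam_pos _
      lam_tendsto := hlam.comp hφψ
      ratio := hratio.comp hφψ
      unit := hu1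
      conv := by
        filter_upwards [hae, ae_all_iff.2 hu2] with t h1 h2
        exact h1.congr fun n => h2 n } hu3
  rw [ENNReal.ofReal_toReal hCtop] at this
  exact this.not_gt hC2

/-! ### Sampling continuous paths -/

/-- The angle whose chord on the unit circle has length `η`. -/
def angle (η : ℝ) : ℝ := 2 * Real.arcsin (η / 2)

lemma sin_half_angle {η : ℝ} (h0 : 0 < η) (h1 : η ≤ 1) : Real.sin (angle η / 2) = η / 2 := by
  rw [angle, mul_div_cancel_left₀ _ two_ne_zero, Real.sin_arcsin] <;> linarith

lemma angle_pos {η : ℝ} (h0 : 0 < η) : 0 < angle η := by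
  rw [angle]
  have := Real.arcsin_pos.2 (half_pos h0)
  linarith

lemma le_angle {η : ℝ} (h0 : 0 < η) (h1 : η ≤ 1) : η ≤ angle η := by
  have h2 := Real.sin_le (half_pos (angle_pos h0)).le
  rw [sin_half_angle h0 h1] at h2
  linarith

/-- Together with `le_angle`, the sampling angle and η agree up to the relative error η, so sampled
time and the mesh η may be exchanged. -/
lemma angle_le {η : ℝ} (h0 : 0 < η) (h1 : η ≤ 1) : angle η ≤ (1 + η) * η := by
  have hθ := angle_pos h0
  have hs := sin_half_angle h0 h1
  have h3 : angle η / 2 ≤ Real.pi / 2 := by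
    rw [angle, mul_div_cancel_left₀ _ two_ne_zero]; exact Real.arcsin_le_pi_div_two _
  have h4 := Real.mul_le_sin (half_pos hθ).le h3
  rw [hs, div_mul_eq_mul_div, div_le_iff₀ Real.pi_pos] at h4
  have h5 : angle η ≤ 2 * η := by
    have := mul_le_mul_of_nonneg_left Real.pi_le_four h0.le
    linarith
  have h6 := Real.sin_gt_sub_cube (half_pos hθ)
  rw [hs] at h6
  have h7 : angle η ^ 2 ≤ (2 * η) ^ 2 := pow_le_pow_left₀ hθ.le h5 2
  have h8 : angle η * angle η ^ 2 ≤ angle η * (2 * η) ^ 2 := mul_le_mul_of_nonneg_left h7 hθ.le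
  have h9 : angle η * η ^ 2 ≤ 2 * η * η ^ 2 := mul_le_mul_of_nonneg_right h5 (by positivity)
  have h10 : η * η ^ 2 ≤ η * η := by
    refine mul_le_mul_of_nonneg_left ?_ h0.le
    rw [sq]; exact mul_le_of_le_one_left h0.le h1
  linarith [sq_nonneg η]

lemma cos_angle {η : ℝ} (h0 : 0 < η) (h1 : η ≤ 1) : Real.cos (angle η) = 1 - η ^ 2 / 2 := by
  have h : angle η = 2 * (angle η / 2) := by ring
  rw [h, Real.cos_two_mul, Real.cos_sq', sin_half_angle h0 h1]
  ring

/-- A chain that rotates uniformly with the preferred angle has no bending energy. -/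
lemma bend_eq_zero_of_circ {y e : E3} (hy : ‖y‖ = 1) (he : ‖e‖ = 1) (hye : inner ℝ y e = 0) {η : ℝ}
    (h0 : 0 < η) (h1 : η ≤ 1) {u : ℕ → E3} {i : ℕ} {φ : ℝ} (e0 : u i = circ y e φ)
    (e1 : u (i + 1) = circ y e (φ + angle η)) (e2 : u (i + 2) = circ y e (φ + 2 * angle η)) :
    bend η u i = 0 := by
  have h := norm_second_difference_sq h0 (u := u) (i := i) (by rw [e0]; exact (norm_circ hy hye _).trans he)
    (by rw [e1]; exact (norm_circ hy hye _).trans he) (by rw [e2]; exact (norm_circ hy hye _).trans he)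
  -- On a circle the second neighbours satisfy u_{i+2} + u_i = 2 cos θ u_{i+1}, and the chord
  -- condition reads cos θ = 1 − η²/2.
  have hz : u (i + 2) - (2 * (1 - η ^ 2 / 2)) • u (i + 1) + u i = 0 := by
    rw [e0, e1, e2, ← cos_angle h0 h1]
    have c1 : φ + 2 * angle η = (φ + angle η) + angle η := by ring
    have c2 : φ = (φ + angle η) - angle η := by ring
    rw [c1]
    nth_rewrite 3 [c2]
    simp only [circ, Real.cos_add (φ + angle η), Real.sin_add (φ + angle η),
      Real.cos_sub (φ + angle η), Real.sin_sub (φ + angle η)]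
    module
  rw [hz, norm_zero, zero_pow two_ne_zero] at h
  exact (mul_eq_zero.1 h.symm).resolve_left (by positivity)

lemma cross_circ_circ {y e : E3} (he : ‖e‖ = 1) (hye : inner ℝ y e = 0) (φ ψ : ℝ) :
    cross (circ y e φ) (circ y e ψ) = Real.sin (ψ - φ) • y := by
  have hc : cross e (cross y e) = y := by
    rw [cross_cross_right, real_inner_self_eq_norm_sq, he, real_inner_comm, hye]; simp
  have hc' : cross (cross y e) e = -y := by rw [cross_swap, hc]
  simp only [circ, cross_add_left, cross_add_right, cross_smul_left, cross_smul_right, cross_same,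
    hc, hc', Real.sin_sub]
  module

lemma sq_lintegral_le {α : Type*} [MeasurableSpace α] {μ : Measure α} {f : α → ℝ≥0∞}
    (hf : AEMeasurable f μ) : (∫⁻ x, f x ∂μ) ^ 2 ≤ μ univ * ∫⁻ x, f x ^ 2 ∂μ := by
  have h := ENNReal.lintegral_mul_le_Lp_mul_Lq μ (Real.HolderConjugate.two_two) hf
    (g := fun _ => 1) aemeasurable_const
  simp only [Pi.mul_apply, mul_one, ENNReal.one_rpow, lintegral_const, one_mul] at h
  have h2 := pow_le_pow_left₀ zero_le h 2
  rw [mul_pow, ← ENNReal.rpow_natCast, ← ENNReal.rpow_natCast, ← ENNReal.rpow_mul,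
    ← ENNReal.rpow_natCast, ← ENNReal.rpow_mul] at h2
  norm_num at h2
  rw [mul_comm]
  exact h2

lemma sum_setLIntegral_Ioc {f : ℝ → ℝ≥0∞} {θ : ℝ} (hθ : 0 ≤ θ) (τ : ℝ) (N : ℕ) :
    ∑ i ∈ Finset.range N, ∫⁻ x in Ioc (τ + i * θ) (τ + i * θ + θ), f x =
      ∫⁻ x in Ioc τ (τ + N * θ), f x := by
  induction N with
  | zero => simp
  | succ N ih =>
    have h1 : 0 ≤ (N : ℝ) * θ := by positivity
    have e : τ + ((N + 1 : ℕ) : ℝ) * θ = τ + N * θ + θ := by push_cast; ring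
    rw [Finset.sum_range_succ, ih, e, ← lintegral_union measurableSet_Ioc
      (Ioc_disjoint_Ioc_of_le le_rfl), Ioc_union_Ioc_eq_Ioc (by linarith) (by linarith)]

lemma HasSobolevDeriv.aestronglyMeasurable {f g : ℝ → E3} (h : HasSobolevDeriv f g) :
    AEStronglyMeasurable g volume := by
  have h1 : AEStronglyMeasurable g (volume.restrict (⋃ n : ℕ, Icc (-(n : ℝ)) n)) :=
    aestronglyMeasurable_iUnion_iff.2 fun n => (h.1 (-n) n).1
  have h2 : (⋃ n : ℕ, Icc (-(n : ℝ)) n) = univ := by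
    refine eq_univ_of_forall fun x => ?_
    obtain ⟨n, hn⟩ := exists_nat_ge |x|
    exact mem_iUnion.2 ⟨n, abs_le.1 hn⟩
  rwa [h2, Measure.restrict_univ] at h1

lemma HasSobolevDeriv.enorm_sub_sq_le {f g : ℝ → E3} (h : HasSobolevDeriv f g) {s t : ℝ}
    (hst : s ≤ t) : ‖f t - f s‖ₑ ^ 2 ≤ ENNReal.ofReal (t - s) * ∫⁻ x in Ioc s t, ‖g x‖ₑ ^ 2 := by
  have h1 : ‖f t - f s‖ₑ ≤ ∫⁻ x in Ioc s t, ‖g x‖ₑ := by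
    rw [h.2 s t, add_sub_cancel_left, intervalIntegral.integral_of_le hst]
    exact enorm_integral_le_lintegral_enorm _
  refine (pow_le_pow_left₀ zero_le h1 2).trans ((sq_lintegral_le
    h.aestronglyMeasurable.enorm.restrict).trans (le_of_eq ?_))
  rw [Measure.restrict_apply_univ, Real.volume_Ioc]

/-- The kinetic energy of a sampled path is controlled by that of the path. -/
lemma HasSobolevDeriv.sum_second_difference_le {f g F : ℝ → E3} (h : HasSobolevDeriv f g)
    (hF : ∀ t, HasDerivAt F (f t) t) {θ : ℝ} (hθ : 0 < θ) (τ : ℝ) (N : ℕ) :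
    ∑ i ∈ Finset.range N, ‖F (τ + i * θ + θ + θ) - (2 : ℝ) • F (τ + i * θ + θ) + F (τ + i * θ)‖ₑ ^ 2 ≤
      ENNReal.ofReal (θ ^ 3) * ∫⁻ x, ‖g x‖ₑ ^ 2 := by
  have hfc := hasSobolevDeriv_continuous h
  have hdc : Continuous fun x => f (x + θ) - f x := (hfc.comp (continuous_add_const θ)).sub hfc
  -- Cauchy–Schwarz is used twice: the second difference of F is an integral of first differences of
  -- f, and each of these is an integral of g over a window of length θ.
  have hterm : ∀ s, ‖F (s + θ + θ) - (2 : ℝ) • F (s + θ) + F s‖ₑ ^ 2 ≤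
      ENNReal.ofReal θ * ∫⁻ x in Ioc s (s + θ), ‖f (x + θ) - f x‖ₑ ^ 2 := by
    intro s
    have hd : ∀ x, HasDerivAt (fun x => F (x + θ) - F x) (f (x + θ) - f x) x := fun x =>
      ((hF (x + θ)).comp_add_const x θ).sub (hF x)
    have h1 := intervalIntegral.integral_eq_sub_of_hasDerivAt (a := s) (b := s + θ)
      (fun x _ => hd x) (hdc.intervalIntegrable _ _)
    have h2 : F (s + θ + θ) - (2 : ℝ) • F (s + θ) + F s =
        ∫ x in s..s + θ, (f (x + θ) - f x) := by rw [h1]; module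
    rw [h2, intervalIntegral.integral_of_le (by linarith)]
    refine (pow_le_pow_left₀ zero_le (enorm_integral_le_lintegral_enorm _) 2).trans
      ((sq_lintegral_le hdc.measurable.enorm.aemeasurable).trans (le_of_eq ?_))
    rw [Measure.restrict_apply_univ, Real.volume_Ioc, add_sub_cancel_left]
  refine (Finset.sum_le_sum fun (i : ℕ) _ => hterm (τ + i * θ)).trans ?_
  rw [← Finset.mul_sum, sum_setLIntegral_Ioc hθ.le]
  obtain ⟨k, hk, hgk⟩ : AEMeasurable (fun x => ‖g x‖ₑ ^ 2) volume :=
    (h.aestronglyMeasurable.enorm).pow_const 2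
  have h3 : ∀ x, ‖f (x + θ) - f x‖ₑ ^ 2 ≤ ENNReal.ofReal θ *
      ∫⁻ t, {p : ℝ × ℝ | p.1 < p.2 ∧ p.2 ≤ p.1 + θ}.indicator (fun p => k p.2) (x, t) := by
    intro x
    have h4 := h.enorm_sub_sq_le (s := x) (t := x + θ) (by linarith)
    rw [add_sub_cancel_left, lintegral_congr_ae (ae_restrict_of_ae hgk),
      ← lintegral_indicator measurableSet_Ioc] at h4
    exact h4
  have hS : MeasurableSet {p : ℝ × ℝ | p.1 < p.2 ∧ p.2 ≤ p.1 + θ} :=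
    (measurableSet_lt measurable_fst measurable_snd).inter
      (measurableSet_le measurable_snd (measurable_fst.add_const θ))
  have hm : Measurable ({p : ℝ × ℝ | p.1 < p.2 ∧ p.2 ≤ p.1 + θ}.indicator fun p => k p.2) :=
    (hk.comp measurable_snd).indicator hS
  calc ENNReal.ofReal θ * ∫⁻ x in Ioc τ (τ + N * θ), ‖f (x + θ) - f x‖ₑ ^ 2
      ≤ ENNReal.ofReal θ * ∫⁻ x, ENNReal.ofReal θ *
        ∫⁻ t, {p : ℝ × ℝ | p.1 < p.2 ∧ p.2 ≤ p.1 + θ}.indicator (fun p => k p.2) (x, t) := by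
        exact mul_le_mul' le_rfl ((setLIntegral_le_lintegral _ _).trans (lintegral_mono h3))
    _ = ENNReal.ofReal θ * (ENNReal.ofReal θ * ∫⁻ t, ∫⁻ x,
        {p : ℝ × ℝ | p.1 < p.2 ∧ p.2 ≤ p.1 + θ}.indicator (fun p => k p.2) (x, t)) := by
        rw [lintegral_const_mul' _ _ ENNReal.ofReal_ne_top]
        congr 2
        exact lintegral_lintegral_swap hm.aemeasurable
    _ = ENNReal.ofReal θ * (ENNReal.ofReal θ * ∫⁻ t, ENNReal.ofReal θ * k t) := by
        congr 2
        -- After exchanging the integrals, a point t is counted for the window starts x in [t − θ,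
        -- t), a set of measure θ. This supplies the third factor θ.
        refine lintegral_congr fun t => ?_
        have : (fun x => {p : ℝ × ℝ | p.1 < p.2 ∧ p.2 ≤ p.1 + θ}.indicator (fun p => k p.2) (x, t)) =
            (Ico (t - θ) t).indicator fun _ => k t := by
          funext x
          simp only [indicator_apply, mem_ofPred_eq, mem_Ico]
          congr 1
          rw [eq_iff_iff]
          constructor <;> rintro ⟨h5, h6⟩ <;> constructor <;> linarith
        rw [this, lintegral_indicator_const measurableSet_Ico, Real.volume_Ico, sub_sub_cancel,
          mul_comm]
    _ = ENNReal.ofReal (θ ^ 3) * ∫⁻ x, ‖g x‖ₑ ^ 2 := by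
        rw [lintegral_const_mul' _ _ ENNReal.ofReal_ne_top, ← lintegral_congr_ae hgk,
          ENNReal.ofReal_pow hθ.le]
        ring

/-- Comparison of the second difference of `u` with that of a primitive of `u × u'`. -/
lemma norm_cross_second_difference_sub_le {u v w W : ℝ → E3} {m θ B ω : ℝ} (hθ : 0 ≤ θ)
    (hω0 : 0 ≤ ω) (hu : ∀ t, HasDerivAt u (v t) t) (hW : ∀ t, HasDerivAt W (w t) t)
    (hw : ∀ t, w t = cross (u t) (v t)) (hB : ∀ t ∈ Icc (m - θ) (m + θ), ‖v t‖ ≤ B)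
    (hω : ∀ s ∈ Icc (m - θ) (m + θ), ∀ t ∈ Icc (m - θ) (m + θ), ‖v s - v t‖ ≤ ω) :
    ‖cross (u m) (u (m + θ) + u (m - θ)) - (W (m + θ) - (2 : ℝ) • W m + W (m - θ))‖ ≤
      2 * (θ * ω * B) * θ := by
  have hB0 : 0 ≤ B := (norm_nonneg _).trans (hB m ⟨by linarith, by linarith⟩)
  have hd1 : ∀ r : ℝ, HasDerivAt (fun r => u (m + r)) (v (m + r)) r := fun r =>
    (hu (m + r)).comp_const_add m r
  have hd2 : ∀ r : ℝ, HasDerivAt (fun r => u (m - r)) (-v (m - r)) r := fun r =>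
    (hu (m - r)).comp_const_sub m r
  have hD1 : ∀ r : ℝ, HasDerivAt (fun r => W (m + r)) (w (m + r)) r := fun r =>
    (hW (m + r)).comp_const_add m r
  have hD2 : ∀ r : ℝ, HasDerivAt (fun r => W (m - r)) (-w (m - r)) r := fun r =>
    (hW (m - r)).comp_const_sub m r
  have hcst : ∀ r : ℝ, HasDerivAt (fun _ : ℝ => u m) 0 r := fun r => hasDerivAt_const r _
  -- θ is replaced by a variable r. The difference vanishes at r = 0, so it suffices to bound its
  -- derivative.
  have hΨ : ∀ r : ℝ, HasDerivAt (fun r => cross (u m) (u (m + r) + u (m - r)) -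
      (W (m + r) - (2 : ℝ) • W m + W (m - r)))
      (cross (u m) (v (m + r) - v (m - r)) - (w (m + r) - w (m - r))) r := by
    intro r
    have h1 := hasDerivAt_cross (hcst r) ((hd1 r).add (hd2 r))
    have h2 := h1.sub (((hD1 r).sub_const ((2 : ℝ) • W m)).add (hD2 r))
    simp only [cross_zero_left, add_zero, ← sub_eq_add_neg] at h2
    exact h2
  have hmain : ∀ r ∈ Icc (m - θ) (m + θ), ‖cross (u m) (v r) - w r‖ ≤ θ * ω * B := by
    intro r hr
    -- A multiple of v r may be subtracted for free in the cross product. The error is then of order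
    -- θωB, with the oscillation ω of the velocity in place of a second factor B.
    have e : cross (u m) (v r) - w r = cross (u m - u r - (m - r) • v r) (v r) := by
      rw [hw, cross_sub_left, cross_sub_left, cross_smul_left, cross_same, smul_zero, sub_zero]
    have hq : ‖u m - u r - (m - r) • v r‖ ≤ ω * |m - r| := by
      have hds : ∀ x ∈ Icc (m - θ) (m + θ), HasDerivWithinAt (fun x => u x - x • v r) (v x - v r)
          (Icc (m - θ) (m + θ)) x := fun x _ => by
        have := (hu x).sub ((hasDerivAt_id x).smul_const (v r))
        rw [one_smul] at this
        exact this.hasDerivWithinAt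
      have := (convex_Icc (m - θ) (m + θ)).norm_image_sub_le_of_norm_hasDerivWithin_le hds
        (fun x hx => hω x hx r hr) hr (⟨by linarith, by linarith⟩ : m ∈ Icc (m - θ) (m + θ))
      rw [Real.norm_eq_abs] at this
      have e : u m - u r - (m - r) • v r = (u m - m • v r) - (u r - r • v r) := by module
      rw [e]
      exact this
    rw [e]
    refine (norm_cross_le _ _).trans (mul_le_mul (hq.trans ?_) (hB r hr) (norm_nonneg _)
      (by positivity))
    rw [mul_comm]
    refine mul_le_mul_of_nonneg_right ?_ hω0
    rw [abs_le]; constructor <;> linarith [hr.1, hr.2]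
  have hbound : ∀ r ∈ Ico (0 : ℝ) θ, ‖cross (u m) (v (m + r) - v (m - r)) - (w (m + r) - w (m - r))‖ ≤
      2 * (θ * ω * B) := by
    intro r hr
    have e : cross (u m) (v (m + r) - v (m - r)) - (w (m + r) - w (m - r)) =
        (cross (u m) (v (m + r)) - w (m + r)) - (cross (u m) (v (m - r)) - w (m - r)) := by
      rw [cross_sub_right]; abel
    rw [e]
    have h1 := hmain (m + r) ⟨by linarith [hr.1], by linarith [hr.2]⟩
    have h2 := hmain (m - r) ⟨by linarith [hr.2], by linarith [hr.1]⟩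
    linarith [norm_sub_le (cross (u m) (v (m + r)) - w (m + r)) (cross (u m) (v (m - r)) - w (m - r))]
  have := norm_image_sub_le_of_norm_deriv_right_le_segment (a := 0) (b := θ)
    (fun r _ => (hΨ r).continuousAt.continuousWithinAt) (fun r _ => (hΨ r).hasDerivWithinAt) hbound θ
    ⟨hθ, le_rfl⟩
  simp only [add_zero, sub_zero] at this
  have hz : cross (u m) (u m + u m) - (W m - (2 : ℝ) • W m + W m) = 0 := by
    rw [cross_add_right, cross_same]; module
  rwa [hz, sub_zero] at this

/-- The chain of values of `u` at the points `τ + i θ`. -/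
def sample (u : ℝ → E3) (τ θ : ℝ) (i : ℕ) : E3 := u (τ + i * θ)

lemma sample_succ (u : ℝ → E3) (τ θ : ℝ) (i : ℕ) :
    sample u τ θ (i + 1) = u (τ + i * θ + θ) := by
  rw [sample]; congr 1; push_cast; ring

lemma sample_succ_succ (u : ℝ → E3) (τ θ : ℝ) (i : ℕ) :
    sample u τ θ (i + 2) = u (τ + i * θ + θ + θ) := by
  rw [sample]; congr 1; push_cast; ring

lemma sq_sub_sq_le_of_close {b x y ω : ℝ} (hb : 1 ≤ b) (hx0 : 0 ≤ x) (hx : x ≤ b) (hy0 : 0 ≤ y)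
    (hω : ω ≤ 1) (h : |y - x| ≤ ω) : |y ^ 2 - x ^ 2| ≤ 3 * b * ω := by
  have hω0 : 0 ≤ ω := (abs_nonneg _).trans h
  rw [sq_sub_sq, abs_mul, abs_of_nonneg (by positivity : 0 ≤ y + x)]
  have h1 := (abs_le.1 h).2
  exact mul_le_mul (by linarith) h (abs_nonneg _) (by positivity)

lemma potential_le_of_close {b x y y' ω : ℝ} (hb : 1 ≤ b) (hx0 : 0 ≤ x) (hx : x ≤ b) (hy0 : 0 ≤ y)
    (hy0' : 0 ≤ y') (hω : ω ≤ 1) (h : |y - x| ≤ ω) (h' : |y' - x| ≤ ω) :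
    (1 - (y ^ 2 + y' ^ 2) / 2) ^ 2 ≤ (x ^ 2 - 1) ^ 2 + 30 * b ^ 3 * ω := by
  have h1 := abs_le.1 (sq_sub_sq_le_of_close hb hx0 hx hy0 hω h)
  have h2 := abs_le.1 (sq_sub_sq_le_of_close hb hx0 hx hy0' hω h')
  have hω0 : 0 ≤ ω := (abs_nonneg _).trans h
  obtain ⟨d, hd⟩ : ∃ d, d = (y ^ 2 + y' ^ 2) / 2 - x ^ 2 := ⟨_, rfl⟩
  have hd1 : |d| ≤ 3 * b * ω := by rw [hd, abs_le]; constructor <;> linarith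
  have hx2 : x ^ 2 ≤ b ^ 2 := pow_le_pow_left₀ hx0 hx 2
  have hb2 : 1 ≤ b ^ 2 := one_le_pow₀ hb
  have hbb : b ≤ b ^ 2 := le_self_pow₀ hb two_ne_zero
  have hd2 : |d + 2 * (x ^ 2 - 1)| ≤ 10 * b ^ 2 := by
    have h3 : 3 * b * ω ≤ 3 * b ^ 2 := by
      have := mul_le_mul hbb hω hω0 (by positivity); linarith
    have h4 := abs_le.1 hd1
    rw [abs_le]; constructor <;> linarith [sq_nonneg x]
  have h5 : d * (d + 2 * (x ^ 2 - 1)) ≤ 3 * b * ω * (10 * b ^ 2) :=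
    (le_abs_self _).trans (by rw [abs_mul]; exact mul_le_mul hd1 hd2 (abs_nonneg _) (by positivity))
  have e : (1 - (y ^ 2 + y' ^ 2) / 2) ^ 2 = (x ^ 2 - 1) ^ 2 + d * (d + 2 * (x ^ 2 - 1)) := by
    rw [hd]; ring
  rw [e]
  linarith

lemma norm_sub_smul_le {u v : ℝ → E3} {s t x a b ω : ℝ} (hu : ∀ t, HasDerivAt u (v t) t)
    (hs : s ∈ Icc a b) (ht : t ∈ Icc a b) (hst : s ≤ t) (h : ∀ r ∈ Icc a b, ‖v r - v x‖ ≤ ω) :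
    ‖u t - u s - (t - s) • v x‖ ≤ ω * (t - s) := by
  have hds : ∀ r ∈ Icc a b, HasDerivWithinAt (fun r => u r - r • v x) (v r - v x) (Icc a b) r :=
    fun r _ => by
      have := (hu r).sub ((hasDerivAt_id r).smul_const (v x))
      rw [one_smul] at this
      exact this.hasDerivWithinAt
  have := (convex_Icc a b).norm_image_sub_le_of_norm_hasDerivWithin_le hds h hs ht
  rw [Real.norm_eq_abs, abs_of_nonneg (by linarith)] at this
  have e : u t - u s - (t - s) • v x = (u t - t • v x) - (u s - s • v x) := by module
  rw [e]
  exact this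

/-- The discrete speeds differ from |w x| by O(ω + ηB), which handles the well term. The chirality
increment is the second difference of a primitive W of w up to an error of order θ²ωB, which handles
the kinetic term. The latter is kept as a second difference, because w' is only square integrable
and can be estimated only after summation over the sites. -/
lemma site_sample_le {u v w W : ℝ → E3} {V : E3 → ℝ} {τ η B ω κ : ℝ} {i : ℕ} (hη : 0 < η)
    (hη1 : η ≤ 1) (hκ : 0 < κ) (hB1 : 1 ≤ B) (hω0 : 0 ≤ ω) (hω1 : 2 * ω + η * B ≤ 1)
    (hu : ∀ t, HasDerivAt u (v t) t) (hW : ∀ t, HasDerivAt W (w t) t)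
    (hw : ∀ t, w t = cross (u t) (v t)) (hvw : ∀ t, ‖v t‖ = ‖w t‖)
    (hB : ∀ t ∈ Icc (τ + i * angle η) (τ + i * angle η + angle η + angle η), ‖v t‖ ≤ B)
    (hω : ∀ s ∈ Icc (τ + i * angle η) (τ + i * angle η + angle η + angle η),
      ∀ t ∈ Icc (τ + i * angle η) (τ + i * angle η + angle η + angle η), ‖v s - v t‖ ≤ ω)
    {x : ℝ} (hx : x ∈ Icc (τ + i * angle η) (τ + i * angle η + angle η))
    {v₀ : ℝ} (hv₀ : 0 ≤ v₀) (hV : V (chi η (sample u τ (angle η)) i) ≤ v₀) :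
    site η V (sample u τ (angle η)) i ≤ (1 + κ) / η ^ 3 *
      ‖W (τ + i * angle η + angle η + angle η) - (2 : ℝ) • W (τ + i * angle η + angle η) +
        W (τ + i * angle η)‖ ^ 2 + angle η * ((‖w x‖ ^ 2 - 1) ^ 2 + v₀ +
          (30 * B ^ 3 * (2 * ω + η * B) + (1 + 1 / κ) * (32 * ω ^ 2 * B ^ 2))) := by
  obtain ⟨θ, hθ⟩ : ∃ θ, θ = angle η := ⟨_, rfl⟩
  rw [← hθ] at hB hω hx hV ⊢
  obtain ⟨s, hs⟩ : ∃ s, s = τ + i * θ := ⟨_, rfl⟩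
  rw [← hs] at hB hω hx ⊢
  have hθ0 : 0 < θ := by rw [hθ]; exact angle_pos hη
  have hηθ : η ≤ θ := by rw [hθ]; exact le_angle hη hη1
  have hθη : θ ≤ (1 + η) * η := by rw [hθ]; exact angle_le hη hη1
  have hθ2 : θ ≤ 2 * η := hθη.trans (mul_le_mul_of_nonneg_right (by linarith) hη.le)
  have hB0 : 0 < B := by linarith
  have e0 : sample u τ θ i = u s := by rw [sample, hs]
  have e1 : sample u τ θ (i + 1) = u (s + θ) := by rw [sample_succ, hs]
  have e2 : sample u τ θ (i + 2) = u (s + θ + θ) := by rw [sample_succ_succ, hs]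
  have hxm : x ∈ Icc s (s + θ + θ) := ⟨hx.1, by linarith [hx.2]⟩
  have hm0 : s ∈ Icc s (s + θ + θ) := ⟨le_rfl, by linarith⟩
  have hm1 : s + θ ∈ Icc s (s + θ + θ) := ⟨by linarith, by linarith⟩
  have hm2 : s + θ + θ ∈ Icc s (s + θ + θ) := ⟨by linarith, le_rfl⟩
  -- the potential part
  have hspeed : ∀ {p q : ℝ}, p ∈ Icc s (s + θ + θ) → q ∈ Icc s (s + θ + θ) → q - p = θ →
      |‖u q - u p‖ / η - ‖w x‖| ≤ 2 * ω + η * B := by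
    intro p q hp hq hpq
    have h1 := norm_sub_smul_le hu hp hq (by linarith) (x := x) fun r hr => hω r hr x hxm
    rw [hpq] at h1
    have h2 := (abs_norm_sub_norm_le (u q - u p) (θ • v x)).trans h1
    rw [norm_smul, Real.norm_eq_abs, abs_of_pos hθ0, hvw] at h2
    have hwB : ‖w x‖ ≤ B := by rw [← hvw]; exact hB x hxm
    have h3 : |‖u q - u p‖ - η * ‖w x‖| ≤ η * (2 * ω + η * B) := by
      have h4 := abs_le.1 h2
      have h5 : (θ - η) * ‖w x‖ ≤ η * η * B :=
        mul_le_mul (by linarith) hwB (norm_nonneg _) (by positivity)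
      have h6 : 0 ≤ (θ - η) * ‖w x‖ := mul_nonneg (by linarith) (norm_nonneg _)
      have h7 : ω * θ ≤ ω * (2 * η) := mul_le_mul_of_nonneg_left hθ2 hω0
      rw [abs_le]; constructor <;> linarith
    have h8 : ‖u q - u p‖ / η - ‖w x‖ = (‖u q - u p‖ - η * ‖w x‖) / η := by field_simp
    rw [h8, abs_div, abs_of_pos hη, div_le_iff₀ hη]
    linarith
  have hpot := potential_le_of_close hB1 (norm_nonneg (w x)) (by rw [← hvw]; exact hB x hxm)
    (speed_nonneg hη (sample u τ θ) i) (speed_nonneg hη (sample u τ θ) (i + 1)) hω1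
    (by rw [speed, e0, e1]; exact hspeed hm0 hm1 (by ring))
    (by rw [speed, e1, e2]; exact hspeed hm1 hm2 (by ring))
  -- the kinetic part
  obtain ⟨A, hA⟩ : ∃ A, A = W (s + θ + θ) - (2 : ℝ) • W (s + θ) + W s := ⟨_, rfl⟩
  obtain ⟨Z, hZ⟩ : ∃ Z, Z = cross (u (s + θ)) (u (s + θ + θ) + u s) := ⟨_, rfl⟩
  have hZA : ‖Z - A‖ ≤ 2 * (θ * ω * B) * θ := by
    have hset : Icc (s + θ - θ) (s + θ + θ) = Icc s (s + θ + θ) := by rw [add_sub_cancel_right]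
    have := norm_cross_second_difference_sub_le (m := s + θ) hθ0.le hω0 hu hW hw
      (by rw [hset]; exact hB) (by rw [hset]; exact hω)
    rw [add_sub_cancel_right] at this
    rw [hZ, hA]
    exact this
  have hchi : chi η (sample u τ θ) (i + 1) - chi η (sample u τ θ) i = η⁻¹ • Z := by
    rw [chi, chi, e0, e1, e2, hZ, cross_add_right, cross_swap (u s)]
    module
  have hkin : ‖chi η (sample u τ θ) (i + 1) - chi η (sample u τ θ) i‖ ^ 2 / η = ‖Z‖ ^ 2 / η ^ 3 := by
    rw [hchi, norm_smul, norm_inv, Real.norm_eq_abs, abs_of_pos hη]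
    field_simp
  -- Young's inequality with a parameter κ keeps the leading coefficient close to 1.
  have hZ2 : ‖Z‖ ^ 2 ≤ (1 + κ) * ‖A‖ ^ 2 + (1 + 1 / κ) * ‖Z - A‖ ^ 2 := by
    have h1 : ‖Z‖ ≤ ‖A‖ + ‖Z - A‖ := by
      have := norm_add_le A (Z - A); rwa [add_sub_cancel] at this
    have h2 := pow_le_pow_left₀ (norm_nonneg _) h1 2
    have h3 : 0 ≤ (κ * ‖A‖ - ‖Z - A‖) ^ 2 / κ := by positivity
    have h4 : (κ * ‖A‖ - ‖Z - A‖) ^ 2 / κ =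
        κ * ‖A‖ ^ 2 - 2 * ‖A‖ * ‖Z - A‖ + 1 / κ * ‖Z - A‖ ^ 2 := by
      field_simp
      ring
    linarith
  have herr : ‖Z - A‖ ^ 2 / η ^ 3 ≤ θ * (32 * ω ^ 2 * B ^ 2) := by
    rw [div_le_iff₀ (by positivity)]
    refine (pow_le_pow_left₀ (norm_nonneg _) hZA 2).trans ?_
    have h3 : θ ^ 3 ≤ (2 * η) ^ 3 := pow_le_pow_left₀ hθ0.le hθ2 3
    have h4 := mul_le_mul_of_nonneg_left h3 (show 0 ≤ 4 * θ * ω ^ 2 * B ^ 2 by positivity)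
    linarith
  have hfin : ‖Z‖ ^ 2 / η ^ 3 ≤ (1 + κ) / η ^ 3 * ‖A‖ ^ 2 +
      (1 + 1 / κ) * (θ * (32 * ω ^ 2 * B ^ 2)) := by
    have h1 := div_le_div_of_nonneg_right hZ2 (show 0 ≤ η ^ 3 by positivity)
    have h2 := mul_le_mul_of_nonneg_left herr (show 0 ≤ 1 + 1 / κ by positivity)
    have h3 : ((1 + κ) * ‖A‖ ^ 2 + (1 + 1 / κ) * ‖Z - A‖ ^ 2) / η ^ 3 =
      (1 + κ) / η ^ 3 * ‖A‖ ^ 2 + (1 + 1 / κ) * (‖Z - A‖ ^ 2 / η ^ 3) := by ring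
    linarith
  rw [← hA, site, bend, hkin]
  have hpos : 0 ≤ 30 * B ^ 3 * (2 * ω + η * B) := by positivity
  have k1 : η * (1 - (speed η (sample u τ θ) i ^ 2 + speed η (sample u τ θ) (i + 1) ^ 2) / 2) ^ 2 +
      η * V (chi η (sample u τ θ) i) ≤
      θ * ((‖w x‖ ^ 2 - 1) ^ 2 + v₀ + 30 * B ^ 3 * (2 * ω + η * B)) := by
    rw [← mul_add]
    have h1 : (1 - (speed η (sample u τ θ) i ^ 2 + speed η (sample u τ θ) (i + 1) ^ 2) / 2) ^ 2 +
      V (chi η (sample u τ θ) i) ≤ (‖w x‖ ^ 2 - 1) ^ 2 + v₀ + 30 * B ^ 3 * (2 * ω + η * B) := by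
        linarith
    exact (mul_le_mul_of_nonneg_left h1 hη.le).trans
      (mul_le_mul_of_nonneg_right hηθ (by positivity))
  linarith

lemma site_eq_zero_of_circ {y e : E3} (hy : ‖y‖ = 1) (he : ‖e‖ = 1) (hye : inner ℝ y e = 0) {η : ℝ}
    (h0 : 0 < η) (h1 : η ≤ 1) {V : E3 → ℝ} (hV : ∀ r : ℝ, V (r • y) = 0) {u : ℕ → E3} {i : ℕ} {φ : ℝ}
    (e0 : u i = circ y e φ) (e1 : u (i + 1) = circ y e (φ + angle η))
    (e2 : u (i + 2) = circ y e (φ + 2 * angle η)) : site η V u i = 0 := by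
  rw [site, bend_eq_zero_of_circ hy he hye h0 h1 e0 e1 e2, chi, e0, e1, cross_circ_circ he hye,
    smul_smul, hV]
  simp

lemma IsTransit.unit_before {V : E3 → ℝ} {y e y' e' : E3} {T : ℝ} {C : ℝ≥0∞}
    {u w a w' : ℝ → E3} (h : IsTransit V y e y' e' T C u w a w') :
    ‖e‖ = 1 ∧ inner ℝ y e = 0 := by
  have h1 : u 0 = e := by rw [h.before_u 0 le_rfl, circ_zero]
  have h2 : w 0 = y := h.before_w 0 le_rfl
  refine ⟨h1 ▸ h.unit 0, ?_⟩
  rw [← h1, ← h2, real_inner_comm]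
  exact h.orth 0

lemma IsTransit.unit_after {V : E3 → ℝ} {y e y' e' : E3} {T : ℝ} {C : ℝ≥0∞}
    {u w a w' : ℝ → E3} (h : IsTransit V y e y' e' T C u w a w') :
    ‖e'‖ = 1 ∧ inner ℝ y' e' = 0 := by
  have h1 : u T = e' := by rw [h.after_u T le_rfl, sub_self, circ_zero]
  have h2 : w T = y' := h.after_w T le_rfl
  refine ⟨h1 ▸ h.unit T, ?_⟩
  rw [← h1, ← h2, real_inner_comm]
  exact h.orth T

set_option maxHeartbeats 800000 in
/-- The energy of a sampled path is asymptotically at most that of the path. -/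
lemma IsTransit.exists_sum_site_sample_le {V : E3 → ℝ} {y e y' e' : E3} {T C : ℝ}
    {u w a w' : ℝ → E3} (h : IsTransit V y e y' e' T (ENNReal.ofReal C) u w a w') (hy : ‖y‖ = 1)
    (hy' : ‖y'‖ = 1) (hT : 0 ≤ T) (hC : 0 ≤ C) (hV : ∀ x, 0 ≤ V x) {ε : ℝ} (hε : 0 < ε) :
    ∃ ρ > 0, ∀ η, 0 < η → η ≤ ρ → ∀ V' : E3 → ℝ, (∀ x, 0 ≤ V' x) → (∀ r : ℝ, V' (r • y) = 0) →
      (∀ r : ℝ, V' (r • y') = 0) → (∀ s ∈ Icc (-1) T, ∀ x ∈ Icc s (s + angle η),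
        V' (η⁻¹ • cross (u s) (u (s + angle η))) ≤ V (w x) + ρ) → ∀ (τ : ℝ) (N : ℕ),
      ∑ i ∈ Finset.range N, site η V' (sample u τ (angle η)) i ≤ C + ε := by
  obtain ⟨v, hv⟩ : ∃ v, v = fun r => cross (w r) (u r) := ⟨_, rfl⟩
  have hwc : Continuous w := hasSobolevDeriv_continuous h.deriv_w
  have huc : Continuous u := hasSobolevDeriv_continuous h.deriv_u
  have hvc : Continuous v := by rw [hv]; exact continuous_cross.comp (hwc.prodMk huc)
  have hu : ∀ t, HasDerivAt u (v t) t := by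
    intro t; rw [hv]; exact h.deriv_u.hasDerivAt (by rw [← hv]; exact hvc) t
  have hw : ∀ t, w t = cross (u t) (v t) := by
    intro t
    rw [hv, cross_cross_right, real_inner_self_eq_norm_sq, h.unit, h.orth]; simp
  have hvw : ∀ t, ‖v t‖ = ‖w t‖ := by
    intro t
    simp only [hv]
    rw [norm_cross_of_orthogonal (by rw [real_inner_comm]; exact h.orth t), h.unit, mul_one]
  obtain ⟨W, hWe⟩ : ∃ W : ℝ → E3, W = fun t => ∫ r in (0 : ℝ)..t, w r := ⟨_, rfl⟩
  have hW : ∀ t, HasDerivAt W (w t) t := fun t => by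
    rw [hWe]; exact (hwc.integral_hasStrictDerivAt 0 t).hasDerivAt
  obtain ⟨he, hye⟩ := h.unit_before
  obtain ⟨he', hye'⟩ := h.unit_after
  have hcomp : IsCompact (Icc (-1) (T + 1)) := isCompact_Icc
  obtain ⟨B₀, hB₀⟩ := hcomp.exists_bound_of_continuousOn hvc.continuousOn
  obtain ⟨B, hBe⟩ : ∃ B, B = max B₀ 1 := ⟨_, rfl⟩
  have hB1 : 1 ≤ B := by rw [hBe]; exact le_max_right _ _
  have hB0 : 0 < B := by linarith
  have hB : ∀ t ∈ Icc (-1) (T + 1), ‖v t‖ ≤ B := fun t ht => by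
    rw [hBe]; exact (hB₀ t ht).trans (le_max_left _ _)
  obtain ⟨κ, hκe⟩ : ∃ κ, κ = min 1 (ε / (4 * (C + 1))) := ⟨_, rfl⟩
  have hκ : 0 < κ := by rw [hκe]; positivity
  have hκ1 : κ ≤ 1 := by rw [hκe]; exact min_le_left _ _
  have hκC : 2 * κ * C ≤ ε / 2 := by
    have h1 : κ ≤ ε / (4 * (C + 1)) := by rw [hκe]; exact min_le_right _ _
    rw [le_div_iff₀ (by positivity)] at h1
    linarith
  -- All error terms at one site are at most K₀σ per unit time, and they are paid only over a time
  -- interval of bounded length.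
  obtain ⟨K₀, hK₀⟩ : ∃ K₀, K₀ = 30 * B ^ 3 * (2 + B) + 1 + (1 + 1 / κ) * (32 * B ^ 2) := ⟨_, rfl⟩
  obtain ⟨σ, ⟨⟨hσ1, hσ2⟩, hσ3⟩, hσ0⟩ : ∃ σ : ℝ, ((σ * (2 + B) < 1 ∧ σ * (K₀ * (T + 3)) < ε / 2) ∧
      σ * 1 < 1) ∧ 0 < σ :=
    ((((eventually_mul_lt (2 + B) one_pos).and (eventually_mul_lt _ (half_pos hε))).and
      (eventually_mul_lt 1 one_pos)).and self_mem_nhdsWithin).exists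
  have hunif := hcomp.uniformContinuousOn_of_continuous hvc.continuousOn
  obtain ⟨δ, hδ, hδv⟩ := Metric.uniformContinuousOn_iff_le.1 hunif σ hσ0
  refine ⟨min (min σ (δ / 4)) (min (1 / 4) (κ / 14)), by positivity, ?_⟩
  intro η hη hηρ V' hV' hV'y hV'y' hpot τ N
  have hησ : η ≤ σ := hηρ.trans ((min_le_left _ _).trans (min_le_left _ _))
  have hηδ : η ≤ δ / 4 := hηρ.trans ((min_le_left _ _).trans (min_le_right _ _))
  have hη4 : η ≤ 1 / 4 := hηρ.trans ((min_le_right _ _).trans (min_le_left _ _))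
  have hηκ : η ≤ κ / 14 := hηρ.trans ((min_le_right _ _).trans (min_le_right _ _))
  have hη1 : η ≤ 1 := by linarith
  obtain ⟨θ, hθ⟩ : ∃ θ, θ = angle η := ⟨_, rfl⟩
  rw [← hθ] at hpot ⊢
  have hθ0 : 0 < θ := by rw [hθ]; exact angle_pos hη
  have hθη : θ ≤ (1 + η) * η := by rw [hθ]; exact angle_le hη hη1
  have hθ2 : θ ≤ 2 * η := hθη.trans (mul_le_mul_of_nonneg_right (by linarith) hη.le)
  obtain ⟨ρ', hρ'⟩ : ∃ ρ', ρ' = K₀ * σ := ⟨_, rfl⟩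
  have hK₀0 : 0 < K₀ := by rw [hK₀]; positivity
  have hρ'0 : 0 < ρ' := by rw [hρ']; positivity
  obtain ⟨f, hf⟩ : ∃ f : ℝ → ℝ≥0∞, f = fun x => ENNReal.ofReal ((‖w x‖ ^ 2 - 1) ^ 2 + V (w x)) +
    (Icc (-1) (T + 1)).indicator (fun _ => ENNReal.ofReal ρ') x := ⟨_, rfl⟩
  obtain ⟨A, hA⟩ : ∃ A : ℕ → E3, A = fun i : ℕ => W (τ + i * θ + θ + θ) -
    (2 : ℝ) • W (τ + i * θ + θ) + W (τ + i * θ) := ⟨_, rfl⟩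
  have hc0 : 0 ≤ (1 + κ) / η ^ 3 := by positivity
  have hsite : ∀ i : ℕ, ENNReal.ofReal (site η V' (sample u τ θ) i) ≤
      ENNReal.ofReal ((1 + κ) / η ^ 3) * ‖A i‖ₑ ^ 2 +
        ∫⁻ x in Ioc (τ + i * θ) (τ + i * θ + θ), f x := by
    intro i
    obtain ⟨s, hs⟩ : ∃ s, s = τ + i * θ := ⟨_, rfl⟩
    -- A triple of samples entirely before 0 or after T lies on a uniform rotation and costs exactly
    -- nothing. Hence neither the offset τ nor the number N of samples enters the bound.
    by_cases hin1 : s + θ + θ ≤ 0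
    · rw [hθ] at hin1 hs ⊢
      have : site η V' (sample u τ (angle η)) i = 0 := by
        refine site_eq_zero_of_circ hy he hye hη hη1 hV'y (φ := s) ?_ ?_ ?_
        · rw [sample, ← hs]; exact h.before_u _ (by rw [← hθ] at hin1; linarith)
        · rw [sample_succ, ← hs]; exact h.before_u _ (by rw [← hθ] at hin1 ⊢; linarith)
        · rw [sample_succ_succ, ← hs, h.before_u _ hin1]; congr 1; ring
      rw [this, ENNReal.ofReal_zero]; exact zero_le
    by_cases hin2 : T ≤ s
    · rw [hθ] at hs ⊢
      have : site η V' (sample u τ (angle η)) i = 0 := by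
        refine site_eq_zero_of_circ hy' he' hye' hη hη1 hV'y' (φ := s - T) ?_ ?_ ?_
        · rw [sample, ← hs]; exact h.after_u _ hin2
        · rw [sample_succ, ← hs, h.after_u _ (by rw [← hθ]; linarith)]; congr 1; ring
        · rw [sample_succ_succ, ← hs, h.after_u _ (by rw [← hθ]; linarith)]; congr 1; ring
      rw [this, ENNReal.ofReal_zero]; exact zero_le
    push Not at hin1 hin2
    have hsub : ∀ x ∈ Icc s (s + θ + θ), x ∈ Icc (-1) (T + 1) := fun x hx =>
      ⟨by linarith [hx.1], by linarith [hx.2]⟩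
    have hpt : ∀ x ∈ Ioc s (s + θ), ENNReal.ofReal ((site η V' (sample u τ θ) i -
        (1 + κ) / η ^ 3 * ‖A i‖ ^ 2) / θ) ≤ f x := by
      intro x hx
      have hxm : x ∈ Icc s (s + θ) := Ioc_subset_Icc_self hx
      have hx1 : x ∈ Icc (-1) (T + 1) := hsub x ⟨hx.1.le, by linarith [hx.2]⟩
      have hVx := hpot s ⟨by linarith, hin2.le⟩ x hxm
      have hle := site_sample_le (V := V') (τ := τ) (i := i) (x := x) (ω := σ) (B := B)
        (v₀ := V (w x) + σ) hη hη1 hκ hB1 hσ0.le (by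
          have := mul_le_mul_of_nonneg_right hησ hB0.le; linarith) hu hW hw hvw
        (by rw [← hθ, ← hs]; exact fun t ht => hB t (hsub t ht))
        (by
          rw [← hθ, ← hs]
          intro p hp q hq
          have := hδv p (hsub p hp) q (hsub q hq) (by
            rw [Real.dist_eq, abs_le]; constructor <;> linarith [hp.1, hp.2, hq.1, hq.2])
          rwa [dist_eq_norm] at this)
        (by rw [← hθ, ← hs]; exact hxm) (by linarith [hV (w x)]) (by
          rw [chi, ← hθ, sample_succ, sample, ← hs]
          exact hVx.trans (by gcongr; exact (min_le_left _ _).trans (min_le_left _ _)))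
      rw [← hθ] at hle
      have hfx : f x = ENNReal.ofReal ((‖w x‖ ^ 2 - 1) ^ 2 + V (w x) + ρ') := by
        rw [hf]
        simp only [indicator_of_mem hx1]
        rw [← ENNReal.ofReal_add (add_nonneg (sq_nonneg _) (hV _)) hρ'0.le]
      rw [hfx]
      refine ENNReal.ofReal_le_ofReal ?_
      rw [div_le_iff₀ hθ0, hA]
      have hρle : σ + (30 * B ^ 3 * (2 * σ + η * B) + (1 + 1 / κ) * (32 * σ ^ 2 * B ^ 2)) ≤ ρ' := by
        have h1 : η * B ≤ σ * B := mul_le_mul_of_nonneg_right hησ hB0.le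
        have h2 : σ ^ 2 ≤ σ := pow_le_of_le_one hσ0.le (by linarith) two_ne_zero
        have h3 : 30 * B ^ 3 * (2 * σ + η * B) ≤ 30 * B ^ 3 * (2 * σ + σ * B) :=
          mul_le_mul_of_nonneg_left (by linarith) (by positivity)
        have h4 : (1 + 1 / κ) * (32 * σ ^ 2 * B ^ 2) ≤ (1 + 1 / κ) * (32 * σ * B ^ 2) := by gcongr
        rw [hρ', hK₀]
        linarith
      have h5 := mul_le_mul_of_nonneg_left hρle hθ0.le
      linarith
    have hint : ENNReal.ofReal (site η V' (sample u τ θ) i - (1 + κ) / η ^ 3 * ‖A i‖ ^ 2) ≤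
        ∫⁻ x in Ioc s (s + θ), f x := by
      calc _ = ∫⁻ _x in Ioc s (s + θ), ENNReal.ofReal ((site η V' (sample u τ θ) i -
            (1 + κ) / η ^ 3 * ‖A i‖ ^ 2) / θ) := by
            rw [setLIntegral_const, Real.volume_Ioc, add_sub_cancel_left,
              ← ENNReal.ofReal_mul' hθ0.le, div_mul_cancel₀ _ hθ0.ne']
        _ ≤ _ := setLIntegral_mono' measurableSet_Ioc hpt
    rw [← hs]
    calc ENNReal.ofReal (site η V' (sample u τ θ) i)
        = ENNReal.ofReal ((1 + κ) / η ^ 3 * ‖A i‖ ^ 2 + (site η V' (sample u τ θ) i -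
          (1 + κ) / η ^ 3 * ‖A i‖ ^ 2)) := by rw [add_sub_cancel]
      _ ≤ ENNReal.ofReal ((1 + κ) / η ^ 3 * ‖A i‖ ^ 2) + ENNReal.ofReal (site η V' (sample u τ θ) i -
          (1 + κ) / η ^ 3 * ‖A i‖ ^ 2) := ENNReal.ofReal_add_le
      _ ≤ _ := by
        rw [ENNReal.ofReal_mul hc0, ENNReal.ofReal_pow (norm_nonneg _), ofReal_norm]
        exact add_le_add_right hint _
  have hJ : (∫⁻ x, ENNReal.ofReal ((‖w x‖ ^ 2 - 1) ^ 2 + V (w x))) + ∫⁻ x, ‖w' x‖ₑ ^ 2 ≤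
      ENNReal.ofReal C := by
    rw [← lintegral_add_right' _ (h.deriv_w.aestronglyMeasurable.enorm.pow_const 2)]
    refine le_trans (le_of_eq (lintegral_congr fun x => ?_)) h.cost
    rw [density, ENNReal.ofReal_add (add_nonneg (sq_nonneg _) (hV _)) (sq_nonneg _),
      ENNReal.ofReal_pow (norm_nonneg _), ofReal_norm]
  obtain ⟨J₀, hJ₀⟩ : ∃ J, J = ∫⁻ x, ENNReal.ofReal ((‖w x‖ ^ 2 - 1) ^ 2 + V (w x)) := ⟨_, rfl⟩
  obtain ⟨J₁, hJ₁⟩ : ∃ J, J = ∫⁻ x, ‖w' x‖ₑ ^ 2 := ⟨_, rfl⟩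
  rw [← hJ₀, ← hJ₁] at hJ
  have hkin := h.deriv_w.sum_second_difference_le hW hθ0 τ N
  rw [← hJ₁] at hkin
  have hfint : ∫⁻ x, f x ≤ J₀ + ENNReal.ofReal (ρ' * (T + 2)) := by
    rw [hf, lintegral_add_right _ (measurable_const.indicator measurableSet_Icc), ← hJ₀,
      lintegral_indicator_const measurableSet_Icc, Real.volume_Icc, ← ENNReal.ofReal_mul hρ'0.le]
    refine add_le_add_right (ENNReal.ofReal_le_ofReal (le_of_eq (by ring))) _
  -- The factor θ³ from the summed second differences meets η⁻³ from the site energy; their quotient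
  -- tends to 1.
  have hfac : (1 + κ) / η ^ 3 * θ ^ 3 ≤ 1 + 2 * κ := by
    have h1 : θ ^ 3 ≤ ((1 + η) * η) ^ 3 := pow_le_pow_left₀ hθ0.le hθη 3
    have h2 : (1 + η) ^ 3 ≤ 1 + κ / 2 := by
      have h3 : η ^ 2 ≤ η := pow_le_of_le_one hη.le hη1 two_ne_zero
      have h4 : η ^ 3 ≤ η := pow_le_of_le_one hη.le hη1 three_ne_zero
      linarith
    have h5 : κ * κ ≤ κ * 1 := mul_le_mul_of_nonneg_left hκ1 hκ.le
    calc (1 + κ) / η ^ 3 * θ ^ 3 ≤ (1 + κ) / η ^ 3 * ((1 + η) * η) ^ 3 := by gcongr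
      _ = (1 + κ) * (1 + η) ^ 3 := by field_simp
      _ ≤ (1 + κ) * (1 + κ / 2) := mul_le_mul_of_nonneg_left h2 (by linarith)
      _ ≤ _ := by linarith
  have hall : ENNReal.ofReal (∑ i ∈ Finset.range N, site η V' (sample u τ θ) i) ≤
      ENNReal.ofReal (C + ε) := by
    rw [ENNReal.ofReal_sum_of_nonneg fun i _ => site_nonneg hη hV' _ i]
    calc ∑ i ∈ Finset.range N, ENNReal.ofReal (site η V' (sample u τ θ) i)
        ≤ ∑ i ∈ Finset.range N, (ENNReal.ofReal ((1 + κ) / η ^ 3) * ‖A i‖ₑ ^ 2 +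
          ∫⁻ x in Ioc (τ + i * θ) (τ + i * θ + θ), f x) := Finset.sum_le_sum fun i _ => hsite i
      _ = ENNReal.ofReal ((1 + κ) / η ^ 3) * ∑ i ∈ Finset.range N, ‖A i‖ₑ ^ 2 +
          ∫⁻ x in Ioc τ (τ + N * θ), f x := by
          rw [Finset.sum_add_distrib, ← Finset.mul_sum, sum_setLIntegral_Ioc hθ0.le]
      _ ≤ ENNReal.ofReal ((1 + κ) / η ^ 3) * (ENNReal.ofReal (θ ^ 3) * J₁) +
          (J₀ + ENNReal.ofReal (ρ' * (T + 2))) := by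
          refine add_le_add (mul_le_mul' le_rfl ?_) ((setLIntegral_le_lintegral _ _).trans hfint)
          rw [hA]; exact hkin
      _ ≤ ENNReal.ofReal (1 + 2 * κ) * J₁ + (J₀ + ENNReal.ofReal (ρ' * (T + 2))) := by
          rw [← mul_assoc, ← ENNReal.ofReal_mul hc0]
          gcongr
      _ = (J₀ + J₁) + ENNReal.ofReal (2 * κ) * J₁ + ENNReal.ofReal (ρ' * (T + 2)) := by
          rw [ENNReal.ofReal_add zero_le_one (by positivity), ENNReal.ofReal_one]; ring
      _ ≤ ENNReal.ofReal C + ENNReal.ofReal (2 * κ) * ENNReal.ofReal C +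
          ENNReal.ofReal (ρ' * (T + 2)) := by
          gcongr
          exact le_add_self.trans hJ
      _ ≤ ENNReal.ofReal (C + ε) := by
          rw [← ENNReal.ofReal_mul (by positivity), ← ENNReal.ofReal_add hC (by positivity),
            ← ENNReal.ofReal_add (by positivity) (by positivity)]
          refine ENNReal.ofReal_le_ofReal ?_
          have : 0 ≤ ρ' := hρ'0.le
          rw [hρ'] at this ⊢
          linarith
  exact (ENNReal.ofReal_le_ofReal_iff (by positivity)).1 hall

/-! ### Gluing transitions along uniform rotations. -/

/-- `P` rotates uniformly about `y` at the times in `I`. -/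
def Rotates (y : E3) (P : ℝ → E3) (I : Set ℝ) : Prop :=
  ∃ e, ‖e‖ = 1 ∧ inner ℝ y e = 0 ∧ ∀ t ∈ I, P t = circ y e t

lemma Rotates.mono {y : E3} {P : ℝ → E3} {I J : Set ℝ} (h : Rotates y P I) (hJ : J ⊆ I) :
    Rotates y P J := by
  obtain ⟨e, h1, h2, h3⟩ := h
  exact ⟨e, h1, h2, fun t ht => h3 t (hJ ht)⟩

lemma Rotates.congr {y : E3} {P P' : ℝ → E3} {I : Set ℝ} (h : Rotates y P I)
    (hP : ∀ t ∈ I, P' t = P t) : Rotates y P' I := by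
  obtain ⟨e, h1, h2, h3⟩ := h
  exact ⟨e, h1, h2, fun t ht => (hP t ht).trans (h3 t ht)⟩

lemma Rotates.shift {y : E3} (hy : ‖y‖ = 1) {P : ℝ → E3} {I : Set ℝ} (h : Rotates y P I) (τ : ℝ) :
    Rotates y (fun t => P (t - τ)) {t | t - τ ∈ I} := by
  obtain ⟨e, h1, h2, h3⟩ := h
  refine ⟨circ y e (-τ), (norm_circ hy h2 _).trans h1, inner_circ h2 _, fun t ht => ?_⟩
  show P (t - τ) = _
  rw [h3 _ ht, circ_circ hy h2]
  congr 1
  ring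

/-- A curve on the sphere that rotates about `y` before time `0` and about `y'` after time `T`. -/
structure IsBridge (y y' : E3) (T : ℝ) (u : ℝ → E3) : Prop where
  nonneg : 0 ≤ T
  unit : ∀ t, ‖u t‖ = 1
  before : Rotates y u (Iic 0)
  after : Rotates y' u (Ici T)
  lip : ∃ B, ∀ s t, ‖u t - u s‖ ≤ B * |t - s|

lemma IsTransit.isBridge {V : E3 → ℝ} {y e y' e' : E3} {T : ℝ} {C : ℝ≥0∞} {u w a w' : ℝ → E3}
    (h : IsTransit V y e y' e' T C u w a w') (hT : 0 ≤ T) (hy : ‖y‖ = 1) (hy' : ‖y'‖ = 1) :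
    IsBridge y y' T u := by
  obtain ⟨he, hye⟩ := h.unit_before
  obtain ⟨he', hye'⟩ := h.unit_after
  refine ⟨hT, h.unit, ⟨e, he, hye, fun t ht => h.before_u t ht⟩, ?_, ?_⟩
  · refine ⟨circ y' e' (-T), (norm_circ hy' hye' _).trans he', inner_circ hye' _, fun t ht => ?_⟩
    rw [h.after_u t ht, circ_circ hy' hye']
    congr 1
    ring
  · have hwc : Continuous w := hasSobolevDeriv_continuous h.deriv_w
    have huc : Continuous u := hasSobolevDeriv_continuous h.deriv_u
    have hvc : Continuous fun r => cross (w r) (u r) := continuous_cross.comp (hwc.prodMk huc)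
    obtain ⟨B, hB⟩ := (isCompact_Icc (a := (0 : ℝ)) (b := T)).exists_bound_of_continuousOn
      hwc.continuousOn
    have hw : ∀ t, ‖w t‖ ≤ max B 1 := by
      intro t
      rcases le_total t 0 with h0 | h0
      · rw [h.before_w t h0, hy]; exact le_max_right _ _
      rcases le_total t T with h1 | h1
      · exact (hB t ⟨h0, h1⟩).trans (le_max_left _ _)
      · rw [h.after_w t h1, hy']; exact le_max_right _ _
    refine ⟨max B 1, fun s t => ?_⟩
    have := convex_univ.norm_image_sub_le_of_norm_hasDerivWithin_le (C := max B 1)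
      (fun t _ => (h.deriv_u.hasDerivAt hvc t).hasDerivWithinAt) (fun t _ => ?_) (mem_univ s)
      (mem_univ t)
    · rwa [Real.norm_eq_abs] at this
    · refine (norm_cross_le _ _).trans ?_
      rw [h.unit, mul_one]; exact hw t

lemma site_congr {η : ℝ} {V : E3 → ℝ} {u u' : ℕ → E3} {i j : ℕ} (h0 : u i = u' j)
    (h1 : u (i + 1) = u' (j + 1)) (h2 : u (i + 2) = u' (j + 2)) : site η V u i = site η V u' j := by
  simp only [site, bend, chi, speed]
  rw [show i + 1 + 1 = i + 2 from rfl, show j + 1 + 1 = j + 2 from rfl, h0, h1, h2]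

lemma inner_circ_circ {y e : E3} (hy : ‖y‖ = 1) (he : ‖e‖ = 1) (hye : inner ℝ y e = 0) (φ ψ : ℝ) :
    inner ℝ (circ y e φ) (circ y e ψ) = Real.cos (ψ - φ) := by
  have h1 : inner ℝ e e = (1 : ℝ) := by rw [real_inner_self_eq_norm_sq, he]; norm_num
  have h2 : inner ℝ (cross y e) (cross y e) = (1 : ℝ) := by
    rw [real_inner_self_eq_norm_sq, norm_cross_of_orthogonal hye, hy, he]; norm_num
  have h3 : inner ℝ e (cross y e) = (0 : ℝ) := inner_cross_right _ _
  have h4 : inner ℝ (cross y e) e = (0 : ℝ) := by rw [real_inner_comm]; exact h3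
  simp only [circ, inner_add_left, inner_add_right, inner_smul_left, inner_smul_right, h1, h2, h3, h4,
    Real.cos_sub]
  simp

lemma norm_circ_sub_le {y e : E3} (hy : ‖y‖ = 1) (he : ‖e‖ = 1) (hye : inner ℝ y e = 0) {θ : ℝ}
    (hθ : 0 ≤ θ) (t : ℝ) : ‖circ y e (t + θ) - circ y e t‖ ≤ θ := by
  refine (pow_le_pow_iff_left₀ (norm_nonneg _) hθ two_ne_zero).1 ?_
  rw [norm_sub_sq_real, norm_circ hy hye, norm_circ hy hye, real_inner_comm,
    inner_circ_circ hy he hye, he, add_sub_cancel_left]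
  linarith [Real.one_sub_sq_div_two_le_cos (x := θ)]

/-- The j-th transition may start at any time in [σ j, σ j + 2π]; within that window the phase of
the running rotation about y j coincides with the initial phase of u j, and the curve switches over.
Gaps of length 2θ ensure that every triple of consecutive samples lies entirely on the old curve or
entirely on the new one, so the site energies add. -/
lemma exists_concatenation {y : ℕ → E3} (hy : ∀ j, ‖y j‖ = 1) {T : ℕ → ℝ} {u : ℕ → ℝ → E3}
    (hu : ∀ j, IsBridge (y j) (y (j + 1)) (T j) (u j)) {σ : ℕ → ℝ} {θ : ℝ} (hθ : 0 < θ) (m : ℕ)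
    (hσ : ∀ j, j + 1 < m → σ j + 2 * Real.pi + T j + 2 * θ ≤ σ (j + 1)) :
    ∃ P : ℝ → E3, (∀ t, ‖P t‖ = 1) ∧
      (∀ j ≤ m, Rotates (y j) P {t | (∀ k, k + 1 = j → σ k + 2 * Real.pi + T k ≤ t) ∧
        (j < m → t ≤ σ j)}) ∧
      (∀ B, θ ≤ B → (∀ j < m, ∀ t, ‖u j (t + θ) - u j t‖ ≤ B) → ∀ t, ‖P (t + θ) - P t‖ ≤ B) ∧
      ∀ η, 0 < η → η ≤ 1 → θ = angle η → ∀ V : E3 → ℝ, (∀ x, 0 ≤ V x) →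
        (∀ j ≤ m, ∀ r : ℝ, V (r • y j) = 0) → ∀ B : ℕ → ℝ,
        (∀ j < m, ∀ τ N, ∑ i ∈ Finset.range N, site η V (sample (u j) τ θ) i ≤ B j) →
        ∀ N, ∑ i ∈ Finset.range N, site η V (sample P 0 θ) i ≤ ∑ j ∈ Finset.range m, B j := by
  have hpi := Real.pi_pos
  induction m with
  | zero =>
    obtain ⟨e, he, hye⟩ := exists_unit_orthogonal (y 0)
    refine ⟨circ (y 0) e, fun t => (norm_circ (hy 0) hye t).trans he, ?_, ?_, ?_⟩
    · intro j hj
      rw [Nat.le_zero.1 hj]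
      exact ⟨e, he, hye, fun t _ => rfl⟩
    · intro B hB _ t
      exact (norm_circ_sub_le (hy 0) he hye hθ.le t).trans hB
    · intro η hη hη1 hθη V hV hVy B hB N
      rw [Finset.range_zero, Finset.sum_empty]
      refine le_of_eq (Finset.sum_eq_zero fun i _ => ?_)
      rw [hθη]
      refine site_eq_zero_of_circ (hy 0) he hye hη hη1 (hVy 0 le_rfl) (φ := 0 + i * angle η) rfl ?_ ?_
      · rw [sample_succ]
      · rw [sample_succ_succ]; congr 1; ring
  | succ m ih =>
    obtain ⟨P, hP1, hP2, hP3, hP4⟩ := ih fun j hj => hσ j (by omega)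
    obtain ⟨J, hJ⟩ : ∃ J : Set ℝ, J = {t | ∀ k, k + 1 = m → σ k + 2 * Real.pi + T k ≤ t} := ⟨_, rfl⟩
    have hJmem : ∀ t, t ∈ J ↔ ∀ k, k + 1 = m → σ k + 2 * Real.pi + T k ≤ t := by
      intro t; rw [hJ]; rfl
    have hrot : Rotates (y m) P J := by
      refine (hP2 m le_rfl).mono fun t ht => ⟨(hJmem t).1 ht, fun h => absurd h (lt_irrefl _)⟩
    obtain ⟨e₁, he₁, hye₁, hPe₁⟩ := hrot
    obtain ⟨e₂, he₂, hye₂, hue₂⟩ := (hu m).before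
    -- The waiting time: at τ the old rotation passes through the initial point of the new curve,
    -- and then both agree wherever both rotate about y m.
    obtain ⟨τ, hτ, hτe⟩ := exists_circ_eq (hy m) he₁ he₂ hye₁ hye₂ (σ m)
    have hphase : ∀ t, circ (y m) e₂ (t - τ) = circ (y m) e₁ t := by
      intro t
      rw [← hτe, circ_circ (hy m) hye₁]
      congr 1
      ring
    have hJlow : ∀ t, σ m - 2 * θ ≤ t → t ∈ J := by
      intro t ht
      refine (hJmem t).2 fun k hk => ?_
      have := hσ k (by omega)
      rw [hk] at this
      linarith
    have hJup : ∀ {s t}, s ∈ J → s ≤ t → t ∈ J := fun hs hst =>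
      (hJmem _).2 fun k hk => ((hJmem _).1 hs k hk).trans hst
    obtain ⟨P', hP'⟩ : ∃ P' : ℝ → E3, P' = fun t => if t ≤ τ then P t else u m (t - τ) := ⟨_, rfl⟩
    have hPl : ∀ t ≤ τ, P' t = P t := fun t ht => by rw [hP']; exact if_pos ht
    have hPr : ∀ t ∈ J, P' t = u m (t - τ) := by
      intro t ht
      by_cases h : t ≤ τ
      · rw [hPl t h, hPe₁ t ht, ← hphase, hue₂ _ (by simp only [mem_Iic]; linarith)]
      · rw [hP']; exact if_neg h
    have hmonoσ : ∀ j ≤ m, σ j ≤ σ m := by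
      intro j hj
      induction hj using Nat.decreasingInduction with
      | of_succ k hk ih =>
        have h1 := hσ k (by omega)
        have h2 := (hu k).nonneg
        exact le_trans (by linarith) ih
      | self => exact le_rfl
    -- Either the window ends before τ, or it starts after τ − 2θ. There the old curve already
    -- rotates about y m and hence coincides with the shifted new one.
    have hdich : ∀ t, (∀ x ∈ Icc t (t + 2 * θ), P' x = P x) ∨
        ∀ x ∈ Icc t (t + 2 * θ), P' x = u m (x - τ) := by
      intro t
      by_cases h : t + 2 * θ ≤ τ
      · exact Or.inl fun x hx => hPl x (hx.2.trans h)
      · have ht : t ∈ J := hJlow t (by linarith [hτ.1])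
        exact Or.inr fun x hx => hPr x (hJup ht hx.1)
    refine ⟨P', ?_, ?_, ?_, ?_⟩
    · intro t
      by_cases h : t ≤ τ
      · rw [hPl t h]; exact hP1 t
      · have : P' t = u m (t - τ) := by rw [hP']; exact if_neg h
        rw [this]; exact (hu m).unit _
    · intro j hj
      rcases hj.lt_or_eq with h | rfl
      · have hjm : j ≤ m := by omega
        refine ((hP2 j hjm).mono fun t ht => ⟨ht.1, fun _ => ht.2 h⟩).congr fun t ht => hPl t ?_
        exact (ht.2 h).trans ((hmonoσ j hjm).trans hτ.1)
      · refine (((hu m).after.shift (hy (m + 1)) τ).mono fun t ht => ?_).congr fun t ht => hPr t ?_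
        · have := ht.1 m rfl
          have := hτ.2
          simp only [mem_ofPred_eq, mem_Ici]
          linarith
        · have := ht.1 m rfl
          have := (hu m).nonneg
          exact hJlow t (by linarith)
    · intro B hB hBu t
      have h1 : t ∈ Icc t (t + 2 * θ) := ⟨le_rfl, by linarith⟩
      have h2 : t + θ ∈ Icc t (t + 2 * θ) := ⟨by linarith, by linarith⟩
      rcases hdich t with h | h
      · rw [h _ h1, h _ h2]
        exact hP3 B hB (fun j hj => hBu j (by omega)) t
      · rw [h _ h1, h _ h2]
        have := hBu m (by omega) (t - τ)
        rwa [sub_add_eq_add_sub] at this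
    · intro η hη hη1 hθη V hV hVy B hB N
      have hIH := hP4 η hη hη1 hθη V hV (fun j hj => hVy j (by omega)) B
        (fun j hj => hB j (by omega)) N
      have hm := hB m (by omega) (-τ) N
      rw [Finset.sum_range_succ]
      refine le_trans ?_ (add_le_add hIH hm)
      rw [← Finset.sum_add_distrib]
      -- Each site of the glued curve is a site of one of the two curves, and the other one
      -- contributes a nonnegative term.
      refine Finset.sum_le_sum fun i _ => ?_
      obtain ⟨t, ht⟩ : ∃ t, t = 0 + (i : ℝ) * θ := ⟨_, rfl⟩
      have h1 : t ∈ Icc t (t + 2 * θ) := ⟨le_rfl, by linarith⟩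
      have h2 : t + θ ∈ Icc t (t + 2 * θ) := ⟨by linarith, by linarith⟩
      have h3 : t + θ + θ ∈ Icc t (t + 2 * θ) := ⟨by linarith, by linarith⟩
      have n1 := site_nonneg hη hV (sample P 0 θ) i
      have n2 := site_nonneg hη hV (sample (u m) (-τ) θ) i
      rcases hdich t with h | h
      · have : site η V (sample P' 0 θ) i = site η V (sample P 0 θ) i := by
          refine site_congr ?_ ?_ ?_
          · rw [sample, sample, ← ht]; exact h t h1
          · rw [sample_succ, sample_succ, ← ht]; exact h _ h2
          · rw [sample_succ_succ, sample_succ_succ, ← ht]; exact h _ h3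
        linarith
      · have : site η V (sample P' 0 θ) i = site η V (sample (u m) (-τ) θ) i := by
          refine site_congr ?_ ?_ ?_
          · rw [sample, sample, ← ht, h t h1, ht]; congr 1; ring
          · rw [sample_succ, sample_succ, ← ht, h _ h2, ht]; congr 1; ring
          · rw [sample_succ_succ, sample_succ_succ, ← ht, h _ h3, ht]; congr 1; ring
        linarith

lemma IsTransit.hasDerivAt {V : E3 → ℝ} {y e y' e' : E3} {T : ℝ} {C : ℝ≥0∞} {u w a w' : ℝ → E3}
    (h : IsTransit V y e y' e' T C u w a w') (t : ℝ) : HasDerivAt u (cross (w t) (u t)) t :=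
  h.deriv_u.hasDerivAt (continuous_cross.comp ((hasSobolevDeriv_continuous h.deriv_w).prodMk
    (hasSobolevDeriv_continuous h.deriv_u))) t

/-- u and u' are uniformly continuous on the compact interval, so the rescaled chord product
approximates u × u' = w uniformly there. -/
lemma IsTransit.exists_chord {V : E3 → ℝ} {y e y' e' : E3} {T : ℝ} {C : ℝ≥0∞} {u w a w' : ℝ → E3}
    (h : IsTransit V y e y' e' T C u w a w') {ω : ℝ} (hω : 0 < ω) :
    ∃ θ₀ > 0, ∀ θ, 0 < θ → θ ≤ θ₀ → ∀ s ∈ Icc (-1) T, ∀ x ∈ Icc s (s + θ),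
      ‖θ⁻¹ • cross (u s) (u (s + θ)) - w x‖ ≤ ω := by
  obtain ⟨v, hv⟩ : ∃ v, v = fun r => cross (w r) (u r) := ⟨_, rfl⟩
  have hwc : Continuous w := hasSobolevDeriv_continuous h.deriv_w
  have huc : Continuous u := hasSobolevDeriv_continuous h.deriv_u
  have hvc : Continuous v := by rw [hv]; exact continuous_cross.comp (hwc.prodMk huc)
  have hu : ∀ t, HasDerivAt u (v t) t := fun t => by rw [hv]; exact h.hasDerivAt t
  have hw : ∀ t, w t = cross (u t) (v t) := by
    intro t
    rw [hv, cross_cross_right, real_inner_self_eq_norm_sq, h.unit, h.orth]; simp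
  have hcomp : IsCompact (Icc (-1) (T + 1)) := isCompact_Icc
  obtain ⟨B₀, hB₀⟩ := hcomp.exists_bound_of_continuousOn hvc.continuousOn
  obtain ⟨B, hBe⟩ : ∃ B, B = max B₀ 1 := ⟨_, rfl⟩
  have hB1 : 1 ≤ B := by rw [hBe]; exact le_max_right _ _
  have hB : ∀ t ∈ Icc (-1) (T + 1), ‖v t‖ ≤ B := fun t ht => by
    rw [hBe]; exact (hB₀ t ht).trans (le_max_left _ _)
  obtain ⟨κ, hκ⟩ : ∃ κ, κ = ω / (1 + B) := ⟨_, rfl⟩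
  have hκ0 : 0 < κ := by rw [hκ]; positivity
  have hκω : κ + κ * B = ω := by rw [hκ]; field_simp
  have hunif := Metric.uniformContinuousOn_iff_le.1
    (hcomp.uniformContinuousOn_of_continuous (huc.prodMk hvc).continuousOn) κ hκ0
  obtain ⟨δ, hδ, hδu⟩ := hunif
  refine ⟨min δ 1, by positivity, fun θ hθ hθδ s hs x hx => ?_⟩
  have hθ1 : θ ≤ 1 := hθδ.trans (min_le_right _ _)
  have hθ2 : θ ≤ δ := hθδ.trans (min_le_left _ _)
  have hsub : Icc s (s + θ) ⊆ Icc (-1) (T + 1) := Icc_subset_Icc hs.1 (by linarith [hs.2])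
  have hclose : ∀ r ∈ Icc s (s + θ), ‖u r - u x‖ ≤ κ ∧ ‖v r - v x‖ ≤ κ := by
    intro r hr
    have := hδu r (hsub hr) x (hsub hx) (by
      rw [Real.dist_eq, abs_le]; constructor <;> linarith [hr.1, hr.2, hx.1, hx.2])
    rw [Prod.dist_eq, dist_eq_norm, dist_eq_norm] at this
    exact max_le_iff.1 this
  have hs' : s ∈ Icc s (s + θ) := ⟨le_rfl, by linarith⟩
  have ht' : s + θ ∈ Icc s (s + θ) := ⟨by linarith, le_rfl⟩
  have hd := norm_sub_smul_le hu hs' ht' (by linarith) fun r hr => (hclose r hr).2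
  rw [add_sub_cancel_left] at hd
  obtain ⟨d, hde⟩ : ∃ d, d = u (s + θ) - u s - θ • v x := ⟨_, rfl⟩
  have hue : u (s + θ) = u s + θ • v x + d := by rw [hde]; abel
  rw [← hde] at hd
  have key : θ⁻¹ • cross (u s) (u (s + θ)) - w x =
      cross (u s - u x) (v x) + θ⁻¹ • cross (u s) d := by
    rw [hue, hw x, cross_add_right, cross_add_right, cross_same, zero_add, cross_smul_right, smul_add,
      smul_smul, inv_mul_cancel₀ hθ.ne', one_smul, cross_sub_left]
    abel
  rw [key]
  refine (norm_add_le _ _).trans ?_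
  have h1 : ‖cross (u s - u x) (v x)‖ ≤ κ * B :=
    (norm_cross_le _ _).trans (mul_le_mul (hclose s hs').1 (hB x (hsub hx)) (norm_nonneg _) hκ0.le)
  have h2 : ‖θ⁻¹ • cross (u s) d‖ ≤ κ := by
    rw [norm_smul, norm_inv, Real.norm_eq_abs, abs_of_pos hθ, inv_mul_le_iff₀ hθ]
    refine (norm_cross_le _ _).trans ?_
    rw [h.unit, one_mul, mul_comm]
    exact hd
  linarith

/-! ### Bridges for the different regimes. -/

/-- Some curve from rotation about `y` to rotation about `y'` can be sampled with energy at
most `c`, for all large `n`. -/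
def AdmitsBridge (η : ℕ → ℝ) (V : ℕ → E3 → ℝ) (y y' : E3) (c : ℝ) : Prop :=
  ∃ T u, IsBridge y y' T u ∧ ∀ᶠ n in atTop, ∀ (τ : ℝ) (N : ℕ),
    ∑ i ∈ Finset.range N, site (η n) (V n) (sample u τ (angle (η n))) i ≤ c

lemma eventually_le_of_tendsto_zero {η : ℕ → ℝ} (hη0 : Tendsto η atTop (𝓝 0)) {ρ : ℝ} (hρ : 0 < ρ) :
    ∀ᶠ n in atTop, η n ≤ ρ := (hη0.eventually (gt_mem_nhds hρ)).mono fun _ h => h.le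

lemma tendsto_angle_zero {η : ℕ → ℝ} (hη0 : Tendsto η atTop (𝓝 0)) :
    Tendsto (fun n => angle (η n)) atTop (𝓝 0) := by
  have : Continuous angle := by unfold angle; fun_prop
  have h := (this.tendsto 0).comp hη0
  rwa [show angle 0 = 0 by simp [angle]] at h

/-- The bound κ n → 0 makes the potential negligible uniformly, so one slow change of axis, chosen
without any potential, serves all large n. -/
lemma admitsBridge_of_vanishing {η κ : ℕ → ℝ} {V : ℕ → E3 → ℝ} (hη : ∀ n, 0 < η n)
    (hη0 : Tendsto η atTop (𝓝 0)) (hκ : Tendsto κ atTop (𝓝 0)) (hV : ∀ n x, 0 ≤ V n x)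
    (hVκ : ∀ n x, V n x ≤ κ n) {y y' : E3} (hy : ‖y‖ = 1) (hy' : ‖y'‖ = 1)
    (hVy : ∀ n, ∀ r : ℝ, V n (r • y) = 0) (hVy' : ∀ n, ∀ r : ℝ, V n (r • y') = 0) {ε : ℝ}
    (hε : 0 < ε) : AdmitsBridge η V y y' ε := by
  obtain ⟨e, he, hye⟩ := exists_unit_orthogonal y
  obtain ⟨e', he', hye'⟩ := exists_unit_orthogonal y'
  obtain ⟨T, u, w, a, w', hT, h⟩ := (reach_slow hy hy' he he' hye hye' (half_pos hε)).exists_isTransit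
    hy hy' rfl rfl
  obtain ⟨ρ, hρ, H⟩ := h.exists_sum_site_sample_le hy hy' hT (half_pos hε).le (fun _ => le_rfl)
    (half_pos hε)
  refine ⟨T, u, h.isBridge hT hy hy', ?_⟩
  filter_upwards [eventually_le_of_tendsto_zero hη0 hρ, eventually_le_of_tendsto_zero hκ hρ]
    with n h1 h2 τ N
  refine (H (η n) (hη n) h1 (V n) (hV n) (hVy n) (hVy' n) (fun s _ x _ => ?_) τ N).trans
    (add_halves ε).le
  rw [zero_add]
  exact (hVκ n _).trans h2

lemma exists_cross_eq_smul {a b z : E3} (hz : ‖z‖ = 1) (ha : inner ℝ z a = 0)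
    (hb : inner ℝ z b = 0) : ∃ r : ℝ, cross a b = r • z := by
  refine ⟨inner ℝ z (cross a b), ?_⟩
  have h1 : cross z (cross a b) = 0 := by rw [cross_cross_right, ha, hb]; simp
  have h2 := cross_cross_right z z (cross a b)
  have h0 : cross z 0 = 0 := by simpa only [zero_smul] using cross_smul_right 0 z 0
  rw [h1, h0, real_inner_self_eq_norm_sq, hz, one_pow, one_smul] at h2
  exact (sub_eq_zero.1 h2.symm).symm

/-- No size bound on V n is needed. Once the sampling angle is shorter than the stop, two
consecutive spins are both perpendicular to y or both perpendicular to y'. Their cross product then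
lies on the line of y or of y', where V n vanishes exactly. -/
lemma admitsBridge_hold {η : ℕ → ℝ} {V : ℕ → E3 → ℝ} (hη : ∀ n, 0 < η n)
    (hη0 : Tendsto η atTop (𝓝 0)) (hV : ∀ n x, 0 ≤ V n x) {y y' : E3} (hy : ‖y‖ = 1)
    (hy' : ‖y'‖ = 1) (hVy : ∀ n, ∀ r : ℝ, V n (r • y) = 0) (hVy' : ∀ n, ∀ r : ℝ, V n (r • y') = 0)
    {ε : ℝ} (hε : 0 < ε) : AdmitsBridge η V y y' (8 / 3 + ε) := by
  obtain ⟨e, e', T, u, w, a, w', t₀, h₀, hT, hh, h, hl, hr⟩ := exists_isTransit_hold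
    (V := fun _ => 0) hy hy' (fun _ => rfl) (fun _ => rfl) (half_pos hε)
  obtain ⟨ρ, hρ, H⟩ := h.exists_sum_site_sample_le hy hy' hT (by positivity) (fun _ => le_rfl)
    (half_pos hε)
  refine ⟨T, u, h.isBridge hT hy hy', ?_⟩
  filter_upwards [eventually_le_of_tendsto_zero hη0 hρ,
    eventually_le_of_tendsto_zero (tendsto_angle_zero hη0) hh] with n h1 h2 τ N
  refine (H (η n) (hη n) h1 (V n) (hV n) (hVy n) (hVy' n) (fun s _ x _ => ?_) τ N).trans
    (by linarith)
  have hθ := angle_pos (hη n)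
  have hline : ∀ {z : E3}, ‖z‖ = 1 → inner ℝ z (u s) = 0 → inner ℝ z (u (s + angle (η n))) = 0 →
      ∃ r : ℝ, cross (u s) (u (s + angle (η n))) = r • z := by
    intro z hz h3 h4
    exact exists_cross_eq_smul hz h3 h4
  have h0 : V n ((η n)⁻¹ • cross (u s) (u (s + angle (η n)))) = 0 := by
    rcases le_total s t₀ with h3 | h3
    · obtain ⟨r, hr⟩ := hline hy (hl s (by linarith)) (hl _ (by linarith))
      rw [hr, smul_smul]; exact hVy n _
    · obtain ⟨r, hr⟩ := hline hy' (hr s h3) (hr _ (by linarith))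
      rw [hr, smul_smul]; exact hVy' n _
  rw [h0, zero_add]
  exact hρ.le

lemma one_sub_sq_le_sin_angle_div {η : ℝ} (h0 : 0 < η) (h1 : η ≤ 1) :
    |Real.sin (angle η) / η - 1| ≤ η ^ 2 := by
  have hθ := angle_pos h0
  have h2 := angle_le h0 h1
  have h3 : angle η / 2 ≤ η := by
    have := mul_le_mul_of_nonneg_right h1 h0.le
    linarith
  have e : Real.sin (angle η) / η = Real.cos (angle η / 2) := by
    rw [show angle η = 2 * (angle η / 2) by ring, Real.sin_two_mul, sin_half_angle h0 h1]
    rw [show 2 * (angle η / 2) / 2 = angle η / 2 by ring]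
    field_simp
  have h4 := Real.one_sub_sq_div_two_le_cos (x := angle η / 2)
  have h5 : (angle η / 2) ^ 2 ≤ η ^ 2 := pow_le_pow_left₀ (by positivity) h3 2
  rw [e, abs_le]
  constructor
  · linarith [sq_nonneg η]
  · linarith [Real.cos_le_one (angle η / 2), sq_nonneg η]

lemma norm_chi_circ {y e : E3} (hy : ‖y‖ = 1) (he : ‖e‖ = 1) (hye : inner ℝ y e = 0) {η : ℝ}
    (h0 : 0 < η) (h1 : η ≤ 1) (φ : ℝ) :
    |‖η⁻¹ • cross (circ y e φ) (circ y e (φ + angle η))‖ - 1| ≤ η ^ 2 := by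
  have hsin := one_sub_sq_le_sin_angle_div h0 h1
  have h2 : 0 ≤ Real.sin (angle η) / η := by
    have := (abs_le.1 hsin).1
    have : η ^ 2 ≤ 1 := pow_le_one₀ h0.le h1
    linarith
  rw [cross_circ_circ he hye, add_sub_cancel_left, smul_smul, norm_smul, hy, mul_one, Real.norm_eq_abs,
    inv_mul_eq_div, abs_of_nonneg h2]
  exact hsin

/-- If w vanished somewhere, sampling the curve would give a chain whose chirality starts and ends
near the unit sphere and comes close to 0. Its bending energy would be almost 8/3, yet by sampling
it is at most C plus a small error. -/
lemma IsTransit.ne_zero {V : E3 → ℝ} {y e y' e' : E3} {T C : ℝ} {u w a w' : ℝ → E3}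
    (h : IsTransit V y e y' e' T (ENNReal.ofReal C) u w a w') (hy : ‖y‖ = 1)
    (hy' : ‖y'‖ = 1) (hT : 0 ≤ T) (hC : 0 ≤ C) (hC' : C < 8 / 3) (hV : ∀ x, 0 ≤ V x) (t₀ : ℝ) :
    w t₀ ≠ 0 := by
  intro hw0
  have ht0 : 0 < t₀ := by
    by_contra! h1
    rw [h.before_w t₀ h1] at hw0
    rw [hw0, norm_zero] at hy; exact zero_ne_one hy
  have ht1 : t₀ < T := by
    by_contra! h1
    rw [h.after_w t₀ h1] at hw0
    rw [hw0, norm_zero] at hy'; exact zero_ne_one hy'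
  obtain ⟨he, hye⟩ := h.unit_before
  obtain ⟨he', hye'⟩ := h.unit_after
  obtain ⟨ε, hε, hCε⟩ : ∃ ε, 0 < ε ∧ C + ε < 8 / 3 - ε := ⟨(8 / 3 - C) / 3, by linarith, by linarith⟩
  obtain ⟨ρ, hρ, H⟩ := h.exists_sum_site_sample_le hy hy' hT hC hV hε
  obtain ⟨r, hr, η₀, hη₀, hdip⟩ := eight_thirds_le_sum_bend hε
  obtain ⟨θ₀, hθ₀, hchord⟩ := h.exists_chord (show 0 < r / 3 by positivity)
  obtain ⟨η, ⟨⟨⟨⟨hη1, hηρ⟩, hηη⟩, hηθ⟩, hηr⟩, hη0⟩ : ∃ η : ℝ, ((((η * 1 < 1 ∧ η * 1 < ρ) ∧ η * 1 < η₀) ∧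
      η * 2 < θ₀) ∧ η * 1 < r) ∧ 0 < η :=
    (((((((eventually_mul_lt 1 one_pos).and (eventually_mul_lt 1 hρ)).and
      (eventually_mul_lt 1 hη₀)).and (eventually_mul_lt 2 hθ₀)).and (eventually_mul_lt 1 hr))).and
        self_mem_nhdsWithin).exists
  rw [mul_one] at hη1 hηρ hηη hηr
  have hθ := angle_pos hη0
  have hθ2 : angle η ≤ 2 * η := (angle_le hη0 hη1.le).trans
    (mul_le_mul_of_nonneg_right (by linarith) hη0.le)
  obtain ⟨θ, hθe⟩ : ∃ θ, θ = angle η := ⟨_, rfl⟩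
  rw [← hθe] at hθ hθ2
  obtain ⟨j, hj⟩ := exists_nat_gt ((t₀ + θ) / θ)
  rw [div_lt_iff₀ hθ] at hj
  obtain ⟨M, hM⟩ := exists_nat_gt ((T - t₀) / θ)
  rw [div_lt_iff₀ hθ] at hM
  -- The offset makes the j-th sample hit t₀. The choices of j and M put the first and last pairs of
  -- samples on the uniform rotations.
  obtain ⟨τ, hτ⟩ : ∃ τ, τ = t₀ - j * θ := ⟨_, rfl⟩
  have hbig := hdip η hη0 hηη.le (sample u τ θ) (j + M) j (fun i _ => h.unit _) (by omega) ?_ ?_ ?_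
  · have hsmall := H η hη0 hηρ.le (fun _ => 0) (fun _ => le_rfl) (fun _ => rfl) (fun _ => rfl)
      (fun s _ x _ => by have := hV (w x); linarith) τ (j + M)
    rw [← hθe] at hsmall
    have : ∀ i, site η (fun _ => 0) (sample u τ θ) i = bend η (sample u τ θ) i := by
      intro i; simp [site]
    simp only [this] at hsmall
    linarith
  · rw [chi, sample, sample, Nat.cast_zero, zero_mul, add_zero, zero_add, Nat.cast_one, one_mul,
      h.before_u _ (by linarith), h.before_u _ (by linarith), hθe]
    refine (norm_chi_circ hy he hye hη0 hη1.le τ).trans_lt ?_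
    calc η ^ 2 = η * η := sq η
      _ ≤ 1 * η := mul_le_mul_of_nonneg_right hη1.le hη0.le
      _ < r := by linarith
  · rw [chi, sample_succ, sample]
    have h1 : T ≤ τ + ↑(j + M) * θ := by push_cast; linarith
    rw [h.after_u _ h1, h.after_u _ (by linarith),
      show τ + ↑(j + M) * θ + θ - T = τ + ↑(j + M) * θ - T + angle η by rw [← hθe]; ring]
    refine (norm_chi_circ hy' he' hye' hη0 hη1.le _).trans_lt ?_
    calc η ^ 2 = η * η := sq η
      _ ≤ 1 * η := mul_le_mul_of_nonneg_right hη1.le hη0.le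
      _ < r := by linarith
  · rw [chi, sample_succ, sample, hτ, sub_add_cancel]
    have := hchord θ hθ (by linarith) t₀ ⟨by linarith, ht1.le⟩ t₀ ⟨le_rfl, by linarith⟩
    rw [hw0, sub_zero, norm_smul, norm_inv, Real.norm_eq_abs, abs_of_pos hθ, inv_mul_le_iff₀ hθ] at this
    rw [norm_smul, norm_inv, Real.norm_eq_abs, abs_of_pos hη0, inv_mul_lt_iff₀ hη0]
    have h2 : θ * (r / 3) ≤ 2 * η * (r / 3) := mul_le_mul_of_nonneg_right hθ2 (by positivity)
    have h3 : 0 < η * r := by positivity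
    linarith

/-- A budget above 8/3 is met by a curve with a stop. Otherwise a near-optimal transition of cost
below 8/3 never meets 0; G is then uniformly continuous near its range, and sampled penalties are
controlled by those of the profile, also after g₀ is replaced by g n. -/
lemma IsPenalty.admitsBridge_of_tendsto {Q : Set E3} {G : E3 → ℝ} (hQ : IsPenalty Q G)
    {η g : ℕ → ℝ} (hη : ∀ n, 0 < η n) (hη0 : Tendsto η atTop (𝓝 0)) (hg : ∀ n, 0 ≤ g n) {g₀ : ℝ}
    (hg₀ : 0 < g₀) (hgt : Tendsto g atTop (𝓝 g₀)) {y y' : E3} (hy : y ∈ Q) (hy' : y' ∈ Q) {c : ℝ}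
    (hc : transitionCost (fun x => 2 * g₀ * G x) y y' < ENNReal.ofReal c) :
    AdmitsBridge η (fun n x => g n * G x) y y' c := by
  have hVn : ∀ n x, 0 ≤ g n * G x := fun n x => mul_nonneg (hg n) (hQ.nonneg x)
  have hVy : ∀ z ∈ Q, ∀ n, ∀ r : ℝ, g n * G (r • z) = 0 := fun z hz n r => by
    rw [hQ.zero z hz, mul_zero]
  rcases lt_or_ge (8 / 3) c with hc8 | hc8
  · have := admitsBridge_hold hη hη0 hVn (hQ.unit y hy) (hQ.unit y' hy') (hVy y hy) (hVy y' hy')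
      (sub_pos.2 hc8)
    rwa [add_sub_cancel] at this
  obtain ⟨b, hb1, hb2⟩ := exists_between hc
  have hbt : b ≠ ⊤ := (hb2.trans_le le_top).ne
  obtain ⟨b', hb', rfl⟩ : ∃ b', 0 ≤ b' ∧ b = ENNReal.ofReal b' :=
    ⟨b.toReal, ENNReal.toReal_nonneg, (ENNReal.ofReal_toReal hbt).symm⟩
  have hbc : b' < c := (ENNReal.ofReal_lt_ofReal_iff'.1 hb2).1
  obtain ⟨ε, hε, hCε⟩ : ∃ ε, 0 < ε ∧ b' + ε + ε = c := ⟨(c - b') / 2, by linarith, by linarith⟩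
  have hyu := hQ.unit y hy
  have hyu' := hQ.unit y' hy'
  obtain ⟨e, he, hye⟩ := exists_unit_orthogonal y
  obtain ⟨e', he', hye'⟩ := exists_unit_orthogonal y'
  obtain ⟨V, hV⟩ : ∃ V : E3 → ℝ, V = fun x => 2 * g₀ * G x / 2 := ⟨_, rfl⟩
  have hVe : ∀ x, V x = g₀ * G x := fun x => by rw [hV]; ring
  have hVe' : V = fun x => g₀ * G x := funext hVe
  have hsm : ∀ z ∈ Q, SmallNear (fun x => 2 * g₀ * G x / 2) z := fun z hz => by
    rw [← hV, hVe']; exact hQ.smallNear hz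
  have hreach := reach_of_transitionCost_lt (F := fun x => 2 * g₀ * G x) hyu hyu' he he' hye hye'
    (hsm y hy) (hsm y' hy') hb1 hε
  rw [← ENNReal.ofReal_add hb' hε.le, ← hV] at hreach
  obtain ⟨T, u, w, a, w', hT, h⟩ := hreach.exists_isTransit hyu hyu'
    (by rw [hVe, hQ.eq_zero hy, mul_zero]) (by rw [hVe, hQ.eq_zero hy', mul_zero])
  have hV0 : ∀ x, 0 ≤ V x := fun x => by rw [hVe]; exact mul_nonneg hg₀.le (hQ.nonneg x)
  have hne := h.ne_zero hyu hyu' hT (by positivity) (by linarith) hV0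
  obtain ⟨ρ, hρ, H⟩ := h.exists_sum_site_sample_le hyu hyu' hT (by positivity) hV0 hε
  have hwc : Continuous w := hasSobolevDeriv_continuous h.deriv_w
  have hcomp : IsCompact (Icc (-1) (T + 1)) := isCompact_Icc
  obtain ⟨R, hR⟩ := hcomp.exists_bound_of_continuousOn hwc.continuousOn
  obtain ⟨t₁, -, ht₁⟩ := hcomp.exists_isMinOn ⟨0, by constructor <;> linarith⟩ hwc.norm.continuousOn
  have hr : 0 < ‖w t₁‖ := norm_pos_iff.2 (hne t₁)
  obtain ⟨Γ, hΓ, hΓG⟩ := hQ.exists_bound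
  obtain ⟨δ, hδ, hδG⟩ := hQ.exists_uniform (R := R) hr (show 0 < ρ / (2 * g₀) by positivity)
  obtain ⟨θ₀, hθ₀, hchord⟩ := h.exists_chord hδ
  refine ⟨T, u, h.isBridge hT hyu hyu', ?_⟩
  have hgclose : ∀ᶠ n in atTop, g n - g₀ < ρ / (2 * Γ) := by
    have : Tendsto (fun n => g n - g₀) atTop (𝓝 0) := by simpa using hgt.sub_const g₀
    exact this.eventually (gt_mem_nhds (by positivity))
  filter_upwards [eventually_le_of_tendsto_zero hη0 hρ, hgclose,
    eventually_le_of_tendsto_zero (tendsto_angle_zero hη0) hθ₀,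
    eventually_le_of_tendsto_zero (tendsto_angle_zero hη0) one_pos] with n h1 h2 h3 h4 τ N
  have hθ := angle_pos (hη n)
  refine (H (η n) (hη n) h1 (fun x => g n * G x) (hVn n) (hVy y hy n) (hVy y' hy' n)
    (fun s hs x hx => ?_) τ N).trans hCε.le
  have hx' : x ∈ Icc (-1) (T + 1) := ⟨hs.1.trans hx.1, by linarith [hs.2, hx.2]⟩
  have hGx := hδG (w x) _ (ht₁ hx') (hR x hx') (hchord _ hθ h3 s hs x hx)
  rw [hQ.hom _ (inv_pos.2 hθ)] at hGx
  rw [hQ.hom _ (inv_pos.2 (hη n)), hVe]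
  obtain ⟨X, hX⟩ : ∃ X, X = cross (u s) (u (s + angle (η n))) := ⟨_, rfl⟩
  rw [← hX] at hGx ⊢
  have e1 : g₀ * G X ≤ g₀ * G (w x) + ρ / 2 := by
    have := mul_le_mul_of_nonneg_left hGx hg₀.le
    have e : g₀ * (G (w x) + ρ / (2 * g₀)) = g₀ * G (w x) + ρ / 2 := by field_simp
    linarith
  have e2 : (g n - g₀) * G X ≤ ρ / 2 := by
    have := mul_le_mul_of_nonneg_right h2.le (hQ.nonneg X)
    have e3 := mul_le_mul_of_nonneg_left (hΓG X) (show 0 ≤ ρ / (2 * Γ) by positivity)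
    have e : ρ / (2 * Γ) * Γ = ρ / 2 := by field_simp
    linarith
  linarith

/-! ### Recovery sequences. -/

/-- The factor R converts lattice time into curve time, one lattice step being one sampling angle.
The glued curve rotates uniformly at both ends with that angle, so the first and the last scalar
product both equal its cosine; this is the boundary condition. -/
lemma exists_chain_of_gap {y : ℕ → E3} (hy : ∀ j, ‖y j‖ = 1) {T : ℕ → ℝ} {u : ℕ → ℝ → E3}
    (hu : ∀ j, IsBridge (y j) (y (j + 1)) (T j) (u j)) {η lam L R : ℝ} {m : ℕ} {s : ℕ → ℝ}
    (hη : 0 < η) (hη1 : η ≤ 1) (hlam : 0 < lam) (hlam1 : lam ≤ 1) (hR : lam * R = angle η)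
    (hL : 1 ≤ L) (hlip : ∀ j < m, ∀ t t', ‖u j t' - u j t‖ ≤ L * |t' - t|) (hs1 : s (m + 1) = 1)
    (hgap : ∀ j < m, s (j + 1) * R + 2 * Real.pi + T j + 2 * angle η ≤ s (j + 2) * R)
    (hfirst : 0 < m → angle η ≤ s 1 * R) :
    ∃ x : ℕ → E3, (∀ i, ‖x i‖ = 1) ∧ IsSpinChain lam x ∧
      (∀ V : E3 → ℝ, (∀ x, 0 ≤ V x) → (∀ j ≤ m, ∀ r : ℝ, V (r • y j) = 0) → ∀ B : ℕ → ℝ,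
        (∀ j < m, ∀ (τ : ℝ) (N : ℕ),
          ∑ i ∈ Finset.range N, site η V (sample (u j) τ (angle η)) i ≤ B j) →
        ∀ N, ∑ i ∈ Finset.range N, site η V x i ≤ ∑ j ∈ Finset.range m, B j) ∧
      (∀ i, ‖chi η x i‖ ≤ 2 * L) ∧
      ∀ j ≤ m, ∀ i : ℕ, (∀ k, k + 1 = j → s (k + 1) * R + 2 * Real.pi + T k ≤ i * angle η) →
        (j < m → i * angle η + angle η ≤ s (j + 1) * R) →
        chi η x i = (Real.sin (angle η) / η) • y j := by
  have hθ := angle_pos hη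
  have hθ2 : angle η ≤ 2 * η := (angle_le hη hη1).trans
    (mul_le_mul_of_nonneg_right (by linarith) hη.le)
  obtain ⟨θ, hθe⟩ : ∃ θ, θ = angle η := ⟨_, rfl⟩
  rw [← hθe] at hθ hθ2 hR hgap hfirst ⊢
  obtain ⟨P, hP1, hP2, hP3, hP4⟩ := exists_concatenation hy hu (σ := fun j => s (j + 1) * R) hθ m
    fun j hj => hgap j (by omega)
  have hrot : ∀ j ≤ m, ∀ i : ℕ, (∀ k, k + 1 = j → s (k + 1) * R + 2 * Real.pi + T k ≤ i * θ) →
      (j < m → i * θ + θ ≤ s (j + 1) * R) → ∃ e, ‖e‖ = 1 ∧ inner ℝ (y j) e = 0 ∧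
        sample P 0 θ i = circ (y j) e (i * θ) ∧ sample P 0 θ (i + 1) = circ (y j) e (i * θ + θ) := by
    intro j hj i h1 h2
    obtain ⟨e, he, hye, heP⟩ := hP2 j hj
    refine ⟨e, he, hye, ?_, ?_⟩
    · rw [sample, zero_add]
      exact heP _ ⟨h1, fun h => by have := h2 h; linarith⟩
    · rw [sample_succ, zero_add]
      exact heP _ ⟨fun k hk => by have := h1 k hk; linarith, h2⟩
  have hN1 : 1 ≤ lastSite lam := Nat.le_floor (by rw [Nat.cast_one, one_le_div hlam]; exact hlam1)
  have hNlam : 1 - lam < lastSite lam * lam := by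
    have := Nat.lt_floor_add_one (1 / lam)
    rw [div_lt_iff₀ hlam] at this
    rw [lastSite]; linarith
  refine ⟨sample P 0 θ, fun i => hP1 _, ⟨fun i _ => hP1 _, ?_⟩, ?_, ?_, ?_⟩
  · obtain ⟨e, he, hye, h0, h1⟩ := hrot 0 (Nat.zero_le m) 0 (fun k hk => by omega)
      (fun h => by have := hfirst h; rw [Nat.cast_zero]; linarith)
    obtain ⟨M, hM⟩ : ∃ M, lastSite lam = M + 1 := ⟨lastSite lam - 1, by omega⟩
    rw [hM, Nat.cast_add, Nat.cast_one] at hNlam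
    -- The last pair of spins sits up to two sampling steps before the curve time R of the right
    -- end; the margin 2 `angle η` in the gap condition absorbs this.
    obtain ⟨e', he', hye', h2, h3⟩ := hrot m le_rfl M (fun k hk => by
      have h4 := hgap k (by omega)
      have h5 : s (k + 2) = 1 := by rw [← hs1, ← hk]
      have hR0 : 0 < R := by
        by_contra! h
        have := mul_nonpos_of_nonneg_of_nonpos hlam.le h
        linarith
      have h6 := mul_lt_mul_of_pos_right hNlam hR0
      have h7 : (M + 1) * lam * R = (M + 1) * θ := by rw [mul_assoc, hR]
      have h8 : (1 - lam) * R = R - θ := by rw [← hR]; ring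
      rw [h5] at h4
      linarith) (fun h => absurd h (lt_irrefl m))
    rw [hM, Nat.add_sub_cancel, h2, h3, show (1 : ℕ) = 0 + 1 from rfl, h0, h1,
      inner_circ_circ (hy 0) he hye, inner_circ_circ (hy m) he' hye']
    congr 1
    ring
  · exact fun V hV hVy B hB N => hP4 η hη hη1 hθe V hV hVy B hB N
  · intro i
    have h1 : ‖sample P 0 θ (i + 1) - sample P 0 θ i‖ ≤ L * θ := by
      rw [sample_succ, sample]
      refine hP3 (L * θ) (le_mul_of_one_le_left hθ.le hL) (fun j hj t => ?_) _
      have := hlip j hj t (t + θ)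
      rwa [add_sub_cancel_left, abs_of_pos hθ] at this
    have h2 : cross (sample P 0 θ i) (sample P 0 θ (i + 1)) =
        cross (sample P 0 θ i) (sample P 0 θ (i + 1) - sample P 0 θ i) := by
      rw [cross_sub_right, cross_same, sub_zero]
    have h3 : ‖sample P 0 θ i‖ = 1 := hP1 _
    rw [chi, h2, norm_smul, norm_inv, Real.norm_eq_abs, abs_of_pos hη, inv_mul_le_iff₀ hη]
    refine (norm_cross_le _ _).trans ?_
    rw [h3, one_mul]
    refine h1.trans ((mul_le_mul_of_nonneg_left hθ2 (by linarith)).trans ?_)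
    linarith
  · intro j hj i h1 h2
    obtain ⟨e, he, hye, h3, h4⟩ := hrot j hj i h1 h2
    rw [chi, h3, h4, cross_circ_circ he hye, add_sub_cancel_left, smul_smul, inv_mul_eq_div]

lemma tendsto_sin_angle_div {η : ℕ → ℝ} (hη : ∀ n, 0 < η n) (hη0 : Tendsto η atTop (𝓝 0)) :
    Tendsto (fun n => Real.sin (angle (η n)) / η n) atTop (𝓝 1) := by
  rw [tendsto_iff_norm_sub_tendsto_zero]
  refine squeeze_zero' (g := fun n => η n ^ 2) (Eventually.of_forall fun _ => norm_nonneg _) ?_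
    (by simpa using hη0.pow 2)
  filter_upwards [eventually_le_of_tendsto_zero hη0 one_pos] with n hn
  exact one_sub_sq_le_sin_angle_div (hη n) hn

/-- The bridges are fixed curves of bounded duration, while the intervals between breakpoints have
lengths (s (j+1) − s j) R n → ∞ in curve time. Hence the transitions fit for large n, and away from
the breakpoints the chirality is (sin θ/η) y j → y j. -/
lemma exists_isConverging {η lam : ℕ → ℝ} {V : ℕ → E3 → ℝ} (hη : ∀ n, 0 < η n)
    (hη0 : Tendsto η atTop (𝓝 0)) (hlam : ∀ n, 0 < lam n) (hlam0 : Tendsto lam atTop (𝓝 0))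
    (hratio : Tendsto (fun n => lam n / η n) atTop (𝓝 0)) (hV : ∀ n x, 0 ≤ V n x) {m : ℕ} {s : ℕ → ℝ}
    {y : ℕ → E3} (hy : ∀ j, ‖y j‖ = 1) (hVy : ∀ n j, ∀ r : ℝ, V n (r • y j) = 0) {B : ℕ → ℝ}
    (hb : ∀ j, AdmitsBridge η V (y j) (y (j + 1)) (B j)) (hs0 : s 0 = 0) (hs1 : s (m + 1) = 1)
    (hs : ∀ j ≤ m, s j < s (j + 1)) {z : ℝ → E3}
    (hz : ∀ᵐ t ∂volI, ∃ j ≤ m, t ∈ Ioo (s j) (s (j + 1)) ∧ z t = y j) :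
    ∃ u : ℕ → ℕ → E3, IsConverging η lam u z ∧ (∀ᶠ n in atTop, IsSpinChain (lam n) (u n) ∧
      ∑ i ∈ interiorSites (lam n), site (η n) (V n) (u n) i ≤ ∑ j ∈ Finset.range m, B j) ∧
      ∃ K, ∀ᶠ n in atTop, ∀ i, ‖chi (η n) (u n) i‖ ≤ K := by
  choose T u hu hub using hb
  choose L hL using fun j => (hu j).lip
  obtain ⟨K, hK⟩ : ∃ K, K = 1 + ∑ j ∈ Finset.range m, |L j| := ⟨_, rfl⟩
  have hLK : ∀ j < m, L j ≤ K := fun j hj => by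
    have := Finset.single_le_sum (fun i _ => abs_nonneg (L i)) (Finset.mem_range.2 hj)
    rw [hK]; linarith [le_abs_self (L j)]
  have hK1 : 1 ≤ K := by rw [hK]; linarith [Finset.sum_nonneg fun i (_ : i ∈ Finset.range m) => abs_nonneg (L i)]
  obtain ⟨R, hR⟩ : ∃ R : ℕ → ℝ, R = fun n => angle (η n) / lam n := ⟨_, rfl⟩
  have hRlam : ∀ n, lam n * R n = angle (η n) := fun n => by
    rw [hR]; exact mul_div_cancel₀ _ (hlam n).ne'
  have hRtop : Tendsto R atTop atTop := by
    have h1 : Tendsto (fun n => η n / lam n) atTop atTop := by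
      have : Tendsto (fun n => lam n / η n) atTop (𝓝[>] 0) :=
        tendsto_nhdsWithin_iff.2 ⟨hratio, Eventually.of_forall fun n => div_pos (hlam n) (hη n)⟩
      refine this.inv_tendsto_nhdsGT_zero.congr fun n => ?_
      simp
    refine tendsto_atTop_mono' _ ?_ h1
    filter_upwards [eventually_le_of_tendsto_zero hη0 one_pos] with n hn
    rw [hR]
    exact div_le_div_of_nonneg_right (le_angle (hη n) hn) (hlam n).le
  have hlin : ∀ {c : ℝ} (C : ℝ), 0 < c → ∀ᶠ n in atTop, C + 2 * angle (η n) ≤ c * R n := by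
    intro c C hc
    have h1 : Tendsto (fun n => c * R n) atTop atTop := hRtop.const_mul_atTop hc
    filter_upwards [h1.eventually_ge_atTop (C + 2),
      eventually_le_of_tendsto_zero (tendsto_angle_zero hη0) one_pos] with n h2 h3
    linarith
  have hgap : ∀ᶠ n in atTop, ∀ j ∈ Finset.range m,
      s (j + 1) * R n + 2 * Real.pi + T j + 2 * angle (η n) ≤ s (j + 2) * R n := by
    rw [Finset.eventually_all]
    intro j hj
    filter_upwards [hlin (2 * Real.pi + T j) (sub_pos.2 (hs (j + 1) (Finset.mem_range.1 hj)))] with n hn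
    linarith
  have hgood : ∀ᶠ n in atTop, η n ≤ 1 ∧ lam n ≤ 1 ∧ (∀ j ∈ Finset.range m,
      s (j + 1) * R n + 2 * Real.pi + T j + 2 * angle (η n) ≤ s (j + 2) * R n) ∧
      angle (η n) ≤ s 1 * R n := by
    have h01 : 0 < s 1 - s 0 := sub_pos.2 (hs 0 (Nat.zero_le m))
    filter_upwards [eventually_le_of_tendsto_zero hη0 one_pos,
      eventually_le_of_tendsto_zero hlam0 one_pos, hgap, hlin 0 h01] with n h1 h2 h3 h4
    refine ⟨h1, h2, h3, ?_⟩
    rw [hs0] at h4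
    linarith [angle_pos (hη n)]
  have hex : ∀ n, ∃ x : ℕ → E3, (∀ i, ‖x i‖ = 1) ∧ (η n ≤ 1 ∧ lam n ≤ 1 ∧ (∀ j ∈ Finset.range m,
      s (j + 1) * R n + 2 * Real.pi + T j + 2 * angle (η n) ≤ s (j + 2) * R n) ∧
      angle (η n) ≤ s 1 * R n → IsSpinChain (lam n) x ∧
      (∀ V : E3 → ℝ, (∀ x, 0 ≤ V x) → (∀ j ≤ m, ∀ r : ℝ, V (r • y j) = 0) → ∀ B : ℕ → ℝ,
        (∀ j < m, ∀ (τ : ℝ) (N : ℕ),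
          ∑ i ∈ Finset.range N, site (η n) V (sample (u j) τ (angle (η n))) i ≤ B j) →
        ∀ N, ∑ i ∈ Finset.range N, site (η n) V x i ≤ ∑ j ∈ Finset.range m, B j) ∧
      (∀ i, ‖chi (η n) x i‖ ≤ 2 * K) ∧
      ∀ j ≤ m, ∀ i : ℕ, (∀ k, k + 1 = j → s (k + 1) * R n + 2 * Real.pi + T k ≤ i * angle (η n)) →
        (j < m → i * angle (η n) + angle (η n) ≤ s (j + 1) * R n) →
        chi (η n) x i = (Real.sin (angle (η n)) / η n) • y j) := by
    intro n
    by_cases h : η n ≤ 1 ∧ lam n ≤ 1 ∧ (∀ j ∈ Finset.range m,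
      s (j + 1) * R n + 2 * Real.pi + T j + 2 * angle (η n) ≤ s (j + 2) * R n) ∧
      angle (η n) ≤ s 1 * R n
    · obtain ⟨x, hx1, hx2⟩ := exists_chain_of_gap hy hu (hη n) h.1 (hlam n) h.2.1 (hRlam n) hK1
        (fun j hj t t' => (hL j t t').trans (mul_le_mul_of_nonneg_right (hLK j hj) (abs_nonneg _)))
        hs1 (fun j hj => h.2.2.1 j (Finset.mem_range.2 hj)) (fun _ => h.2.2.2)
      exact ⟨x, hx1, fun _ => hx2⟩
    · exact ⟨fun _ => y 0, fun _ => hy 0, fun h' => absurd h' h⟩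
  choose x hx1 hx2 using hex
  refine ⟨x, ⟨hη, hη0, hlam, hlam0, hratio, fun n i _ => hx1 n i, ?_⟩, ?_, 2 * K, ?_⟩
  · filter_upwards [hz, ae_restrict_mem measurableSet_Ioo] with t ⟨j, hj, htj, hzt⟩ ht
    rw [hzt]
    have hlim : Tendsto (fun n => (Real.sin (angle (η n)) / η n) • y j) atTop (𝓝 (y j)) := by
      simpa using (tendsto_sin_angle_div hη hη0).smul_const (y j)
    refine hlim.congr' ?_
    obtain ⟨C, hC⟩ : ∃ C, ∀ k, k + 1 = j → 2 * Real.pi + T k ≤ C :=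
      ⟨2 * Real.pi + T (j - 1), fun k hk => by rw [← hk, Nat.add_sub_cancel]⟩
    filter_upwards [hgood, eventually_index hlam hlam0 ht, hlin C (sub_pos.2 htj.1),
      hlin 0 (sub_pos.2 htj.2)] with n h1 h2 h3 h4
    rw [min_eq_left (by omega)]
    have hRn : R n = angle (η n) / lam n := by rw [hR]
    have hθ := angle_pos (hη n)
    have e1 : t / lam n * angle (η n) = t * R n := by rw [hRn]; ring
    have h5 : (⌊t / lam n⌋₊ : ℝ) * angle (η n) ≤ t * R n := by
      rw [← e1]
      exact mul_le_mul_of_nonneg_right (Nat.floor_le (div_nonneg ht.1.le (hlam n).le)) hθ.le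
    have h6 : t * R n ≤ ((⌊t / lam n⌋₊ : ℝ) + 1) * angle (η n) := by
      rw [← e1]
      exact mul_le_mul_of_nonneg_right (Nat.lt_floor_add_one _).le hθ.le
    symm
    refine (hx2 n h1).2.2.2 j hj _ (fun k hk => ?_) fun _ => ?_
    · have := hC k hk
      rw [hk]
      linarith
    · linarith
  · filter_upwards [hgood, (Finset.eventually_all (Finset.range m)).2 fun j _ => hub j] with n h1 h2
    exact ⟨(hx2 n h1).1, (hx2 n h1).2.1 (V n) (hV n) (fun j _ r => hVy n j r) B
      (fun j hj => h2 j (Finset.mem_range.2 hj)) _⟩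
  · filter_upwards [hgood] with n h1
    exact (hx2 n h1).2.2.1

lemma measurable_chirality (lam del : ℝ) (u : ℕ → E3) : Measurable (chirality lam del u) := by
  have h1 : Measurable fun i : ℕ => (√(2 * del))⁻¹ • cross (u (min i (lastSite lam - 1)))
    (u (min i (lastSite lam - 1) + 1)) := Measurable.of_discrete
  exact h1.comp (Nat.measurable_floor.comp (measurable_id.div_const lam))

/-- The uniform bound K turns almost everywhere convergence of the chiralities into L¹ convergence.
-/
lemma IsConverging.exists_tendsto {del lam : ℕ → ℝ} {u : ℕ → ℕ → E3} {z : L1}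
    (h : IsConverging (fun n => √(2 * del n)) lam u z) {K : ℝ}
    (hK : ∀ᶠ n in atTop, ∀ i, ‖chi (√(2 * del n)) (u n) i‖ ≤ K) :
    ∃ x : ℕ → L1, (∀ᶠ n in atTop, (x n : ℝ → E3) =ᵐ[volI] chirality (lam n) (del n) (u n)) ∧
      Tendsto x atTop (𝓝 z) := by
  have hm : ∀ n, AEStronglyMeasurable (chirality (lam n) (del n) (u n)) volI := fun n =>
    (measurable_chirality _ _ _).aestronglyMeasurable
  have hbound : ∀ᶠ n in atTop, ∀ t, ‖chirality (lam n) (del n) (u n) t‖ ≤ K := by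
    filter_upwards [hK] with n hn t
    exact hn _
  have hex : ∀ n, ∃ x : L1, (∀ t, ‖chirality (lam n) (del n) (u n) t‖ ≤ K) →
      (x : ℝ → E3) =ᵐ[volI] chirality (lam n) (del n) (u n) := by
    intro n
    by_cases hb : ∀ t, ‖chirality (lam n) (del n) (u n) t‖ ≤ K
    · have hL : MemLp (chirality (lam n) (del n) (u n)) 1 volI :=
        MemLp.of_bound (hm n) K (Eventually.of_forall hb)
      exact ⟨hL.toLp _, fun _ => hL.coeFn_toLp⟩
    · exact ⟨0, fun h => absurd h hb⟩
  choose x hx using hex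
  refine ⟨x, hbound.mono hx, ?_⟩
  rw [Lp.tendsto_Lp_iff_tendsto_eLpNorm']
  have hzero : Tendsto (fun n => ∫⁻ t, ‖chirality (lam n) (del n) (u n) t - z t‖ₑ ∂volI) atTop
      (𝓝 (∫⁻ _, 0 ∂volI)) := by
    have hzm : AEStronglyMeasurable (z : ℝ → E3) volI := Lp.aestronglyMeasurable z
    refine tendsto_lintegral_filter_of_dominated_convergence'
      (fun t => ENNReal.ofReal K + ‖(z : ℝ → E3) t‖ₑ) ?_ ?_ ?_ ?_
    · exact Eventually.of_forall fun n => ((hm n).sub hzm).enorm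
    · filter_upwards [hbound] with n hn
      refine Eventually.of_forall fun t => (enorm_sub_le).trans (add_le_add_left ?_ _)
      rw [← ofReal_norm]
      exact ENNReal.ofReal_le_ofReal (hn t)
    · rw [lintegral_add_left measurable_const, lintegral_const]
      have h1 : ∫⁻ t, ‖(z : ℝ → E3) t‖ₑ ∂volI < ⊤ := by
        rw [← eLpNorm_one_eq_lintegral_enorm]; exact Lp.eLpNorm_lt_top z
      exact (ENNReal.add_lt_top.2 ⟨ENNReal.mul_lt_top ENNReal.ofReal_lt_top (measure_lt_top _ _), h1⟩).ne
    · filter_upwards [h.conv] with t ht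
      have h1 : Tendsto (fun n => chirality (lam n) (del n) (u n) t) atTop (𝓝 (z t)) := ht
      have h2 := (h1.sub_const (z t)).enorm
      simpa using h2
  rw [lintegral_zero] at hzero
  refine hzero.congr' ?_
  filter_upwards [hbound.mono hx] with n hn
  rw [eLpNorm_one_eq_lintegral_enorm]
  refine lintegral_congr_ae ?_
  filter_upwards [hn] with t ht
  rw [Pi.sub_apply, ht]

/-- A diagonal argument: choose xs n almost minimizing the larger of the distance to x and the
excess F n − F₀ x. The infimum tends to 0 by hypothesis. -/
lemma exists_recovery_of_edist_le {X : Type*} [PseudoEMetricSpace X] {F : ℕ → X → ℝ≥0∞}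
    {F₀ : X → ℝ≥0∞} {x : X} (h : ∀ ε : ℝ, 0 < ε → ∀ᶠ n in atTop, ∃ x', edist x' x ≤ ENNReal.ofReal ε ∧
      F n x' ≤ F₀ x + ENNReal.ofReal ε) :
    ∃ xs : ℕ → X, Tendsto xs atTop (𝓝 x) ∧ limsup (fun n => F n (xs n)) atTop ≤ F₀ x := by
  obtain ⟨d, hd⟩ : ∃ d : ℕ → X → ℝ≥0∞, d = fun n x' => max (edist x' x) (F n x' - F₀ x) := ⟨_, rfl⟩
  have hex : ∀ n, ∃ x', d n x' ≤ (⨅ x', d n x') + ((n : ℝ≥0∞) + 1)⁻¹ := by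
    intro n
    rcases eq_or_ne (⨅ x', d n x') ⊤ with h1 | h1
    · exact ⟨x, by rw [h1, top_add]; exact le_top⟩
    · have h2 : ((n : ℝ≥0∞) + 1)⁻¹ ≠ 0 :=
        ENNReal.inv_ne_zero.2 (ENNReal.add_ne_top.2 ⟨ENNReal.natCast_ne_top n, ENNReal.one_ne_top⟩)
      obtain ⟨x', hx'⟩ := iInf_lt_iff.1 (ENNReal.lt_add_right h1 h2)
      exact ⟨x', hx'.le⟩
  choose xs hxs using hex
  have hinf : Tendsto (fun n => ⨅ x', d n x') atTop (𝓝 0) := by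
    rw [ENNReal.tendsto_nhds_zero]
    intro ε hε
    obtain ⟨r, hr, hrε⟩ := exists_between hε
    have hrt : r ≠ ⊤ := (hrε.trans_le le_top).ne
    filter_upwards [h r.toReal (ENNReal.toReal_pos hr.ne' hrt)] with n ⟨x', h1, h2⟩
    rw [ENNReal.ofReal_toReal hrt] at h1 h2
    refine (iInf_le _ x').trans (le_trans ?_ hrε.le)
    rw [hd]
    exact max_le h1 (tsub_le_iff_left.2 h2)
  have hinv : Tendsto (fun n : ℕ => ((n : ℝ≥0∞) + 1)⁻¹) atTop (𝓝 0) := by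
    have := (tendsto_add_atTop_iff_nat (f := fun n : ℕ => (n : ℝ≥0∞)⁻¹) 1).2
      ENNReal.tendsto_inv_nat_nhds_zero
    simpa using this
  have hlim : Tendsto (fun n => d n (xs n)) atTop (𝓝 0) := by
    refine tendsto_of_tendsto_of_tendsto_of_le_of_le tendsto_const_nhds ?_ (fun _ => zero_le) hxs
    simpa using hinf.add hinv
  refine ⟨xs, ?_, ?_⟩
  · rw [tendsto_iff_edist_tendsto_0]
    refine tendsto_of_tendsto_of_tendsto_of_le_of_le tendsto_const_nhds hlim (fun _ => zero_le)
      fun n => ?_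
    simp only [hd]
    exact le_max_left _ _
  · have h1 : Tendsto (fun n => F₀ x + d n (xs n)) atTop (𝓝 (F₀ x)) := by
      simpa using hlim.const_add (F₀ x)
    rw [← h1.limsup_eq]
    refine limsup_le_limsup (Eventually.of_forall fun n => ?_)
    refine le_add_tsub.trans (add_le_add_right ?_ _)
    simp only [hd]
    exact le_max_right _ _

lemma exists_recovery_of_approx {X : Type*} [PseudoEMetricSpace X] {F : ℕ → X → ℝ≥0∞}
    {F₀ : X → ℝ≥0∞} {x : X} (h : ∀ ε : ℝ, 0 < ε → ∃ (x' : X) (xs : ℕ → X),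
      edist x' x ≤ ENNReal.ofReal ε ∧ Tendsto xs atTop (𝓝 x') ∧
      ∀ᶠ n in atTop, F n (xs n) ≤ F₀ x + ENNReal.ofReal ε) :
    ∃ xs : ℕ → X, Tendsto xs atTop (𝓝 x) ∧ limsup (fun n => F n (xs n)) atTop ≤ F₀ x := by
  refine exists_recovery_of_edist_le fun ε hε => ?_
  obtain ⟨x', xs, h1, h2, h3⟩ := h (ε / 2) (by positivity)
  have h4 := (tendsto_iff_edist_tendsto_0.1 h2).eventually
    (ge_mem_nhds (ENNReal.ofReal_pos.2 (half_pos hε)))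
  have h5 : ENNReal.ofReal (ε / 2) + ENNReal.ofReal (ε / 2) = ENNReal.ofReal ε := by
    rw [← ENNReal.ofReal_add (by positivity) (by positivity), add_halves]
  filter_upwards [h3, h4] with n h6 h7
  refine ⟨xs n, (edist_triangle _ x' _).trans ((add_le_add h7 h1).trans h5.le), h6.trans ?_⟩
  exact add_le_add_right (ENNReal.ofReal_le_ofReal (by linarith)) _

/-- `z` takes the value `y j` on the interval `(s j, s (j+1))`, for `0 ≤ j ≤ m`. -/
structure IsPiecewise (m : ℕ) (s : ℕ → ℝ) (y : ℕ → E3) (z : ℝ → E3) : Prop where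
  zero : s 0 = 0
  one : s (m + 1) = 1
  lt : ∀ j ≤ m, s j < s (j + 1)
  eq : ∀ᵐ t ∂volI, ∃ j ≤ m, t ∈ Ioo (s j) (s (j + 1)) ∧ z t = y j

lemma IsStep.isPiecewise {Q : Set E3} {z : ℝ → E3} {m : ℕ} {s : ℕ → ℝ} {y : ℕ → E3}
    (h : IsStep Q z m s y) : IsPiecewise m s y z := by
  refine ⟨h.zero, h.one, h.lt, ?_⟩
  have hall : ∀ᵐ t ∂volI, ∀ j, j ≤ m → t ∈ Ioo (s j) (s (j + 1)) → z t = y j := by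
    rw [ae_all_iff]
    intro j
    by_cases hj : j ≤ m
    · filter_upwards [h.eq j hj] with t ht _ using ht
    · exact Eventually.of_forall fun t hj' => absurd hj' hj
  filter_upwards [hall, (countable_range s).ae_notMem volI, ae_restrict_mem measurableSet_Ioo]
    with t h1 h2 h3
  obtain ⟨j, hj, h4, h5⟩ := h.exists_index h3
  have h6 : t ∈ Ioo (s j) (s (j + 1)) := ⟨lt_of_le_of_ne h4 fun h => h2 ⟨j, h⟩, h5⟩
  exact ⟨j, hj, h6, h1 j hj h6⟩

/-- Take a continuous L¹-approximation g of z, sample it on a fine grid and replace each sample by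
an almost nearest point of K. The distance from g to K is at most |g − z|, so no regularity of K is
needed. -/
lemma exists_piecewise_edist_le {K : Set E3} (hK : K.Nonempty) {z : L1} (hz : ∀ᵐ t ∂volI, z t ∈ K)
    {ε : ℝ} (hε : 0 < ε) : ∃ (z' : L1) (m : ℕ) (s : ℕ → ℝ) (y : ℕ → E3), IsPiecewise m s y z' ∧
      (∀ j, y j ∈ K) ∧ edist z' z ≤ ENNReal.ofReal ε := by
  obtain ⟨κ, hκ⟩ : ∃ κ, κ = ε / 5 := ⟨_, rfl⟩
  have hκ0 : 0 < κ := by rw [hκ]; positivity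
  obtain ⟨g, hg, -⟩ := (Lp.memLp z).exists_boundedContinuous_eLpNorm_sub_le ENNReal.one_ne_top
    (ENNReal.ofReal_pos.2 hκ0).ne'
  have hunif := Metric.uniformContinuousOn_iff_le.1 ((isCompact_Icc (a := (0 : ℝ))
    (b := 1)).uniformContinuousOn_of_continuous g.continuous.continuousOn) κ hκ0
  obtain ⟨δ, hδ, hδg⟩ := hunif
  obtain ⟨m, hm⟩ := exists_nat_one_div_lt hδ
  obtain ⟨s, hs⟩ : ∃ s : ℕ → ℝ, s = fun (j : ℕ) => (j : ℝ) / (m + 1) := ⟨_, rfl⟩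
  have hm0 : (0 : ℝ) < m + 1 := by positivity
  have hss : ∀ j, s (j + 1) = s j + 1 / (m + 1) := fun j => by rw [hs]; push_cast; ring
  have hy : ∀ j, ∃ y ∈ K, dist (g (s j)) y < Metric.infDist (g (s j)) K + κ := fun j =>
    (Metric.infDist_lt_iff hK).1 (by linarith)
  choose y hyK hyd using hy
  obtain ⟨f, hf⟩ : ∃ f : ℝ → E3, f = fun (t : ℝ) => y ⌊t * (m + 1)⌋₊ := ⟨_, rfl⟩
  have hfm : Measurable f := by
    rw [hf]
    exact (Measurable.of_discrete (f := y)).comp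
      (Nat.measurable_floor.comp (measurable_id.mul_const _))
  have hindex : ∀ t ∈ Ioo (0 : ℝ) 1, ⌊t * (m + 1)⌋₊ ≤ m ∧ s ⌊t * (m + 1)⌋₊ ≤ t ∧
      t < s (⌊t * (m + 1)⌋₊ + 1) := by
    intro t ht
    have h0 : 0 ≤ t * (m + 1) := mul_nonneg ht.1.le hm0.le
    refine ⟨?_, ?_, ?_⟩
    · refine Nat.lt_succ_iff.1 ((Nat.floor_lt h0).2 ?_)
      push_cast
      exact mul_lt_of_lt_one_left hm0 ht.2
    · simp only [hs]; rw [div_le_iff₀ hm0]; exact Nat.floor_le h0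
    · simp only [hs]; rw [lt_div_iff₀ hm0]; push_cast; exact Nat.lt_floor_add_one _
  have hs0 : ∀ j, 0 ≤ s j := fun j => by simp only [hs]; positivity
  have hs1 : ∀ j ≤ m, s j ≤ 1 := fun j hj => by
    simp only [hs]; rw [div_le_one hm0]
    have : (j : ℝ) ≤ m := by exact_mod_cast hj
    linarith
  have hfL : MemLp f 1 volI := by
    refine MemLp.of_bound hfm.aestronglyMeasurable (∑ j ∈ Finset.range (m + 1), ‖y j‖) ?_
    filter_upwards [ae_restrict_mem measurableSet_Ioo] with t ht
    rw [hf]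
    exact Finset.single_le_sum (f := fun j => ‖y j‖) (fun _ _ => norm_nonneg _)
      (Finset.mem_range.2 (Nat.lt_succ_iff.2 (hindex t ht).1))
  refine ⟨hfL.toLp f, m, s, y, ⟨?_, ?_, ?_, ?_⟩, hyK, ?_⟩
  · simp [hs]
  · simp only [hs]; push_cast; exact div_self hm0.ne'
  · intro j _; rw [hss]; linarith [one_div_pos.2 hm0]
  · filter_upwards [hfL.coeFn_toLp, (countable_range s).ae_notMem volI,
      ae_restrict_mem measurableSet_Ioo] with t h1 h2 h3
    obtain ⟨h4, h5, h6⟩ := hindex t h3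
    exact ⟨_, h4, ⟨lt_of_le_of_ne h5 fun h => h2 ⟨_, h⟩, h6⟩, by rw [h1, hf]⟩
  · have hpt : ∀ᵐ t ∂volI, ‖(hfL.toLp f : ℝ → E3) t - z t‖ₑ ≤
        ENNReal.ofReal 2 * ‖(z : ℝ → E3) t - g t‖ₑ + ENNReal.ofReal (3 * κ) := by
      filter_upwards [hfL.coeFn_toLp, hz, ae_restrict_mem measurableSet_Ioo] with t h1 h2 h3
      rw [h1]
      obtain ⟨h4, h5, h6⟩ := hindex t h3
      obtain ⟨j, hj⟩ : ∃ j, j = ⌊t * (m + 1)⌋₊ := ⟨_, rfl⟩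
      rw [← hj] at h4 h5 h6
      have hfj : f t = y j := by rw [hf, hj]
      have hsj := hs1 j h4
      rw [hss] at h6
      have e1 : dist (g (s j)) (g t) ≤ κ := hδg _ ⟨hs0 j, hsj⟩ _ ⟨h3.1.le, h3.2.le⟩ (by
        rw [Real.dist_eq, abs_le]; constructor <;> linarith)
      have e2 := hyd j
      have e3 : Metric.infDist (g (s j)) K ≤ Metric.infDist (g t) K + dist (g (s j)) (g t) :=
        Metric.infDist_le_infDist_add_dist
      have e4 : Metric.infDist (g t) K ≤ dist (g t) (z t) := Metric.infDist_le_dist_of_mem h2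
      have e5 : dist (y j) (z t) ≤ dist (y j) (g (s j)) + (dist (g (s j)) (g t) + dist (g t) (z t)) :=
        (dist_triangle _ _ _).trans (add_le_add_right (dist_triangle _ _ _) _)
      rw [dist_comm (y j) (g (s j))] at e5
      have e6 : ‖f t - z t‖ ≤ 2 * ‖(z : ℝ → E3) t - g t‖ + 3 * κ := by
        rw [hfj, ← dist_eq_norm, ← dist_eq_norm, dist_comm (z t)]
        linarith
      rw [← ofReal_norm, ← ofReal_norm, ← ENNReal.ofReal_mul (by norm_num),
        ← ENNReal.ofReal_add (by positivity) (by positivity)]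
      exact ENNReal.ofReal_le_ofReal e6
    rw [Lp.edist_def, eLpNorm_one_eq_lintegral_enorm]
    refine (lintegral_mono_ae hpt).trans ?_
    rw [lintegral_add_right _ measurable_const, lintegral_const, lintegral_const_mul' _ _ (by simp)]
    have hvol : volI univ = 1 := by simp
    rw [eLpNorm_one_eq_lintegral_enorm] at hg
    have hg' : ∫⁻ t, ‖(z : ℝ → E3) t - g t‖ₑ ∂volI ≤ ENNReal.ofReal κ := hg
    rw [hvol, mul_one]
    calc _ ≤ ENNReal.ofReal 2 * ENNReal.ofReal κ + ENNReal.ofReal (3 * κ) := by gcongr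
      _ = ENNReal.ofReal ε := by
        rw [← ENNReal.ofReal_mul (by norm_num),
          ← ENNReal.ofReal_add (by positivity) (by positivity), hκ]
        congr 1; ring

/-- Along a subsequence converging almost everywhere the integrals of G converge too, by boundedness
and by continuity at unit vectors. -/
lemma exists_piecewise_lintegral_le {G : E3 → ℝ} (hGc : ContinuousOn G {0}ᶜ) {Γ : ℝ}
    (hΓ : ∀ x, G x ≤ Γ) {z : L1} (hz : ∀ᵐ t ∂volI, ‖z t‖ = 1) {ε : ℝ} (hε : 0 < ε) :
    ∃ (z' : L1) (m : ℕ) (s : ℕ → ℝ) (y : ℕ → E3), IsPiecewise m s y z' ∧ (∀ j, ‖y j‖ = 1) ∧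
      edist z' z ≤ ENNReal.ofReal ε ∧ ∫⁻ t, ENNReal.ofReal (G (z' t)) ∂volI ≤
        (∫⁻ t, ENNReal.ofReal (G (z t)) ∂volI) + ENNReal.ofReal ε := by
  obtain ⟨e, he, -⟩ := exists_unit_orthogonal 0
  choose x m s y h1 h2 h3 using fun n : ℕ => exists_piecewise_edist_le (K := {x | ‖x‖ = 1}) ⟨e, he⟩ hz
    (show (0 : ℝ) < 1 / (n + 1) by positivity)
  have hlim0 : Tendsto (fun n : ℕ => ENNReal.ofReal (1 / ((n : ℝ) + 1))) atTop (𝓝 0) := by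
    have := ENNReal.tendsto_ofReal (tendsto_one_div_add_atTop_nhds_zero_nat (𝕜 := ℝ))
    rwa [ENNReal.ofReal_zero] at this
  have hlim : Tendsto x atTop (𝓝 z) := by
    rw [tendsto_iff_edist_tendsto_0]
    exact tendsto_of_tendsto_of_tendsto_of_le_of_le tendsto_const_nhds hlim0 (fun _ => zero_le) h3
  obtain ⟨φ, hφ, hae⟩ := (tendstoInMeasure_of_tendsto_Lp hlim).exists_seq_tendsto_ae
  have hGm : Measurable G := measurable_of_continuousOn_compl_singleton 0 hGc
  have hint : Tendsto (fun n => ∫⁻ t, ENNReal.ofReal (G (x (φ n) t)) ∂volI) atTop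
      (𝓝 (∫⁻ t, ENNReal.ofReal (G (z t)) ∂volI)) := by
    refine tendsto_lintegral_of_dominated_convergence' (fun _ => ENNReal.ofReal Γ) ?_ ?_ ?_ ?_
    · exact fun n => (hGm.comp_aemeasurable (Lp.aestronglyMeasurable _).aemeasurable).ennreal_ofReal
    · exact fun n => Eventually.of_forall fun t => ENNReal.ofReal_le_ofReal (hΓ _)
    · rw [lintegral_const]
      exact (ENNReal.mul_lt_top ENNReal.ofReal_lt_top (measure_lt_top _ _)).ne
    · filter_upwards [hae, hz] with t ht hzt
      have hne : (z t : E3) ≠ 0 := fun h => by rw [h, norm_zero] at hzt; exact zero_ne_one hzt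
      exact ENNReal.tendsto_ofReal ((hGc.continuousAt (isOpen_compl_singleton.mem_nhds hne)).tendsto.comp ht)
  have hfin : ∫⁻ t, ENNReal.ofReal (G (z t)) ∂volI ≠ ⊤ := by
    refine ((lintegral_mono fun t => ENNReal.ofReal_le_ofReal (hΓ _)).trans_lt ?_).ne
    rw [lintegral_const]
    exact ENNReal.mul_lt_top ENNReal.ofReal_lt_top (measure_lt_top _ _)
  have hev := hint.eventually (gt_mem_nhds (ENNReal.lt_add_right hfin (ENNReal.ofReal_pos.2 hε).ne'))
  have hev2 := (hlim0.comp hφ.tendsto_atTop).eventually (gt_mem_nhds (ENNReal.ofReal_pos.2 hε))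
  obtain ⟨n, h4, h5⟩ := (hev.and hev2).exists
  exact ⟨x (φ n), _, _, _, h1 _, h2 _, (h3 _).trans h5.le, h4.le⟩

section

variable {G : E3 → ℝ} {lam del mu : ℕ → ℝ}

lemma exists_tendsto_of_isPiecewise {Q : Set E3} (hQ : IsPenalty Q G) (hlam_pos : ∀ n, 0 < lam n)
    (hdel_pos : ∀ n, 0 < del n) (hmu_pos : ∀ n, 0 < mu n) (hlam : Tendsto lam atTop (𝓝 0))
    (hη0 : Tendsto (fun n => √(2 * del n)) atTop (𝓝 0))
    (hratio : Tendsto (fun n => lam n / √(2 * del n)) atTop (𝓝 0)) {m : ℕ} {s : ℕ → ℝ} {y : ℕ → E3}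
    {z : L1} (hz : IsPiecewise m s y z) (hy : ∀ j, y j ∈ Q) {B : ℕ → ℝ}
    (hb : ∀ j, AdmitsBridge (fun n => √(2 * del n)) (fun n x => mu n / (2 * del n ^ 2) * G x) (y j)
      (y (j + 1)) (B j)) :
    ∃ xs : ℕ → L1, Tendsto xs atTop (𝓝 z) ∧ ∀ᶠ n in atTop,
      scaledFunctional G (lam n) (del n) (mu n) (xs n) ≤
        ENNReal.ofReal (∑ j ∈ Finset.range m, B j) := by
  have hη : ∀ n, 0 < √(2 * del n) := fun n => by have := hdel_pos n; positivity
  have hg : ∀ n, 0 ≤ mu n / (2 * del n ^ 2) := fun n => by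
    have := hdel_pos n; have := hmu_pos n; positivity
  obtain ⟨u, hu, hchain, K, hK⟩ := exists_isConverging hη hη0 hlam_pos hlam hratio
    (fun n x => mul_nonneg (hg n) (hQ.nonneg x)) (fun j => hQ.unit _ (hy j))
    (fun n j r => by rw [hQ.zero _ (hy j), mul_zero]) hb hz.zero hz.one hz.lt hz.eq
  obtain ⟨xs, hxs, hlim⟩ := hu.exists_tendsto hK
  refine ⟨xs, hlim, ?_⟩
  filter_upwards [hxs, hchain] with n h1 h2
  exact (scaledFunctional_le (hlam_pos n) (hdel_pos n) hQ.hom h2.1 h1).trans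
    (ENNReal.ofReal_le_ofReal h2.2)

variable {k : ℕ} {q : Fin k → E3}

/-- Every function with values in the wells is approximated by piecewise constant ones, whose many
transitions cost arbitrarily little because g n → 0. -/
lemma recovery_limitZero (hk : 1 ≤ k) (hQ : IsPenalty (wells q) G) (hlam_pos : ∀ n, 0 < lam n)
    (hdel_pos : ∀ n, 0 < del n) (hmu_pos : ∀ n, 0 < mu n) (hlam : Tendsto lam atTop (𝓝 0))
    (hη0 : Tendsto (fun n => √(2 * del n)) atTop (𝓝 0))
    (hratio : Tendsto (fun n => lam n / √(2 * del n)) atTop (𝓝 0))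
    (hg : Tendsto (fun n => mu n / (2 * del n ^ 2)) atTop (𝓝 0)) (z : L1) :
    ∃ xs : ℕ → L1, Tendsto xs atTop (𝓝 z) ∧
      limsup (fun n => scaledFunctional G (lam n) (del n) (mu n) (xs n)) atTop ≤ limitZero q z := by
  classical
  by_cases hz : ∀ᵐ t ∂volI, z t ∈ wells q
  swap
  · refine ⟨fun _ => z, tendsto_const_nhds, ?_⟩
    rw [limitZero, if_neg hz]; exact le_top
  refine exists_recovery_of_approx fun ε hε => ?_
  obtain ⟨Γ, hΓ, hGΓ⟩ := hQ.exists_bound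
  obtain ⟨z', m, s, y, hp, hy, hd⟩ := exists_piecewise_edist_le (K := wells q)
    ⟨q ⟨0, hk⟩, ⟨_, Or.inl rfl⟩⟩ hz hε
  have hη : ∀ n, 0 < √(2 * del n) := fun n => by have := hdel_pos n; positivity
  have hg0 : ∀ n, 0 ≤ mu n / (2 * del n ^ 2) := fun n => by
    have := hdel_pos n; have := hmu_pos n; positivity
  obtain ⟨xs, h1, h2⟩ := exists_tendsto_of_isPiecewise hQ hlam_pos hdel_pos hmu_pos hlam hη0 hratio hp hy
    (B := fun _ => ε / (m + 1)) fun j => admitsBridge_of_vanishing hη hη0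
      (κ := fun n => mu n / (2 * del n ^ 2) * Γ) (by simpa using hg.mul_const Γ)
      (fun n x => mul_nonneg (hg0 n) (hQ.nonneg x))
      (fun n x => mul_le_mul_of_nonneg_left (hGΓ x) (hg0 n)) (hQ.unit _ (hy j)) (hQ.unit _ (hy (j + 1)))
      (fun n r => by rw [hQ.zero _ (hy j), mul_zero])
      (fun n r => by rw [hQ.zero _ (hy (j + 1)), mul_zero]) (by positivity)
  refine ⟨z', xs, hd, h1, h2.mono fun n hn => hn.trans (le_add_left (ENNReal.ofReal_le_ofReal ?_))⟩
  rw [Finset.sum_const, Finset.card_range, nsmul_eq_mul, mul_div_assoc', div_le_iff₀ (by positivity)]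
  linarith

lemma recovery_of_isStep (hQ : IsPenalty (wells q) G) (hlam_pos : ∀ n, 0 < lam n)
    (hdel_pos : ∀ n, 0 < del n) (hmu_pos : ∀ n, 0 < mu n) (hlam : Tendsto lam atTop (𝓝 0))
    (hη0 : Tendsto (fun n => √(2 * del n)) atTop (𝓝 0))
    (hratio : Tendsto (fun n => lam n / √(2 * del n)) atTop (𝓝 0)) {H : E3 → E3 → ℝ}
    (hH : ∀ y ∈ wells q, ∀ y' ∈ wells q, ∀ ε > 0, AdmitsBridge (fun n => √(2 * del n))
      (fun n x => mu n / (2 * del n ^ 2) * G x) y y' (H y y' + ε)) {z : L1} {m : ℕ} {s : ℕ → ℝ}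
    {y : ℕ → E3} (hs : IsStep (wells q) z m s y) {F₀ : L1 → ℝ≥0∞}
    (hF : ENNReal.ofReal (∑ j ∈ Finset.range m, H (y j) (y (j + 1))) ≤ F₀ z) :
    ∃ xs : ℕ → L1, Tendsto xs atTop (𝓝 z) ∧
      limsup (fun n => scaledFunctional G (lam n) (del n) (mu n) (xs n)) atTop ≤ F₀ z := by
  refine exists_recovery_of_approx fun ε hε => ?_
  obtain ⟨xs, h1, h2⟩ := exists_tendsto_of_isPiecewise hQ hlam_pos hdel_pos hmu_pos hlam hη0 hratio
    hs.isPiecewise hs.mem (B := fun j => H (y j) (y (j + 1)) + ε / (m + 1))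
    fun j => hH _ (hs.mem j) _ (hs.mem (j + 1)) _ (by positivity)
  refine ⟨z, xs, by simp, h1, h2.mono fun n hn => hn.trans ?_⟩
  have h3 : ∑ _j ∈ Finset.range m, ε / ((m : ℝ) + 1) ≤ ε := by
    rw [Finset.sum_const, Finset.card_range, nsmul_eq_mul, mul_div_assoc', div_le_iff₀ (by positivity)]
    linarith
  rw [Finset.sum_add_distrib]
  exact ENNReal.ofReal_add_le.trans (add_le_add hF (ENNReal.ofReal_le_ofReal h3))

lemma recovery_limitTransition (hQ : IsPenalty (wells q) G) (hlam_pos : ∀ n, 0 < lam n)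
    (hdel_pos : ∀ n, 0 < del n) (hmu_pos : ∀ n, 0 < mu n) (hlam : Tendsto lam atTop (𝓝 0))
    (hη0 : Tendsto (fun n => √(2 * del n)) atTop (𝓝 0))
    (hratio : Tendsto (fun n => lam n / √(2 * del n)) atTop (𝓝 0)) {g₀ : ℝ} (hg₀ : 0 < g₀)
    (hg : Tendsto (fun n => mu n / (2 * del n ^ 2)) atTop (𝓝 g₀)) (z : L1) :
    ∃ xs : ℕ → L1, Tendsto xs atTop (𝓝 z) ∧
      limsup (fun n => scaledFunctional G (lam n) (del n) (mu n) (xs n)) atTop ≤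
        limitTransition q (fun x => 2 * g₀ * G x) z := by
  classical
  by_cases hz : IsBV z ∧ ∀ᵐ t ∂volI, z t ∈ wells q
  swap
  · refine ⟨fun _ => z, tendsto_const_nhds, ?_⟩
    rw [limitTransition, if_neg hz]; exact le_top
  obtain ⟨d, hd, -, hsep⟩ := hQ.exists_separation
  obtain ⟨m, s, y, hs⟩ := hz.1.exists_isStep hz.2 hd hsep
  have hη : ∀ n, 0 < √(2 * del n) := fun n => by have := hdel_pos n; positivity
  have hg0 : ∀ n, 0 ≤ mu n / (2 * del n ^ 2) := fun n => by
    have := hdel_pos n; have := hmu_pos n; positivity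
  have hfin : ∀ y ∈ wells q, ∀ y' ∈ wells q, transitionCost (fun x => 2 * g₀ * G x) y y' ≠ ⊤ :=
    fun y hy y' hy' => ((hQ.transitionCost_lt_top _ hy hy').trans_lt ENNReal.ofReal_lt_top).ne
  refine recovery_of_isStep hQ hlam_pos hdel_pos hmu_pos hlam hη0 hratio
    (H := fun y y' => (transitionCost (fun x => 2 * g₀ * G x) y y').toReal)
    (fun y hy y' hy' ε hε => hQ.admitsBridge_of_tendsto hη hη0 hg0 hg₀ hg hy hy' ?_) hs ?_
  · rw [ENNReal.ofReal_add ENNReal.toReal_nonneg hε.le, ENNReal.ofReal_toReal (hfin y hy y' hy')]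
    exact ENNReal.lt_add_right (hfin y hy y' hy') (ENNReal.ofReal_pos.2 hε).ne'
  · rw [limitTransition, if_pos hz, hs.tsum_eq (transitionCost fun x => 2 * g₀ * G x),
      ENNReal.ofReal_sum_of_nonneg fun _ _ => ENNReal.toReal_nonneg]
    exact Finset.sum_le_sum fun j _ => ENNReal.ofReal_toReal_le

lemma recovery_limitCount (hQ : IsPenalty (wells q) G) (hlam_pos : ∀ n, 0 < lam n)
    (hdel_pos : ∀ n, 0 < del n) (hmu_pos : ∀ n, 0 < mu n) (hlam : Tendsto lam atTop (𝓝 0))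
    (hη0 : Tendsto (fun n => √(2 * del n)) atTop (𝓝 0))
    (hratio : Tendsto (fun n => lam n / √(2 * del n)) atTop (𝓝 0)) (z : L1) :
    ∃ xs : ℕ → L1, Tendsto xs atTop (𝓝 z) ∧
      limsup (fun n => scaledFunctional G (lam n) (del n) (mu n) (xs n)) atTop ≤ limitCount q z := by
  classical
  by_cases hz : IsBV z ∧ ∀ᵐ t ∂volI, z t ∈ wells q
  swap
  · refine ⟨fun _ => z, tendsto_const_nhds, ?_⟩
    rw [limitCount, if_neg hz]; exact le_top
  obtain ⟨d, hd, -, hsep⟩ := hQ.exists_separation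
  obtain ⟨m, s, y, hs⟩ := hz.1.exists_isStep hz.2 hd hsep
  have hη : ∀ n, 0 < √(2 * del n) := fun n => by have := hdel_pos n; positivity
  have hg0 : ∀ n, 0 ≤ mu n / (2 * del n ^ 2) := fun n => by
    have := hdel_pos n; have := hmu_pos n; positivity
  refine recovery_of_isStep hQ hlam_pos hdel_pos hmu_pos hlam hη0 hratio (H := fun _ _ => 8 / 3)
    (fun y hy y' hy' ε hε => admitsBridge_hold hη hη0 (fun n x => mul_nonneg (hg0 n) (hQ.nonneg x))
      (hQ.unit _ hy) (hQ.unit _ hy') (fun n r => by rw [hQ.zero _ hy, mul_zero])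
      (fun n r => by rw [hQ.zero _ hy', mul_zero]) hε) hs ?_
  rw [limitCount, if_pos hz, hs.encard_jumpSet, Finset.sum_const, Finset.card_range, nsmul_eq_mul,
    mul_comm, ENNReal.ofReal_mul (by norm_num), ENNReal.ofReal_natCast]
  exact le_rfl

lemma IsConverging.tendsto_lintegral_stepFn {η : ℕ → ℝ} {u : ℕ → ℕ → E3} {z : ℝ → E3}
    (h : IsConverging η lam u z) (hGc : ContinuousOn G {0}ᶜ) {Γ : ℝ} (hΓ : ∀ x, G x ≤ Γ)
    (hz : ∀ᵐ t ∂volI, ‖z t‖ = 1) :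
    Tendsto (fun n => ∫⁻ t, stepFn (fun i => G (chi (η n) (u n) i)) (lam n) (lastSite (lam n) - 1) t
      ∂volI) atTop (𝓝 (∫⁻ t, ENNReal.ofReal (G (z t)) ∂volI)) := by
  refine tendsto_lintegral_of_dominated_convergence (fun _ => ENNReal.ofReal Γ)
    (fun n => measurable_stepFn _ _ _) (fun n => Eventually.of_forall fun t => ?_) ?_ ?_
  · rw [stepFn]
    split_ifs
    · exact ENNReal.ofReal_le_ofReal (hΓ _)
    · exact zero_le
  · rw [lintegral_const]
    exact (ENNReal.mul_lt_top ENNReal.ofReal_lt_top (measure_lt_top _ _)).ne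
  · filter_upwards [h.tendsto, hz, ae_restrict_mem measurableSet_Ioo] with t ht hzt htI
    have hne : z t ≠ 0 := fun h => by rw [h, norm_zero] at hzt; exact zero_ne_one hzt
    refine (ENNReal.tendsto_ofReal ((hGc.continuousAt
      (isOpen_compl_singleton.mem_nhds hne)).tendsto.comp ht)).congr' ?_
    filter_upwards [eventually_index h.lam_pos h.lam_tendsto htI] with n hn
    rw [stepFn, if_pos (by omega)]
    rfl

/-- The values of the approximating step functions are arbitrary unit vectors, about which the
rotations pay the penalty all the time. The chain is therefore built without potential, at small
bending energy, and its penalty is computed separately: it converges to p₀ ∫ G(z'). -/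
lemma recovery_limitBulk {Q : Set E3} (hQ : IsPenalty Q G) (hlam_pos : ∀ n, 0 < lam n)
    (hdel_pos : ∀ n, 0 < del n) (hmu_pos : ∀ n, 0 < mu n) (hlam : Tendsto lam atTop (𝓝 0))
    (hη0 : Tendsto (fun n => √(2 * del n)) atTop (𝓝 0))
    (hratio : Tendsto (fun n => lam n / √(2 * del n)) atTop (𝓝 0)) {p₀ : ℝ}
    (hp : Tendsto (fun n => √(2 * del n) * (mu n / (2 * del n ^ 2)) / lam n) atTop (𝓝 p₀)) (z : L1) :
    ∃ xs : ℕ → L1, Tendsto xs atTop (𝓝 z) ∧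
      limsup (fun n => scaledFunctional G (lam n) (del n) (mu n) (xs n)) atTop ≤ limitBulk G p₀ z := by
  classical
  by_cases hz : ∀ᵐ t ∂volI, ‖z t‖ = 1
  swap
  · refine ⟨fun _ => z, tendsto_const_nhds, ?_⟩
    rw [limitBulk, if_neg hz]; exact le_top
  refine exists_recovery_of_approx fun ε hε => ?_
  obtain ⟨Γ, hΓ, hGΓ⟩ := hQ.exists_bound
  obtain ⟨κ, hκ0, hκε, hκp⟩ : ∃ κ, 0 < κ ∧ κ ≤ ε ∧ (|p₀| + 2) * κ ≤ ε := by
    refine ⟨ε / (|p₀| + 2), by positivity, div_le_self hε.le (by linarith [abs_nonneg p₀]), ?_⟩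
    rw [mul_div_cancel₀]; positivity
  obtain ⟨z', m, s, y, hpw, hy, hd, hGz⟩ := exists_piecewise_lintegral_le hQ.cont hGΓ hz hκ0
  have hη : ∀ n, 0 < √(2 * del n) := fun n => by have := hdel_pos n; positivity
  -- With zero potential any unit vector is an admissible axis, and all transitions together cost at
  -- most κ.
  obtain ⟨u, hu, hchain, K, hK⟩ := exists_isConverging (V := fun _ _ => 0) (B := fun _ => κ / (m + 1))
    hη hη0 hlam_pos hlam hratio (fun _ _ => le_rfl) hy (fun _ _ _ => rfl)
    (fun j => admitsBridge_of_vanishing hη hη0 (κ := fun _ => 0) tendsto_const_nhds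
      (fun _ _ => le_rfl) (fun _ _ => le_rfl) (hy j) (hy (j + 1)) (fun _ _ => rfl) (fun _ _ => rfl)
      (by positivity)) hpw.zero hpw.one hpw.lt hpw.eq
  obtain ⟨xs, hxs, hlim⟩ := hu.exists_tendsto hK
  have hz' : ∀ᵐ t ∂volI, ‖z' t‖ = 1 := by
    filter_upwards [hpw.eq] with t ⟨j, _, _, hj⟩
    rw [hj]; exact hy j
  obtain ⟨I, hI⟩ : ∃ I, I = ∫⁻ t, ENNReal.ofReal (G (z' t)) ∂volI := ⟨_, rfl⟩
  obtain ⟨S, hS⟩ : ∃ S : ℕ → ℝ, S = fun n => lam n * ∑ i ∈ interiorSites (lam n),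
    G (chi √(2 * del n) (u n) i) := ⟨_, rfl⟩
  have hSI : Tendsto (fun n => ENNReal.ofReal (S n)) atTop (𝓝 I) := by
    rw [hI]
    refine (hu.tendsto_lintegral_stepFn hQ.cont hGΓ hz').congr fun n => ?_
    rw [lintegral_stepFn (hlam_pos n) (lastSite_mul_le (hlam_pos n)) fun i => hQ.nonneg _, hS]
    rfl
  have hIfin : I ≠ ⊤ := by
    rw [hI]
    refine ((lintegral_mono fun t => ENNReal.ofReal_le_ofReal (hGΓ _)).trans_lt ?_).ne
    rw [lintegral_const]
    exact ENNReal.mul_lt_top ENNReal.ofReal_lt_top (measure_lt_top _ _)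
  have hmul : Tendsto (fun n => ENNReal.ofReal (√(2 * del n) * (mu n / (2 * del n ^ 2)) / lam n) *
      ENNReal.ofReal (S n)) atTop (𝓝 (ENNReal.ofReal p₀ * I)) :=
    ENNReal.Tendsto.mul (ENNReal.tendsto_ofReal hp) (Or.inr hIfin) hSI (Or.inr ENNReal.ofReal_ne_top)
  have hev := hmul.eventually (gt_mem_nhds (ENNReal.lt_add_right
    (ENNReal.mul_ne_top ENNReal.ofReal_ne_top hIfin) (ENNReal.ofReal_pos.2 hκ0).ne'))
  refine ⟨z', xs, hd.trans (ENNReal.ofReal_le_ofReal hκε), hlim, ?_⟩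
  filter_upwards [hxs, hchain, hev] with n h1 h2 h3
  refine (scaledFunctional_le (hlam_pos n) (hdel_pos n) hQ.hom h2.1 h1).trans ?_
  obtain ⟨P, hP⟩ : ∃ P, P = √(2 * del n) * (mu n / (2 * del n ^ 2)) / lam n := ⟨_, rfl⟩
  have hP0 : 0 ≤ P := by
    have := hdel_pos n; have := hmu_pos n; have := hlam_pos n
    rw [hP]; positivity
  have hsplit : ∑ i ∈ interiorSites (lam n), site √(2 * del n)
      (fun x => mu n / (2 * del n ^ 2) * G x) (u n) i =
      (∑ i ∈ interiorSites (lam n), site √(2 * del n) (fun _ => 0) (u n) i) + P * S n := by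
    have h4 : P * S n = ∑ i ∈ interiorSites (lam n),
        √(2 * del n) * (mu n / (2 * del n ^ 2) * G (chi √(2 * del n) (u n) i)) := by
      simp only [hS]
      rw [hP, ← mul_assoc, div_mul_cancel₀ _ (hlam_pos n).ne', Finset.mul_sum]
      exact Finset.sum_congr rfl fun i _ => mul_assoc _ _ _
    rw [h4, ← Finset.sum_add_distrib]
    refine Finset.sum_congr rfl fun i _ => ?_
    simp only [site]
    ring
  have h5 : ∑ _j ∈ Finset.range m, κ / ((m : ℝ) + 1) ≤ κ := by
    rw [Finset.sum_const, Finset.card_range, nsmul_eq_mul, mul_div_assoc', div_le_iff₀ (by positivity)]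
    linarith
  rw [← hP, ← ENNReal.ofReal_mul hP0] at h3
  rw [hsplit, limitBulk, if_pos hz]
  refine ENNReal.ofReal_add_le.trans ?_
  refine (add_le_add (ENNReal.ofReal_le_ofReal (h2.2.trans h5)) h3.le).trans ?_
  rw [← hI] at hGz
  refine (add_le_add_right (add_le_add_left (mul_le_mul_right hGz _) _) _).trans ?_
  rw [mul_add, ← ENNReal.ofReal_mul' hκ0.le]
  have h6 : ENNReal.ofReal (p₀ * κ) ≤ ENNReal.ofReal (|p₀| * κ) :=
    ENNReal.ofReal_le_ofReal (mul_le_mul_of_nonneg_right (le_abs_self _) hκ0.le)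
  have h7 : ENNReal.ofReal κ + ENNReal.ofReal (|p₀| * κ) + ENNReal.ofReal κ ≤ ENNReal.ofReal ε := by
    rw [← ENNReal.ofReal_add (by positivity) (by positivity),
      ← ENNReal.ofReal_add (by positivity) (by positivity)]
    exact ENNReal.ofReal_le_ofReal (by linarith)
  refine le_trans ?_ (add_le_add_right h7 _)
  refine le_trans (add_le_add_right (add_le_add_left (add_le_add_right h6 _) _) _) (le_of_eq ?_)
  ring

end

/-! ### Assembling the four regimes. -/

lemma isPenalty_wells {k : ℕ} (hk : 1 ≤ k) {q : Fin k → E3} (hq : ∀ l, ‖q l‖ = 1) {G : E3 → ℝ}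
    (hG_nonneg : ∀ z, 0 ≤ G z) (hG_cont : ContinuousOn G {0}ᶜ)
    (hG_hom : ∀ c : ℝ, 0 < c → ∀ z, G (c • z) = G z) (hG_zero : {z | G z = 0} = wellLines q) :
    IsPenalty (wells q) G := by
  have hmem : ∀ x, G x = 0 ↔ ∃ l, ∃ c : ℝ, c • q l = x := by
    intro x
    have h1 : G x = 0 ↔ x ∈ wellLines q := by rw [← hG_zero]; rfl
    rw [h1, wellLines, mem_iUnion]
    refine exists_congr fun l => ?_
    rw [SetLike.mem_coe, Submodule.mem_span_singleton]
  refine ⟨?_, ?_, hG_nonneg, hG_cont, hG_hom, ?_, ?_, ?_⟩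
  · have : wells q = range q ∪ range fun l => -q l := by
      ext x
      simp only [wells, mem_ofPred_eq, mem_union, mem_range, exists_or, eq_comm]
    rw [this]
    exact (finite_range _).union (finite_range _)
  · rintro y ⟨l, rfl | rfl⟩
    · exact hq l
    · rw [norm_neg]; exact hq l
  · rintro y ⟨l, rfl | rfl⟩ c
    · exact (hmem _).2 ⟨l, c, rfl⟩
    · exact (hmem _).2 ⟨l, -c, by rw [neg_smul, smul_neg]⟩
  · intro y hy h0
    obtain ⟨l, c, rfl⟩ := (hmem y).1 h0
    rw [norm_smul, hq, mul_one, Real.norm_eq_abs] at hy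
    rcases (abs_eq zero_le_one).1 hy with rfl | rfl
    · exact ⟨l, Or.inl (one_smul _ _)⟩
    · exact ⟨l, Or.inr (by rw [neg_smul, one_smul])⟩
  -- The origin belongs to a union of lines only if there is at least one line.
  · exact (hmem 0).2 ⟨⟨0, hk⟩, 0, zero_smul _ _⟩

end HelicalChain

end

theorem theorem3p15 {k : ℕ} (hk : 1 ≤ k) (q : Fin k → E3) (hq : ∀ l, ‖q l‖ = 1)
    (hq_inj : Function.Injective q)
    (G : E3 → ℝ) (hG_nonneg : ∀ z, 0 ≤ G z) (hG_cont : ContinuousOn G {0}ᶜ)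
    (hG_hom : ∀ c : ℝ, 0 < c → ∀ z, G (c • z) = G z)
    (hG_zero : {z | G z = 0} = wellLines q)
    (lam del mu p β : ℕ → ℝ)
    (hlam_pos : ∀ n, 0 < lam n) (hdel_pos : ∀ n, 0 < del n) (hmu_pos : ∀ n, 0 < mu n)
    (hlam : Tendsto lam atTop (𝓝 0)) (hdel : Tendsto del atTop (𝓝 0))
    (hβ_def : ∀ n, β n = lam n / √(del n))
    (hp_def : ∀ n, p n = mu n / (√2 * lam n * del n ^ (3 / 2 : ℝ)))
    (hβ : Tendsto β atTop (𝓝 0)) :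
    (∀ p₀ : ℝ, Tendsto p atTop (𝓝 p₀) →
      GammaConverges (fun n => scaledFunctional G (lam n) (del n) (mu n)) (limitBulk G p₀)) ∧
    (Tendsto p atTop atTop → Tendsto (fun n => p n * β n) atTop (𝓝 0) →
      GammaConverges (fun n => scaledFunctional G (lam n) (del n) (mu n)) (limitZero q)) ∧
    (∀ ℓ : ℝ, 0 < ℓ → Tendsto p atTop atTop → Tendsto (fun n => p n * β n) atTop (𝓝 ℓ) →
      GammaConverges (fun n => scaledFunctional G (lam n) (del n) (mu n))
        (limitTransition q (fun z => √2 * ℓ * G z))) ∧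
    (Tendsto p atTop atTop → Tendsto (fun n => p n * β n) atTop atTop →
      GammaConverges (fun n => scaledFunctional G (lam n) (del n) (mu n)) (limitCount q)) := by
  have hQ := isPenalty_wells hk hq hG_nonneg hG_cont hG_hom hG_zero
  have h2 : 0 < √2 := by positivity
  have hg0 : ∀ n, 0 ≤ mu n / (2 * del n ^ 2) := fun n => by
    have := hdel_pos n; have := hmu_pos n; positivity
  have hη0 : Tendsto (fun n => √(2 * del n)) atTop (𝓝 0) := by
    simpa using (hdel.const_mul 2).sqrt
  have hsqrt : ∀ n, √(2 * del n) = √2 * √(del n) := fun n => Real.sqrt_mul (by norm_num) _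
  have hratio : Tendsto (fun n => lam n / √(2 * del n)) atTop (𝓝 0) := by
    have := hβ.div_const √2
    rw [zero_div] at this
    refine this.congr fun n => ?_
    rw [hβ_def, hsqrt, div_div, mul_comm √2]
  have hpow : ∀ n, del n ^ (3 / 2 : ℝ) = del n * √(del n) := fun n => by
    rw [show (3 / 2 : ℝ) = 1 + 1 / 2 by norm_num, Real.rpow_add (hdel_pos n), Real.rpow_one,
      ← Real.sqrt_eq_rpow]
  have hsq : ∀ n, √(del n) * √(del n) = del n := fun n => Real.mul_self_sqrt (hdel_pos n).le
  have hsq2 : √2 * √2 = 2 := Real.mul_self_sqrt (by norm_num)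
  -- p n is the weight of the penalty per unit length of I, namely the site weight η g divided by λ.
  have hp_eq : ∀ n, p n = √(2 * del n) * (mu n / (2 * del n ^ 2)) / lam n := by
    intro n
    have h3 := Real.sqrt_pos.2 (hdel_pos n)
    have h4 := hlam_pos n
    have h5 := hdel_pos n
    rw [hp_def, hpow, hsqrt, div_eq_div_iff (by positivity) (by positivity)]
    calc mu n * lam n = mu n * lam n * (√2 * √2) / 2 * (√(del n) * √(del n)) * del n / del n ^ 2 := by
          rw [hsq2, hsq]; field_simp
      _ = _ := by ring
  -- The potential strength in the profile problem is governed by p β alone.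
  have hg_eq : ∀ n, mu n / (2 * del n ^ 2) = p n * β n / √2 := by
    intro n
    have h3 := Real.sqrt_pos.2 (hdel_pos n)
    have h4 := hlam_pos n
    have h5 := hdel_pos n
    rw [hp_def, hβ_def, hpow, div_mul_div_comm, div_div, div_eq_div_iff (by positivity) (by positivity)]
    calc _ = mu n * lam n * del n * (√2 * √2) * (√(del n) * √(del n)) := by ring
      _ = _ := by rw [hsq2, hsq]; ring
  have hlim : ∀ {l : ℝ}, Tendsto (fun n => p n * β n) atTop (𝓝 l) →
      Tendsto (fun n => mu n / (2 * del n ^ 2)) atTop (𝓝 (l / √2)) := fun h =>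
    (h.div_const √2).congr fun n => (hg_eq n).symm
  have hpF : ∀ {F : Filter ℝ}, Tendsto p atTop F →
      Tendsto (fun n => √(2 * del n) * (mu n / (2 * del n ^ 2)) / lam n) atTop F := fun h =>
    h.congr hp_eq
  refine ⟨fun p₀ hp => ⟨?_, ?_⟩, fun hp hpβ => ⟨?_, ?_⟩, fun ℓ hℓ hp hpβ => ?_,
    fun hp hpβ => ⟨?_, ?_⟩⟩
  · exact liminf_le_of_converging hG_hom hlam_pos hdel_pos hlam hdel hratio
      fun φ hφ u z E hu hE => hu.limitBulk_le hG_nonneg hG_cont (fun n => hg0 _) hE ((hpF hp).comp hφ)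
  · exact recovery_limitBulk hQ hlam_pos hdel_pos hmu_pos hlam hη0 hratio (hpF hp)
  · exact liminf_le_of_converging hG_hom hlam_pos hdel_pos hlam hdel hratio
      fun φ hφ u z E hu hE => hu.limitZero_le hQ (fun n => hg0 _) hE ((hpF hp).comp hφ)
  · exact recovery_limitZero hk hQ hlam_pos hdel_pos hmu_pos hlam hη0 hratio (by simpa using hlim hpβ)
  · obtain ⟨g₀, hg₀⟩ : ∃ g₀, g₀ = ℓ / √2 := ⟨_, rfl⟩
    have hg₀pos : 0 < g₀ := by rw [hg₀]; positivity
    have hg := hlim hpβ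
    rw [← hg₀] at hg
    -- The profile functional carries F/2, so the limit strength g₀ = ℓ/√2 of the potential
    -- corresponds to F = 2 g₀ G = √2 ℓ G.
    have e : √2 * ℓ = 2 * g₀ := by
      rw [hg₀, mul_div_assoc', eq_div_iff h2.ne', mul_right_comm, hsq2]
    rw [e]
    exact ⟨liminf_le_of_converging hG_hom hlam_pos hdel_pos hlam hdel hratio
      fun φ hφ u z E hu hE => hu.limitTransition_le hQ (fun n => hg0 _) hE ((hpF hp).comp hφ) hg₀pos
        (hg.comp hφ),
      recovery_limitTransition hQ hlam_pos hdel_pos hmu_pos hlam hη0 hratio hg₀pos hg⟩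
  · have hg : Tendsto (fun n => mu n / (2 * del n ^ 2)) atTop atTop :=
      (hpβ.atTop_div_const h2).congr fun n => (hg_eq n).symm
    exact liminf_le_of_converging hG_hom hlam_pos hdel_pos hlam hdel hratio
      fun φ hφ u z E hu hE => hu.limitCount_le hQ (fun n => hg0 _) hE ((hpF hp).comp hφ) (hg.comp hφ)
  · exact recovery_limitCount hQ hlam_pos hdel_pos hmu_pos hlam hη0 hratio
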